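/- \textbf{1. Computations.} Fix sets of process names, packets, queuing-event names, requests and message bodies. A \emph{computation} $H$ consists of: a set of \emph{halting} processes; a number $N\in\mathbb N\cup\{\infty\}$ of views and, for each $i<N$, a set $V_i$ of processes; for each joining process $J$ a parent $\mathrm{par}(J)$; a set of packets $k$, each with a source, a target, a content $\mathrm{cont}(k)$ and a queuing event $q(k)$; subsets of sent and of received packets; for each $i$ and $P$ at most one notification $n_i(P)$, with content ``$R$ removed'', ``$J$ joined, parent $E$'', ``you are the new process $P$'', or ``done''; a set of dropped notifications; for each request an issuing process and a body; a set of \emph{events}, which may contain queuing events $q$ (located at the source of their packets; one queuing event for a whole multicast) and the \emph{triggers}: dequeuing events $\mathrm{deq}(k)$ (at the target), notification events $\mathrm{not}_i(P)$ (at $P$) and request events (at the issuer); and a relation $\preceq$ on events, with $e\prec f$ iff $e\preceq f\not\preceq e$ and $e\asymp f$ iff $e\preceq f\preceq e$. Write $C(P,Q)$ for the set (channel) of packets from $P$ to $Q$, $j(P)$ for the first view that contains $P$, $d(P)\in\mathbb N\cup\{\infty\}$ for one more than the last such view ($\infty$ if there is none). $P$ is \emph{original} if $j(P)=0$, and \emph{removed}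 if $d(P)<N$. \textbf{2. Histories.} $H$ is a \emph{history} if the following hold. (Views) $N\ge 1$; every process is a member of some view, and the views of which it is a member are those with $j(P)\le i<d(P)$; $V_0$ is finite, and $V_{i+1}$ arises from $V_i$ by adding one new member or by removing one member. (Packets) Every packet lies on exactly one channel; received packets are sent; the queuing event of a packet occurs at its source, and its dequeuing event, if there is one, strictly follows the queuing event. The packets that share a queuing event are finitely many, have the same source and content, and have distinct targets. (FIFO) If $k,k'\in C(P,Q)$, $q(k)\prec q(k')$ and $\mathrm{deq}(k')$ exists, then $\mathrm{deq}(k)$ exists and $\mathrm{deq}(k)\prec\mathrm{deq}(k')$. (Membership service) $n_i(P)$ is: absent for $i<j(P)$; ``new $P$'' for $i=j(P)$; ``$J$ joined, parent $\mathrm{par}(J)$'' or ``$R$ removed'' for $j(P)<i<d(P)$ if $j(J)=i$, respectively $d(R)=i$; for $i=d(P)$, ``done'' if $P$ is removed or halting, and absent otherwise; absent for $i>d(P)$. (Notifications) Only existing notifications are dequeued; $\mathrm{not}_0(P)$ occurs for every original $P$; if $j(P)\le i<i'\le d(P)$ and $\mathrm{not}_{i'}(P)$ occurs then $\mathrm{not}_i(P)$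 occurs and strictly precedes it. (Parent) If $j(J)=i>0$ then $\mathrm{par}(J)\in V_{i-1}$, and if $\mathrm{not}_i(J)$ occurs then so does $\mathrm{not}_i(\mathrm{par}(J))$ and $\mathrm{not}_i(\mathrm{par}(J))\asymp \mathrm{not}_i(J)$. (Order) Every event is located at a process; $\preceq$ is a weak partial order (reflexive and transitive on events), and a linear order on the events at each process; it is the smallest such relation that contains its restrictions to the single processes, $q(k)\preceq\mathrm{deq}(k)$, and the relations $\mathrm{not}_{j(J)}(\mathrm{par}(J))\asymp\mathrm{not}_{j(J)}(J)$ for $j(J)>0$ (all between events that occur). (Well-foundedness) Each event has finitely many predecessors at its process; if there are events at $P$ then $\mathrm{not}_{j(P)}(P)$ is the first of them, and $\mathrm{not}_{d(P)}(P)$, if it occurs, is the last. (Process liveness) For $k\in C(P,Q)$: $Q\in V_{j(P)}$ or $\mathrm{not}_{j(Q)}(P)\prec q(k)$; and $q(k)\prec\mathrm{not}_{d(Q)}(P)$ if the latter occurs. (Piggyback) If $k\in C(P,Q)$ is dequeued, and $i\le j(P)$ or $\mathrm{not}_i(P)\prec q(k)$, then $i\le j(Q)$ or $\mathrm{not}_i(Q)\prec\mathrm{deq}(k)$.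 (Self channel) If $k\in C(P,P)$ and $q(k)\prec\mathrm{not}_i(P)$ then $\mathrm{deq}(k)$ occurs and $\mathrm{deq}(k)\prec\mathrm{not}_i(P)$. (Halting) Halting processes have finitely many events. Dropped notifications are not dequeued; a notification $n_i(P)$ of a non-halting $P$ is dequeued if no notification $n_{i'}(P)$ with $i'\le i$ is dropped. Packets of non-halting sources are sent; dequeued packets are received; a packet between non-halting processes is dequeued if it and all packets queued before it on its channel are received. Requests of non-halting processes are dequeued. A history is \emph{conforming} if: whenever only finitely many packets of $C(P,Q)$ are dequeued, $P$ is removed or $Q$ halts; if $n_i(P)$ is ``$Q$ removed'' and is dequeued, then no packet from $Q$ is dequeued at $P$ after it; notifications are dropped only at halting processes; halting processes are members of finitely many views; a process without events is not the parent of a joining process; removed processes halt. The channel $C(P,Q)$ is \emph{upstream} if $d(P)\le d(Q)$ and $P\ne Q$, and downstream otherwise. A conforming history is \emph{lossless} if all sent packets are received, no notification is dropped, all received packets on upstream channels are dequeued, and all packets on downstream channels are sent. It is \emph{transactional} if moreover all notifications, requests and received packets are dequeued and processed to completion. \textbf{3. The protocol.} The packet contents are: messages $\mathrm{msg}(m)$,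 acknowledgements $\mathrm{ack}(m)$, ghosts and flushes (with a view number), donations and co-donations. A stamped message $m$ has a body, an originator, a view and a vector time (a partial function from processes to $\mathbb N$); it is a \emph{forwarded} message of a sender that is not its originator. A process keeps: cur\_view, v\_gap, its own name, the membership and the queue of pending view changes, the live set and the contact set, a vector time, a receive set, a forwarding queue for each process, the wait sets of its own and of the forwarded messages (records: message, index, instability set), a launch queue, ghost\_height, flush\_height, ghost and flush vectors, and counters mpkt\_out and mpkt\_in[$\cdot$]; counters and indices have two components $(f,b)$, for forwarded and for original messages, and $\|(f,b)\|=f+b$. Its height is cur\_view+v\_gap. Each trigger starts a procedure, as follows; unless a target is named, packets are multicast to the contact set. \emph{CheckFlush}: if the forwarded wait set is empty then, if ghost\_height is less than the height, set it to the height and multicast a ghost with this height; then, if also the own wait set is empty and flush\_height is less than the height, do the same with flush. \emph{Scan}: repeatedly deliver the deliverable messages of the receive set (message view $=$ cur\_view, the next one of its originator, and vector time not ahead of the local one at any other member), incrementing the entry of the originator in the vector time. \emph{Request}: if v\_gap $>0$ append the body to the launch queue; otherwise increment mpkt\_out.$b$, stamp the message (the own entry of its vector time being vt[self]+mpkt\_out.$b-$mpkt\_in[self].$b$),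 add to the own wait set the record (message, mpkt\_out, mpkt\_in) and multicast it. \emph{Initial view}: start with members, live set and contact set $V_0$ and with all counters, heights, ghost and flush entries equal to $0$. \emph{Being the new process} $J$: start with the state in which the parent dequeues its notification; increment v\_gap, enqueue the join; add $J$ to the live set; let the contact set be $\{J\}$; clear the own wait set and the launch queue; set to $0$ the $b$-components of mpkt\_out and of the indices of the forwarded wait set; set flush\_height and the $J$-entries of ghost and flush to ghost\_height, and mpkt\_in[$J$] to mpkt\_out; create an empty forwarding queue for $J$; CheckFlush. \emph{Join of $J$ with parent $E$}: increment v\_gap, enqueue the join; add $J$ to the live and contact sets; create an empty forwarding queue for $J$; each record with an instability at $E$ gets the instability $(f,0)$ at $J$, where $f$ is the $f$-component of the one at $E$; ghost[$J$]$=$flush[$J$]$=$ghost[$E$]; mpkt\_in[$J$]$=$(mpkt\_in[$E$].$f,0)$; send a donation of the state (all records, mpkt\_in, ghost\_height, flush\_height) to $J$; CheckFlush. \emph{Removal of $R$}: increment v\_gap, enqueue the removal; remove $R$ from the live and contact sets and from the instability sets, dropping the records that become stable; delete mpkt\_in[$R$]; forward each message in the forwarding queue of $R$ (increment mpkt\_out.$f$,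 multicast it, add the record (message, mpkt\_out, mpkt\_in) to the forwarded wait set); delete the $R$-entries of the forwarding queue, ghost and flush; CheckFlush. ``Done'' has no effect. \emph{Message $m$ from $S$}: send $\mathrm{ack}(m)$ to $S$; increment mpkt\_in[$S$] (in $b$ if $S$ is the originator, in $f$ otherwise); if $m$ is neither of an older view, nor delivered, nor in the receive set, add it to the receive set and to the forwarding queue of $S$, and Scan. \emph{Ack of $m$ from $S$}: delete the instability of $m$ at $S$; if the record becomes stable, drop it and CheckFlush. \emph{Ghost $v$ from $S$}: ghost[$S$]$:=v$. \emph{Flush $v$ from $S$}: flush[$S$]$:=v$; TryToInstall. \emph{TryToInstall}: if flush[$P$] is at least the height for all $P$ in the live set, then install all pending views one by one (drop the messages of the old view from the receive set and from the forwarding queues of live processes, increment cur\_view and decrement v\_gap, update the membership, reset the vector time to $0$ on the members, Scan), and then treat the bodies in the launch queue in order as requests. \emph{Donation from $S$}: add $S$ to the contact set; send a co-donation (of the same kind of data) to $S$; process records. \emph{Co-donation from $S$}: process records; TryToInstall. \emph{Processing records}: take the local records with an instability at $S$ and the donated records with an instability at the recipient, sorted lexicographically by $(\|\mathrm{index}\|,0)$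 for the former and $(\|\mathrm{iset}[\mathrm{self}]\|,\|\mathrm{index}\|)$ for the latter; for a donated record with $\|\mathrm{mpkt\_in}[S]\|<\|\mathrm{index}\|$ simulate the receipt of its message from $S$, for a local record with $\|\mathrm{index}\|\le\|\mathrm{donation.mpkt\_in}[\mathrm{self}]\|$ simulate the receipt of its acknowledgement from $S$ (each simulated receipt is a \emph{sub-transaction}); then set ghost[$S$], flush[$S$] to the donated heights. A \emph{history of an execution} is a history together with an assignment of states to the triggers such that the state does not change between successive transactions of a process, a new process is initialized as above, and the queuing events after each trigger $t$ and before the next trigger of the same process are exactly, and in this order, the packets that the procedure started by $t$ in its state queues (to a nonempty set of targets). They form, with $t$, the \emph{transaction} of $t$. \textbf{4. Setting.} Let $H$ be a transactional history of an execution of the protocol, in which some process joins. Let $G$ be the first process that joins, $D=\mathrm{par}(G)$, and $c=j(G)>0$ the \emph{critical view}. The view of an event $e$ is the largest $i$ with $\mathrm{not}_i(P)\preceq e$ for some $P$. The \emph{clean events} are elements $\ell_i$, to which all $\mathrm{not}_i(P)$ are collapsed, and all other events; they are ordered by $\ell_i<\ell_{i'}$ iff $i<i'$; $\ell_i<f$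 iff $i\le\mathrm{view}(f)$; $e<\ell_i$ iff $\mathrm{view}(e)<i$; $e<f$ iff $\mathrm{view}(e)<\mathrm{view}(f)$, or the views are equal and $e\prec f$. An event is \emph{pre-critical} if its clean event is $<\ell_c$, and otherwise post-critical; a packet is pre-critical if its queuing event is. A pre-critical packet is \emph{timely} if it is dequeued pre-critically and \emph{untimely} otherwise. For original $P$, the critical donation from $P$ is the donation packet from $P$ to $G$, and $t_{P,G}$ is its dequeuing event; the critical co-donation to $P$ is the co-donation packet from $G$ to $P$, and $t_{G,P}$ its dequeuing event (if they exist). \textbf{5. Labels.} A label is a quadruple $(\ell,s,a,w)$, ordered left lexicographically: $\ell$ is a clean event; $s\in\{\hat0\}+(\text{clean events}\sqcup\mathbb N)$, with $\hat0$ the least element and the two summands ordered as usual and mutually incomparable; $a$ is an adjustment in $$-g<+g<-f<+f<-a<+a<\hat0<-m<+m$$ (ghost, flush, ack, message, from $-G$ or $+G$), and $w\in\{\hat0<\mathrm{codonate}<\mathrm{donate}<\mathrm{ack}<\mathrm{ghost}<\mathrm{flush}<\mathrm{bcast}_1<\mathrm{bcast}_2<\dots\}$. An event of $H$ has as first coordinate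 the clean event of the trigger of its transaction and as third coordinate $\hat0$. For a trigger $s=w=\hat0$. For a queuing event, $w$ is given by the content; it is $\mathrm{bcast}_i$ for the $i$-th message of a transaction. For a side effect of the $n$-th sub-transaction of the critical donation from $P$, $s$ is the $n$-th queuing event of an untimely packet on $C(P,D)$ that is a message or an ack of a message not originating at $D$. For a side effect of the $n$-th sub-transaction of the critical co-donation to $P$, $s$ is the $n$-th event among the queuing events of untimely packets on $C(D,P)$ that are forwarded messages or acks and the queuing events of post-critical message packets on $C(G,G)$ that precede $t_{P,G}$. For a side effect of TryToInstall in the critical co-donation transaction of $P$, $s$ is the last post-critical queuing event of a flush packet on $C(G,G)$ before $t_{P,G}$ (its content is the height at $P$ in that transaction). For the $n$-th sub-transaction of any other donation or co-donation $s=n\in\mathbb N$. In all other cases $s=\hat0$. Write $\lambda(e)$ for the label of $e$. \textbf{6. The reduced history $H^r$.} It has one more process, $-G$; write $+G=G$. Its halting processes are those of $H$ and $-G$; it has as many views as $H$, with $V^r_i=V_i$ for $i\ge c$ and $V_i^r=V_i\cup\{G,-G\}$ for $i<c$; parents, requests and bodies are those of $H$; no notification is dropped. The reduction of a message extends its vector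 time by $[G]=[-G]=0$ if its view is less than $c$ and is the same message otherwise; the reduction of a content reduces all messages in it. A \emph{clone} of a packet has the reduced content; a \emph{zombie} of a ghost packet is a flush packet with the same number. The packets of $H^r$ are as follows, where $\sigma,\tau\in\{+,-\}$. (a) The reductions of all packets of $H$ but the critical donations and co-donations, with their queuing events, dequeuing events (if any) and labels. (b) For $P\ne G$ and each pre-critical $k\in C(P,D)$ that is a ghost, a flush, a message or an ack of a message not originating at $D$: a clone on the channel from $P$ to $\sigma G$, with queuing event $q(k)$ or, in the case of an ack, a new queuing event at $P$ with label $\lambda(q(k))$ with adjustment $\sigma m$. It is dequeued with label $\lambda(\mathrm{deq}(k))$ if $k$ is timely; if $k$ is untimely it is dequeued iff $\sigma=+$ and $t_{P,G}$ exists, with label $(t_{P,G},q(k),\hat0,\hat0)$. (c) For $P\neq G$ and each pre-critical $k\in C(D,P)$ that is a forwarded message, an ack or a ghost: a clone from $\sigma G$ to $P$, with a new queuing event $q(k)_\sigma$ at $\sigma G$ with label $\lambda(q(k))$; for a ghost also a zombie, with a new queuing event at $\sigma G$ with label $\lambda(q(k))$ with last coordinate flush. (The new queuing events are shared by all packets that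 come from one multicast.) If $k$ is timely they are dequeued, with label $\lambda(\mathrm{deq}(k))$ with adjustment $\sigma m$, $\sigma a$, $\sigma g$ for message, ack and ghost clones and $\sigma f$ for zombies. If $k$ is untimely they are dequeued iff $\sigma=+$ and $t_{G,P}$ exists, with label $(t_{G,P},q(k),a,\hat0)$, where $a=+g$ for ghost clones, $+f$ for zombies and $\hat0$ otherwise. (d) For each pre-critical (hence timely) $k\in C(D,D)$ that is a forwarded message, an ack of a forwarded message or a ghost: a clone from $\sigma G$ to $\tau G$, with queuing event $q(k)_\sigma$ or, for an ack, a new queuing event at $\sigma G$ with label $\lambda(q(k))$ with adjustment $\tau m$; for a ghost also a zombie, with the zombie queuing event at $\sigma G$ of (c). They are dequeued with label $\lambda(\mathrm{deq}(k))$ with adjustment $\sigma m$, $\sigma a$, $\sigma g$, respectively $\sigma f$ for zombies. (e) For each original $P\ne G$ and each post-critical $k\in C(G,G)$ that is a ghost, a flush or a message, is queued in a transaction whose trigger $t$ has a view less than $d(P)$ and, if $t_{P,G}$ exists, satisfies $t<t_{P,G}$ as a clean event: a clone from $G$ to $P$ with queuing event $q(k)$, which is dequeued iff $t_{G,P}$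 exists, with label $(t_{G,P},q(k),\hat0,\hat0)$. Packets as in (a) are sent or received iff they are in $H$. All clones and zombies are sent, and they are received iff they are dequeued. The notifications and notification events are those of $H$ with these changes: $n_0(\pm G)=$ ``new $\pm G$''; $n_i(\pm G)=n_i(D)$ for $0<i<c$; ``$G$ joined, parent $D$'' at $P\neq G$ and ``new $G$'' at $G$ in view $c$ are replaced by ``$-G$ removed''; $n_c(-G)=$ ``done''; and $\mathrm{not}_i(\pm G)$ occurs for all $i<c$. The label of $\mathrm{not}_i(P)$ is $(\ell_i,\hat0,\hat0,\hat0)$. Finally $\preceq$ is the reflexive transitive closure of the relations: $q(k)\preceq\mathrm{deq}(k)$; $e\preceq f$ if $e,f$ are located at the same process and the label of $e$ is less than that of $f$; and $\mathrm{not}_{j(J)}(\mathrm{par}(J))\asymp\mathrm{not}_{j(J)}(J)$ for all processes $J\ne G$ that join in $H$ (all between events that occur in $H^r$). \textbf{Theorem.} Let $H$ be a transactional history of an execution of the protocol in which some process joins, and let $H^r$ be its reduced history. Then $H^r$ is a history, that is, it satisfies all the laws in the definition of a history (among them FIFO, Piggyback, Self channel and Well-foundedness), and it is a conforming history. Its order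 is induced by the labels: for all events $e\prec f$ of $H^r$ the label of $e$ is less than the label of $f$, and two events $e,f$ at the same process satisfy $e\prec f$ if and only if the label of $e$ is less than the label of $f$. -/

import Mathlib

open scoped Classical

noncomputable section

namespace CBCast

/-! ## The computational model -/

/-- Contents of a membership notification. `new` tells the recipient that it is the new member,
`done` tells the recipient that it is no longer a member. -/
inductive Notice (Proc : Type*)
  | removed (pid : Proc)
  | joined (pid parent : Proc)
  | new (pid : Proc)
  | done

/-- `Notice` is functorial in the set of process names. -/
def Notice.map {Proc Proc' : Type*} (φ : Proc → Proc') : Notice Proc → Notice Proc'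
  | .removed R => .removed (φ R)
  | .joined J E => .joined (φ J) (φ E)
  | .new P => .new (φ P)
  | .done => .done

/-- Names of events: the queuing events (one per multicast, hence their own type `Que`), the dequeuing
event of a packet, the dequeuing event of the notification of view `i` at `P`, and the dequeuing event
of a message broadcast request. Which of these events occur is part of a computation. -/
inductive Ev (Proc Pkt Que Req : Type*)
  | queue (q : Que)
  | dequeue (k : Pkt)
  | notify (i : ℕ) (P : Proc)
  | request (r : Req)

/-- Triggers are the dequeuing events; the queuing events are side effects. -/
def Ev.IsTrigger {Proc Pkt Que Req : Type*} : Ev Proc Pkt Que Req → Prop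
  | .queue _ => False
  | _ => True

/-- The ingredients of a history, before any law is imposed.  Views are indexed by `i < numView`;
`le` is the weak (pre)order on events. -/
structure Computation (Proc Pkt Que Req Cont Body : Type*) where
  halting : Set Proc
  numView : ℕ∞
  view : ℕ → Set Proc
  /-- the parent of a process that joins after view zero (irrelevant for other processes) -/
  parent : Proc → Proc
  packets : Set Pkt
  source : Pkt → Proc
  target : Pkt → Proc
  content : Pkt → Cont
  sent : Set Pkt
  received : Set Pkt
  /-- `notice i P` is the notification of view `i` that is meant for `P`, if there is one -/
  notice : ℕ → Proc → Option (Notice Proc)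
  /-- the dropped notifications -/
  dropped : Set (ℕ × Proc)
  issuer : Req → Proc
  body : Req → Body
  /-- the queuing event of a packet -/
  queuing : Pkt → Que
  /-- the events that occur -/
  events : Set (Ev Proc Pkt Que Req)
  le : Ev Proc Pkt Que Req → Ev Proc Pkt Que Req → Prop

namespace Computation

variable {Proc Pkt Que Req Cont Body : Type*} (H : Computation Proc Pkt Que Req Cont Body)

/-- Strict precedence. -/
def lt (e f : Ev Proc Pkt Que Req) : Prop := H.le e f ∧ ¬ H.le f e

/-- The channel from `P` to `Q`. -/
def channel (P Q : Proc) : Set Pkt := {k | k ∈ H.packets ∧ H.source k = P ∧ H.target k = Q}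

/-- The views of which `P` is a member. -/
def memberViews (P : Proc) : Set ℕ := {i | (i : ℕ∞) < H.numView ∧ P ∈ H.view i}

/-- The first view of which `P` is a member. -/
def joinView (P : Proc) : ℕ := sInf (H.memberViews P)

/-- One more than the last view of which `P` is a member (`⊤` if there is no last one). -/
def deathView (P : Proc) : ℕ∞ := ⨆ i ∈ H.memberViews P, ((i : ℕ∞) + 1)

def Original (P : Proc) : Prop := H.joinView P = 0

def Removed (P : Proc) : Prop := H.deathView P < H.numView

/-- The set of events that occur at the process `P`. -/
def eventsAt (P : Proc) : Set (Ev Proc Pkt Que Req) :=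
  {e | e ∈ H.events ∧
    match e with
    | .queue q => ∃ k ∈ H.packets, H.queuing k = q ∧ H.source k = P
    | .dequeue k => k ∈ H.packets ∧ H.target k = P
    | .notify _ X => X = P
    | .request r => H.issuer r = P}

/-- The relations that generate the event order: the order at each process, the queuing event of a
packet precedes its dequeuing event, and the join event of a child is contemporaneous with the
corresponding notification event at its parent. -/
def Generates (e f : Ev Proc Pkt Que Req) : Prop :=
  e ∈ H.events ∧ f ∈ H.events ∧
    ((∃ P, e ∈ H.eventsAt P ∧ f ∈ H.eventsAt P ∧ H.le e f) ∨
     (∃ k ∈ H.packets, e = .queue (H.queuing k) ∧ f = .dequeue k) ∨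
     (∃ J, 0 < H.joinView J ∧
       ((e = .notify (H.joinView J) (H.parent J) ∧ f = .notify (H.joinView J) J) ∨
        (e = .notify (H.joinView J) J ∧ f = .notify (H.joinView J) (H.parent J)))))

/-- The laws of the model. -/
structure IsHistory : Prop where
  numView_pos : 0 < H.numView
  /-- every event occurs at some process -/
  event_located : ∀ e ∈ H.events, ∃ P, e ∈ H.eventsAt P
  /-- precedence is a weak partial order -/
  le_refl : ∀ e ∈ H.events, H.le e e
  le_trans : ∀ e ∈ H.events, ∀ f ∈ H.events, ∀ g ∈ H.events, H.le e f → H.le f g → H.le e g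
  /-- View Interval -/
  member_nonempty : ∀ P, (H.memberViews P).Nonempty
  view_interval : ∀ P, H.memberViews P = {i | H.joinView P ≤ i ∧ (i : ℕ∞) < H.deathView P}
  /-- View Change -/
  view_zero_finite : (H.view 0).Finite
  view_change : ∀ i : ℕ, ((i + 1 : ℕ) : ℕ∞) < H.numView →
    ∃ P, (P ∉ H.view i ∧ H.view (i + 1) = insert P (H.view i)) ∨
         (P ∈ H.view i ∧ H.view (i + 1) = H.view i \ {P})
  /-- Channel -/
  packet_channel : ∀ k ∈ H.packets, ∃! c : Proc × Proc, k ∈ H.channel c.1 c.2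
  received_sent : H.received ⊆ H.sent
  sent_packet : H.sent ⊆ H.packets
  /-- Packet Event -/
  packet_queued : ∀ k ∈ H.packets, .queue (H.queuing k) ∈ H.eventsAt (H.source k)
  packet_dequeued : ∀ k, .dequeue k ∈ H.events →
    k ∈ H.packets ∧ H.lt (.queue (H.queuing k)) (.dequeue k)
  multicast_finite : ∀ k ∈ H.packets, {k' | k' ∈ H.packets ∧ H.queuing k' = H.queuing k}.Finite
  multicast_same : ∀ k ∈ H.packets, ∀ k' ∈ H.packets, H.queuing k = H.queuing k' →
    H.content k = H.content k' ∧ H.source k = H.source k'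
  multicast_target : ∀ k ∈ H.packets, ∀ k' ∈ H.packets, H.queuing k = H.queuing k' →
    H.target k = H.target k' → k = k'
  /-- Packet Order: channels are FIFO -/
  packet_order : ∀ P Q, ∀ k ∈ H.channel P Q, ∀ k' ∈ H.channel P Q,
    H.lt (.queue (H.queuing k)) (.queue (H.queuing k')) → .dequeue k' ∈ H.events →
    .dequeue k ∈ H.events ∧ H.lt (.dequeue k) (.dequeue k')
  /-- Group Membership Service -/
  notice_before : ∀ i P, i < H.joinView P → H.notice i P = none
  notice_join : ∀ P, H.notice (H.joinView P) P = some (.new P)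
  notice_joined : ∀ (i : ℕ) P J, H.joinView P < i → (i : ℕ∞) < H.deathView P →
    H.joinView J = i → H.notice i P = some (.joined J (H.parent J))
  notice_removed : ∀ (i : ℕ) P R, H.joinView P < i → (i : ℕ∞) < H.deathView P →
    H.deathView R = i → H.notice i P = some (.removed R)
  notice_done : ∀ (i : ℕ) P, H.deathView P = i → (H.Removed P ∨ P ∈ H.halting) →
    H.notice i P = some .done
  notice_end : ∀ (i : ℕ) P, H.deathView P = i → ¬ H.Removed P → P ∉ H.halting →
    H.notice i P = none
  notice_after : ∀ (i : ℕ) P, H.deathView P < i → H.notice i P = none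
  /-- Notification Event -/
  notify_notice : ∀ i P, .notify i P ∈ H.events → H.notice i P ≠ none
  notify_original : ∀ P, H.Original P → .notify 0 P ∈ H.events
  /-- Notification Order -/
  notify_order : ∀ P (i i' : ℕ), H.joinView P ≤ i → i < i' → (i' : ℕ∞) ≤ H.deathView P →
    .notify i' P ∈ H.events → .notify i P ∈ H.events ∧ H.lt (.notify i P) (.notify i' P)
  /-- Parent: a parent is an existing member, and a child is born contemporaneously with the
  processing of the notification by its parent -/
  parent_member : ∀ J, 0 < H.joinView J → H.parent J ∈ H.view (H.joinView J - 1)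
  parent_event : ∀ J, 0 < H.joinView J → .notify (H.joinView J) J ∈ H.events →
    .notify (H.joinView J) (H.parent J) ∈ H.events ∧
    H.le (.notify (H.joinView J) (H.parent J)) (.notify (H.joinView J) J) ∧
    H.le (.notify (H.joinView J) J) (.notify (H.joinView J) (H.parent J))
  /-- Process Order -/
  process_total : ∀ P, ∀ e ∈ H.eventsAt P, ∀ f ∈ H.eventsAt P, H.le e f ∨ H.le f e
  process_antisymm : ∀ P, ∀ e ∈ H.eventsAt P, ∀ f ∈ H.eventsAt P, H.le e f → H.le f e → e = f
  /-- Process Liveness -/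
  liveness_join : ∀ P Q, ∀ k ∈ H.channel P Q, Q ∈ H.view (H.joinView P) ∨
    (.notify (H.joinView Q) P ∈ H.events ∧
      H.lt (.notify (H.joinView Q) P) (.queue (H.queuing k)))
  liveness_death : ∀ P Q, ∀ k ∈ H.channel P Q, ∀ i : ℕ, H.deathView Q = i →
    .notify i P ∈ H.events → H.lt (.queue (H.queuing k)) (.notify i P)
  /-- Piggyback -/
  piggyback : ∀ P Q, ∀ k ∈ H.channel P Q, .dequeue k ∈ H.events → ∀ i : ℕ,
    (i ≤ H.joinView P ∨
      (.notify i P ∈ H.events ∧ H.lt (.notify i P) (.queue (H.queuing k)))) →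
    (i ≤ H.joinView Q ∨ (.notify i Q ∈ H.events ∧ H.lt (.notify i Q) (.dequeue k)))
  /-- Self Channel -/
  self_channel : ∀ P, ∀ k ∈ H.channel P P, ∀ i : ℕ, .notify i P ∈ H.events →
    H.lt (.queue (H.queuing k)) (.notify i P) →
    .dequeue k ∈ H.events ∧ H.lt (.dequeue k) (.notify i P)
  /-- Order Foundation -/
  foundation : ∀ P, ∀ e ∈ H.eventsAt P, {f | f ∈ H.eventsAt P ∧ H.lt f e}.Finite
  join_first : ∀ P, (H.eventsAt P).Nonempty → .notify (H.joinView P) P ∈ H.events ∧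
    ∀ e ∈ H.eventsAt P, H.le (.notify (H.joinView P) P) e
  halt_last : ∀ P (i : ℕ), H.deathView P = i → .notify i P ∈ H.events →
    ∀ e ∈ H.eventsAt P, H.le e (.notify i P)
  /-- Minimal Order -/
  minimal_order : ∀ e ∈ H.events, ∀ f ∈ H.events,
    (H.le e f ↔ Relation.ReflTransGen H.Generates e f)
  /-- First Halting -/
  halting_finite : ∀ P ∈ H.halting, (H.eventsAt P).Finite
  /-- Second Halting -/
  dropped_not_processed : ∀ i P, (i, P) ∈ H.dropped → .notify i P ∉ H.events
  notice_processed : ∀ (i : ℕ) P, P ∉ H.halting → H.notice i P ≠ none →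
    (∀ j ≤ i, (j, P) ∉ H.dropped) → .notify i P ∈ H.events
  /-- Third Halting -/
  packet_sent : ∀ P Q, ∀ k ∈ H.channel P Q, P ∉ H.halting → k ∈ H.sent
  dequeued_received : ∀ k, .dequeue k ∈ H.events → k ∈ H.received
  packet_processed : ∀ P Q, ∀ k ∈ H.channel P Q, P ∉ H.halting → Q ∉ H.halting →
    (∀ k' ∈ H.channel P Q, H.le (.queue (H.queuing k')) (.queue (H.queuing k)) →
      k' ∈ H.received) →
    .dequeue k ∈ H.events
  /-- Fourth Halting -/
  request_processed : ∀ r, H.issuer r ∉ H.halting → .request r ∈ H.events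

/-- A conforming history. -/
structure IsConforming : Prop extends H.IsHistory where
  conforming_channel : ∀ P Q, {k | k ∈ H.channel P Q ∧ .dequeue k ∈ H.events}.Finite →
    H.Removed P ∨ Q ∈ H.halting
  conforming_packet : ∀ P Q (i : ℕ), H.notice i P = some (.removed Q) → .notify i P ∈ H.events →
    ∀ k ∈ H.channel Q P, .dequeue k ∈ H.events → ¬ H.lt (.notify i P) (.dequeue k)
  conforming_notification : ∀ i P, (i, P) ∈ H.dropped → P ∈ H.halting
  conforming_gms : ∀ P ∈ H.halting, (H.memberViews P).Finite
  conforming_parent : ∀ P, H.eventsAt P = ∅ → ¬ ∃ J, 0 < H.joinView J ∧ H.parent J = P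
  conforming_halt : ∀ P, H.Removed P → P ∈ H.halting

/-- An upstream channel; all other channels are downstream. -/
def Upstream (P Q : Proc) : Prop := H.deathView P ≤ H.deathView Q ∧ P ≠ Q

structure IsLossless : Prop where
  no_dropped_packet : H.sent ⊆ H.received
  no_dropped_notice : H.dropped = ∅
  upstream_clear : ∀ P Q, H.Upstream P Q → ∀ k ∈ H.channel P Q, k ∈ H.received →
    .dequeue k ∈ H.events
  downstream_clear : ∀ P Q, ¬ H.Upstream P Q → ∀ k ∈ H.channel P Q, k ∈ H.sent

/-- The part of being transactional that concerns dequeuing: a conforming, lossless history in which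
all notifications, all requests and all received packets are dequeued. (That their processing is
completed is part of `Execution` below.) -/
structure IsTransactional : Prop extends H.IsConforming, H.IsLossless where
  all_notices : ∀ i P, H.notice i P ≠ none → .notify i P ∈ H.events
  all_requests : ∀ r, .request r ∈ H.events
  all_received : ∀ k ∈ H.received, .dequeue k ∈ H.events

/-- The view of an event `e`: the largest `i` such that some notification event of view `i` weakly
precedes `e`. -/
def eventView (e : Ev Proc Pkt Que Req) : ℕ :=
  sSup {i | ∃ P, .notify i P ∈ H.events ∧ H.le (.notify i P) e}

end Computation

/-! ## The protocol -/

/-- A stamped message: payload, originator, view and vector time. -/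
@[ext] structure Message (Proc Body : Type*) where
  body : Body
  orig : Proc
  view : ℕ
  vt : Proc → Option ℕ

/-- A pair of counters: forwarded and originally broadcast messages. -/
@[ext] structure Count where
  f : ℕ
  b : ℕ

def Count.total (c : Count) : ℕ := c.f + c.b

/-- The total of a possibly missing counter. -/
def totalOf (c : Option Count) : ℕ := (c.map Count.total).getD 0

/-- A record of the wait set: a message, its index and its instability set. -/
@[ext] structure WaitRec (Proc Body : Type*) where
  msg : Message Proc Body
  index : Count
  iset : Proc → Option Count

/-- The contents of donations and co-donations. -/
@[ext] structure Donation (Proc Body : Type*) where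
  waitSet : List (WaitRec Proc Body)
  mpktIn : Proc → Option Count
  ghostHeight : ℕ
  flushHeight : ℕ

/-- The contents of packets. -/
inductive Content (Proc Body : Type*)
  | msg (m : Message Proc Body)
  | ack (m : Message Proc Body)
  | ghost (v : ℕ)
  | flush (v : ℕ)
  | donation (d : Donation Proc Body)
  | codonation (d : Donation Proc Body)

/-- A pending view change. -/
inductive ViewChange (Proc : Type*)
  | join (pid : Proc)
  | remove (pid : Proc)

/-- The state of a process (the user data, which does not influence any other variable, is not
modelled). Sets of messages and records are kept as lists in order of arrival; vectors indexed by
process identifiers are partial functions. -/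
structure State (Proc Body : Type*) where
  curView : ℕ
  vGap : ℕ
  self : Proc
  mset : Set Proc
  pendViewQueue : List (ViewChange Proc)
  liveSet : Set Proc
  contactSet : Set Proc
  vt : Proc → Option ℕ
  receiveSet : List (Message Proc Body)
  fwdQueue : Proc → Option (List (Message Proc Body))
  bcastWaitSet : List (WaitRec Proc Body)
  fwdWaitSet : List (WaitRec Proc Body)
  launchQueue : List Body
  ghostHeight : ℕ
  flushHeight : ℕ
  ghost : Proc → Option ℕ
  flush : Proc → Option ℕ
  mpktOut : Count
  mpktIn : Proc → Option Count

/-- The part of a transaction to which a side effect belongs: the `n`-th simulated receipt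
(counted from `0`) inside a donation or co-donation transaction, the attempt to install views at the
end of a co-donation transaction, or anything else. -/
inductive Phase
  | main
  | sub (n : ℕ)
  | install

/-- A side effect: a packet content that is multicast to a set of targets. -/
structure Effect (Proc Body : Type*) where
  content : Content Proc Body
  targets : Set Proc
  phase : Phase

/-- A procedure: it changes the state and produces a sequence of side effects. -/
def Act (Proc Body : Type*) : Type _ := State Proc Body → State Proc Body × List (Effect Proc Body)

namespace Act

variable {Proc Body : Type*}

def skip : Act Proc Body := fun s => (s, [])

def modify (g : State Proc Body → State Proc Body) : Act Proc Body := fun s => (g s, [])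

def seq (p q : Act Proc Body) : Act Proc Body :=
  fun s => ((q (p s).1).1, (p s).2 ++ (q (p s).1).2)

/-- Queue a packet to a set of targets. -/
def emit (c : Content Proc Body) (T : Set Proc) : Act Proc Body := fun s => (s, [⟨c, T, .main⟩])

/-- Queue a packet to the current contact set. -/
def emitContacts (c : Content Proc Body) : Act Proc Body := fun s => (s, [⟨c, s.contactSet, .main⟩])

def forEach {α : Type*} (p : α → Act Proc Body) : List α → Act Proc Body
  | [] => skip
  | x :: xs => seq (p x) (forEach p xs)

/-- Attach a phase to all the side effects of a procedure. -/
def inPhase (φ : Phase) (p : Act Proc Body) : Act Proc Body :=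
  fun s => ((p s).1, (p s).2.map fun ε => { ε with phase := φ })

end Act

section Protocol

variable {Proc Body : Type*}

open Act

def State.waitSet (s : State Proc Body) : List (WaitRec Proc Body) := s.bcastWaitSet ++ s.fwdWaitSet

def State.height (s : State Proc Body) : ℕ := s.curView + s.vGap

/-- The state as it is sent in donations and co-donations. -/
def State.donated (s : State Proc Body) : Donation Proc Body :=
  ⟨s.waitSet, s.mpktIn, s.ghostHeight, s.flushHeight⟩

/-- `CheckFlush()` -/
def checkFlush : Act Proc Body := fun s =>
  if s.fwdWaitSet ≠ [] then (s, [])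
  else
    seq
      (fun s => if s.ghostHeight < s.height then
          seq (modify fun s => { s with ghostHeight := s.height })
            (emitContacts (.ghost s.height)) s
        else (s, []))
      (fun s => if s.bcastWaitSet ≠ [] then (s, [])
        else if s.flushHeight < s.height then
          seq (modify fun s => { s with flushHeight := s.height })
            (emitContacts (.flush s.height)) s
        else (s, []))
      s

/-- A message is deliverable. -/
def deliverable (s : State Proc Body) (m : Message Proc Body) : Prop :=
  m.view = s.curView ∧ (m.vt m.orig).getD 0 = (s.vt m.orig).getD 0 + 1 ∧
    ∀ pid ∈ s.mset, pid ≠ m.orig → (m.vt pid).getD 0 ≤ (s.vt pid).getD 0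

/-- One pass over the receive set that delivers the deliverable messages. -/
def scanPass (s : State Proc Body) : State Proc Body :=
  s.receiveSet.foldl (fun s m =>
    if deliverable s m then
      { s with
        vt := Function.update s.vt m.orig (some ((s.vt m.orig).getD 0 + 1))
        receiveSet := s.receiveSet.filter fun m' => decide (m' ≠ m) }
    else s) s

/-- `Scan()`: repeat the pass until nothing more is delivered. A pass that delivers something shortens
the receive set and a pass that delivers nothing changes nothing, so that as many passes as there
are messages suffice. -/
def scan (s : State Proc Body) : State Proc Body := scanPass^[s.receiveSet.length] s

/-- `protBroadcast(msg)` -/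
def protBroadcast (x : Body) : Act Proc Body := fun s =>
  if 0 < s.vGap then ({ s with launchQueue := s.launchQueue ++ [x] }, [])
  else
    let out : Count := { s.mpktOut with b := s.mpktOut.b + 1 }
    let vt' := Function.update s.vt s.self
      (some ((s.vt s.self).getD 0 + out.b - ((s.mpktIn s.self).map Count.b).getD 0))
    let m : Message Proc Body := ⟨x, s.self, s.curView, vt'⟩
    ({ s with
        mpktOut := out
        bcastWaitSet := s.bcastWaitSet ++ [⟨m, out, s.mpktIn⟩] },
      [⟨.msg m, s.contactSet, .main⟩])

/-- `protStart(roster, pid)` -/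
def protStart (roster : Set Proc) (pid : Proc) : Act Proc Body := fun _ =>
  ({ curView := 0
     vGap := 0
     self := pid
     mset := roster
     pendViewQueue := []
     liveSet := roster
     contactSet := roster
     vt := fun p => if p ∈ roster then some 0 else none
     receiveSet := []
     fwdQueue := fun p => if p ∈ roster then some [] else none
     bcastWaitSet := []
     fwdWaitSet := []
     launchQueue := []
     ghostHeight := 0
     flushHeight := 0
     ghost := fun p => if p ∈ roster then some 0 else none
     flush := fun p => if p ∈ roster then some 0 else none
     mpktOut := ⟨0, 0⟩
     mpktIn := fun p => if p ∈ roster then some ⟨0, 0⟩ else none }, [])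

/-- `protRun(pid)` -/
def protRun (pid : Proc) : Act Proc Body :=
  seq (modify fun s =>
    { s with
      vGap := s.vGap + 1
      pendViewQueue := s.pendViewQueue ++ [.join pid]
      liveSet := insert pid s.liveSet
      contactSet := {pid}
      fwdQueue := Function.update s.fwdQueue pid (some [])
      bcastWaitSet := []
      fwdWaitSet := s.fwdWaitSet.map fun r => { r with index := { r.index with b := 0 } }
      launchQueue := []
      flushHeight := s.ghostHeight
      ghost := Function.update s.ghost pid (some s.ghostHeight)
      flush := Function.update s.flush pid (some s.ghostHeight)
      mpktOut := { s.mpktOut with b := 0 }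
      mpktIn := Function.update s.mpktIn pid (some { s.mpktOut with b := 0 })
      self := pid }) checkFlush

/-- Discard the instability of `P`. -/
def WaitRec.discard (P : Proc) (r : WaitRec Proc Body) : WaitRec Proc Body :=
  { r with iset := Function.update r.iset P none }

/-- The instability set is empty. -/
def WaitRec.Stable (r : WaitRec Proc Body) : Prop := ∀ P, r.iset P = none

/-- Forward one message. -/
def forward (m : Message Proc Body) : Act Proc Body := fun s =>
  let out : Count := { s.mpktOut with f := s.mpktOut.f + 1 }
  ({ s with
      mpktOut := out
      fwdWaitSet := s.fwdWaitSet ++ [⟨m, out, s.mpktIn⟩] },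
    [⟨.msg m, s.contactSet, .main⟩])

/-- `protRemove(rem)` -/
def protRemove (rem : Proc) : Act Proc Body := fun s =>
  seq (modify fun s =>
      { s with
        vGap := s.vGap + 1
        pendViewQueue := s.pendViewQueue ++ [.remove rem]
        liveSet := s.liveSet \ {rem}
        contactSet := s.contactSet \ {rem}
        bcastWaitSet := (s.bcastWaitSet.map (WaitRec.discard rem)).filter
          fun r => decide (¬ r.Stable)
        fwdWaitSet := (s.fwdWaitSet.map (WaitRec.discard rem)).filter
          fun r => decide (¬ r.Stable)
        mpktIn := Function.update s.mpktIn rem none })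
    (seq (forEach forward ((s.fwdQueue rem).getD []))
      (seq (modify fun s =>
          { s with
            fwdQueue := Function.update s.fwdQueue rem none
            ghost := Function.update s.ghost rem none
            flush := Function.update s.flush rem none })
        checkFlush)) s

/-- `protJoin(jn, par)` -/
def protJoin (jn par : Proc) : Act Proc Body :=
  let addInst : WaitRec Proc Body → WaitRec Proc Body := fun r =>
    match r.iset par with
    | some c => { r with iset := Function.update r.iset jn (some ⟨c.f, 0⟩) }
    | none => r
  seq (modify fun s =>
      { s with
        vGap := s.vGap + 1
        pendViewQueue := s.pendViewQueue ++ [.join jn]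
        liveSet := insert jn s.liveSet
        contactSet := insert jn s.contactSet
        fwdQueue := Function.update s.fwdQueue jn (some [])
        bcastWaitSet := s.bcastWaitSet.map addInst
        fwdWaitSet := s.fwdWaitSet.map addInst
        ghost := Function.update s.ghost jn (s.ghost par)
        flush := Function.update s.flush jn (s.ghost par)
        mpktIn := Function.update s.mpktIn jn
          (some ⟨((s.mpktIn par).map Count.f).getD 0, 0⟩) })
    (seq (fun s => emit (.donation s.donated) {jn} s) checkFlush)

/-- `ReceiveMessage(msg, sender)` -/
def receiveMessage (m : Message Proc Body) (sender : Proc) : Act Proc Body :=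
  seq (emit (.ack m) {sender})
    (seq (modify fun s =>
        { s with
          mpktIn := Function.update s.mpktIn sender ((s.mpktIn sender).map fun c =>
            if m.orig = sender then { c with b := c.b + 1 } else { c with f := c.f + 1 }) })
      (modify fun s =>
        if m.view < s.curView then s
        else if m.view = s.curView ∧ (m.vt m.orig).getD 0 ≤ (s.vt m.orig).getD 0 then s
        else if m ∈ s.receiveSet then s
        else scan
          { s with
            receiveSet := s.receiveSet ++ [m]
            fwdQueue := Function.update s.fwdQueue sender
              ((s.fwdQueue sender).map fun l => l ++ [m]) }))

/-- `ReceiveAck(msg, sender)` -/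
def receiveAck (m : Message Proc Body) (sender : Proc) : Act Proc Body := fun s =>
  let upd : WaitRec Proc Body → WaitRec Proc Body := fun r =>
    if r.msg = m then r.discard sender else r
  let gone : WaitRec Proc Body → Prop := fun r => r.msg = m ∧ r.Stable
  let s' : State Proc Body :=
    { s with
      bcastWaitSet := (s.bcastWaitSet.map upd).filter fun r => decide (¬ gone r)
      fwdWaitSet := (s.fwdWaitSet.map upd).filter fun r => decide (¬ gone r) }
  if ∃ r ∈ s.waitSet.map upd, gone r then checkFlush s' else (s', [])

/-- `ReceiveGhost(view, sender)` -/
def receiveGhost (v : ℕ) (sender : Proc) : Act Proc Body :=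
  modify fun s => { s with ghost := Function.update s.ghost sender (some v) }

/-- One round of the installation loop. -/
def installOne (s : State Proc Body) : State Proc Body :=
  let keep : List (Message Proc Body) → List (Message Proc Body) :=
    fun l => l.filter fun m => decide (m.view ≠ s.curView)
  let mset' : Set Proc :=
    match s.pendViewQueue.head? with
    | some (.join pid) => insert pid s.mset
    | some (.remove pid) => s.mset \ {pid}
    | none => s.mset
  scan
    { s with
      receiveSet := keep s.receiveSet
      fwdQueue := fun pid => if pid ∈ s.liveSet then (s.fwdQueue pid).map keep else s.fwdQueue pid
      curView := s.curView + 1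
      vGap := s.vGap - 1
      pendViewQueue := s.pendViewQueue.tail
      mset := mset'
      vt := fun pid => if pid ∈ mset' then some 0 else none }

/-- `TryToInstall()` -/
def tryToInstall : Act Proc Body := fun s =>
  if ∃ pid ∈ s.liveSet, (s.flush pid).getD 0 < s.height then (s, [])
  else
    let s' := installOne^[s.vGap] s
    forEach protBroadcast s'.launchQueue { s' with launchQueue := [] }

/-- `ReceiveFlush(view, sender)` -/
def receiveFlush (v : ℕ) (sender : Proc) : Act Proc Body :=
  seq (modify fun s => { s with flush := Function.update s.flush sender (some v) }) tryToInstall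

/-- The untimely records that are examined when the donation or co-donation `d` from `sender` is
processed: the local records that are unstable at the sender (tagged `true`) and the donated records
that are unstable at the recipient (tagged `false`). -/
def untimelyRecords (d : Donation Proc Body) (sender : Proc) (s : State Proc Body) :
    List (Bool × WaitRec Proc Body) :=
  (s.waitSet.filter fun r => (r.iset sender).isSome).map (fun r => (true, r)) ++
    (d.waitSet.filter fun r => (r.iset s.self).isSome).map (fun r => (false, r))

/-- The pair `(height_a, height_b)` by which these records are sorted. -/
def recordHeight (self : Proc) : Bool × WaitRec Proc Body → ℕ × ℕ
  | (true, r) => (r.index.total, 0)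
  | (false, r) => (totalOf (r.iset self), r.index.total)

/-- Process the sorted records; `n` counts the simulated receipts so far. -/
def processRecords (d : Donation Proc Body) (sender : Proc) :
    ℕ → List (Bool × WaitRec Proc Body) → Act Proc Body
  | _, [] => skip
  | n, (false, r) :: l => fun s =>
    if totalOf (s.mpktIn sender) < r.index.total then
      seq (inPhase (.sub n) (receiveMessage r.msg sender)) (processRecords d sender (n + 1) l) s
    else processRecords d sender n l s
  | n, (true, r) :: l => fun s =>
    if r.index.total ≤ totalOf (d.mpktIn s.self) then
      seq (inPhase (.sub n) (receiveAck r.msg sender)) (processRecords d sender (n + 1) l) s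
    else processRecords d sender n l s

/-- The common part of the processing of donations and co-donations. -/
def processDonation (d : Donation Proc Body) (sender : Proc) : Act Proc Body := fun s =>
  seq
    (processRecords d sender 0
      ((untimelyRecords d sender s).insertionSort fun x y =>
        (recordHeight s.self x).1 < (recordHeight s.self y).1 ∨
          ((recordHeight s.self x).1 = (recordHeight s.self y).1 ∧
            (recordHeight s.self x).2 ≤ (recordHeight s.self y).2)))
    (modify fun s =>
      { s with
        ghost := Function.update s.ghost sender (some d.ghostHeight)
        flush := Function.update s.flush sender (some d.flushHeight) }) s

/-- `ReceiveDonation(donation, sender)` -/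
def receiveDonation (d : Donation Proc Body) (sender : Proc) : Act Proc Body :=
  seq (modify fun s => { s with contactSet := insert sender s.contactSet })
    (seq (fun s => emit (.codonation s.donated) {sender} s) (processDonation d sender))

/-- `ReceiveCoDonation(co_donation, sender)` -/
def receiveCoDonation (d : Donation Proc Body) (sender : Proc) : Act Proc Body :=
  seq (processDonation d sender) (inPhase .install tryToInstall)

/-- `protPacket(k, sender)` -/
def protPacket : Content Proc Body → Proc → Act Proc Body
  | .msg m, S => receiveMessage m S
  | .ack m, S => receiveAck m S
  | .ghost v, S => receiveGhost v S
  | .flush v, S => receiveFlush v S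
  | .donation d, S => receiveDonation d S
  | .codonation d, S => receiveCoDonation d S

variable {Pkt Que Req : Type*}

/-- The procedure that a trigger event invokes. -/
def handle (H : Computation Proc Pkt Que Req (Content Proc Body) Body) :
    Ev Proc Pkt Que Req → Act Proc Body
  | .queue _ => skip
  | .dequeue k => protPacket (H.content k) (H.source k)
  | .request r => protBroadcast (H.body r)
  | .notify i P =>
    match H.notice i P with
    | some (.new Q) => if i = 0 then protStart (H.view 0) Q else protRun Q
    | some (.joined J E) => protJoin J E
    | some (.removed R) => protRemove R
    | some .done => skip
    | none => skip

/-- An execution of the protocol that gives rise to the computation `H`, in which every trigger is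
processed to completion. `pre e` is the state in which the trigger `e` is dequeued, `trigger q` is the
trigger of the transaction to which the queuing event `q` belongs, and `position q` is the position of
`q` in the sequence of side effects of that transaction. -/
structure Execution (H : Computation Proc Pkt Que Req (Content Proc Body) Body) where
  pre : Ev Proc Pkt Que Req → State Proc Body
  trigger : Que → Ev Proc Pkt Que Req
  position : Que → ℕ
  /-- a joining process starts with the state in which its parent dequeues the notification -/
  fork : ∀ J, 0 < H.joinView J → .notify (H.joinView J) J ∈ H.events →
    pre (.notify (H.joinView J) J) = pre (.notify (H.joinView J) (H.parent J))
  /-- the state does not change between successive transactions -/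
  carry : ∀ P, ∀ e ∈ H.eventsAt P, ∀ f ∈ H.eventsAt P, e.IsTrigger → f.IsTrigger → H.lt e f →
    (∀ g ∈ H.eventsAt P, g.IsTrigger → ¬ (H.lt e g ∧ H.lt g f)) →
    pre f = (handle H e (pre e)).1
  /-- the trigger of a queuing event is the last trigger before it at the same process -/
  trigger_last : ∀ q P, .queue q ∈ H.eventsAt P →
    trigger q ∈ H.eventsAt P ∧ (trigger q).IsTrigger ∧ H.lt (trigger q) (.queue q) ∧
    ∀ g ∈ H.eventsAt P, g.IsTrigger → H.lt g (.queue q) → H.le g (trigger q)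
  /-- every queuing event is the side effect that the protocol prescribes -/
  effect_of : ∀ q, .queue q ∈ H.events →
    ∃ ε, (handle H (trigger q) (pre (trigger q))).2[position q]? = some ε ∧
      (∀ k ∈ H.packets, H.queuing k = q → H.content k = ε.content) ∧
      {Q | ∃ k ∈ H.packets, H.queuing k = q ∧ H.target k = Q} = ε.targets
  /-- every prescribed side effect (with at least one target) takes place -/
  effect_occurs : ∀ e ∈ H.events, e.IsTrigger → ∀ n ε,
    (handle H e (pre e)).2[n]? = some ε → ε.targets.Nonempty →
    ∃ q, .queue q ∈ H.events ∧ trigger q = e ∧ position q = n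
  /-- side effects take place in the prescribed order -/
  effect_order : ∀ q q', .queue q ∈ H.events → .queue q' ∈ H.events → trigger q = trigger q' →
    position q < position q' → H.lt (.queue q) (.queue q')
  effect_inj : ∀ q q', .queue q ∈ H.events → .queue q' ∈ H.events → trigger q = trigger q' →
    position q = position q' → q = q'

end Protocol

/-! ## The label space -/

section Labels

variable {Proc Pkt Que Req Body : Type*}

/-- The clean event set: all notification events of one view are collapsed into one element. -/
inductive Clean (Proc Pkt Que Req : Type*)
  | view (i : ℕ)
  | event (e : Ev Proc Pkt Que Req)

/-- The clean event that corresponds to an event. -/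
def cleanOf : Ev Proc Pkt Que Req → Clean Proc Pkt Que Req
  | .notify i _ => .view i
  | e => .event e

/-- The clean event order. -/
def cleanLT {Cont : Type*} (H : Computation Proc Pkt Que Req Cont Body) :
    Clean Proc Pkt Que Req → Clean Proc Pkt Que Req → Prop
  | .view i, .view j => i < j
  | .view i, .event f => i ≤ H.eventView f
  | .event e, .view j => H.eventView e < j
  | .event e, .event f =>
    H.eventView e < H.eventView f ∨ (H.eventView e = H.eventView f ∧ H.lt e f)

/-- The sub-transaction coordinate: a least element, together with the disjoint union of the clean
events and the serial numbers. -/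
inductive Sub (Proc Pkt Que Req : Type*)
  | zero
  | ev (c : Clean Proc Pkt Que Req)
  | serial (n : ℕ)

def subLT {Cont : Type*} (H : Computation Proc Pkt Que Req Cont Body) :
    Sub Proc Pkt Que Req → Sub Proc Pkt Que Req → Prop
  | .zero, .zero => False
  | .zero, _ => True
  | .ev c, .ev c' => cleanLT H c c'
  | .serial n, .serial n' => n < n'
  | _, _ => False

/-- `pos` stands for the joining process `G`, `neg` for the additional process `-G`. -/
inductive Sign
  | pos
  | neg

/-- The adjustment coordinate. -/
inductive Adj
  | ghost (s : Sign)
  | flush (s : Sign)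
  | ack (s : Sign)
  | zero
  | msg (s : Sign)

/-- The place of an adjustment in the linear order of the nine adjustments. -/
def Adj.rank : Adj → ℕ
  | .ghost .neg => 0
  | .ghost .pos => 1
  | .flush .neg => 2
  | .flush .pos => 3
  | .ack .neg => 4
  | .ack .pos => 5
  | .zero => 6
  | .msg .neg => 7
  | .msg .pos => 8

/-- The side-effect coordinate (`bcast i` is used for `i ≥ 1`). -/
inductive Side
  | trigger
  | codonate
  | donate
  | ack
  | ghost
  | flush
  | bcast (i : ℕ)

def Side.rank : Side → ℕ
  | .trigger => 0
  | .codonate => 1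
  | .donate => 2
  | .ack => 3
  | .ghost => 4
  | .flush => 5
  | .bcast i => 5 + i

/-- Labels: constellation, sub-transaction, adjustment and side-effect coordinate. -/
@[ext] structure Label (Proc Pkt Que Req : Type*) where
  con : Clean Proc Pkt Que Req
  sub : Sub Proc Pkt Que Req
  adj : Adj
  side : Side

/-- The left lexicographic order on labels. -/
def labelLT {Cont : Type*} (H : Computation Proc Pkt Que Req Cont Body)
    (a b : Label Proc Pkt Que Req) : Prop :=
  cleanLT H a.con b.con ∨ (a.con = b.con ∧
    (subLT H a.sub b.sub ∨ (a.sub = b.sub ∧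
      (a.adj.rank < b.adj.rank ∨ (a.adj = b.adj ∧ a.side.rank < b.side.rank)))))

end Labels

def Content.IsMsg {Proc Body : Type*} : Content Proc Body → Prop
  | .msg _ => True
  | _ => False

def Content.IsAck {Proc Body : Type*} : Content Proc Body → Prop
  | .ack _ => True
  | _ => False

def Content.IsGhost {Proc Body : Type*} : Content Proc Body → Prop
  | .ghost _ => True
  | _ => False

def Content.IsFlush {Proc Body : Type*} : Content Proc Body → Prop
  | .flush _ => True
  | _ => False

def Content.IsDonation {Proc Body : Type*} : Content Proc Body → Prop
  | .donation _ => True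
  | _ => False

def Content.IsCoDonation {Proc Body : Type*} : Content Proc Body → Prop
  | .codonation _ => True
  | _ => False

/-- A message that does not originate at `D` (so that it is a forwarded message if `D` sends it). -/
def Content.IsMsgNotFrom {Proc Body : Type*} (D : Proc) : Content Proc Body → Prop
  | .msg m => m.orig ≠ D
  | _ => False

/-- An acknowledgement of a message that does not originate at `D`. -/
def Content.IsAckNotFrom {Proc Body : Type*} (D : Proc) : Content Proc Body → Prop
  | .ack m => m.orig ≠ D
  | _ => False

/-! ## Labelling the events of the given history

Throughout, `G` is the process that joins in the critical view change and `H.parent G` is its parent.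
-/

section Original

variable {Proc Pkt Que Req Body : Type*}
  (H : Computation Proc Pkt Que Req (Content Proc Body) Body) (X : Execution H) (G : Proc)

/-- The event happens before the critical view change. -/
def PreCritical (e : Ev Proc Pkt Que Req) : Prop := cleanLT H (cleanOf e) (.view (H.joinView G))

/-- A packet that is both queued and dequeued before the critical view change. -/
def Timely (k : Pkt) : Prop :=
  k ∈ H.packets ∧ PreCritical H G (.queue (H.queuing k)) ∧
    .dequeue k ∈ H.events ∧ PreCritical H G (.dequeue k)

/-- A packet that is queued before the critical view change, but not dequeued before it. -/
def Untimely (k : Pkt) : Prop :=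
  k ∈ H.packets ∧ PreCritical H G (.queue (H.queuing k)) ∧
    ¬ (.dequeue k ∈ H.events ∧ PreCritical H G (.dequeue k))

/-- `k` is the critical donation packet from the original process `P`. -/
def IsCritDonation (P : Proc) (k : Pkt) : Prop :=
  k ∈ H.channel P G ∧ H.Original P ∧ (H.content k).IsDonation

/-- `k` is the critical co-donation packet to the original process `P`. -/
def IsCritCoDonation (P : Proc) (k : Pkt) : Prop :=
  k ∈ H.channel G P ∧ H.Original P ∧ (H.content k).IsCoDonation

/-- `d` is the critical donation packet from `P`, and it is dequeued. -/
def DonationTime (P : Proc) (d : Pkt) : Prop := IsCritDonation H G P d ∧ .dequeue d ∈ H.events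

/-- `c` is the critical co-donation packet to `P`, and it is dequeued. -/
def CoDonationTime (P : Proc) (c : Pkt) : Prop := IsCritCoDonation H G P c ∧ .dequeue c ∈ H.events

/-- The queuing event `q` takes place at `G` before the critical donation from `P` is dequeued. -/
def BeforeDonation (P : Proc) (q : Que) : Prop :=
  ∃ d, DonationTime H G P d ∧ H.lt (.queue q) (.dequeue d)

/-- The queuing events that correspond to the sub-transactions of the critical donation transaction
of `P`. -/
def donationQueuings (P : Proc) : Set Que :=
  {q | ∃ k ∈ H.channel P (H.parent G), H.queuing k = q ∧ Untimely H G k ∧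
    ((H.content k).IsMsg ∨ (H.content k).IsAckNotFrom (H.parent G))}

/-- The queuing events that correspond to the sub-transactions of the critical co-donation
transaction of `P`. -/
def coDonationQueuings (P : Proc) : Set Que :=
  {q | (∃ k ∈ H.channel (H.parent G) P, H.queuing k = q ∧ Untimely H G k ∧
      ((H.content k).IsMsgNotFrom (H.parent G) ∨ (H.content k).IsAck)) ∨
    (∃ k ∈ H.channel G G, H.queuing k = q ∧ (H.content k).IsMsg ∧
      ¬ PreCritical H G (.queue q) ∧ BeforeDonation H G P q)}

/-- The flush queuing events at `G`, after the critical view change and before the critical donation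
from `P` is dequeued. -/
def flushQueuings (P : Proc) : Set Que :=
  {q | ∃ k ∈ H.channel G G, H.queuing k = q ∧ (H.content k).IsFlush ∧
    ¬ PreCritical H G (.queue q) ∧ BeforeDonation H G P q}

/-- `q` is the `n`-th element of `S`, counted from `0`. -/
def IsNth (S : Set Que) (n : ℕ) (q : Que) : Prop :=
  q ∈ S ∧ {q' | q' ∈ S ∧ H.lt (.queue q') (.queue q)}.Finite ∧
    {q' | q' ∈ S ∧ H.lt (.queue q') (.queue q)}.ncard = n

/-- The queuing event that satisfies `p`, as a sub-transaction coordinate. -/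
def subOf (p : Que → Prop) : Sub Proc Pkt Que Req :=
  if h : ∃ q, p q then .ev (cleanOf (.queue h.choose)) else .zero

/-- The side effect of the protocol that is the queuing event `q`. -/
def effectAt (q : Que) : Option (Effect Proc Body) :=
  (handle H (X.trigger q) (X.pre (X.trigger q))).2[X.position q]?

/-- The sub-transaction coordinate of a queuing event. -/
def subCoord (q : Que) : Sub Proc Pkt Que Req :=
  match (effectAt H X q).map Effect.phase with
  | some (.sub n) =>
    match X.trigger q with
    | .dequeue k =>
      if IsCritDonation H G (H.source k) k then
        subOf fun q' => IsNth H (donationQueuings H G (H.source k)) n q'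
      else if IsCritCoDonation H G (H.target k) k then
        subOf fun q' => IsNth H (coDonationQueuings H G (H.target k)) n q'
      else .serial (n + 1)
    | _ => .zero
  | some .install =>
    match X.trigger q with
    | .dequeue k =>
      if IsCritCoDonation H G (H.target k) k then
        subOf fun q' => q' ∈ flushQueuings H G (H.target k) ∧
          (∀ q'' ∈ flushQueuings H G (H.target k), H.le (.queue q'') (.queue q')) ∧
          ∃ k' ∈ H.channel G G, H.queuing k' = q' ∧
            H.content k' = .flush (X.pre (X.trigger q)).height
      else .zero
    | _ => .zero
  | _ => .zero

/-- The side-effect coordinate of a queuing event. A message that is the `i`-th message of its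
transaction (or of its final installation) has the coordinate `bcast i`. -/
def sideCoord (q : Que) : Side :=
  match (effectAt H X q).map Effect.content with
  | some (.codonation _) => .codonate
  | some (.donation _) => .donate
  | some (.ack _) => .ack
  | some (.ghost _) => .ghost
  | some (.flush _) => .flush
  | some (.msg _) =>
    .bcast (((handle H (X.trigger q) (X.pre (X.trigger q))).2.take (X.position q + 1)).countP
      fun ε => decide ε.content.IsMsg)
  | none => .trigger

/-- The label of an event of the given history. -/
def label : Ev Proc Pkt Que Req → Label Proc Pkt Que Req
  | .queue q => ⟨cleanOf (X.trigger q), subCoord H X G q, .zero, sideCoord H X q⟩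
  | e => ⟨cleanOf e, .zero, .zero, .trigger⟩

end Original

/-! ## The reduced history -/

section Reduction

/-- Names of the packets of the reduced history. A sign `s` stands for the process `G` (`pos`) or `-G`
(`neg`). -/
inductive RPkt (Proc Pkt : Type*)
  /-- the reduction of a packet -/
  | orig (k : Pkt)
  /-- the clone from `P` to `s` of a packet from `P` to the critical parent -/
  | into (s : Sign) (k : Pkt)
  /-- the clone from `s` to `P` of a packet from the critical parent to `P` -/
  | outof (s : Sign) (k : Pkt)
  /-- the zombie from `s` to `P` of a ghost packet from the critical parent to `P` -/
  | outofZombie (s : Sign) (k : Pkt)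
  /-- the clone from `s` to `t` of a packet from the critical parent to itself -/
  | within (s t : Sign) (k : Pkt)
  /-- the zombie from `s` to `t` of a ghost packet from the critical parent to itself -/
  | withinZombie (s t : Sign) (k : Pkt)
  /-- the clone from `G` to `P` of a post-critical packet from `G` to itself -/
  | late (P : Proc) (k : Pkt)

/-- Names of the queuing events of the reduced history. -/
inductive RQue (Que : Type*)
  | orig (q : Que)
  /-- the clone at the same process, adjusted by a message from `s` -/
  | shift (s : Sign) (q : Que)
  /-- the clone at the process `s` -/
  | clone (s : Sign) (q : Que)
  /-- the clone at the process `s`, adjusted by a message from `t` -/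
  | cloneShift (s t : Sign) (q : Que)
  /-- the zombie at the process `s` -/
  | zombie (s : Sign) (q : Que)

variable {Proc Pkt Que Req Body : Type*}

/-- The processes `G` and `-G` of the reduced history; the process set is extended by `none`. -/
def Sign.proc (G : Proc) : Sign → Option Proc
  | .pos => some G
  | .neg => none

/-- A vector indexed by processes, with no entry for `-G`. -/
def extendVec {α : Type*} (v : Proc → Option α) : Option Proc → Option α
  | some P => v P
  | none => none

/-- The reduction of a stamped message; `c` is the critical view. -/
def redMsg (G : Proc) (c : ℕ) (m : Message Proc Body) : Message (Option Proc) Body where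
  body := m.body
  orig := some m.orig
  view := m.view
  vt := if m.view < c then
      Function.update (Function.update (extendVec m.vt) (some G) (some 0)) none (some 0)
    else extendVec m.vt

def redDonation (G : Proc) (c : ℕ) (d : Donation Proc Body) : Donation (Option Proc) Body where
  waitSet := d.waitSet.map fun r => ⟨redMsg G c r.msg, r.index, extendVec r.iset⟩
  mpktIn := extendVec d.mpktIn
  ghostHeight := d.ghostHeight
  flushHeight := d.flushHeight

/-- The reduction of a packet content. -/
def redContent (G : Proc) (c : ℕ) : Content Proc Body → Content (Option Proc) Body
  | .msg m => .msg (redMsg G c m)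
  | .ack m => .ack (redMsg G c m)
  | .ghost v => .ghost v
  | .flush v => .flush v
  | .donation d => .donation (redDonation G c d)
  | .codonation d => .codonation (redDonation G c d)

/-- A ghost comes back as a flush. -/
def zombify {P B : Type*} : Content P B → Content P B
  | .ghost v => .flush v
  | x => x

variable (H : Computation Proc Pkt Que Req (Content Proc Body) Body) (X : Execution H) (G : Proc)

/-- The contents that are cloned from the critical parent `D` to `G` and `-G` on outgoing channels. -/
def ClonedOut (k : Pkt) : Prop :=
  (H.content k).IsMsgNotFrom (H.parent G) ∨ (H.content k).IsAck ∨ (H.content k).IsGhost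

/-- The contents that are cloned on the channels between `G` and `-G`. -/
def ClonedWithin (k : Pkt) : Prop :=
  (H.content k).IsMsgNotFrom (H.parent G) ∨ (H.content k).IsAckNotFrom (H.parent G) ∨
    (H.content k).IsGhost

/-- The packets of the reduced history. -/
def rPackets : Set (RPkt Proc Pkt) :=
  {x | match x with
    | .orig k => k ∈ H.packets ∧ (∀ P, ¬ IsCritDonation H G P k) ∧ ∀ P, ¬ IsCritCoDonation H G P k
    | .into _ k => k ∈ H.packets ∧ H.target k = H.parent G ∧ H.source k ≠ G ∧
        PreCritical H G (.queue (H.queuing k)) ∧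
        ((H.content k).IsGhost ∨ (H.content k).IsFlush ∨ (H.content k).IsMsg ∨
          (H.content k).IsAckNotFrom (H.parent G))
    | .outof _ k => k ∈ H.packets ∧ H.source k = H.parent G ∧ H.target k ≠ G ∧
        PreCritical H G (.queue (H.queuing k)) ∧ ClonedOut H G k
    | .outofZombie _ k => k ∈ H.packets ∧ H.source k = H.parent G ∧ H.target k ≠ G ∧
        PreCritical H G (.queue (H.queuing k)) ∧ (H.content k).IsGhost
    | .within _ _ k => k ∈ H.channel (H.parent G) (H.parent G) ∧ Timely H G k ∧ ClonedWithin H G k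
    | .withinZombie _ _ k => k ∈ H.channel (H.parent G) (H.parent G) ∧ Timely H G k ∧
        (H.content k).IsGhost
    | .late P k => P ≠ G ∧ H.Original P ∧ k ∈ H.channel G G ∧
        ¬ PreCritical H G (.queue (H.queuing k)) ∧
        (H.eventView (X.trigger (H.queuing k)) : ℕ∞) < H.deathView P ∧
        (∀ d, DonationTime H G P d →
          cleanLT H (cleanOf (X.trigger (H.queuing k))) (cleanOf (.dequeue d))) ∧
        ((H.content k).IsGhost ∨ (H.content k).IsFlush ∨ (H.content k).IsMsg)}

def rSource : RPkt Proc Pkt → Option Proc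
  | .orig k => some (H.source k)
  | .into _ k => some (H.source k)
  | .outof s _ => s.proc G
  | .outofZombie s _ => s.proc G
  | .within s _ _ => s.proc G
  | .withinZombie s _ _ => s.proc G
  | .late _ _ => some G

def rTarget : RPkt Proc Pkt → Option Proc
  | .orig k => some (H.target k)
  | .into s _ => s.proc G
  | .outof _ k => some (H.target k)
  | .outofZombie _ k => some (H.target k)
  | .within _ t _ => t.proc G
  | .withinZombie _ t _ => t.proc G
  | .late P _ => some P

def rContent : RPkt Proc Pkt → Content (Option Proc) Body
  | .orig k => redContent G (H.joinView G) (H.content k)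
  | .into _ k => redContent G (H.joinView G) (H.content k)
  | .outof _ k => redContent G (H.joinView G) (H.content k)
  | .outofZombie _ k => zombify (redContent G (H.joinView G) (H.content k))
  | .within _ _ k => redContent G (H.joinView G) (H.content k)
  | .withinZombie _ _ k => zombify (redContent G (H.joinView G) (H.content k))
  | .late _ k => redContent G (H.joinView G) (H.content k)

def rQueuing : RPkt Proc Pkt → RQue Que
  | .orig k => .orig (H.queuing k)
  | .into s k => if (H.content k).IsAck then .shift s (H.queuing k) else .orig (H.queuing k)
  | .outof s k => .clone s (H.queuing k)
  | .outofZombie s k => .zombie s (H.queuing k)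
  | .within s t k =>
    if (H.content k).IsAck then .cloneShift s t (H.queuing k) else .clone s (H.queuing k)
  | .withinZombie s _ k => .zombie s (H.queuing k)
  | .late _ k => .orig (H.queuing k)

/-- The queuing events that occur in the reduced history. -/
def rQueued : RQue Que → Prop
  | .orig q => .queue q ∈ H.events ∧
      ∀ k ∈ H.packets, H.queuing k = q →
        (∀ P, ¬ IsCritDonation H G P k) ∧ ∀ P, ¬ IsCritCoDonation H G P k
  | .shift _ q => PreCritical H G (.queue q) ∧ ∃ k ∈ H.packets, H.queuing k = q ∧
      H.target k = H.parent G ∧ (H.content k).IsAckNotFrom (H.parent G)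
  | .clone _ q => PreCritical H G (.queue q) ∧ ∃ k ∈ H.packets, H.queuing k = q ∧
      H.source k = H.parent G ∧ ClonedOut H G k
  | .cloneShift _ _ q => PreCritical H G (.queue q) ∧
      ∃ k ∈ H.channel (H.parent G) (H.parent G), H.queuing k = q ∧
        (H.content k).IsAckNotFrom (H.parent G)
  | .zombie _ q => PreCritical H G (.queue q) ∧ ∃ k ∈ H.packets, H.queuing k = q ∧
      H.source k = H.parent G ∧ (H.content k).IsGhost

/-- The packets that are dequeued in the reduced history. -/
def rDequeued (x : RPkt Proc Pkt) : Prop :=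
  x ∈ rPackets H X G ∧
    match x with
    | .orig k => .dequeue k ∈ H.events
    | .into s k => Timely H G k ∨ (s = .pos ∧ ∃ d, DonationTime H G (H.source k) d)
    | .outof s k => Timely H G k ∨ (s = .pos ∧ ∃ c, CoDonationTime H G (H.target k) c)
    | .outofZombie s k => Timely H G k ∨ (s = .pos ∧ ∃ c, CoDonationTime H G (H.target k) c)
    | .within _ _ _ => True
    | .withinZombie _ _ _ => True
    | .late P _ => ∃ c, CoDonationTime H G P c

/-- The adjustment with which a packet from `s` is processed. -/
def adjOf (s : Sign) : Content Proc Body → Adj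
  | .msg _ => .msg s
  | .ack _ => .ack s
  | .ghost _ => .ghost s
  | .flush _ => .flush s
  | .donation _ => .zero
  | .codonation _ => .zero

/-- The label of the dequeuing of a packet inside the transaction whose trigger is the dequeuing of a
packet that satisfies `p`: the simulated receipt that corresponds to the queuing event `q`. (If there
is no such packet then there is no such event either, and the value does not matter.) -/
def subLabel (p : Pkt → Prop) (q : Que) (a : Adj) (k : Pkt) : Label Proc Pkt Que Req :=
  ⟨cleanOf (.dequeue (if h : ∃ d, p d then h.choose else k)), .ev (cleanOf (.queue q)), a, .trigger⟩

/-- The labels of the events of the reduced history. -/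
def rLabel : Ev (Option Proc) (RPkt Proc Pkt) (RQue Que) Req → Label Proc Pkt Que Req
  | .queue (.orig q) => label H X G (.queue q)
  | .queue (.shift s q) => { label H X G (.queue q) with adj := .msg s }
  | .queue (.clone _ q) => label H X G (.queue q)
  | .queue (.cloneShift _ t q) => { label H X G (.queue q) with adj := .msg t }
  | .queue (.zombie _ q) => { label H X G (.queue q) with side := .flush }
  | .dequeue (.orig k) => label H X G (.dequeue k)
  | .dequeue (.into _ k) =>
    if Timely H G k then label H X G (.dequeue k)
    else subLabel (DonationTime H G (H.source k)) (H.queuing k) .zero k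
  | .dequeue (.outof s k) =>
    if Timely H G k then { label H X G (.dequeue k) with adj := adjOf s (H.content k) }
    else subLabel (CoDonationTime H G (H.target k)) (H.queuing k)
      (if (H.content k).IsGhost then .ghost s else .zero) k
  | .dequeue (.outofZombie s k) =>
    if Timely H G k then { label H X G (.dequeue k) with adj := .flush s }
    else subLabel (CoDonationTime H G (H.target k)) (H.queuing k) (.flush s) k
  | .dequeue (.within s _ k) => { label H X G (.dequeue k) with adj := adjOf s (H.content k) }
  | .dequeue (.withinZombie s _ k) => { label H X G (.dequeue k) with adj := .flush s }
  | .dequeue (.late P k) => subLabel (CoDonationTime H G P) (H.queuing k) .zero k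
  | .notify i _ => ⟨.view i, .zero, .zero, .trigger⟩
  | .request r => label H X G (.request r)

/-- The events of the reduced history. -/
def rEvents : Set (Ev (Option Proc) (RPkt Proc Pkt) (RQue Que) Req) :=
  {e | match e with
    | .queue q => rQueued H G q
    | .dequeue x => rDequeued H X G x
    | .notify i (some P) => .notify i P ∈ H.events ∨ (P = G ∧ i < H.joinView G)
    | .notify i none => i < H.joinView G
    | .request r => .request r ∈ H.events}

/-- The notifications of the reduced history. -/
def rNotice (i : ℕ) : Option Proc → Option (Notice (Option Proc))
  | none =>
    if i = 0 then some (.new none)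
    else if i < H.joinView G then (H.notice i (H.parent G)).map (Notice.map some)
    else if i = H.joinView G then some .done
    else none
  | some P =>
    if P = G ∧ i = 0 then some (.new (some G))
    else if P = G ∧ i < H.joinView G then (H.notice i (H.parent G)).map (Notice.map some)
    else if i = H.joinView G ∧
        (H.notice i P = some (.joined G (H.parent G)) ∨ H.notice i P = some (.new G)) then
      some (.removed none)
    else (H.notice i P).map (Notice.map some)

/-- The reduced history without its order. -/
def reducedBase : Computation (Option Proc) (RPkt Proc Pkt) (RQue Que) Req
    (Content (Option Proc) Body) Body where
  halting := insert none (some '' H.halting)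
  numView := H.numView
  view i := if i < H.joinView G then some '' H.view i ∪ {some G, none} else some '' H.view i
  parent := Option.map H.parent
  packets := rPackets H X G
  source := rSource H G
  target := rTarget H G
  content := rContent H G
  sent := {x | x ∈ rPackets H X G ∧
    match x with
    | .orig k => k ∈ H.sent
    | _ => True}
  received := {x | x ∈ rPackets H X G ∧
    match x with
    | .orig k => k ∈ H.received
    | _ => rDequeued H X G x}
  notice := rNotice H G
  dropped := ∅
  issuer r := some (H.issuer r)
  body := H.body
  queuing := rQueuing H
  events := rEvents H X G
  le _ _ := False

/-- The primitive order relations of the reduced history. -/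
def rPrim (e f : Ev (Option Proc) (RPkt Proc Pkt) (RQue Que) Req) : Prop :=
  e ∈ rEvents H X G ∧ f ∈ rEvents H X G ∧
    ((∃ x ∈ rPackets H X G, e = .queue (rQueuing H x) ∧ f = .dequeue x) ∨
     (∃ P, e ∈ (reducedBase H X G).eventsAt P ∧ f ∈ (reducedBase H X G).eventsAt P ∧
       labelLT H (rLabel H X G e) (rLabel H X G f)) ∨
     (∃ J, J ≠ G ∧ 0 < H.joinView J ∧
       ((e = .notify (H.joinView J) (some (H.parent J)) ∧ f = .notify (H.joinView J) (some J)) ∨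
        (e = .notify (H.joinView J) (some J) ∧
          f = .notify (H.joinView J) (some (H.parent J))))))

/-- The reduced history. -/
def reduced : Computation (Option Proc) (RPkt Proc Pkt) (RQue Que) Req
    (Content (Option Proc) Body) Body :=
  { reducedBase H X G with le := Relation.ReflTransGen (rPrim H X G) }

end Reduction

end CBCast

end

set_option linter.unusedSimpArgs false
set_option linter.unusedSectionVars false

namespace CBCast

open CBCast.Computation

variable {Proc Pkt Que Req Body : Type*}

local notation "Evt" => Ev Proc Pkt Que Req
local notation "Cnt" => Content Proc Body
local notation "St" => State Proc Body
local notation "Msg" => Message Proc Body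
local notation "Rec" => WaitRec Proc Body
local notation "Eff" => Effect Proc Body
local notation "Dnt" => Donation Proc Body

variable {P Q S J R : Proc} {k : Pkt} {q q' : Que} {e f g : Ev Proc Pkt Que Req} {i n : ℕ} {s s' : State Proc Body} {ε : Effect Proc Body} {es : List (Effect Proc Body)} {c : Content Proc Body} {d : Donation Proc Body} {m : Message Proc Body} {r r' r'' : WaitRec Proc Body}

namespace Computation

variable {Cont : Type*} {H : Computation Proc Pkt Que Req Cont Body}

lemma notify_at (h : .notify i P ∈ H.events) : .notify i P ∈ H.eventsAt P := ⟨h, rfl⟩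

namespace IsHistory

variable (hH : H.IsHistory)
include hH

lemma eventsAt_unique (h : e ∈ H.eventsAt P) (h' : e ∈ H.eventsAt Q) : P = Q := by
  cases e with
  | queue q =>
    obtain ⟨_, k, hk, hq, rfl⟩ := h
    obtain ⟨_, k', hk', hq', rfl⟩ := h'
    exact (hH.multicast_same k hk k' hk' (hq.trans hq'.symm)).2
  | dequeue k =>
    obtain ⟨_, _, rfl⟩ := h
    exact h'.2.2
  | notify i X =>
    have h1 : X = P := h.2
    have h2 : X = Q := h'.2
    rw [← h1, h2]
  | request r =>
    have h1 : H.issuer r = P := h.2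
    have h2 : H.issuer r = Q := h'.2
    rw [← h1, h2]

lemma lt_trans' (he : e ∈ H.events) (hf : f ∈ H.events) (hg : g ∈ H.events) (h : H.lt e f)
    (h' : H.lt f g) : H.lt e g :=
  ⟨hH.le_trans e he f hf g hg h.1 h'.1, fun h2 => h.2 (hH.le_trans f hf g hg e he h'.1 h2)⟩

lemma lt_of_lt_of_le' (he : e ∈ H.events) (hf : f ∈ H.events) (hg : g ∈ H.events) (h : H.lt e f)
    (h' : H.le f g) : H.lt e g :=
  ⟨hH.le_trans e he f hf g hg h.1 h', fun h2 => h.2 (hH.le_trans f hf g hg e he h' h2)⟩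

lemma lt_of_le_of_lt' (he : e ∈ H.events) (hf : f ∈ H.events) (hg : g ∈ H.events) (h : H.le e f)
    (h' : H.lt f g) : H.lt e g :=
  ⟨hH.le_trans e he f hf g hg h h'.1, fun h2 => h'.2 (hH.le_trans g hg e he f hf h2 h)⟩

lemma lt_of_ne (he : e ∈ H.eventsAt P) (hf : f ∈ H.eventsAt P) (h : H.le e f) (hne : e ≠ f) :
    H.lt e f :=
  ⟨h, fun h' => hne (hH.process_antisymm P e he f hf h h')⟩

lemma lt_or_le (he : e ∈ H.eventsAt P) (hf : f ∈ H.eventsAt P) : H.lt e f ∨ H.le f e := by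
  by_cases h : H.le f e
  · exact .inr h
  · exact .inl ⟨(hH.process_total P e he f hf).resolve_right h, h⟩

lemma trichotomy (he : e ∈ H.eventsAt P) (hf : f ∈ H.eventsAt P) : H.lt e f ∨ e = f ∨ H.lt f e := by
  rcases hH.lt_or_le he hf with h | h
  · exact .inl h
  · by_cases hne : f = e
    · exact .inr (.inl hne.symm)
    · exact .inr (.inr (hH.lt_of_ne hf he h hne))

lemma joinView_mem (P : Proc) : H.joinView P ∈ H.memberViews P :=
  Nat.sInf_mem (hH.member_nonempty P)

lemma join_lt_death (P : Proc) : (H.joinView P : ℕ∞) < H.deathView P := by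
  have h := hH.joinView_mem P
  rw [hH.view_interval P] at h; exact h.2

lemma deathView_le (P : Proc) : H.deathView P ≤ H.numView := by
  refine iSup₂_le fun i hi => ?_
  exact Order.add_one_le_of_lt hi.1

lemma mem_view_iff (hi : (i : ℕ∞) < H.numView) (P : Proc) :
    P ∈ H.view i ↔ H.joinView P ≤ i ∧ (i : ℕ∞) < H.deathView P := by
  have h := hH.view_interval P
  have h2 : i ∈ H.memberViews P ↔ i ∈ {i | H.joinView P ≤ i ∧ (i : ℕ∞) < H.deathView P} := by rw [h]
  exact ⟨fun h3 => h2.1 ⟨hi, h3⟩, fun h3 => (h2.2 h3).2⟩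

lemma mem_view (h1 : H.joinView P ≤ i) (h2 : (i : ℕ∞) < H.deathView P) : P ∈ H.view i :=
  (hH.mem_view_iff (h2.trans_le (hH.deathView_le P)) P).2 ⟨h1, h2⟩

lemma original_finite : {P | H.Original P}.Finite := by
  refine hH.view_zero_finite.subset fun P hP => ?_
  refine hH.mem_view (le_of_eq hP) ?_
  have := hH.join_lt_death P
  rwa [show H.joinView P = 0 from hP] at this

lemma view_step (hi : ((i + 1 : ℕ) : ℕ∞) < H.numView) :
    (∃ J, H.joinView J = i + 1 ∧ H.view (i + 1) = insert J (H.view i) ∧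
      (∀ J', H.joinView J' = i + 1 → J' = J) ∧ ∀ R, H.deathView R ≠ (i + 1 : ℕ)) ∨
    (∃ R, H.deathView R = (i + 1 : ℕ) ∧ H.view (i + 1) = H.view i \ {R} ∧
      (∀ R', H.deathView R' = (i + 1 : ℕ) → R' = R) ∧ ∀ J, H.joinView J ≠ i + 1) := by
  have hi' : ((i : ℕ) : ℕ∞) < H.numView := lt_trans (by exact_mod_cast Nat.lt_succ_self i) hi
  have hd : ∀ R, H.deathView R = (i + 1 : ℕ) → R ∈ H.view i ∧ R ∉ H.view (i + 1) := by
    intro R hR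
    constructor
    · refine hH.mem_view ?_ (by rw [hR]; exact_mod_cast Nat.lt_succ_self i)
      have := hH.join_lt_death R
      rw [hR] at this; exact Nat.lt_succ_iff.1 (by exact_mod_cast this)
    · rw [hH.mem_view_iff hi, hR]; simp
  have hj : ∀ J, H.joinView J = i + 1 → J ∉ H.view i ∧ J ∈ H.view (i + 1) := by
    intro J hJ
    constructor
    · rw [hH.mem_view_iff hi', hJ]; simp
    · exact hH.mem_view hJ.le (hJ ▸ hH.join_lt_death J)
  obtain ⟨P, ⟨h1, h2⟩ | ⟨h1, h2⟩⟩ := hH.view_change i hi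
  · left
    refine ⟨P, ?_, h2, ?_, ?_⟩
    · have h3 : P ∈ H.view (i + 1) := by rw [h2]; exact Set.mem_insert _ _
      rw [hH.mem_view_iff hi] at h3
      rw [hH.mem_view_iff hi'] at h1
      by_contra h4
      exact h1 ⟨by omega, lt_trans (by exact_mod_cast Nat.lt_succ_self i) h3.2⟩
    · intro J' hJ'
      obtain ⟨h3, h4⟩ := hj J' hJ'
      rw [h2] at h4; exact h4.resolve_right h3
    · intro R hR
      obtain ⟨h3, h4⟩ := hd R hR
      rw [h2] at h4; exact h4 (Set.mem_insert_of_mem _ h3)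
  · right
    refine ⟨P, ?_, h2, ?_, ?_⟩
    · have h3 : P ∉ H.view (i + 1) := by rw [h2]; simp
      rw [hH.mem_view_iff hi] at h3
      rw [hH.mem_view_iff hi'] at h1
      apply le_antisymm
      · by_contra h4
        exact h3 ⟨h1.1.trans (Nat.le_succ i), not_le.1 h4⟩
      · have := Order.add_one_le_of_lt h1.2
        exact_mod_cast this
    · intro R' hR'
      obtain ⟨h3, h4⟩ := hd R' hR'
      rw [h2] at h4
      by_contra hne
      exact h4 ⟨h3, hne⟩
    · intro J hJ
      obtain ⟨h3, h4⟩ := hj J hJ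
      rw [h2] at h4; exact h3 h4.1

lemma joinView_inj {J' : Proc} (h : 0 < H.joinView J) (h' : H.joinView J' = H.joinView J) :
    J' = J := by
  obtain ⟨i, hi⟩ := Nat.exists_eq_succ_of_ne_zero h.ne'
  have hn : ((i + 1 : ℕ) : ℕ∞) < H.numView := by
    have := (hH.join_lt_death J).trans_le (hH.deathView_le J)
    rwa [hi] at this
  rcases hH.view_step hn with ⟨J0, _, _, h2, _⟩ | ⟨_, _, _, _, h2⟩
  · rw [h2 J hi, h2 J' (h'.trans hi)]
  · exact absurd hi (h2 J)

lemma deathView_ne_joinView (h : 0 < H.joinView J) : H.deathView R ≠ (H.joinView J : ℕ) := by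
  obtain ⟨i, hi⟩ := Nat.exists_eq_succ_of_ne_zero h.ne'
  have hn : ((i + 1 : ℕ) : ℕ∞) < H.numView := by
    have := (hH.join_lt_death J).trans_le (hH.deathView_le J)
    rwa [hi] at this
  rcases hH.view_step hn with ⟨_, _, _, _, h2⟩ | ⟨_, _, _, _, h2⟩
  · rw [hi]; exact h2 R
  · exact absurd hi (h2 J)

lemma notice_cases (h1 : H.joinView P < i) (h2 : (i : ℕ∞) < H.deathView P) :
    (∃ J, H.joinView J = i ∧ H.notice i P = some (.joined J (H.parent J)) ∧
      H.view i = insert J (H.view (i - 1))) ∨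
    (∃ R, H.deathView R = i ∧ H.notice i P = some (.removed R) ∧
      H.view i = H.view (i - 1) \ {R}) := by
  obtain ⟨i, rfl⟩ := Nat.exists_eq_succ_of_ne_zero (Nat.ne_zero_of_lt h1)
  rcases hH.view_step (h2.trans_le (hH.deathView_le P)) with ⟨J, hJ, hv, _⟩ | ⟨R, hR, hv, _⟩
  · exact .inl ⟨J, hJ, hH.notice_joined _ P J h1 h2 hJ, hv⟩
  · exact .inr ⟨R, hR, hH.notice_removed _ P R h1 h2 hR, hv⟩

lemma notify_range (h : .notify i P ∈ H.events) :
    H.joinView P ≤ i ∧ (i : ℕ∞) ≤ H.deathView P := by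
  have h1 := hH.notify_notice i P h
  constructor
  · by_contra h2
    exact h1 (hH.notice_before i P (by omega))
  · by_contra h2
    exact h1 (hH.notice_after i P (not_le.1 h2))

lemma notice_last (h : H.deathView P = i) : H.notice i P = some .done ∨ H.notice i P = none := by
  by_cases h1 : H.Removed P ∨ P ∈ H.halting
  · exact .inl (hH.notice_done i P h h1)
  · push Not at h1
    exact .inr (hH.notice_end i P h h1.1 h1.2)

lemma of_notice_removed (h : H.notice i P = some (.removed R)) :
    H.deathView R = i ∧ H.joinView P < i ∧ (i : ℕ∞) < H.deathView P ∧
      H.view i = H.view (i - 1) \ {R} := by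
  have h1 : H.joinView P < i := by
    rcases lt_trichotomy (H.joinView P) i with h1 | h1 | h1
    · exact h1
    · rw [← h1, hH.notice_join P] at h; simp at h
    · rw [hH.notice_before i P h1] at h; simp at h
  have h2 : (i : ℕ∞) < H.deathView P := by
    rcases lt_trichotomy (i : ℕ∞) (H.deathView P) with h2 | h2 | h2
    · exact h2
    · rcases hH.notice_last h2.symm with h3 | h3 <;> rw [h3] at h <;> simp at h
    · rw [hH.notice_after i P h2] at h; simp at h
  rcases hH.notice_cases h1 h2 with ⟨J', h3, h4, h5⟩ | ⟨J', h3, h4, h5⟩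
  · rw [h4] at h; simp at h
  · rw [h4] at h
    simp only [Option.some.injEq, Notice.removed.injEq] at h
    obtain rfl := h
    exact ⟨h3, h1, h2, h5⟩

lemma notify_le_local {P' : Proc} (hi : .notify i P' ∈ H.events) (he : e ∈ H.eventsAt P)
    (hle : H.le (.notify i P') e) :
    i ≤ H.joinView P ∨ (.notify i P ∈ H.events ∧ H.le (.notify i P) e) := by
  rw [hH.minimal_order _ hi _ he.1] at hle
  induction hle generalizing P with
  | refl =>
    have : P' = P := he.2
    subst this; exact .inr ⟨hi, hH.le_refl _ hi⟩
  | @tail b f hab hbf ih =>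
    obtain ⟨hb, hf, ⟨Q, hbQ, hfQ, hle⟩ | ⟨k, hk, rfl, rfl⟩ | ⟨J, hJ, ⟨rfl, rfl⟩ | ⟨rfl, rfl⟩⟩⟩ := hbf
    · obtain rfl := hH.eventsAt_unique he hfQ
      rcases ih hbQ with h | ⟨h, h'⟩
      · exact .inl h
      · exact .inr ⟨h, hH.le_trans _ h _ hb _ hf h' hle⟩
    · have h1 := hH.packet_queued k hk
      have hP : H.target k = P := he.2.2
      have h2 := hH.piggyback (H.source k) P k ⟨hk, rfl, hP⟩ hf i
      rcases ih h1 with h | ⟨h, h'⟩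
      · rcases h2 (.inl h) with h3 | h3
        · exact .inl h3
        · exact .inr ⟨h3.1, h3.2.1⟩
      · rcases h2 (.inr ⟨h, hH.lt_of_ne (notify_at h) h1 h' (by simp)⟩) with h3 | h3
        · exact .inl h3
        · exact .inr ⟨h3.1, h3.2.1⟩
    · have hP : J = P := he.2
      subst hP
      left
      have h1 := notify_at hb
      have h0 := hH.notify_range hb
      by_contra hlt
      rcases ih h1 with h | ⟨h, h'⟩
      · omega
      · exact (hH.notify_order _ _ _ h0.1 (not_le.1 hlt) (hH.notify_range h).2 h).2.2 h'
    · have hP : H.parent J = P := he.2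
      subst hP
      have h1 := notify_at hb
      have h0 := hH.notify_range hb
      have h3 := hH.notify_range hf
      have hij : i ≤ H.joinView J := by
        by_contra hlt
        rcases ih h1 with h | ⟨h, h'⟩
        · omega
        · exact (hH.notify_order _ _ _ h0.1 (not_le.1 hlt) (hH.notify_range h).2 h).2.2 h'
      by_cases h4 : i ≤ H.joinView (H.parent J)
      · exact .inl h4
      right
      rcases hij.lt_or_eq with h5 | h5
      · have := hH.notify_order _ _ _ (not_le.1 h4).le h5 h3.2 hf
        exact ⟨this.1, this.2.1⟩
      · subst h5; exact ⟨hf, hH.le_refl _ hf⟩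

lemma notify_finite (he : e ∈ H.eventsAt P) :
    {i | .notify i P ∈ H.events ∧ H.le (.notify i P) e}.Finite := by
  have h1 := (hH.foundation P e he).insert e
  refine Set.Finite.of_finite_image (f := fun i => (Ev.notify i P : Evt))
    (h1.subset ?_) (fun i _ j _ h => by simpa using h)
  rintro _ ⟨i, ⟨hi, hle⟩, rfl⟩
  by_cases h : (Ev.notify i P : Evt) = e
  · exact .inl h
  · exact .inr ⟨notify_at hi, hH.lt_of_ne (notify_at hi) he hle h⟩

lemma eventView_spec (he : e ∈ H.eventsAt P) :
    .notify (H.eventView e) P ∈ H.events ∧ H.le (.notify (H.eventView e) P) e ∧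
    ∀ i P', .notify i P' ∈ H.events → H.le (.notify i P') e → i ≤ H.eventView e := by
  set S : Set ℕ := {i | ∃ P, .notify i P ∈ H.events ∧ H.le (.notify i P) e} with hS
  have hj := hH.join_first P ⟨e, he⟩
  have hfin : S.Finite := by
    refine ((hH.notify_finite he).union (Set.finite_Iic (H.joinView P))).subset ?_
    rintro i ⟨P', h1, h2⟩
    rcases hH.notify_le_local h1 he h2 with h | h
    · exact .inr h
    · exact .inl h
  have hmem : H.joinView P ∈ S := ⟨P, hj.1, hj.2 e he⟩
  have hmax : H.eventView e ∈ S := Nat.sSup_mem ⟨_, hmem⟩ hfin.bddAbove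
  have hle : ∀ i ∈ S, i ≤ H.eventView e := fun i hi => le_csSup hfin.bddAbove hi
  refine ⟨?_, ?_, fun i P' h1 h2 => hle i ⟨P', h1, h2⟩⟩ <;>
  · obtain ⟨P', h1, h2⟩ := hmax
    rcases hH.notify_le_local h1 he h2 with h | h
    · rw [le_antisymm h (hle _ hmem)]
      first | exact hj.1 | exact hj.2 e he
    · first | exact h.1 | exact h.2

lemma le_eventView {P' : Proc} (he : e ∈ H.eventsAt P) (hi : .notify i P' ∈ H.events)
    (h : H.le (.notify i P') e) : i ≤ H.eventView e :=
  (hH.eventView_spec he).2.2 i P' hi h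

lemma joinView_le_eventView (he : e ∈ H.eventsAt P) : H.joinView P ≤ H.eventView e :=
  (hH.notify_range (hH.eventView_spec he).1).1

lemma eventView_mono (he : e ∈ H.events) (hf : f ∈ H.events) (h : H.le e f) :
    H.eventView e ≤ H.eventView f := by
  obtain ⟨P, hP⟩ := hH.event_located e he
  obtain ⟨Q, hQ⟩ := hH.event_located f hf
  obtain ⟨h1, h2, _⟩ := hH.eventView_spec hP
  exact hH.le_eventView hQ h1 (hH.le_trans _ h1 _ he _ hf h2 h)

lemma notify_le_iff (he : e ∈ H.eventsAt P) (hi : .notify i P ∈ H.events) :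
    H.le (.notify i P) e ↔ i ≤ H.eventView e := by
  refine ⟨hH.le_eventView he hi, fun h => ?_⟩
  obtain ⟨h1, h2, _⟩ := hH.eventView_spec he
  rcases h.lt_or_eq with h3 | h3
  · have := hH.notify_order P _ _ (hH.notify_range hi).1 h3 (hH.notify_range h1).2 h1
    exact hH.le_trans _ hi _ h1 _ he.1 this.2.1 h2
  · rw [h3]; exact h2

lemma lt_notify_iff (he : e ∈ H.eventsAt P) (hi : .notify i P ∈ H.events) :
    H.lt e (.notify i P) ↔ H.eventView e < i := by
  rw [← not_le, ← hH.notify_le_iff he hi]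
  refine ⟨fun h => h.2, fun h => ?_⟩
  exact (hH.lt_or_le he (notify_at hi)).resolve_right h

lemma eventView_notify (h : .notify i P ∈ H.events) : H.eventView (.notify i P) = i := by
  have he := notify_at h
  refine le_antisymm ?_ (hH.le_eventView he h (hH.le_refl _ h))
  obtain ⟨h1, h2, _⟩ := hH.eventView_spec he
  by_contra hlt
  exact (hH.notify_order P _ _ (hH.notify_range h).1 (not_le.1 hlt) (hH.notify_range h1).2 h1).2.2 h2

lemma notify_mem_of_le (he : e ∈ H.eventsAt P) (h1 : H.joinView P ≤ i) (h2 : i ≤ H.eventView e) :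
    .notify i P ∈ H.events := by
  obtain ⟨h3, _, _⟩ := hH.eventView_spec he
  rcases h2.lt_or_eq with h4 | h4
  · exact (hH.notify_order P _ _ h1 h4 (hH.notify_range h3).2 h3).1
  · rw [h4]; exact h3

lemma eventView_lt_deathView (he : e ∈ H.eventsAt P)
    (hne : ∀ i : ℕ, H.deathView P = i → e ≠ .notify i P) :
    (H.eventView e : ℕ∞) < H.deathView P := by
  obtain ⟨h1, h2, _⟩ := hH.eventView_spec he
  refine lt_of_le_of_ne (hH.notify_range h1).2 fun h => hne _ h.symm ?_
  exact hH.process_antisymm P _ he _ (notify_at h1) (hH.halt_last P _ h.symm h1 e he) h2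

lemma cleanLT_of_lt (he : e ∈ H.events) (hf : f ∈ H.events) (h : H.lt e f)
    (hn : ∀ i Q, f = .notify i Q → e ∈ H.eventsAt Q) :
    cleanLT H (cleanOf e) (cleanOf f) := by
  have h1 := hH.eventView_mono he hf h.1
  have h2 : ∀ i Q, f = .notify i Q → H.eventView e < i := by
    rintro i Q rfl; exact (hH.lt_notify_iff (hn i Q rfl) hf).1 h
  cases e with
  | notify i P =>
    rw [hH.eventView_notify he] at h1 h2
    cases f with
    | notify j Q => exact h2 j Q rfl
    | _ => exact h1
  | _ =>
    cases f with
    | notify j Q => exact h2 j Q rfl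
    | _ =>
      rcases h1.lt_or_eq with h3 | h3
      · exact .inl h3
      · exact .inr ⟨h3, h⟩

lemma eventView_dequeue_lt (hk : k ∈ H.channel P Q) (hconf : ∀ (i : ℕ), H.notice i Q = some (.removed P) → .notify i Q ∈ H.events →
      ¬ H.lt (.notify i Q) (.dequeue k)) (hd : .dequeue k ∈ H.events) : (H.eventView (.dequeue k) : ℕ∞) < H.deathView P := by
  have hdQ : (.dequeue k : Evt) ∈ H.eventsAt Q := ⟨hd, hk.1, hk.2.2⟩
  have hqP : (.queue (H.queuing k) : Evt) ∈ H.eventsAt P := by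
    have := hH.packet_queued k hk.1
    rwa [hk.2.1] at this
  by_contra hlt
  rw [not_lt] at hlt
  obtain ⟨i, hi⟩ := ENat.ne_top_iff_exists.1 (ne_top_of_le_ne_top (ENat.natCast_ne_top _) hlt)
  rw [← hi] at hlt
  have hlt' : i ≤ H.eventView (.dequeue k) := by exact_mod_cast hlt
  have hjP := hH.join_lt_death P
  rw [← hi] at hjP
  have hjP' : H.joinView P < i := by exact_mod_cast hjP
  have hQd : (H.eventView (.dequeue k) : ℕ∞) < H.deathView Q :=
    hH.eventView_lt_deathView hdQ (by simp)
  by_cases hjQ : i ≤ H.joinView Q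
  · rcases hH.liveness_join P Q k hk with h | ⟨h, h'⟩
    · have h1 : H.joinView P < H.joinView Q := hjP'.trans_le hjQ
      rw [hH.mem_view_iff ((hH.join_lt_death P).trans_le (hH.deathView_le P))] at h; omega
    · have h1 := (hH.notify_range h).2
      rw [← hi] at h1
      have h2 : H.joinView Q = i := le_antisymm (by exact_mod_cast h1) hjQ
      rw [h2] at h h'; exact h'.2 (hH.halt_last P i hi.symm h _ hqP)
  · have h1 := hH.notify_mem_of_le hdQ (not_le.1 hjQ).le hlt'
    have h2 := hH.notice_removed i Q P (not_le.1 hjQ)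
      (_root_.lt_of_le_of_lt (by exact_mod_cast hlt') hQd) hi.symm
    exact hconf i h2 h1 (hH.lt_of_ne (notify_at h1) hdQ
      ((hH.notify_le_iff hdQ h1).2 hlt') (by simp))

end IsHistory

/-- `e` and `f` are successive triggers of the process `P`. -/
structure Consec (H : Computation Proc Pkt Que Req Cont Body) (P : Proc) (e f : Evt) : Prop where
  left : e ∈ H.eventsAt P
  right : f ∈ H.eventsAt P
  left_trigger : e.IsTrigger
  right_trigger : f.IsTrigger
  lt : H.lt e f
  le_left : ∀ g ∈ H.eventsAt P, g.IsTrigger → H.lt g f → H.le g e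

namespace IsHistory

variable (hH : H.IsHistory)
include hH

lemma exists_maximal {S : Set Evt} (hS : S.Finite) (hne : S.Nonempty)
    (hP : ∀ e ∈ S, e ∈ H.eventsAt P) : ∃ m ∈ S, ∀ e ∈ S, H.le e m := by
  induction S, hS using Set.Finite.induction_on with
  | empty => exact absurd hne (by simp)
  | @insert a S _ _ ih =>
    have ha := hP a (Set.mem_insert _ _)
    by_cases h : S.Nonempty
    · obtain ⟨m, hm, hmax⟩ := ih h fun e he => hP e (Set.mem_insert_of_mem _ he)
      have hmP := hP m (Set.mem_insert_of_mem _ hm)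
      rcases hH.process_total P a ha m hmP with h1 | h1
      · refine ⟨m, Set.mem_insert_of_mem _ hm, ?_⟩
        rintro e (rfl | he)
        · exact h1
        · exact hmax e he
      · refine ⟨a, Set.mem_insert _ _, ?_⟩
        rintro e (rfl | he)
        · exact hH.le_refl _ ha.1
        · exact hH.le_trans _ (hP e (Set.mem_insert_of_mem _ he)).1 _ hmP.1 _ ha.1 (hmax e he) h1
    · rw [Set.not_nonempty_iff_eq_empty] at h
      subst h
      refine ⟨a, Set.mem_insert _ _, ?_⟩
      rintro e (rfl | he)
      · exact hH.le_refl _ ha.1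
      · exact absurd he (by simp)

lemma exists_consec (he : e ∈ H.eventsAt P) (ht : e.IsTrigger) (hne : e ≠ .notify (H.joinView P) P) :
    ∃ e', H.Consec P e' e := by
  have hj := hH.join_first P ⟨e, he⟩
  obtain ⟨m, ⟨hm1, hm2, hm3⟩, hm⟩ := hH.exists_maximal (P := P)
    (S := {g | g ∈ H.eventsAt P ∧ g.IsTrigger ∧ H.lt g e})
    ((hH.foundation P e he).subset fun g hg => ⟨hg.1, hg.2.2⟩)
    ⟨_, notify_at hj.1, trivial,
      hH.lt_of_ne (notify_at hj.1) he (hj.2 e he) hne.symm⟩ fun g hg => hg.1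
  exact ⟨m, hm1, he, hm2, ht, hm3, fun g h1 h2 h3 => hm g ⟨h1, h2, h3⟩⟩

/-- Induction over the triggers of a process, from a given one. -/
lemma trigger_induction {e0 : Evt} {Φ : Evt → Prop} (h0 : e0 ∈ H.eventsAt P) (ht0 : e0.IsTrigger)
    (base : Φ e0) (step : ∀ e' e, H.Consec P e' e → H.le e0 e' → Φ e' → Φ e) (he : e ∈ H.eventsAt P)
    (ht : e.IsTrigger) (hle : H.le e0 e) : Φ e := by
  generalize hn : {f | f ∈ H.eventsAt P ∧ H.lt f e}.ncard = n
  induction n using Nat.strong_induction_on generalizing e with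
  | _ n ih =>
    by_cases heq : e = e0
    · rwa [heq]
    have hlt := hH.lt_of_ne h0 he hle (Ne.symm heq)
    have hne : e ≠ .notify (H.joinView P) P := by
      rintro rfl; exact hlt.2 ((hH.join_first P ⟨e0, h0⟩).2 e0 h0)
    obtain ⟨e', hc⟩ := hH.exists_consec he ht hne
    have hle' := hc.le_left e0 h0 ht0 hlt
    refine step e' e hc hle' (ih _ ?_ hc.left hc.left_trigger hle' rfl)
    rw [← hn]
    refine Set.ncard_lt_ncard ?_ (hH.foundation P e he)
    refine ⟨fun f hf => ⟨hf.1, hH.lt_trans' hf.1.1 hc.left.1 he.1 hf.2 hc.lt⟩, fun h => ?_⟩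
    have := h ⟨hc.left, hc.lt⟩
    exact this.2.2 this.2.1

lemma global_induction {Φ : Proc → Evt → Prop} (orig : ∀ P, H.joinView P = 0 → .notify 0 P ∈ H.events → Φ P (.notify 0 P)) (fork : ∀ J e', 0 < H.joinView J → .notify (H.joinView J) J ∈ H.events →
      H.Consec (H.parent J) e' (.notify (H.joinView J) (H.parent J)) → Φ (H.parent J) e' →
      Φ J (.notify (H.joinView J) J)) (step : ∀ P e' e, H.Consec P e' e → Φ P e' → Φ P e) (he : e ∈ H.eventsAt P) (ht : e.IsTrigger) : Φ P e := by
  generalize hn : H.joinView P = n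
  induction n using Nat.strong_induction_on generalizing P e with
  | _ n ih =>
    have hj := hH.join_first P ⟨e, he⟩
    refine hH.trigger_induction (notify_at hj.1) trivial ?_
      (fun e' e hc _ => step P e' e hc) he ht (hj.2 e he)
    by_cases h0 : H.joinView P = 0
    · have := orig P h0 (h0 ▸ hj.1)
      rwa [h0]
    · have hpos := Nat.pos_of_ne_zero h0
      have hpar := (hH.parent_event P hpos hj.1).1
      have hmem := hH.parent_member P hpos
      have hv : ((H.joinView P - 1 : ℕ) : ℕ∞) < H.numView := by
        refine _root_.lt_of_le_of_lt ?_ ((hH.join_lt_death P).trans_le (hH.deathView_le P))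
        exact_mod_cast Nat.sub_le _ _
      rw [hH.mem_view_iff hv] at hmem
      have hlt : H.joinView (H.parent P) < H.joinView P := by omega
      obtain ⟨e', hc⟩ := hH.exists_consec (notify_at hpar) trivial
        (by simpa using hlt.ne')
      exact fork P e' hpos hj.1 hc (ih _ (hn ▸ hlt) hc.left hc.left_trigger rfl)

end IsHistory

namespace Consec

variable {P : Proc} {e f : Ev Proc Pkt Que Req}

lemma eventView_eq (h : H.Consec P e f) (hH : H.IsHistory) (hf : ∀ i Q, f ≠ .notify i Q) :
    H.eventView f = H.eventView e := by
  refine le_antisymm ?_ (hH.eventView_mono h.left.1 h.right.1 h.lt.1)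
  obtain ⟨h1, h2, _⟩ := hH.eventView_spec h.right
  have h3 := notify_at h1
  exact hH.le_eventView h.left h1 (h.le_left _ h3 trivial (hH.lt_of_ne h3 h.right h2 (hf _ _).symm))

lemma eventView_succ (h : H.Consec P e (.notify i P)) (hH : H.IsHistory) :
    i = H.eventView e + 1 := by
  obtain ⟨h1, h2, _⟩ := hH.eventView_spec h.left
  have hi := h.right.1
  have hlt : H.eventView e < i := (hH.lt_notify_iff h.left hi).1 h.lt
  by_contra hne
  have hj := hH.joinView_le_eventView h.left
  have h3 := hH.notify_order P (H.eventView e + 1) i (by omega) (by omega) (hH.notify_range hi).2 hi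
  have h4 := h.le_left _ (notify_at h3.1) trivial h3.2
  have := hH.le_eventView h.left h3.1 h4
  omega

lemma joinView_lt (h : H.Consec P e (.notify i P)) (hH : H.IsHistory) : H.joinView P < i := by
  have := h.eventView_succ hH
  have := hH.joinView_le_eventView h.left
  omega

end Consec

end Computation

section ProtocolLemmas

/-- The number of messages among the side effects. -/
noncomputable def countMsg (es : List Eff) : ℕ := es.countP fun ε => decide ε.content.IsMsg

lemma countMsg_append (es es' : List Eff) :
    countMsg (es ++ es') = countMsg es + countMsg es' := List.countP_append

/-- Increase the counter of forwarded (`n = true`) or of original (`n = false`) messages. -/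
def Count.plus (n : Bool) (c : Count) (k : ℕ) : Count :=
  if n then ⟨c.f + k, c.b⟩ else ⟨c.f, c.b + k⟩

lemma Count.plus_plus (n : Bool) (c : Count) (k l : ℕ) :
    (c.plus n k).plus n l = c.plus n (k + l) := by
  cases n <;> simp [Count.plus, add_assoc]

lemma Count.plus_zero (n : Bool) (c : Count) : c.plus n 0 = c := by cases n <;> simp [Count.plus]

lemma Count.total_plus (n : Bool) (c : Count) (k : ℕ) : (c.plus n k).total = c.total + k := by
  cases n <;> simp only [Count.plus, Count.total] <;> simp <;> omega

/-- The record `r'` is a later version of `r`; instabilities were added at most in `E`. -/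
structure WaitRec.Desc (E : Set Proc) (r r' : Rec) : Prop where
  msg : r'.msg = r.msg
  index : r'.index = r.index
  iset : ∀ Q ∉ E, (r'.iset Q).isSome → (r.iset Q).isSome

lemma WaitRec.Desc.refl (E : Set Proc) (r : Rec) : r.Desc E r := ⟨rfl, rfl, fun _ _ h => h⟩

lemma WaitRec.Desc.trans {E : Set Proc} (h : r.Desc E r') (h' : r'.Desc E r'') : r.Desc E r'' :=
  ⟨h'.msg.trans h.msg, h'.index.trans h.index, fun Q hQ h2 => h.iset Q hQ (h'.iset Q hQ h2)⟩

lemma WaitRec.Desc.mono {E E' : Set Proc} (hE : E ⊆ E') (h : r.Desc E r') : r.Desc E' r' :=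
  ⟨h.msg, h.index, fun Q hQ h2 => h.iset Q (fun h3 => hQ (hE h3)) h2⟩

lemma WaitRec.desc_discard (E : Set Proc) (P : Proc) (r : Rec) : r.Desc E (r.discard P) := by
  refine ⟨rfl, rfl, fun Q _ h => ?_⟩
  by_cases hQ : Q = P
  · subst hQ; simp [WaitRec.discard] at h
  · simpa [WaitRec.discard, hQ] using h

/-- The invariants of a state that do not refer to the history. -/
structure State.Sound (s : St) : Prop where
  ghost_le : s.ghostHeight ≤ s.height
  flush_le : s.flushHeight ≤ s.height
  quiet : s.flushHeight = s.height → 0 < s.vGap → s.bcastWaitSet = [] ∧ s.fwdWaitSet = []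
  nodup : (s.waitSet.map fun r => r.index.total).Nodup
  total_le : ∀ r ∈ s.waitSet, r.index.total ≤ s.mpktOut.total
  nodup_f : (s.fwdWaitSet.map fun r => r.index.f).Nodup
  f_le : ∀ r ∈ s.fwdWaitSet, r.index.f ≤ s.mpktOut.f

/-- The list of records `l'` arises from `l` by discarding instabilities and records. -/
structure Shrink (E : Set Proc) (l l' : List Rec) : Prop where
  sub : (l'.map WaitRec.index).Sublist (l.map WaitRec.index)
  desc : ∀ r' ∈ l', ∃ r ∈ l, WaitRec.Desc E r r'

lemma Shrink.refl (E : Set Proc) (l : List Rec) : Shrink E l l :=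
  ⟨List.Sublist.refl _, fun r' h => ⟨r', h, .refl _ _⟩⟩

lemma Shrink.map {E : Set Proc} (l : List Rec) {g : Rec → Rec} (hg : ∀ r, WaitRec.Desc E r (g r)) :
    Shrink E l (l.map g) := by
  constructor
  · have : WaitRec.index ∘ g = (WaitRec.index : Rec → Count) := funext fun r => (hg r).index
    rw [List.map_map, this]
  · intro r' hr'
    obtain ⟨r, hr, rfl⟩ := List.mem_map.1 hr'
    exact ⟨r, hr, hg r⟩

lemma Shrink.filter {E : Set Proc} {l l' : List Rec} (h : Shrink E l l') (p : Rec → Bool) :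
    Shrink E l (l'.filter p) :=
  ⟨(List.filter_sublist.map _).trans h.sub, fun r' h' => h.desc r' (List.mem_of_mem_filter h')⟩

lemma State.Sound.shrink (hs : s.Sound) {E : Set Proc}
    (hb : Shrink E s.bcastWaitSet s'.bcastWaitSet) (hf : Shrink E s.fwdWaitSet s'.fwdWaitSet)
    (ho : s'.mpktOut = s.mpktOut) (h1 : s'.ghostHeight ≤ s'.height)
    (h2 : s'.flushHeight ≤ s'.height)
    (h3 : s'.flushHeight = s'.height → 0 < s'.vGap → s.bcastWaitSet = [] ∧ s.fwdWaitSet = []) :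
    s'.Sound := by
  have hw : (s'.waitSet.map WaitRec.index).Sublist (s.waitSet.map WaitRec.index) := by
    simp only [State.waitSet, List.map_append]; exact hb.sub.append hf.sub
  have hmap : ∀ (l : List Rec) (g : Count → ℕ),
      (l.map fun r => g r.index) = (l.map WaitRec.index).map g := by simp
  refine ⟨h1, h2, fun h4 h5 => ?_, ?_, ?_, ?_, ?_⟩
  · obtain ⟨h6, h7⟩ := h3 h4 h5
    have h8 := hb.sub
    have h9 := hf.sub
    rw [h6] at h8
    rw [h7] at h9; simpa using And.intro h8 h9
  · have := hs.nodup
    rw [hmap] at this ⊢; exact this.sublist (hw.map _)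
  · intro r hr
    rw [ho]
    have h4 := hw.subset (List.mem_map_of_mem hr)
    obtain ⟨r0, h5, h6⟩ := List.mem_map.1 h4
    rw [← h6]; exact hs.total_le r0 h5
  · have := hs.nodup_f
    rw [hmap] at this ⊢; exact this.sublist (hf.sub.map _)
  · intro r hr
    rw [ho]
    have h4 := hf.sub.subset (List.mem_map_of_mem hr)
    obtain ⟨r0, h5, h6⟩ := List.mem_map.1 h4
    rw [← h6]; exact hs.f_le r0 h5

/-- What is known about a single side effect of a procedure that leads from `s` to `s'`. -/
def Effect.Ok (X : Proc) (n : Bool) (M : Set Msg) (s s' : St) (ε : Eff) : Prop :=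
  ε.targets ⊆ insert X s'.contactSet ∧ match ε.content with
  | .msg m => s.contactSet ⊆ ε.targets ∧ (n = false → m.orig = s.self) ∧
      (n = true → m ∈ (s.fwdQueue X).getD [] ∨ m ∈ M)
  | .ack _ => n = false ∧ ε.targets = {X}
  | .ghost v => v ≤ s'.ghostHeight
  | .flush v => v ≤ s'.flushHeight
  | .donation _ => n = true ∧ ε.targets = {X}
  | .codonation _ => n = false ∧ ε.targets = {X}

/-- The record `r` was added by a procedure with the side effects `es`. -/
def NewRec (n : Bool) (s : St) (es : List Eff) (r : Rec) : Prop :=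
  ∃ k ε, es[k]? = some ε ∧ ε.content = .msg r.msg ∧
    r.index = s.mpktOut.plus n (countMsg (es.take (k + 1)))

/-- A procedure that does not change the height leads from `s` to `s'` with side effects `es`. `X` is
the sender of the packet or the subject of the notification (`n = true`) that is processed; `M`
bounds the set of messages whose receipt is simulated. -/
structure Evol (X : Proc) (n : Bool) (M : Set Msg) (s s' : St) (es : List Eff) : Prop where
  self_eq : s'.self = s.self
  height_eq : s'.height = s.height
  live_eq : s'.liveSet = s.liveSet
  contact_mono : s.contactSet ⊆ s'.contactSet
  contact_new : s'.contactSet ⊆ insert X s.contactSet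
  ghostH_mono : s.ghostHeight ≤ s'.ghostHeight
  flushH_mono : s.flushHeight ≤ s'.flushHeight
  sound : s.Sound → s'.Sound
  ghost_eq : ∀ Q ≠ X, s'.ghost Q = s.ghost Q
  flush_eq : ∀ Q ≠ X, s'.flush Q = s.flush Q
  mpktIn_eq : ∀ Q ≠ X, s'.mpktIn Q = s.mpktIn Q
  mpktIn_mono : totalOf (s.mpktIn X) ≤ totalOf (s'.mpktIn X)
  curView_eq : ∀ B ≠ X, B ∈ s.liveSet → (s.flush B).getD 0 < s.height → s'.curView = s.curView
  out_eq : s'.mpktOut = s.mpktOut.plus n (countMsg es)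
  bcast_rec : ∀ r' ∈ s'.bcastWaitSet, (∃ r ∈ s.bcastWaitSet, r.Desc ∅ r') ∨
    (n = false ∧ NewRec n s es r')
  fwd_rec : ∀ r' ∈ s'.fwdWaitSet, (∃ r ∈ s.fwdWaitSet, r.Desc ∅ r') ∨
    (n = true ∧ NewRec n s es r')
  clean : ∀ B ≠ X, s.mpktIn B = none → (∀ r ∈ s.waitSet, r.iset B = none) →
    ∀ r ∈ s'.waitSet, r.iset B = none
  fwdQueue_sub : ∀ R m, m ∈ (s'.fwdQueue R).getD [] →
    m ∈ (s.fwdQueue R).getD [] ∨ (R = X ∧ m ∈ M)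
  eff : ∀ ε ∈ es, ε.Ok X n M s s'

namespace Evol

variable {X : Proc} {n : Bool} {M : Set (Message Proc Body)} {s s' s'' : State Proc Body}
  {es es' : List (Effect Proc Body)}

lemma newRec_left (es' : List Eff) (h : NewRec n s es r) (h' : r.Desc ∅ r') :
    NewRec n s (es ++ es') r' := by
  obtain ⟨k, ε, h1, h2, h3⟩ := h
  have hk : k < es.length := (List.getElem?_eq_some_iff.1 h1).1
  refine ⟨k, ε, ?_, ?_, ?_⟩
  · rw [List.getElem?_append_left hk, h1]
  · rw [h'.msg, h2]
  · rw [h'.index, h3, List.take_append_of_le_length hk]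

lemma newRec_right (hout : s'.mpktOut = s.mpktOut.plus n (countMsg es)) (h : NewRec n s' es' r) :
    NewRec n s (es ++ es') r := by
  obtain ⟨k, ε, h1, h2, h3⟩ := h
  refine ⟨es.length + k, ε, ?_, h2, ?_⟩
  · rw [List.getElem?_append_right (Nat.le_add_right _ _), Nat.add_sub_cancel_left, h1]
  · rw [h3, hout, Count.plus_plus, add_assoc, List.take_length_add_append, countMsg_append]

lemma trans (h : Evol X n M s s' es) (h' : Evol X n M s' s'' es') :
    Evol X n M s s'' (es ++ es') where
  self_eq := h'.self_eq.trans h.self_eq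
  height_eq := h'.height_eq.trans h.height_eq
  live_eq := h'.live_eq.trans h.live_eq
  contact_mono := h.contact_mono.trans h'.contact_mono
  contact_new := h'.contact_new.trans (Set.insert_subset (Set.mem_insert _ _) h.contact_new)
  ghostH_mono := h.ghostH_mono.trans h'.ghostH_mono
  flushH_mono := h.flushH_mono.trans h'.flushH_mono
  sound := fun hs => h'.sound (h.sound hs)
  ghost_eq := fun Q hQ => (h'.ghost_eq Q hQ).trans (h.ghost_eq Q hQ)
  flush_eq := fun Q hQ => (h'.flush_eq Q hQ).trans (h.flush_eq Q hQ)
  mpktIn_eq := fun Q hQ => (h'.mpktIn_eq Q hQ).trans (h.mpktIn_eq Q hQ)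
  mpktIn_mono := h.mpktIn_mono.trans h'.mpktIn_mono
  curView_eq := fun B hB h1 h2 => by
    rw [h'.curView_eq B hB (h.live_eq ▸ h1) (by rw [h.flush_eq B hB, h.height_eq]; exact h2),
      h.curView_eq B hB h1 h2]
  out_eq := by rw [h'.out_eq, h.out_eq, Count.plus_plus, countMsg_append]
  bcast_rec := fun r'' hr => by
    rcases h'.bcast_rec r'' hr with ⟨r', h1, h2⟩ | ⟨h1, h2⟩
    · rcases h.bcast_rec r' h1 with ⟨r, h3, h4⟩ | ⟨h3, h4⟩
      · exact .inl ⟨r, h3, h4.trans h2⟩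
      · exact .inr ⟨h3, newRec_left es' h4 h2⟩
    · exact .inr ⟨h1, newRec_right h.out_eq h2⟩
  fwd_rec := fun r'' hr => by
    rcases h'.fwd_rec r'' hr with ⟨r', h1, h2⟩ | ⟨h1, h2⟩
    · rcases h.fwd_rec r' h1 with ⟨r, h3, h4⟩ | ⟨h3, h4⟩
      · exact .inl ⟨r, h3, h4.trans h2⟩
      · exact .inr ⟨h3, newRec_left es' h4 h2⟩
    · exact .inr ⟨h1, newRec_right h.out_eq h2⟩
  clean := fun B hB h1 h2 => h'.clean B hB (by rw [h.mpktIn_eq B hB, h1]) (h.clean B hB h1 h2)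
  fwdQueue_sub := fun R m hm => by
    rcases h'.fwdQueue_sub R m hm with h1 | h1
    · exact h.fwdQueue_sub R m h1
    · exact .inr h1
  eff := fun ε hε => by
    rcases List.mem_append.1 hε with h1 | h1
    · obtain ⟨h2, h3⟩ := h.eff ε h1
      refine ⟨h2.trans (Set.insert_subset_insert h'.contact_mono), ?_⟩
      revert h3
      cases ε.content with
      | ghost v => exact fun h3 => h3.trans h'.ghostH_mono
      | flush v => exact fun h3 => h3.trans h'.flushH_mono
      | _ => exact id
    · obtain ⟨h2, h3⟩ := h'.eff ε h1
      refine ⟨h2, ?_⟩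
      revert h3
      cases ε.content with
      | msg m =>
        rintro ⟨h4, h5, h6⟩
        refine ⟨h.contact_mono.trans h4, fun hn => (h5 hn).trans h.self_eq, fun hn => ?_⟩
        rcases h6 hn with h7 | h7
        · exact (h.fwdQueue_sub X m h7).imp id And.right
        · exact .inr h7
      | _ => exact id

lemma seq {p q : Act Proc Body} (h : Evol X n M s (p s).1 (p s).2)
    (h' : Evol X n M (p s).1 (q (p s).1).1 (q (p s).1).2) :
    Evol X n M s (Act.seq p q s).1 (Act.seq p q s).2 := h.trans h'

lemma of_frame (h1 : s'.self = s.self) (h2 : s'.height = s.height) (h3 : s'.liveSet = s.liveSet) (h4 : s'.contactSet = s.contactSet) (h5 : s'.ghostHeight = s.ghostHeight) (h6 : s'.flushHeight = s.flushHeight) (h7 : s'.mpktOut = s.mpktOut) (h8 : Shrink ∅ s.bcastWaitSet s'.bcastWaitSet) (h9 : Shrink ∅ s.fwdWaitSet s'.fwdWaitSet) (hgap : s'.vGap ≤ s.vGap) (ghost_eq : ∀ Q ≠ X, s'.ghost Q = s.ghost Q) (flush_eq : ∀ Q ≠ X, s'.flush Q = s.flush Q) (mpktIn_eq : ∀ Q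 ≠ X, s'.mpktIn Q = s.mpktIn Q) (mpktIn_mono : totalOf (s.mpktIn X) ≤ totalOf (s'.mpktIn X)) (curView_eq : ∀ B ≠ X, B ∈ s.liveSet → (s.flush B).getD 0 < s.height → s'.curView = s.curView) (fwdQueue_sub : ∀ R m, m ∈ (s'.fwdQueue R).getD [] →
      m ∈ (s.fwdQueue R).getD [] ∨ (R = X ∧ m ∈ M)) : Evol X n M s s' [] where
  self_eq := h1
  height_eq := h2
  live_eq := h3
  contact_mono := h4.ge
  contact_new := h4 ▸ Set.subset_insert _ _
  ghostH_mono := h5.ge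
  flushH_mono := h6.ge
  sound := fun hs => hs.shrink h8 h9 h7 (by rw [h5, h2]; exact hs.ghost_le)
    (by rw [h6, h2]; exact hs.flush_le)
    (by rw [h6, h2]; exact fun h10 h11 => hs.quiet h10 (h11.trans_le hgap))
  ghost_eq := ghost_eq
  flush_eq := flush_eq
  mpktIn_eq := mpktIn_eq
  mpktIn_mono := mpktIn_mono
  curView_eq := curView_eq
  out_eq := by rw [h7]; exact (Count.plus_zero _ _).symm
  bcast_rec := fun r h => .inl (h8.desc r h)
  fwd_rec := fun r h => .inl (h9.desc r h)
  clean := fun B _ _ h11 r hr => by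
    have : ∃ r0 ∈ s.waitSet, r0.Desc ∅ r := by
      rcases List.mem_append.1 hr with h | h
      · obtain ⟨r0, h, h'⟩ := h8.desc r h
        exact ⟨r0, List.mem_append_left _ h, h'⟩
      · obtain ⟨r0, h, h'⟩ := h9.desc r h
        exact ⟨r0, List.mem_append_right _ h, h'⟩
    obtain ⟨r0, h, h'⟩ := this
    have h12 := h'.iset B (by simp)
    rw [h11 r0 h] at h12; simpa using h12
  fwdQueue_sub := fwdQueue_sub
  eff := fun ε hε => absurd hε (by simp)

lemma refl : Evol X n M s s [] :=
  of_frame rfl rfl rfl rfl rfl rfl rfl (.refl _ _) (.refl _ _) le_rfl (fun _ _ => rfl)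
    (fun _ _ => rfl) (fun _ _ => rfl) le_rfl (fun _ _ _ _ => rfl) (fun _ _ h => .inl h)

lemma phase (h : Evol X n M s s' es) (φ : Phase) :
    Evol X n M s s' (es.map fun ε => { ε with phase := φ }) := by
  have hc : ∀ l : List Eff, countMsg (l.map fun ε => { ε with phase := φ }) = countMsg l := by
    intro l
    simp only [countMsg, List.countP_map]; rfl
  have hr : ∀ r, NewRec n s es r → NewRec n s (es.map fun ε => { ε with phase := φ }) r := by
    rintro r ⟨k, ε, h1, h2, h3⟩
    refine ⟨k, { ε with phase := φ }, by simp [h1], h2, ?_⟩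
    rw [← List.map_take, hc, h3]
  exact
  { h with
    out_eq := by rw [hc]; exact h.out_eq
    bcast_rec := fun r hr' => (h.bcast_rec r hr').imp id (And.imp id (hr r))
    fwd_rec := fun r hr' => (h.fwd_rec r hr').imp id (And.imp id (hr r))
    eff := fun ε hε => by
      obtain ⟨ε0, h0, rfl⟩ := List.mem_map.1 hε
      exact h.eff ε0 h0 }

lemma forEach {α : Type*} {p : α → Act Proc Body} (h : ∀ x s, Evol X n M s (p x s).1 (p x s).2)
    (l : List α) (s : St) :
    Evol X n M s (Act.forEach p l s).1 (Act.forEach p l s).2 := by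
  induction l generalizing s with
  | nil => exact refl
  | cons x l ih => exact (h x s).trans (ih _)

end Evol

/-! ### The single procedures -/

lemma checkFlush_cases (s : St) : ∃ g f es,
    checkFlush s = ({ s with ghostHeight := g, flushHeight := f }, es) ∧
    s.ghostHeight ≤ g ∧ s.flushHeight ≤ f ∧ (g = s.ghostHeight ∨ g = s.height) ∧
    (f = s.flushHeight ∨ (f = s.height ∧ s.bcastWaitSet = [] ∧ s.fwdWaitSet = [])) ∧
    (es = [] ∨ (s.fwdWaitSet = [] ∧ (es = [⟨.ghost g, s.contactSet, .main⟩] ∨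
      es = [⟨.flush f, s.contactSet, .main⟩] ∨
      es = [⟨.ghost g, s.contactSet, .main⟩, ⟨.flush f, s.contactSet, .main⟩]))) := by
  obtain ⟨p, e⟩ : ∃ p, p = checkFlush s := ⟨_, rfl⟩
  rw [← e]
  obtain ⟨cv, vg, _, _, _, _, C, _, _, _, b, w, _, gh, fh⟩ := s
  by_cases h1 : w = [] <;> by_cases h2 : gh < cv + vg <;> by_cases h3 : b = [] <;>
    by_cases h4 : fh < cv + vg <;>
    simp only [checkFlush, Act.seq, Act.modify, Act.emitContacts, State.height, h1, h2, h3, h4, ne_eq,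
      not_true, not_false_eq_true, if_true, if_false, List.nil_append, List.append_nil,
      List.singleton_append] at e ⊢ <;>
    exact ⟨_, _, _, e, by simp [le_of_lt, *], by simp [le_of_lt, *], by simp, by simp, by simp⟩

lemma checkFlush_evol (X : Proc) (n : Bool) (M : Set Msg) (s : St) :
    Evol X n M s (checkFlush s).1 (checkFlush s).2 := by
  obtain ⟨g, f, es, h0, h1, h2, h3, h4, h5⟩ := checkFlush_cases s
  rw [h0]
  have hmem : ∀ ε ∈ es, ε = ⟨.ghost g, s.contactSet, .main⟩ ∨
      ε = ⟨.flush f, s.contactSet, .main⟩ := by rcases h5 with rfl | ⟨_, rfl | rfl | rfl⟩ <;> simp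
  have hc : countMsg es = 0 := by
    rw [countMsg, List.countP_eq_zero]
    intro ε hε
    rcases hmem ε hε with rfl | rfl <;> simp only [decide_eq_true_eq] <;> exact id
  refine ⟨rfl, rfl, rfl, subset_rfl, Set.subset_insert _ _, h1, h2, fun hs => ?_, fun _ _ => rfl,
    fun _ _ => rfl, fun _ _ => rfl, le_rfl, fun _ _ _ _ => rfl, ?_, fun r h => .inl ⟨r, h, .refl _ _⟩,
    fun r h => .inl ⟨r, h, .refl _ _⟩, fun _ _ _ h => h, fun _ _ h => .inl h, ?_⟩
  · refine hs.shrink (.refl ∅ _) (.refl ∅ _) rfl ?_ ?_ ?_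
    · change g ≤ s.height
      rcases h3 with h | h
      · rw [h]; exact hs.ghost_le
      · exact h.le
    · change f ≤ s.height
      rcases h4 with h | h
      · rw [h]; exact hs.flush_le
      · exact h.1.le
    · change f = s.height → 0 < s.vGap → _
      intro h6 h7
      rcases h4 with h | h
      · exact hs.quiet (h ▸ h6) h7
      · exact h.2
  · rw [hc, Count.plus_zero]
  · intro ε hε
    rcases hmem ε hε with rfl | rfl
    · exact ⟨Set.subset_insert _ _, le_rfl⟩
    · exact ⟨Set.subset_insert _ _, le_rfl⟩

lemma scanPass_frame (s : St) : ∃ v l, scanPass s = { s with vt := v, receiveSet := l } := by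
  unfold scanPass
  generalize s.receiveSet = l0
  induction l0 generalizing s with
  | nil => exact ⟨s.vt, s.receiveSet, rfl⟩
  | cons m l0 ih =>
    rw [List.foldl_cons]
    split_ifs
    · obtain ⟨v, l, h⟩ := ih { s with
        vt := Function.update s.vt m.orig (some ((s.vt m.orig).getD 0 + 1))
        receiveSet := s.receiveSet.filter fun m' => decide (m' ≠ m) }
      exact ⟨v, l, h⟩
    · exact ih s

lemma scan_frame (s : St) : ∃ v l, scan s = { s with vt := v, receiveSet := l } := by
  unfold scan
  generalize s.receiveSet.length = n
  induction n generalizing s with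
  | zero => exact ⟨s.vt, s.receiveSet, rfl⟩
  | succ n ih =>
    rw [Function.iterate_succ_apply]
    obtain ⟨v, l, h⟩ := scanPass_frame s
    rw [h]
    obtain ⟨v', l', h'⟩ := ih { s with vt := v, receiveSet := l }
    exact ⟨v', l', h'⟩

lemma install_frame (k : ℕ) (s : St) (hk : k ≤ s.vGap) : ∃ v l q p ms, installOne^[k] s = { s with
      vt := v, receiveSet := l, fwdQueue := q, pendViewQueue := p, mset := ms,
      curView := s.curView + k, vGap := s.vGap - k } ∧
    ∀ R m, m ∈ (q R).getD [] → m ∈ (s.fwdQueue R).getD [] := by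
  induction k generalizing s with
  | zero => exact ⟨s.vt, s.receiveSet, s.fwdQueue, s.pendViewQueue, s.mset, rfl, fun _ _ h => h⟩
  | succ k ih =>
    rw [Function.iterate_succ_apply]
    have h1 : ∃ v l q p ms, installOne s = { s with
        vt := v, receiveSet := l, fwdQueue := q, pendViewQueue := p, mset := ms,
        curView := s.curView + 1, vGap := s.vGap - 1 } ∧
        ∀ R m, m ∈ (q R).getD [] → m ∈ (s.fwdQueue R).getD [] := by
      unfold installOne
      dsimp only
      generalize hs1 : ({ s with
          receiveSet := _, fwdQueue := _, curView := _, vGap := _, pendViewQueue := _, mset := _,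
          vt := _ } : St) = s1
      obtain ⟨v, l, h⟩ := scan_frame s1
      rw [h]
      subst hs1
      refine ⟨v, l, _, _, _, rfl, fun R m hm => ?_⟩
      by_cases hR : R ∈ s.liveSet
      · dsimp only at hm
        rw [if_pos hR] at hm
        cases hq : s.fwdQueue R with
        | none => rw [hq] at hm; simp at hm
        | some l => rw [hq] at hm; simp at hm; simpa using hm.1
      · dsimp only at hm
        rwa [if_neg hR] at hm
    obtain ⟨v, l, q, p, ms, h, hq⟩ := h1
    rw [h]
    obtain ⟨v', l', q', p', ms', h', hq'⟩ := ih { s with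
        vt := v, receiveSet := l, fwdQueue := q, pendViewQueue := p, mset := ms,
        curView := s.curView + 1, vGap := s.vGap - 1 } (by dsimp only; omega)
    refine ⟨v', l', q', p', ms', ?_, fun R m hm => hq R m (hq' R m hm)⟩
    rw [h']
    simp only [State.mk.injEq, and_true]; omega

end ProtocolLemmas

section ProtocolLemmas

lemma State.Sound.of_new_bcast (hs : s.Sound) (h1 : s'.bcastWaitSet = s.bcastWaitSet ++ [r])
    (h2 : s'.fwdWaitSet = s.fwdWaitSet) (h3 : s'.mpktOut = s.mpktOut.plus false 1)
    (h4 : r.index = s'.mpktOut) (h5 : s'.ghostHeight ≤ s'.height) (h6 : s'.flushHeight ≤ s'.height)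
    (h7 : s'.vGap = 0) :
    s'.Sound := by
  have hperm : s'.waitSet.Perm (r :: s.waitSet) := by
    simp only [State.waitSet, h1, h2, List.append_assoc, List.singleton_append]
    exact List.perm_middle
  have htot : s'.mpktOut.total = s.mpktOut.total + 1 := by rw [h3, Count.total_plus]
  refine ⟨h5, h6, fun _ h8 => by omega, ?_, ?_, ?_, ?_⟩
  · rw [(hperm.map _).nodup_iff, List.map_cons, List.nodup_cons]
    refine ⟨fun h8 => ?_, hs.nodup⟩
    obtain ⟨r', h9, h10⟩ := List.mem_map.1 h8
    have := hs.total_le r' h9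
    rw [h10, h4] at this; omega
  · intro r' hr'
    rcases List.mem_cons.1 (hperm.mem_iff.1 hr') with rfl | h8
    · rw [h4]
    · have := hs.total_le r' h8
      omega
  · rw [h2]; exact hs.nodup_f
  · rw [h2, h3]; exact hs.f_le

lemma State.Sound.of_new_fwd (hs : s.Sound) (h1 : s'.fwdWaitSet = s.fwdWaitSet ++ [r])
    (h2 : s'.bcastWaitSet = s.bcastWaitSet) (h3 : s'.mpktOut = s.mpktOut.plus true 1)
    (h4 : r.index = s'.mpktOut) (h5 : s'.ghostHeight ≤ s'.height) (h6 : s'.flushHeight ≤ s'.height)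
    (h7 : s'.flushHeight ≠ s'.height) : s'.Sound := by
  have hperm : s'.waitSet.Perm (r :: s.waitSet) := by
    simp only [State.waitSet, h1, h2]
    exact (List.perm_append_singleton r (s.bcastWaitSet ++ s.fwdWaitSet)).symm.symm.trans (.refl _)
      |> fun h => by simpa using h
  have htot : s'.mpktOut.total = s.mpktOut.total + 1 := by rw [h3, Count.total_plus]
  have hf : s'.mpktOut.f = s.mpktOut.f + 1 := by rw [h3]; rfl
  refine ⟨h5, h6, fun h _ => absurd h h7, ?_, ?_, ?_, ?_⟩
  · rw [(hperm.map _).nodup_iff, List.map_cons, List.nodup_cons]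
    refine ⟨fun h8 => ?_, hs.nodup⟩
    obtain ⟨r', h9, h10⟩ := List.mem_map.1 h8
    have := hs.total_le r' h9
    rw [h10, h4] at this; omega
  · intro r' hr'
    rcases List.mem_cons.1 (hperm.mem_iff.1 hr') with rfl | h8
    · rw [h4]
    · have := hs.total_le r' h8
      omega
  · rw [h1, List.map_append, List.nodup_append]
    refine ⟨hs.nodup_f, by simp, ?_⟩
    intro a ha b hb hab
    obtain ⟨r', h9, h10⟩ := List.mem_map.1 ha
    have := hs.f_le r' h9
    simp only [List.map_cons, List.map_nil, List.mem_singleton] at hb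
    rw [h4] at hb; omega
  · intro r' hr'
    rw [h1] at hr'
    rcases List.mem_append.1 hr' with h8 | h8
    · have := hs.f_le r' h8
      omega
    · rw [List.mem_singleton.1 h8, h4]

lemma countMsg_singleton (m : Msg) (T : Set Proc) (φ : Phase) :
    countMsg [⟨.msg m, T, φ⟩] = 1 := by
  rw [countMsg, List.countP_cons_of_pos (by exact decide_eq_true trivial)]
  rfl

lemma countMsg_singleton_of_not (h : ¬ ε.content.IsMsg) : countMsg [ε] = 0 := by
  rw [countMsg, List.countP_cons_of_neg (by simpa using h)]
  rfl

lemma protBroadcast_evol (X : Proc) (M : Set Msg) (x : Body) (s : St) :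
    Evol X false M s (protBroadcast x s).1 (protBroadcast x s).2 := by
  unfold protBroadcast
  split_ifs with h
  · exact Evol.of_frame rfl rfl rfl rfl rfl rfl rfl (.refl _ _) (.refl _ _) le_rfl (fun _ _ => rfl)
      (fun _ _ => rfl) (fun _ _ => rfl) le_rfl (fun _ _ _ _ => rfl) (fun _ _ h => .inl h)
  · have hnew : ∀ (v : Proc → Option ℕ),
        NewRec false s [⟨.msg ⟨x, s.self, s.curView, v⟩, s.contactSet, .main⟩]
        ⟨⟨x, s.self, s.curView, v⟩, ⟨s.mpktOut.f, s.mpktOut.b + 1⟩, s.mpktIn⟩ := fun v =>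
      ⟨0, _, rfl, rfl, by rw [List.take_one]; simp [countMsg_singleton, Count.plus]⟩
    refine ⟨rfl, rfl, rfl, subset_rfl, Set.subset_insert _ _, le_rfl, le_rfl, fun hs => ?_,
      fun _ _ => rfl, fun _ _ => rfl, fun _ _ => rfl, le_rfl, fun _ _ _ _ => rfl, ?_, ?_,
      fun r h => .inl ⟨r, h, .refl _ _⟩, ?_, fun _ _ h => .inl h, ?_⟩
    · exact hs.of_new_bcast rfl rfl rfl rfl hs.ghost_le hs.flush_le (by dsimp only; omega)
    · rw [countMsg_singleton]; rfl
    · intro r hr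
      rcases List.mem_append.1 hr with h1 | h1
      · exact .inl ⟨r, h1, .refl _ _⟩
      · rw [List.mem_singleton.1 h1]; exact .inr ⟨rfl, hnew _⟩
    · intro B _ h1 h2 r hr
      rcases List.mem_append.1 hr with h3 | h3
      · rcases List.mem_append.1 h3 with h4 | h4
        · exact h2 r (List.mem_append_left _ h4)
        · rw [List.mem_singleton.1 h4]; exact h1
      · exact h2 r (List.mem_append_right _ h3)
    · intro ε hε
      rw [List.mem_singleton.1 hε]
      exact ⟨Set.subset_insert _ _, subset_rfl, fun _ => rfl, fun h => absurd h (by simp)⟩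

lemma tryToInstall_evol (X : Proc) (M : Set Msg) (s : St) :
    Evol X false M s (tryToInstall s).1 (tryToInstall s).2 := by
  unfold tryToInstall
  split_ifs with h
  · exact .refl
  · obtain ⟨v, l, q, p, ms, h1, h2⟩ := install_frame s.vGap s le_rfl
    dsimp only
    refine Evol.trans (es := []) ?_ (Evol.forEach (fun x s => protBroadcast_evol X M x s) _ _)
    rw [h1]
    refine Evol.of_frame rfl ?_ rfl rfl rfl rfl rfl (.refl _ _) (.refl _ _) (Nat.sub_le _ _)
      (fun _ _ => rfl) (fun _ _ => rfl) (fun _ _ => rfl) le_rfl ?_ (fun R m h => .inl (h2 R m h))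
    · simp only [State.height]; omega
    · intro B _ h3 h4; exact absurd ⟨B, h3, h4⟩ h

lemma receiveMessage_evol (m : Msg) (X : Proc) (M : Set Msg) (hm : m ∈ M) (s : St) :
    Evol X false M s (receiveMessage m X s).1 (receiveMessage m X s).2 := by
  unfold receiveMessage
  have hemit : ∀ s : St, Evol X false M s s [⟨.ack m, {X}, .main⟩] := by
    intro s
    have h : Evol X false M s s [] := .refl
    refine { h with out_eq := ?_, bcast_rec := ?_, fwd_rec := ?_, eff := ?_ }
    · rw [countMsg_singleton_of_not (by exact id), Count.plus_zero]
    · exact fun r hr => .inl ⟨r, hr, .refl _ _⟩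
    · exact fun r hr => .inl ⟨r, hr, .refl _ _⟩
    · intro ε hε
      rw [List.mem_singleton.1 hε]; exact ⟨by simp, rfl, rfl⟩
  refine (hemit s).seq (Evol.seq (Evol.of_frame rfl rfl rfl rfl rfl rfl rfl (.refl _ _) (.refl _ _)
    le_rfl (fun _ _ => rfl) (fun _ _ => rfl) ?_ ?_ (fun _ _ _ _ => rfl) (fun _ _ h => .inl h)) ?_)
  · intro Q hQ; exact Function.update_of_ne hQ _ _
  · simp only [Act.emit, Act.modify, Function.update_self]
    cases s.mpktIn X with
    | none => exact le_rfl
    | some c =>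
      simp only [totalOf, Option.map_some, Option.getD_some]
      split_ifs <;> simp only [Count.total] <;> omega
  · generalize (Act.modify _ _ : St × List Eff).1 = s1
    unfold Act.modify
    dsimp only
    split_ifs
    · exact .refl
    · exact .refl
    · exact .refl
    · generalize hs2 : ({ s1 with receiveSet := _, fwdQueue := _ } : St) = s2
      obtain ⟨v, l, h⟩ := scan_frame s2
      rw [h]
      subst hs2
      refine Evol.of_frame rfl rfl rfl rfl rfl rfl rfl (.refl _ _) (.refl _ _) le_rfl
        (fun _ _ => rfl) (fun _ _ => rfl) (fun _ _ => rfl) le_rfl (fun _ _ _ _ => rfl) ?_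
      intro R m' h'
      dsimp only at h'
      by_cases hR : R = X
      · subst hR
        rw [Function.update_self] at h'
        cases hq : s1.fwdQueue R with
        | none => rw [hq] at h'; simp at h'
        | some l =>
          rw [hq] at h'
          simp only [Option.map_some, Option.getD_some, List.mem_append, List.mem_singleton] at h'
          rcases h' with h' | rfl
          · exact .inl h'
          · exact .inr ⟨rfl, hm⟩
      · rw [Function.update_of_ne hR] at h'; exact .inl h'

/-- The state after an acknowledgement, before `CheckFlush`. -/
noncomputable def afterAck (m : Msg) (X : Proc) (s : St) : St := { s with
    bcastWaitSet := (s.bcastWaitSet.map fun r => if r.msg = m then r.discard X else r).filter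
      fun r => decide (¬ (r.msg = m ∧ r.Stable))
    fwdWaitSet := (s.fwdWaitSet.map fun r => if r.msg = m then r.discard X else r).filter
      fun r => decide (¬ (r.msg = m ∧ r.Stable)) }

lemma receiveAck_eq (m : Msg) (X : Proc) (s : St) :
    receiveAck m X s = checkFlush (afterAck m X s) ∨ receiveAck m X s = (afterAck m X s, []) := by
  unfold receiveAck
  dsimp only
  split_ifs
  · exact .inl rfl
  · exact .inr rfl

lemma receiveAck_evol (m : Msg) (X : Proc) (M : Set Msg) (s : St) :
    Evol X false M s (receiveAck m X s).1 (receiveAck m X s).2 := by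
  have hg : ∀ r : Rec, r.Desc ∅ ((fun r => if r.msg = m then r.discard X else r) r) := by
    intro r
    dsimp only
    split_ifs
    · exact WaitRec.desc_discard _ _ _
    · exact .refl _ _
  have h : Evol X false M s (afterAck m X s) [] :=
    Evol.of_frame rfl rfl rfl rfl rfl rfl rfl ((Shrink.map _ hg).filter _) ((Shrink.map _ hg).filter _)
      le_rfl (fun _ _ => rfl) (fun _ _ => rfl) (fun _ _ => rfl) le_rfl (fun _ _ _ _ => rfl)
      (fun _ _ h => .inl h)
  rcases receiveAck_eq m X s with h1 | h1 <;> rw [h1]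
  · exact h.trans (checkFlush_evol X false M _)
  · exact h

lemma receiveAck_discard (m : Msg) (X : Proc) (s : St) (hr : r ∈ (receiveAck m X s).1.waitSet)
    (hm : r.msg = m) :
    r.iset X = none := by
  have h : r ∈ (afterAck m X s).waitSet := by
    rcases receiveAck_eq m X s with h1 | h1 <;> rw [h1] at hr
    · obtain ⟨g, f, es, h2, _⟩ := checkFlush_cases (afterAck m X s)
      rw [h2] at hr; exact hr
    · exact hr
  have key : ∀ l : List Rec, r ∈ (l.map fun r => if r.msg = m then r.discard X else r).filter
      (fun r => decide (¬ (r.msg = m ∧ r.Stable))) → r.iset X = none := by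
    intro l hl
    obtain ⟨r0, _, h1⟩ := List.mem_map.1 (List.mem_of_mem_filter hl)
    split_ifs at h1 with h2
    · rw [← h1]; simp [WaitRec.discard]
    · rw [h1] at h2; exact absurd hm h2
  rcases List.mem_append.1 h with h1 | h1
  · exact key _ h1
  · exact key _ h1

lemma modifyVectors_evol (X : Proc) (n : Bool) (M : Set Msg) (s : St) (g f : Proc → Option ℕ)
    (hg : ∀ Q ≠ X, g Q = s.ghost Q) (hf : ∀ Q ≠ X, f Q = s.flush Q) :
    Evol X n M s { s with ghost := g, flush := f } [] :=
  Evol.of_frame rfl rfl rfl rfl rfl rfl rfl (.refl _ _) (.refl _ _) le_rfl hg hf (fun _ _ => rfl)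
    le_rfl (fun _ _ _ _ => rfl) (fun _ _ h => .inl h)

lemma receiveGhost_evol (v : ℕ) (X : Proc) (M : Set Msg) (s : St) :
    Evol X false M s (receiveGhost v X s).1 (receiveGhost v X s).2 :=
  modifyVectors_evol X false M s _ _ (fun _ hQ => Function.update_of_ne hQ _ _) (fun _ _ => rfl)

lemma receiveFlush_evol (v : ℕ) (X : Proc) (M : Set Msg) (s : St) :
    Evol X false M s (receiveFlush v X s).1 (receiveFlush v X s).2 :=
  Evol.seq (modifyVectors_evol X false M s _ _ (fun _ _ => rfl)
    (fun _ hQ => Function.update_of_ne hQ _ _)) (tryToInstall_evol X M _)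

lemma processRecords_evol (d : Dnt) (X : Proc) (n : ℕ) (l : List (Bool × Rec)) (s : St) :
    Evol X false Set.univ s (processRecords d X n l s).1 (processRecords d X n l s).2 := by
  induction l generalizing n s with
  | nil => exact .refl
  | cons x l ih =>
    rcases x with ⟨_ | _, r⟩ <;> unfold processRecords <;> split_ifs
    · exact Evol.seq ((receiveMessage_evol r.msg X _ (Set.mem_univ _) s).phase _) (ih _ _)
    · exact ih _ _
    · exact Evol.seq ((receiveAck_evol r.msg X _ s).phase _) (ih _ _)
    · exact ih _ _

lemma processDonation_evol (d : Dnt) (X : Proc) (s : St) :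
    Evol X false Set.univ s (processDonation d X s).1 (processDonation d X s).2 :=
  Evol.seq (processRecords_evol _ _ _ _ _) (modifyVectors_evol X false _ _ _ _
    (fun _ hQ => Function.update_of_ne hQ _ _) (fun _ hQ => Function.update_of_ne hQ _ _))

lemma emit_evol {X : Proc} {n : Bool} (M : Set Msg) (s : St) (hc : ¬ c.IsMsg)
    (h : Effect.Ok X n M s s ⟨c, {X}, .main⟩) : Evol X n M s s [⟨c, {X}, .main⟩] := by
  have h0 : Evol X n M s s [] := .refl
  refine { h0 with out_eq := ?_, bcast_rec := ?_, fwd_rec := ?_, eff := ?_ }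
  · rw [countMsg_singleton_of_not hc, Count.plus_zero]
  · exact fun r hr => .inl ⟨r, hr, .refl _ _⟩
  · exact fun r hr => .inl ⟨r, hr, .refl _ _⟩
  · intro ε hε
    rwa [List.mem_singleton.1 hε]

lemma receiveDonation_evol (d : Dnt) (X : Proc) (s : St) :
    Evol X false Set.univ s (receiveDonation d X s).1 (receiveDonation d X s).2 := by
  refine Evol.seq ?_ (Evol.seq (emit_evol _ _ (by simp [Content.IsMsg]) ⟨by simp, rfl, rfl⟩)
    (processDonation_evol _ _ _))
  have h : Evol X false Set.univ s s [] := .refl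
  exact { h with
    contact_mono := Set.subset_insert _ _
    contact_new := subset_rfl
    sound := fun hs => hs.shrink (.refl ∅ _) (.refl ∅ _) rfl hs.ghost_le hs.flush_le hs.quiet
    eff := fun ε hε => absurd hε (by simp [Act.modify]) }

lemma receiveCoDonation_evol (d : Dnt) (X : Proc) (s : St) :
    Evol X false Set.univ s (receiveCoDonation d X s).1 (receiveCoDonation d X s).2 :=
  Evol.seq (processDonation_evol _ _ _) ((tryToInstall_evol _ _ _).phase _)

lemma protPacket_evol (c : Cnt) (X : Proc) (s : St) :
    Evol X false Set.univ s (protPacket c X s).1 (protPacket c X s).2 := by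
  cases c with
  | msg m => exact receiveMessage_evol m X _ (Set.mem_univ _) s
  | ack m => exact receiveAck_evol m X _ s
  | ghost v => exact receiveGhost_evol v X _ s
  | flush v => exact receiveFlush_evol v X _ s
  | donation d => exact receiveDonation_evol d X s
  | codonation d => exact receiveCoDonation_evol d X s

/-! ### Membership changes -/

lemma forward_evol {X : Proc} (hm : m ∈ (s.fwdQueue X).getD []) (hs : s.flushHeight < s.height) :
    Evol X true ∅ s (forward m s).1 (forward m s).2 := by
  refine ⟨rfl, rfl, rfl, subset_rfl, Set.subset_insert _ _, le_rfl, le_rfl, fun h => ?_,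
      fun _ _ => rfl, fun _ _ => rfl, fun _ _ => rfl, le_rfl, fun _ _ _ _ => rfl, ?_,
      fun r h => .inl ⟨r, h, .refl _ _⟩, ?_, ?_, fun _ _ h => .inl h, ?_⟩
  · exact h.of_new_fwd rfl rfl rfl rfl h.ghost_le h.flush_le hs.ne
  · simp only [forward]; rw [countMsg_singleton]; rfl
  · intro r hr
    rcases List.mem_append.1 hr with h1 | h1
    · exact .inl ⟨r, h1, .refl _ _⟩
    · rw [List.mem_singleton.1 h1]
      exact .inr ⟨rfl, 0, _, rfl, rfl, by
        simp only [forward]; rw [List.take_one]; simp [countMsg_singleton, Count.plus]⟩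
  · intro B _ h1 h2 r hr
    rcases List.mem_append.1 hr with h3 | h3
    · exact h2 r (List.mem_append_left _ h3)
    · rcases List.mem_append.1 h3 with h4 | h4
      · exact h2 r (List.mem_append_right _ h4)
      · rw [List.mem_singleton.1 h4]; exact h1
  · intro ε hε
    rw [List.mem_singleton.1 hε]
    exact ⟨Set.subset_insert _ _, subset_rfl, fun h => absurd h (by simp), fun _ => .inl hm⟩

lemma forEach_forward_evol {X : Proc} (l : List Msg) (hl : ∀ m ∈ l, m ∈ (s.fwdQueue X).getD [])
    (hs : s.flushHeight < s.height) :
    Evol X true ∅ s (Act.forEach forward l s).1 (Act.forEach forward l s).2 := by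
  induction l generalizing s with
  | nil => exact .refl
  | cons m l ih =>
    refine (forward_evol (hl m List.mem_cons_self) hs).trans (ih ?_ hs)
    exact fun m' h' => hl m' (List.mem_cons_of_mem _ h')

/-- The state in which the forwarding of messages after the removal of `R` begins. -/
noncomputable def beforeForward (R : Proc) (s : St) : St := { s with
    vGap := s.vGap + 1
    pendViewQueue := s.pendViewQueue ++ [.remove R]
    liveSet := s.liveSet \ {R}
    contactSet := s.contactSet \ {R}
    bcastWaitSet := (s.bcastWaitSet.map (WaitRec.discard R)).filter fun r => decide (¬ r.Stable)
    fwdWaitSet := (s.fwdWaitSet.map (WaitRec.discard R)).filter fun r => decide (¬ r.Stable)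
    mpktIn := Function.update s.mpktIn R none }

lemma beforeForward_shrink (R : Proc) (s : St) :
    Shrink ∅ s.bcastWaitSet (beforeForward R s).bcastWaitSet ∧
    Shrink ∅ s.fwdWaitSet (beforeForward R s).fwdWaitSet :=
  ⟨(Shrink.map _ (WaitRec.desc_discard _ _)).filter _,
    (Shrink.map _ (WaitRec.desc_discard _ _)).filter _⟩

lemma beforeForward_sound (hs : s.Sound) : (beforeForward R s).Sound := by
  have h : (beforeForward R s).height = s.height + 1 := rfl
  refine hs.shrink (beforeForward_shrink R s).1 (beforeForward_shrink R s).2 rfl ?_ ?_ ?_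
  · rw [h]; exact hs.ghost_le.trans (Nat.le_succ _)
  · rw [h]; exact hs.flush_le.trans (Nat.le_succ _)
  · rw [h]
    intro h1
    have : s.flushHeight ≤ s.height := hs.flush_le
    change s.flushHeight = _ at h1
    omega

/-- The part of the removal procedure that follows the first update of the state. -/
noncomputable def finishRemove (R : Proc) : Act Proc Body := fun s =>
  Act.seq (Act.forEach forward ((s.fwdQueue R).getD [])) (Act.seq (Act.modify fun s => { s with
        fwdQueue := Function.update s.fwdQueue R none
        ghost := Function.update s.ghost R none
        flush := Function.update s.flush R none }) checkFlush) s

lemma protRemove_eq (R : Proc) (s : St) :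
    protRemove R s = finishRemove R (beforeForward R s) := rfl

lemma protRemove_evol (R : Proc) (hs : s.Sound) :
    Evol R true ∅ (beforeForward R s) (protRemove R s).1 (protRemove R s).2 := by
  have hlt : (beforeForward R s).flushHeight < (beforeForward R s).height := by
    have : s.flushHeight ≤ s.height := hs.flush_le
    exact Nat.lt_succ_of_le this
  rw [protRemove_eq]
  refine Evol.seq (forEach_forward_evol _ (fun _ h => h) hlt) (Evol.seq (Evol.of_frame rfl rfl rfl
    rfl rfl rfl rfl (.refl _ _) (.refl _ _) le_rfl
    (fun _ hQ => Function.update_of_ne hQ _ _) (fun _ hQ => Function.update_of_ne hQ _ _)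
    (fun _ _ => rfl) le_rfl (fun _ _ _ _ => rfl) ?_) (checkFlush_evol _ _ _ _))
  intro Q m h
  simp only [Act.modify] at h
  by_cases hQ : Q = R
  · subst hQ; rw [Function.update_self] at h; simp at h
  · rw [Function.update_of_ne hQ] at h; exact .inl h

/-- The instability that a joining process inherits from its parent. -/
noncomputable def WaitRec.inherit (J E : Proc) (r : Rec) : Rec := match r.iset E with
  | some c => { r with iset := Function.update r.iset J (some ⟨c.f, 0⟩) }
  | none => r

lemma WaitRec.desc_inherit (J E : Proc) (r : Rec) : r.Desc {J} (r.inherit J E) := by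
  unfold WaitRec.inherit
  split
  · refine ⟨rfl, rfl, fun Q hQ h => ?_⟩
    dsimp only at h
    rwa [Function.update_of_ne hQ] at h
  · exact .refl _ _

/-- The state in which the donation to `J` is sent. -/
noncomputable def beforeDonate (J E : Proc) (s : St) : St := { s with
    vGap := s.vGap + 1
    pendViewQueue := s.pendViewQueue ++ [.join J]
    liveSet := insert J s.liveSet
    contactSet := insert J s.contactSet
    fwdQueue := Function.update s.fwdQueue J (some [])
    bcastWaitSet := s.bcastWaitSet.map (WaitRec.inherit J E)
    fwdWaitSet := s.fwdWaitSet.map (WaitRec.inherit J E)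
    ghost := Function.update s.ghost J (s.ghost E)
    flush := Function.update s.flush J (s.ghost E)
    mpktIn := Function.update s.mpktIn J (some ⟨((s.mpktIn E).map Count.f).getD 0, 0⟩) }

lemma protJoin_eq (J E : Proc) (s : St) : protJoin J E s = ((checkFlush (beforeDonate J E s)).1,
      ⟨.donation (beforeDonate J E s).donated, {J}, .main⟩ :: (checkFlush (beforeDonate J E s)).2) :=
  rfl

lemma beforeDonate_shrink (J E : Proc) (s : St) :
    Shrink {J} s.bcastWaitSet (beforeDonate J E s).bcastWaitSet ∧
    Shrink {J} s.fwdWaitSet (beforeDonate J E s).fwdWaitSet :=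
  ⟨Shrink.map _ (WaitRec.desc_inherit _ _), Shrink.map _ (WaitRec.desc_inherit _ _)⟩

lemma beforeDonate_sound {E : Proc} (hs : s.Sound) : (beforeDonate J E s).Sound := by
  have h : (beforeDonate J E s).height = s.height + 1 := rfl
  refine hs.shrink (beforeDonate_shrink J E s).1 (beforeDonate_shrink J E s).2 rfl ?_ ?_ ?_
  · rw [h]; exact hs.ghost_le.trans (Nat.le_succ _)
  · rw [h]; exact hs.flush_le.trans (Nat.le_succ _)
  · rw [h]
    intro h1
    have : s.flushHeight ≤ s.height := hs.flush_le
    change s.flushHeight = _ at h1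
    omega

lemma protJoin_evol (J E : Proc) (s : St) :
    Evol J true ∅ (beforeDonate J E s) (protJoin J E s).1 (protJoin J E s).2 := by
  rw [protJoin_eq]
  have h : Evol J true ∅ (beforeDonate J E s) (beforeDonate J E s)
      [⟨.donation (beforeDonate J E s).donated, {J}, .main⟩] :=
    emit_evol _ _ (by exact id) ⟨by simp, rfl, rfl⟩
  exact h.trans (checkFlush_evol J true ∅ _)

/-- The initial state of the new process `J`, before `CheckFlush`. -/
noncomputable def newborn (J : Proc) (s : St) : St := { s with
    vGap := s.vGap + 1
    pendViewQueue := s.pendViewQueue ++ [.join J]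
    liveSet := insert J s.liveSet
    contactSet := {J}
    fwdQueue := Function.update s.fwdQueue J (some [])
    bcastWaitSet := []
    fwdWaitSet := s.fwdWaitSet.map fun r => { r with index := { r.index with b := 0 } }
    launchQueue := []
    flushHeight := s.ghostHeight
    ghost := Function.update s.ghost J (some s.ghostHeight)
    flush := Function.update s.flush J (some s.ghostHeight)
    mpktOut := { s.mpktOut with b := 0 }
    mpktIn := Function.update s.mpktIn J (some { s.mpktOut with b := 0 })
    self := J }

lemma protRun_eq (J : Proc) (s : St) : protRun J s = checkFlush (newborn J s) := rfl

lemma newborn_sound (hs : s.Sound) : (newborn J s).Sound := by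
  have h : (newborn J s).height = s.height + 1 := rfl
  have h0 : s.ghostHeight ≤ s.height := hs.ghost_le
  have hw : (newborn J s).waitSet =
      s.fwdWaitSet.map fun r => { r with index := { r.index with b := 0 } } := rfl
  refine ⟨?_, ?_, ?_, ?_, ?_, ?_, ?_⟩
  · rw [h]; exact h0.trans (Nat.le_succ _)
  · rw [h]; exact h0.trans (Nat.le_succ _)
  · rw [h]; intro h1; change s.ghostHeight = _ at h1; omega
  · rw [hw, List.map_map]; exact hs.nodup_f
  · rw [hw]
    intro r hr
    obtain ⟨r0, h1, rfl⟩ := List.mem_map.1 hr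
    exact hs.f_le r0 h1
  · change ((s.fwdWaitSet.map _).map _).Nodup
    rw [List.map_map]; exact hs.nodup_f
  · intro r hr
    obtain ⟨r0, h1, rfl⟩ := List.mem_map.1 hr
    exact hs.f_le r0 h1

lemma protRun_evol (J : Proc) (s : St) :
    Evol J true ∅ (newborn J s) (protRun J s).1 (protRun J s).2 := checkFlush_evol _ _ _ _

end ProtocolLemmas

section EffectOrder

/-- The place of a content in the order in which a procedure produces side effects. -/
def Content.rank : Cnt → ℕ
  | .codonation _ => 1
  | .donation _ => 2
  | .ack _ => 3
  | .ghost _ => 4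
  | .flush _ => 5
  | .msg _ => 6

/-- A side effect with content `c` may come before one with content `c'`. -/
def Content.Before (c c' : Cnt) : Prop := c.rank < c'.rank ∨ (c.IsMsg ∧ c'.IsMsg)

/-- `ε` may come before `ε'` in one transaction. -/
def Effect.Before (ε ε' : Eff) : Prop := match ε.phase, ε'.phase with
  | .main, .main => ε.content.Before ε'.content
  | .main, _ => True
  | .sub n, .sub m => n < m ∨ (n = m ∧ ε.content.Before ε'.content)
  | .sub _, .install => True
  | .install, .install => ε.content.Before ε'.content
  | _, _ => False

/-- The side effects are in order and all of them belong to the main phase. -/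
structure MainOrdered (es : List Eff) : Prop where
  phase : ∀ ε ∈ es, ε.phase = .main
  pairwise : es.Pairwise fun ε ε' => ε.content.Before ε'.content

lemma MainOrdered.before (h : MainOrdered es) : es.Pairwise Effect.Before := by
  refine h.pairwise.imp_of_mem fun {ε ε'} h1 h2 h3 => ?_
  unfold Effect.Before
  rw [h.phase ε h1, h.phase ε' h2]; exact h3

lemma MainOrdered.of_msg (h1 : ∀ ε ∈ es, ε.phase = .main) (h2 : ∀ ε ∈ es, ε.content.IsMsg) :
    MainOrdered es :=
  ⟨h1, List.pairwise_of_forall_mem_list fun ε hε ε' hε' => .inr ⟨h2 ε hε, h2 ε' hε'⟩⟩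

lemma checkFlush_ordered (s : St) : MainOrdered (checkFlush s).2 := by
  obtain ⟨g, f, es, h0, _, _, _, _, h5⟩ := checkFlush_cases s
  rw [h0]
  constructor
  · rcases h5 with rfl | ⟨_, rfl | rfl | rfl⟩ <;> simp
  · rcases h5 with rfl | ⟨_, rfl | rfl | rfl⟩ <;> simp [Content.Before, Content.rank]

lemma checkFlush_ack_lt (s : St) : ∀ ε ∈ (checkFlush s).2, 4 ≤ ε.content.rank := by
  obtain ⟨g, f, es, h0, _, _, _, _, h5⟩ := checkFlush_cases s
  rw [h0]
  rcases h5 with rfl | ⟨_, rfl | rfl | rfl⟩ <;> simp [Content.rank]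

lemma forEach_mem {α : Type*} {p : α → Act Proc Body} {Q : Eff → Prop}
    (h : ∀ x s, ∀ ε ∈ (p x s).2, Q ε) (l : List α) (s : St) :
    ∀ ε ∈ (Act.forEach p l s).2, Q ε := by
  induction l generalizing s with
  | nil => exact fun ε hε => absurd hε (by simp [Act.forEach, Act.skip])
  | cons x l ih =>
    intro ε hε
    rcases List.mem_append.1 hε with h1 | h1
    · exact h x s ε h1
    · exact ih _ ε h1

lemma forEach_forward_fwdWaitSet (l : List Msg) (s : St) :
    (Act.forEach forward l s).1.fwdWaitSet = [] → (Act.forEach forward l s).2 = [] := by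
  have key : ∀ (l : List Msg) (s : St),
      s.fwdWaitSet ≠ [] → (Act.forEach forward l s).1.fwdWaitSet ≠ [] := by
    intro l
    induction l with
    | nil => exact fun s h => h
    | cons m l ih => exact fun s h => ih _ (by simp [forward])
  cases l with
  | nil => exact fun _ => rfl
  | cons m l => exact fun h => absurd h (key l _ (by simp [forward]))

lemma protBroadcast_effects (x : Body) (s : St) :
    ∀ ε ∈ (protBroadcast x s).2, ε.phase = .main ∧ ε.content.IsMsg := by
  unfold protBroadcast
  split_ifs
  · simp
  · simp [Content.IsMsg]

lemma tryToInstall_effects (s : St) :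
    ∀ ε ∈ (tryToInstall s).2, ε.phase = .main ∧ ε.content.IsMsg := by
  unfold tryToInstall
  split_ifs
  · simp
  · exact forEach_mem (fun x s => protBroadcast_effects x s) _ _

lemma tryToInstall_effective (h : (tryToInstall s).2 ≠ []) :
    ∀ pid ∈ s.liveSet, s.height ≤ (s.flush pid).getD 0 := by
  unfold tryToInstall at h
  split_ifs at h with h1
  · exact absurd rfl h
  · push Not at h1
    exact h1

lemma finishRemove_ordered (R : Proc) (s : St) : MainOrdered (finishRemove R s).2 := by
  unfold finishRemove
  simp only [Act.seq, Act.modify, List.nil_append]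
  generalize (s.fwdQueue R).getD [] = l
  generalize hs2 : ({ (Act.forEach forward l s).1 with fwdQueue := _, ghost := _, flush := _ } :
    St) = s2
  obtain ⟨g, f, es, h0, _, _, _, _, h5⟩ := checkFlush_cases s2
  have hf : ∀ ε ∈ (Act.forEach forward l s).2, ε.phase = .main ∧ ε.content.IsMsg :=
    forEach_mem (fun m s => by simp [forward, Content.IsMsg]) _ _
  rcases h5 with h6 | ⟨h6, -⟩
  · rw [h0, h6, List.append_nil]; exact .of_msg (fun ε hε => (hf ε hε).1) (fun ε hε => (hf ε hε).2)
  · have h7 : (Act.forEach forward l s).1.fwdWaitSet = [] := by rw [← h6, ← hs2]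
    rw [forEach_forward_fwdWaitSet l s h7, List.nil_append]; exact checkFlush_ordered s2

lemma protJoin_ordered (J E : Proc) (s : St) : MainOrdered (protJoin J E s).2 := by
  rw [protJoin_eq]
  refine ⟨?_, ?_⟩
  · intro ε hε
    rcases List.mem_cons.1 hε with rfl | h
    · rfl
    · exact (checkFlush_ordered _).phase ε h
  · refine List.pairwise_cons.2 ⟨fun ε hε => .inl ?_, (checkFlush_ordered _).pairwise⟩
    have := checkFlush_ack_lt _ ε hε
    simp only [Content.rank] at *; omega

lemma receiveMessage_effects (m : Msg) (X : Proc) (s : St) :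
    (receiveMessage m X s).2 = [⟨.ack m, {X}, .main⟩] := by
  simp [receiveMessage, Act.seq, Act.emit, Act.modify]

lemma receiveAck_ordered (m : Msg) (X : Proc) (s : St) : MainOrdered (receiveAck m X s).2 := by
  rcases receiveAck_eq m X s with h | h <;> rw [h]
  · exact checkFlush_ordered _
  · exact ⟨by simp, by simp⟩

/-- The condition under which the receipt of a record is simulated in state `s`. -/
def Simulated (d : Dnt) (X : Proc) (s : St) : Bool × Rec → Prop
  | (false, r) => totalOf (s.mpktIn X) < r.index.total
  | (true, r) => r.index.total ≤ totalOf (d.mpktIn s.self)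

lemma Simulated.mono {X : Proc} {M : Set Msg} (h : Evol X false M s s' es) {x : Bool × Rec}
    (hx : Simulated d X s' x) : Simulated d X s x := by
  rcases x with ⟨_ | _, r⟩
  · exact h.mpktIn_mono.trans_lt hx
  · rw [Simulated, h.self_eq] at hx; exact hx

lemma countP_simulated_mono {X : Proc} {M : Set Msg} (h : Evol X false M s s' es)
    (l : List (Bool × Rec)) :
    l.countP (fun x => decide (Simulated d X s' x)) ≤
      l.countP (fun x => decide (Simulated d X s x)) := List.countP_mono_left fun x _ hx => by
    simp only [decide_eq_true_eq] at hx ⊢; exact hx.mono h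

/-- Acknowledgements, ghosts and flushes. -/
def Content.Reply (c : Cnt) : Prop := 3 ≤ c.rank ∧ c.rank ≤ 5

lemma receiveAck_reply (m : Msg) (X : Proc) (s : St) :
    ∀ ε ∈ (receiveAck m X s).2, ε.content.Reply := by
  have : ∀ s : St, ∀ ε ∈ (checkFlush s).2, ε.content.Reply := by
    intro s
    obtain ⟨g, f, es, h0, _, _, _, _, h5⟩ := checkFlush_cases s
    rw [h0]
    rcases h5 with rfl | ⟨_, rfl | rfl | rfl⟩ <;> simp [Content.Reply, Content.rank]
  rcases receiveAck_eq m X s with h | h <;> rw [h]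
  · exact this _
  · simp

lemma subBlock (p q : Act Proc Body) (s : St) (n k : ℕ) (h1 : MainOrdered (p s).2) (h1' : ∀ ε ∈ (p s).2, ε.content.Reply) (h2 : (q (p s).1).2.Pairwise Effect.Before ∧
      ∀ ε ∈ (q (p s).1).2, ε.content.Reply ∧ ∃ m, ε.phase = .sub m ∧ n + 1 ≤ m ∧ m < n + 1 + k) :
    (Act.seq (Act.inPhase (.sub n) p) q s).2.Pairwise Effect.Before ∧
      ∀ ε ∈ (Act.seq (Act.inPhase (.sub n) p) q s).2, ε.content.Reply ∧
        ∃ m, ε.phase = .sub m ∧ n ≤ m ∧ m < n + (k + 1) := by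
  simp only [Act.seq, Act.inPhase]
  refine ⟨List.pairwise_append.2 ⟨?_, h2.1, ?_⟩, ?_⟩
  · rw [List.pairwise_map]; exact h1.pairwise.imp fun h => .inr ⟨rfl, h⟩
  · intro ε hε ε' hε'
    obtain ⟨ε0, _, rfl⟩ := List.mem_map.1 hε
    obtain ⟨_, m, h3, h4, _⟩ := h2.2 ε' hε'
    unfold Effect.Before
    rw [h3]; exact .inl h4
  · intro ε hε
    rcases List.mem_append.1 hε with h3 | h3
    · obtain ⟨ε0, h4, rfl⟩ := List.mem_map.1 h3
      exact ⟨h1' ε0 h4, n, rfl, le_rfl, by omega⟩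
    · obtain ⟨h4, m, h5, h6, h7⟩ := h2.2 ε h3
      exact ⟨h4, m, h5, by omega, by omega⟩

lemma processRecords_effects (d : Dnt) (X : Proc) (n : ℕ) (l : List (Bool × Rec)) (s : St) :
    (processRecords d X n l s).2.Pairwise Effect.Before ∧
    ∀ ε ∈ (processRecords d X n l s).2, ε.content.Reply ∧ ∃ m, ε.phase = .sub m ∧ n ≤ m ∧
      m < n + l.countP (fun x => decide (Simulated d X s x)) := by
  have step : ∀ (n : ℕ) (s : St) (p : Act Proc Body) (x : Bool × Rec)
      (l : List (Bool × Rec)), Simulated d X s x →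
      Evol X false Set.univ s (p s).1 (p s).2 → MainOrdered (p s).2 →
      (∀ ε ∈ (p s).2, ε.content.Reply) →
      ((processRecords d X (n + 1) l (p s).1).2.Pairwise Effect.Before ∧
        ∀ ε ∈ (processRecords d X (n + 1) l (p s).1).2, ε.content.Reply ∧
          ∃ m, ε.phase = .sub m ∧ n + 1 ≤ m ∧
          m < n + 1 + l.countP (fun x => decide (Simulated d X (p s).1 x))) →
      ((Act.seq (Act.inPhase (.sub n) p) (processRecords d X (n + 1) l) s).2.Pairwise Effect.Before ∧
      ∀ ε ∈ (Act.seq (Act.inPhase (.sub n) p) (processRecords d X (n + 1) l) s).2,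
        ε.content.Reply ∧ ∃ m, ε.phase = .sub m ∧ n ≤ m ∧
          m < n + (x :: l).countP (fun x => decide (Simulated d X s x))) := by
    intro n s p x l hx hev h1 h2 ⟨h3, h4⟩
    rw [List.countP_cons_of_pos (by simpa using hx)]
    refine subBlock _ _ _ _ _ h1 h2 ⟨h3, fun ε hε => ?_⟩
    obtain ⟨h5, m, h6, h7, h8⟩ := h4 ε hε
    exact ⟨h5, m, h6, h7, h8.trans_le (Nat.add_le_add_left (countP_simulated_mono hev l) _)⟩
  induction l generalizing n s with
  | nil => exact ⟨List.Pairwise.nil, fun ε hε => absurd hε (by simp [processRecords, Act.skip])⟩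
  | cons x l ih =>
    rcases x with ⟨_ | _, r⟩
    · unfold processRecords
      split_ifs with hc
      · refine step _ _ _ (false, r) l hc (receiveMessage_evol _ _ _ (Set.mem_univ _) _) ?_ ?_ ?_
        · rw [receiveMessage_effects]; exact ⟨by simp, by simp⟩
        · rw [receiveMessage_effects]; simp [Content.Reply, Content.rank]
        · exact ih _ _
      · rw [List.countP_cons_of_neg (by simp only [decide_eq_true_eq]; exact hc)]
        exact ih n s
    · unfold processRecords
      split_ifs with hc
      · refine step _ _ _ (true, r) l hc (receiveAck_evol _ _ _ _) (receiveAck_ordered _ _ _)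
          (receiveAck_reply _ _ _) ?_
        exact ih _ _
      · rw [List.countP_cons_of_neg (by simp only [decide_eq_true_eq]; exact hc)]
        exact ih n s

/-- The number of simulated receipts is at most this. -/
noncomputable def simCount (d : Dnt) (X : Proc) (s : St) : ℕ :=
  (untimelyRecords d X s).countP fun x => decide (Simulated d X s x)

lemma processDonation_effects (d : Dnt) (X : Proc) (s : St) :
    (processDonation d X s).2.Pairwise Effect.Before ∧
    ∀ ε ∈ (processDonation d X s).2, ε.content.Reply ∧ ∃ m, ε.phase = .sub m ∧
      m < simCount d X s := by
  unfold processDonation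
  simp only [Act.seq, Act.modify, List.append_nil]
  obtain ⟨h1, h2⟩ := processRecords_effects d X 0 ((untimelyRecords d X s).insertionSort fun x y =>
        (recordHeight s.self x).1 < (recordHeight s.self y).1 ∨
          ((recordHeight s.self x).1 = (recordHeight s.self y).1 ∧
            (recordHeight s.self x).2 ≤ (recordHeight s.self y).2)) s
  refine ⟨h1, fun ε hε => ?_⟩
  obtain ⟨h3, m, h4, _, h5⟩ := h2 ε hε
  rw [(List.perm_insertionSort _ _).countP_eq, Nat.zero_add] at h5; exact ⟨h3, m, h4, h5⟩

lemma processDonation_flush (d : Dnt) (X : Proc) (s : St) :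
    (processDonation d X s).1.flush X = some d.flushHeight := by
  simp [processDonation, Act.seq, Act.modify]

lemma receiveDonation_eq (d : Dnt) (X : Proc) (s : St) :
    (receiveDonation d X s).2 = ⟨.codonation s.donated, {X}, .main⟩ ::
      (processDonation d X { s with contactSet := insert X s.contactSet }).2 := rfl

lemma receiveCoDonation_eq (d : Dnt) (X : Proc) (s : St) :
    (receiveCoDonation d X s).2 = (processDonation d X s).2 ++
      (tryToInstall (processDonation d X s).1).2.map fun ε => { ε with phase := .install } := rfl

lemma protPacket_before (c : Cnt) (X : Proc) (s : St) :
    (protPacket c X s).2.Pairwise Effect.Before := by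
  have hmsg : ∀ s : St, MainOrdered (tryToInstall s).2 := fun s =>
    .of_msg (fun ε hε => (tryToInstall_effects s ε hε).1)
      (fun ε hε => (tryToInstall_effects s ε hε).2)
  cases c with
  | msg m => simp only [protPacket]; rw [receiveMessage_effects]; simp
  | ack m => exact (receiveAck_ordered m X s).before
  | ghost v => exact List.Pairwise.nil
  | flush v =>
    simp only [protPacket, receiveFlush, Act.seq, Act.modify, List.nil_append]
    exact (hmsg _).before
  | donation d =>
    simp only [protPacket]
    rw [receiveDonation_eq]
    refine List.pairwise_cons.2 ⟨fun ε hε => ?_, (processDonation_effects d X _).1⟩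
    obtain ⟨_, m, h, _⟩ := (processDonation_effects d X _).2 ε hε
    unfold Effect.Before
    rw [h]; trivial
  | codonation d =>
    simp only [protPacket]
    rw [receiveCoDonation_eq]
    refine List.pairwise_append.2 ⟨(processDonation_effects d X _).1, ?_, ?_⟩
    · rw [List.pairwise_map]; exact (hmsg _).pairwise.imp fun h => h
    · intro ε hε ε' hε'
      obtain ⟨_, m, h, _⟩ := (processDonation_effects d X _).2 ε hε
      obtain ⟨ε0, _, rfl⟩ := List.mem_map.1 hε'
      unfold Effect.Before
      rw [h]; trivial

lemma protPacket_sub {X : Proc} (hε : ε ∈ (protPacket c X s).2) (hn : ε.phase = .sub n) :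
    ε.content.Reply ∧ ∃ d, (c = .donation d ∨ c = .codonation d) ∧ n < simCount d X s := by
  cases c with
  | msg m => simp only [protPacket] at hε; rw [receiveMessage_effects] at hε; simp at hε; simp [hε] at hn
  | ack m => rw [(receiveAck_ordered m X s).phase ε hε] at hn; simp at hn
  | ghost v => simp [protPacket, receiveGhost, Act.modify] at hε
  | flush v =>
    simp only [protPacket, receiveFlush, Act.seq, Act.modify, List.nil_append] at hε
    rw [(tryToInstall_effects _ ε hε).1] at hn; simp at hn
  | donation d =>
    simp only [protPacket] at hε
    rw [receiveDonation_eq] at hε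
    rcases List.mem_cons.1 hε with rfl | h
    · simp at hn
    · obtain ⟨h0, m, h1, h2⟩ := (processDonation_effects d X _).2 ε h
      rw [h1] at hn
      simp only [Phase.sub.injEq] at hn
      subst hn; exact ⟨h0, d, .inl rfl, h2⟩
  | codonation d =>
    simp only [protPacket] at hε
    rw [receiveCoDonation_eq] at hε
    rcases List.mem_append.1 hε with h | h
    · obtain ⟨h0, m, h1, h2⟩ := (processDonation_effects d X _).2 ε h
      rw [h1] at hn
      simp only [Phase.sub.injEq] at hn
      subst hn; exact ⟨h0, d, .inr rfl, h2⟩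
    · obtain ⟨ε0, _, rfl⟩ := List.mem_map.1 h
      simp at hn

lemma protPacket_install {X : Proc} (hε : ε ∈ (protPacket c X s).2) (hn : ε.phase = .install) :
    ε.content.IsMsg ∧ ∃ d, c = .codonation d ∧ (X ∈ s.liveSet → s.height ≤ d.flushHeight) ∧
      ∀ Q ∈ s.liveSet, Q ≠ X → s.height ≤ (s.flush Q).getD 0 := by
  cases c with
  | msg m => simp only [protPacket] at hε; rw [receiveMessage_effects] at hε; simp at hε; simp [hε] at hn
  | ack m => rw [(receiveAck_ordered m X s).phase ε hε] at hn; simp at hn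
  | ghost v => simp [protPacket, receiveGhost, Act.modify] at hε
  | flush v =>
    simp only [protPacket, receiveFlush, Act.seq, Act.modify, List.nil_append] at hε
    rw [(tryToInstall_effects _ ε hε).1] at hn; simp at hn
  | donation d =>
    simp only [protPacket] at hε
    rw [receiveDonation_eq] at hε
    rcases List.mem_cons.1 hε with rfl | h
    · simp at hn
    · obtain ⟨_, m, h1, h2⟩ := (processDonation_effects d X _).2 ε h
      rw [h1] at hn; simp at hn
  | codonation d =>
    simp only [protPacket] at hε
    rw [receiveCoDonation_eq] at hε
    rcases List.mem_append.1 hε with h | h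
    · obtain ⟨_, m, h1, h2⟩ := (processDonation_effects d X _).2 ε h
      rw [h1] at hn; simp at hn
    · obtain ⟨ε0, h0, rfl⟩ := List.mem_map.1 h
      refine ⟨(tryToInstall_effects _ ε0 h0).2, d, rfl, ?_⟩
      have h1 := tryToInstall_effective (List.ne_nil_of_mem h0)
      have hev := processDonation_evol d X s
      rw [hev.height_eq, hev.live_eq] at h1
      refine ⟨fun hX => ?_, fun Q hQ hne => ?_⟩
      · have := h1 X hX
        rwa [processDonation_flush] at this
      · have := h1 Q hQ
        rwa [hev.flush_eq Q hne] at this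

lemma protPacket_main {X : Proc} (hε : ε ∈ (protPacket c X s).2) (hn : ε.phase = .main) :
    (∃ m, c = .msg m ∧ (protPacket c X s).2 = [ε] ∧ ε = ⟨.ack m, {X}, .main⟩) ∨
    (∃ m, c = .ack m ∧ (ε.content.IsGhost ∨ ε.content.IsFlush)) ∨
    (∃ v, c = .flush v ∧ ε.content.IsMsg) ∨
    (∃ d, c = .donation d ∧ ε.content = .codonation s.donated) := by
  cases c with
  | msg m =>
    simp only [protPacket] at *
    rw [receiveMessage_effects] at *
    simp only [List.mem_singleton] at hε; exact .inl ⟨m, rfl, by rw [hε], hε⟩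
  | ack m =>
    refine .inr (.inl ⟨m, rfl, ?_⟩)
    have := receiveAck_reply m X s ε hε
    have h0 : 4 ≤ ε.content.rank := by
      simp only [protPacket] at hε
      rcases receiveAck_eq m X s with h | h <;> rw [h] at hε
      · exact checkFlush_ack_lt _ ε hε
      · simp at hε
    revert this h0
    cases ε.content <;> simp [Content.Reply, Content.rank, Content.IsGhost, Content.IsFlush]
  | ghost v => simp [protPacket, receiveGhost, Act.modify] at hε
  | flush v =>
    simp only [protPacket, receiveFlush, Act.seq, Act.modify, List.nil_append] at hε
    exact .inr (.inr (.inl ⟨v, rfl, (tryToInstall_effects _ ε hε).2⟩))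
  | donation d =>
    simp only [protPacket] at hε
    rw [receiveDonation_eq] at hε
    rcases List.mem_cons.1 hε with rfl | h
    · exact .inr (.inr (.inr ⟨d, rfl, rfl⟩))
    · obtain ⟨_, m, h1, h2⟩ := (processDonation_effects d X _).2 ε h
      rw [h1] at hn; simp at hn
  | codonation d =>
    simp only [protPacket] at hε
    rw [receiveCoDonation_eq] at hε
    rcases List.mem_append.1 hε with h | h
    · obtain ⟨_, m, h1, h2⟩ := (processDonation_effects d X _).2 ε h
      rw [h1] at hn; simp at hn
    · obtain ⟨ε0, h0, rfl⟩ := List.mem_map.1 h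
      simp at hn

end EffectOrder

namespace Computation

variable {H : Computation Proc Pkt Que Req (Content Proc Body) Body}

/-- The kinds of triggers at the process `P`. -/
inductive TriggerCase (H : Computation Proc Pkt Que Req Cnt Body) (P : Proc) :
    Evt → Prop
  | dequeue (k : Pkt) (hk : k ∈ H.channel (H.source k) P) : TriggerCase H P (.dequeue k)
  | request (r : Req) : TriggerCase H P (.request r)
  | start (h : H.joinView P = 0) (hh : handle H (.notify 0 P) = protStart (H.view 0) P) :
      TriggerCase H P (.notify 0 P)
  | run (h : 0 < H.joinView P) (hh : handle H (.notify (H.joinView P) P) = protRun P) :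
      TriggerCase H P (.notify (H.joinView P) P)
  | join (J : Proc) (h1 : H.joinView P < H.joinView J) (h2 : (H.joinView J : ℕ∞) < H.deathView P)
      (hv : H.view (H.joinView J) = insert J (H.view (H.joinView J - 1)))
      (hn : H.notice (H.joinView J) P = some (.joined J (H.parent J)))
      (hh : handle H (.notify (H.joinView J) P) = protJoin J (H.parent J)) :
      TriggerCase H P (.notify (H.joinView J) P)
  | remove (R : Proc) (i : ℕ) (h : H.deathView R = i) (h1 : H.joinView P < i)
      (h2 : (i : ℕ∞) < H.deathView P) (hv : H.view i = H.view (i - 1) \ {R})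
      (hn : H.notice i P = some (.removed R))
      (hh : handle H (.notify i P) = protRemove R) : TriggerCase H P (.notify i P)
  | done (i : ℕ) (h : H.deathView P = i) (hh : handle H (.notify i P) = Act.skip) :
      TriggerCase H P (.notify i P)

namespace IsHistory

variable (hH : H.IsHistory)
include hH

lemma triggerCase (he : e ∈ H.eventsAt P) (ht : e.IsTrigger) : TriggerCase H P e := by
  match e, ht with
  | .dequeue k, _ => exact .dequeue k ⟨he.2.1, rfl, he.2.2⟩
  | .request r, _ => exact .request r
  | .notify i P', _ =>
    obtain rfl : P' = P := he.2
    obtain ⟨h1, h2⟩ := hH.notify_range he.1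
    rcases h1.eq_or_lt with h1 | h1
    · subst h1
      have hn := hH.notice_join P'
      rcases Nat.eq_zero_or_pos (H.joinView P') with h0 | h0
      · have := TriggerCase.start (H := H) (P := P') h0 (by simp only [h0] at hn; simp [handle, hn])
        rwa [h0]
      · exact .run h0 (by simp [handle, hn, h0.ne'])
    · rcases h2.eq_or_lt with h2 | h2
      · refine .done i h2.symm ?_
        rcases hH.notice_last h2.symm with h | h <;> simp [handle, h]
      · rcases hH.notice_cases h1 h2 with ⟨J, hJ, hn, hv⟩ | ⟨R, hR, hn, hv⟩
        · subst hJ; exact .join J h1 h2 hv hn (by simp [handle, hn])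
        · exact .remove R i hR h1 h2 hv hn (by simp [handle, hn])

end IsHistory

lemma mem_channel_self (h : k ∈ H.packets) : k ∈ H.channel (H.source k) (H.target k) :=
  ⟨h, rfl, rfl⟩

end Computation

variable {H : Computation Proc Pkt Que Req (Content Proc Body) Body} {X : Execution H} {G : Proc}

local notation "𝔱" k:max => Execution.trigger X (Computation.queuing H k)

local notation "REvt" => Ev (Option Proc) (RPkt Proc Pkt) (RQue Que) Req
local notation "Cln" => Clean Proc Pkt Que Req
local notation "Hʳ" => reduced H X G
local notation "rPkts" => rPackets H X G
local notation "rLbl" => rLabel H X G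
local notation "rTgt" => rTarget H G
local notation "rSrc" => rSource H G
local notation "rEvts" => rEvents H X G
local notation "rDeqs" => rDequeued H X G
local notation "rNtc" => rNotice H G

lemma handle_notify (H : Computation Proc Pkt Que Req Cnt Body) (i : ℕ) (P : Proc) :
    (∃ Q, handle H (.notify i P) = protStart (H.view 0) Q) ∨
    (∃ Q, handle H (.notify i P) = protRun Q) ∨ (∃ J E, handle H (.notify i P) = protJoin J E) ∨
    (∃ R, handle H (.notify i P) = protRemove R) ∨ handle H (.notify i P) = Act.skip := by
  rcases h : H.notice i P with _ | (R | ⟨J, E⟩ | Q | _)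
  · simp [handle, h]
  · exact .inr (.inr (.inr (.inl ⟨R, by simp [handle, h]⟩)))
  · exact .inr (.inr (.inl ⟨J, E, by simp [handle, h]⟩))
  · by_cases h0 : i = 0
    · exact .inl ⟨Q, by subst h0; simp [handle, h]⟩
    · exact .inr (.inl ⟨Q, by simp [handle, h, h0]⟩)
  · exact .inr (.inr (.inr (.inr (by simp [handle, h]))))

lemma handle_before (H : Computation Proc Pkt Que Req Cnt Body) (e : Evt) (s : St) :
    (handle H e s).2.Pairwise Effect.Before := by
  match e with
  | .queue _ => exact List.Pairwise.nil
  | .dequeue k => exact protPacket_before _ _ _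
  | .request r => exact (MainOrdered.of_msg (fun ε h => (protBroadcast_effects _ _ ε h).1)
      (fun ε h => (protBroadcast_effects _ _ ε h).2)).before
  | .notify i P =>
    rcases handle_notify H i P with ⟨Q, h⟩ | ⟨Q, h⟩ | ⟨J, E, h⟩ | ⟨R, h⟩ | h <;> rw [h]
    · exact List.Pairwise.nil
    · rw [protRun_eq]; exact (checkFlush_ordered _).before
    · exact (protJoin_ordered _ _ _).before
    · rw [protRemove_eq]; exact (finishRemove_ordered _ _).before
    · exact List.Pairwise.nil

lemma handle_main (H : Computation Proc Pkt Que Req Cnt Body) (he : ∀ k, e ≠ .dequeue k) (s : St) :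
    ∀ ε ∈ (handle H e s).2, ε.phase = .main := by
  match e with
  | .queue _ => intro ε h; cases h
  | .dequeue k => exact (he k rfl).elim
  | .request r => exact fun ε h => (protBroadcast_effects _ _ ε h).1
  | .notify i P =>
    rcases handle_notify H i P with ⟨Q, h⟩ | ⟨Q, h⟩ | ⟨J, E, h⟩ | ⟨R, h⟩ | h <;> rw [h]
    · intro ε h; cases h
    · rw [protRun_eq]; exact (checkFlush_ordered _).phase
    · exact (protJoin_ordered _ _ _).phase
    · rw [protRemove_eq]; exact (finishRemove_ordered _ _).phase
    · intro ε h; cases h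

namespace Execution

variable (X)

/-- The state after the transaction of the trigger `e`. -/
noncomputable def post (e : Evt) : St := (handle H e (X.pre e)).1

/-- The side effects of the transaction of the trigger `e`. -/
noncomputable def effects (e : Evt) : List Eff := (handle H e (X.pre e)).2

lemma pre_eq (h : H.Consec P e f) : X.pre f = X.post e :=
  X.carry P e h.left f h.right h.left_trigger h.right_trigger h.lt fun g hg hgt hlt =>
    hlt.1.2 (h.le_left g hg hgt hlt.2)

section Queuing

variable {X}
variable (hH : H.IsHistory) {P : Proc} {q q' : Que} (hq : .queue q ∈ H.eventsAt P)
include hq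

lemma trigger_mem : X.trigger q ∈ H.eventsAt P := (X.trigger_last q P hq).1
lemma trigger_isTrigger : (X.trigger q).IsTrigger := (X.trigger_last q P hq).2.1
lemma trigger_lt : H.lt (X.trigger q) (.queue q) := (X.trigger_last q P hq).2.2.1

include hH

lemma lt_queue_iff (hf : f ∈ H.eventsAt P) (ht : f.IsTrigger) :
    H.lt f (.queue q) ↔ H.le f (X.trigger q) :=
  ⟨fun h => (X.trigger_last q P hq).2.2.2 f hf ht h, fun h =>
    hH.lt_of_le_of_lt' hf.1 (trigger_mem hq).1 hq.1 h (trigger_lt hq)⟩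

lemma queue_lt_iff (hf : f ∈ H.eventsAt P) (ht : f.IsTrigger) :
    H.lt (.queue q) f ↔ H.lt (X.trigger q) f := by
  refine ⟨fun h => hH.lt_trans' (trigger_mem hq).1 hq.1 hf.1 (trigger_lt hq) h, fun h => ?_⟩
  rcases hH.trichotomy hq hf with h1 | h1 | h1
  · exact h1
  · subst h1; exact ht.elim
  · exact absurd ((lt_queue_iff hH hq hf ht).1 h1) h.2

lemma eventView_queue : H.eventView (.queue q) = H.eventView (X.trigger q) := by
  have h1 := hH.eventView_mono (trigger_mem (X := X) hq).1 hq.1 (trigger_lt (X := X) hq).1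
  refine le_antisymm ?_ h1
  obtain ⟨h2, h3, -⟩ := hH.eventView_spec hq
  have h4 := (lt_queue_iff (X := X) hH hq (notify_at h2) trivial).1
    (hH.lt_of_ne (notify_at h2) hq h3 (by simp))
  exact hH.le_eventView (trigger_mem (X := X) hq) h2 h4

lemma queue_lt_queue_iff (hq' : .queue q' ∈ H.eventsAt P) :
    H.lt (.queue q) (.queue q') ↔ H.lt (X.trigger q) (X.trigger q') ∨
      (X.trigger q = X.trigger q' ∧ X.position q < X.position q') := by
  have key : ∀ {q q'}, Ev.queue q ∈ H.eventsAt P → Ev.queue q' ∈ H.eventsAt P →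
      H.lt (X.trigger q) (X.trigger q') → H.lt (.queue q) (.queue q') := fun hq hq' h =>
    hH.lt_trans' hq.1 (trigger_mem hq').1 hq'.1
      ((queue_lt_iff hH hq (trigger_mem hq') (trigger_isTrigger hq')).2 h) (trigger_lt hq')
  constructor
  · intro h
    rcases hH.trichotomy (trigger_mem hq) (trigger_mem hq') with h1 | h1 | h1
    · exact .inl h1
    · refine .inr ⟨h1, ?_⟩
      by_contra hc
      rcases (not_lt.1 hc).eq_or_lt with h2 | h2
      · have := X.effect_inj q q' hq.1 hq'.1 h1 h2.symm
        subst this; exact h.2 h.1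
      · exact h.2 (X.effect_order q' q hq'.1 hq.1 h1.symm h2).1
    · exact absurd (key hq' hq h1).1 h.2
  · rintro (h | ⟨h, h'⟩)
    · exact key hq hq' h
    · exact X.effect_order q q' hq.1 hq'.1 h h'

end Queuing

lemma exists_effect (hH : H.IsHistory) (hk : k ∈ H.channel P Q) :
    ∃ ε, (X.effects (𝔱 k))[X.position (H.queuing k)]? = some ε ∧
      ε.content = H.content k ∧ Q ∈ ε.targets := by
  obtain ⟨ε, h1, h2, h3⟩ := X.effect_of (H.queuing k) (hH.packet_queued k hk.1).1
  refine ⟨ε, h1, (h2 k hk.1 rfl).symm, ?_⟩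
  rw [← h3]; exact ⟨k, hk.1, rfl, hk.2.2⟩

lemma queue_mem (hH : H.IsHistory) (hk : k ∈ H.channel P Q) :
    .queue (H.queuing k) ∈ H.eventsAt P := hk.2.1 ▸ hH.packet_queued k hk.1

lemma exists_packet (hH : H.IsHistory) (he : e ∈ H.eventsAt P) (ht : e.IsTrigger)
    (h : (X.effects e)[n]? = some ε) (hQ : Q ∈ ε.targets) :
    ∃ k ∈ H.channel P Q, 𝔱 k = e ∧ X.position (H.queuing k) = n ∧
      H.content k = ε.content := by
  obtain ⟨q, hq, rfl, rfl⟩ := X.effect_occurs e he.1 ht n ε h ⟨Q, hQ⟩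
  obtain ⟨ε', h1, h2, h3⟩ := X.effect_of q hq
  obtain rfl : ε' = ε := Option.some.inj (h1.symm.trans h)
  rw [← h3] at hQ
  obtain ⟨k, hk, rfl, rfl⟩ := hQ
  refine ⟨k, ⟨hk, ?_, rfl⟩, rfl, rfl, h2 k hk rfl⟩
  exact hH.eventsAt_unique (trigger_mem (hH.packet_queued k hk)) he

end Execution

lemma protStart_sound (V : Set Proc) (P : Proc) (s : St) : (protStart V P s).1.Sound := by
  constructor <;> simp [protStart, State.waitSet]

namespace Execution

variable (X)

/-- The trigger `e` at `P` is not the last notification of `P`. -/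
def Live (H : Computation Proc Pkt Que Req Cnt Body) (P : Proc) (e : Evt) : Prop := ∀ i : ℕ, H.deathView P = i → e ≠ .notify i P

lemma live_of_lt (hH : H.IsHistory) (he : e ∈ H.eventsAt P) (hf : f ∈ H.eventsAt P) (h : H.lt e f) :
    Live H P e := by
  rintro i hi rfl; exact h.2 (hH.halt_last P i hi he.1 _ hf)

/-- The invariants of the state after the trigger `e` at the process `P`. -/
structure StateInv (P : Proc) (e : Evt) : Prop where
  sound : (X.post e).Sound
  self_eq : (X.post e).self = P
  height_eq : (X.post e).height = H.eventView e
  live_eq : (X.post e).liveSet = H.view (H.eventView e)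
  contact_self : P ∈ (X.post e).contactSet
  original : H.Original P → (X.post e).liveSet ⊆ (X.post e).contactSet

variable {X}

lemma StateInv.evol {n : Bool} {M : Set Msg} (h : Evol S n M s (X.post e) es) (h1 : s.Sound)
    (h2 : s.self = P) (h3 : s.height = H.eventView e) (h4 : s.liveSet = H.view (H.eventView e))
    (h5 : P ∈ s.contactSet) (h6 : H.Original P → s.liveSet ⊆ s.contactSet) : StateInv X P e where
  sound := h.sound h1
  self_eq := h.self_eq.trans h2
  height_eq := h.height_eq.trans h3
  live_eq := h.live_eq.trans h4
  contact_self := h.contact_mono h5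
  original := fun ho => h.live_eq ▸ (h6 ho).trans h.contact_mono

variable (hH : H.IsHistory)
include hH

lemma stateInv_aux (he : e ∈ H.eventsAt P) (ht : e.IsTrigger) : Live H P e → StateInv X P e := by
  refine hH.global_induction (Φ := fun P e => Live H P e → StateInv X P e) ?_ ?_ ?_ he ht
  · intro P h0 hm _
    have hv := hH.eventView_notify hm
    have hn := hH.notice_join P
    rw [h0] at hn
    have hp : X.post (.notify 0 P) = (protStart (H.view 0) P (X.pre (.notify 0 P))).1 := by
      simp [post, handle, hn]
    have hP : P ∈ H.view 0 := hH.mem_view h0.le (h0 ▸ hH.join_lt_death P)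
    constructor <;> rw [hp]
    · exact protStart_sound _ _ _
    · rfl
    · rw [hv]; rfl
    · rw [hv]; rfl
    · exact hP
    · exact fun _ => subset_rfl
  · intro J e' hJ hm hc hi hl
    have hi := hi (live_of_lt hH hc.left hc.right hc.lt)
    have hs := hc.eventView_succ hH
    have hp : X.post (.notify (H.joinView J) J) = (protRun J (X.post e')).1 := by
      rw [← X.pre_eq hc, ← X.fork J hJ hm, post]; simp [handle, hH.notice_join J, hJ.ne']
    have hv := hH.eventView_notify hm
    have hnew : H.view (H.joinView J) = insert J (H.view (H.eventView e')) := by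
      rcases hH.view_step (i := H.eventView e')
        (by rw [← hs]; exact (hH.join_lt_death J).trans_le (hH.deathView_le J)) with
        ⟨J', h1, h2, h3, -⟩ | ⟨R, -, -, -, h⟩
      · rw [← h3 J hs] at h2; rwa [hs]
      · exact absurd hs (h J)
    refine StateInv.evol (hp ▸ protRun_evol J (X.post e')) (newborn_sound hi.sound) rfl ?_ ?_
      (Set.mem_singleton _) ?_
    · have := hi.height_eq
      rw [hv, hs, ← this]; simp [State.height, newborn, add_assoc]
    · rw [hv, hnew, ← hi.live_eq]; rfl
    · intro ho; exact absurd ho hJ.ne'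
  · intro P e' e hc hi hl
    have hi := hi (live_of_lt hH hc.left hc.right hc.lt)
    have hpre := X.pre_eq hc
    have hpost : X.post e = (handle H e (X.post e')).1 := by rw [← hpre]; rfl
    rcases hH.triggerCase hc.right hc.right_trigger with
      ⟨k, hk⟩ | ⟨r⟩ | ⟨h, hh⟩ | ⟨h, hh⟩ | ⟨J, h1, h2, hv, hn, hh⟩ | ⟨R, i, h, h1, h2, hv, hn, hh⟩ |
      ⟨i, h, hh⟩
    · have hv := hc.eventView_eq hH (by simp)
      exact StateInv.evol (hpost ▸ protPacket_evol (H.content k) (H.source k) (X.post e'))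
        hi.sound hi.self_eq (hv ▸ hi.height_eq) (hv ▸ hi.live_eq) hi.contact_self hi.original
    · have hv := hc.eventView_eq hH (by simp)
      exact StateInv.evol (hpost ▸ protBroadcast_evol P ∅ (H.body r) (X.post e'))
        hi.sound hi.self_eq (hv ▸ hi.height_eq) (hv ▸ hi.live_eq) hi.contact_self hi.original
    · exact absurd (hc.joinView_lt hH) (by omega)
    · exact absurd (hc.joinView_lt hH) (lt_irrefl _)
    · have hs := hc.eventView_succ hH
      have hw := hH.eventView_notify hc.right.1
      rw [hh] at hpost
      refine StateInv.evol (hpost ▸ protJoin_evol J (H.parent J) (X.post e'))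
        (beforeDonate_sound hi.sound) hi.self_eq ?_ ?_ (.inr hi.contact_self) ?_
      · rw [hw, hs, ← hi.height_eq]; simp [State.height, beforeDonate, add_assoc]
      · rw [hw, hv, hs, Nat.add_sub_cancel, ← hi.live_eq]; rfl
      · exact fun ho => Set.insert_subset_insert (hi.original ho)
    · have hs := hc.eventView_succ hH
      have hw := hH.eventView_notify hc.right.1
      have hRP : P ≠ R := by rintro rfl; exact h2.ne h.symm
      rw [hh] at hpost
      refine StateInv.evol (hpost ▸ protRemove_evol R hi.sound)
        (beforeForward_sound hi.sound) hi.self_eq ?_ ?_ ⟨hi.contact_self, hRP⟩ ?_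
      · rw [hw, hs, ← hi.height_eq]; simp [State.height, beforeForward, add_assoc]
      · rw [hw, hv, hs, Nat.add_sub_cancel, ← hi.live_eq]; rfl
      · exact fun ho => Set.sdiff_subset_sdiff_left (hi.original ho)
    · exact absurd rfl (hl i h)

lemma stateInv (he : e ∈ H.eventsAt P) (ht : e.IsTrigger) (hl : Live H P e) : StateInv X P e :=
  stateInv_aux hH he ht hl

lemma effects_done (he : e ∈ H.eventsAt P) (hl : ¬ Live H P e) : X.effects e = [] := by
  simp only [Live, not_forall, ne_eq, not_not] at hl
  obtain ⟨i, hi, rfl⟩ := hl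
  rcases hH.notice_last hi with h | h <;> simp [effects, handle, h, Act.skip]

lemma live_of_effect (he : e ∈ H.eventsAt P) (h : ε ∈ X.effects e) : Live H P e := by
  by_contra hl
  rw [effects_done hH he hl] at h; cases h

lemma live_trigger (hq : .queue q ∈ H.eventsAt P) :
    Live H P (X.trigger q) := live_of_lt hH (trigger_mem hq) hq (trigger_lt hq)

lemma exists_pre (he : e ∈ H.eventsAt P) (ht : e.IsTrigger) (hne : e ≠ .notify (H.joinView P) P) :
    ∃ e', H.Consec P e' e ∧ X.pre e = X.post e' ∧ StateInv X P e' := by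
  obtain ⟨e', h⟩ := hH.exists_consec he ht hne
  exact ⟨e', h, X.pre_eq h, stateInv hH h.left h.left_trigger (live_of_lt hH h.left h.right h.lt)⟩

/-- An invariant of the states that follow a trigger is a consequence of its preservation by the
steps of the protocol. -/
lemma state_induction {Φ : Proc → Evt → Prop} (orig : ∀ P, H.joinView P = 0 → .notify 0 P ∈ H.events →
      X.post (.notify 0 P) = (protStart (H.view 0) P (X.pre (.notify 0 P))).1 → Φ P (.notify 0 P)) (fork : ∀ J e', 0 < H.joinView J → .notify (H.joinView J) J ∈ H.events →
      H.Consec (H.parent J) e' (.notify (H.joinView J) (H.parent J)) →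
      StateInv X (H.parent J) e' → X.post (.notify (H.joinView J) J) = (protRun J (X.post e')).1 →
      Φ (H.parent J) e' → Φ J (.notify (H.joinView J) J)) (dequeue : ∀ P e' k, H.Consec P e' (.dequeue k) → k ∈ H.channel (H.source k) P →
      StateInv X P e' →
      X.post (.dequeue k) = (protPacket (H.content k) (H.source k) (X.post e')).1 →
      X.effects (.dequeue k) = (protPacket (H.content k) (H.source k) (X.post e')).2 →
      Φ P e' → Φ P (.dequeue k)) (request : ∀ P e' r, H.Consec P e' (.request r) → StateInv X P e' →
      X.post (.request r) = (protBroadcast (H.body r) (X.post e')).1 → Φ P e' → Φ P (.request r)) (join : ∀ P e' J, H.Consec P e' (.notify (H.joinView J) P) → H.joinView P < H.joinView J →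
      (H.joinView J : ℕ∞) < H.deathView P → StateInv X P e' →
      X.post (.notify (H.joinView J) P) = (protJoin J (H.parent J) (X.post e')).1 → Φ P e' →
      Φ P (.notify (H.joinView J) P)) (remove : ∀ P e' R i, H.Consec P e' (.notify i P) → H.joinView P < i →
      (i : ℕ∞) < H.deathView P → H.deathView R = i → StateInv X P e' →
      X.post (.notify i P) = (protRemove R (X.post e')).1 → Φ P e' → Φ P (.notify i P)) (he : e ∈ H.eventsAt P) (ht : e.IsTrigger) (hl : Live H P e) : Φ P e := by
  refine hH.global_induction (Φ := fun P e => Live H P e → Φ P e) ?_ ?_ ?_ he ht hl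
  · intro P h0 hm _
    have hn := hH.notice_join P
    rw [h0] at hn; exact orig P h0 hm (by simp [post, handle, hn])
  · intro J e' hJ hm hc hi _
    have hl := live_of_lt hH hc.left hc.right hc.lt
    refine fork J e' hJ hm hc (stateInv hH hc.left hc.left_trigger hl) ?_ (hi hl)
    rw [← X.pre_eq hc, ← X.fork J hJ hm, post]; simp [handle, hH.notice_join J, hJ.ne']
  · intro P e' e hc hi hl
    have hl' := live_of_lt hH hc.left hc.right hc.lt
    have hs : StateInv X P e' := stateInv hH hc.left hc.left_trigger hl'
    have hpre := X.pre_eq hc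
    have hpost : X.post e = (handle H e (X.post e')).1 := by rw [← hpre]; rfl
    have heff : X.effects e = (handle H e (X.post e')).2 := by rw [← hpre]; rfl
    rcases hH.triggerCase hc.right hc.right_trigger with
      ⟨k, hk⟩ | ⟨r⟩ | ⟨h, hh⟩ | ⟨h, hh⟩ | ⟨J, h1, h2, hv, hn, hh⟩ | ⟨R, i, h, h1, h2, hv, hn, hh⟩ |
      ⟨i, h, hh⟩
    · exact dequeue P e' k hc hk hs hpost heff (hi hl')
    · exact request P e' r hc hs hpost (hi hl')
    · exact absurd (hc.joinView_lt hH) (by omega)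
    · exact absurd (hc.joinView_lt hH) (lt_irrefl _)
    · exact join P e' J hc h1 h2 hs (by rw [hpost, hh]) (hi hl')
    · exact remove P e' R i hc h1 h2 h hs (by rw [hpost, hh]) (hi hl')
    · exact absurd rfl (hl i h)

end Execution

section Vectors

/-- The entry of the ghost vector that the receipt of a packet sets. -/
def Content.ghostOf : Cnt → Option ℕ
  | .ghost v => some v
  | .donation d => some d.ghostHeight
  | .codonation d => some d.ghostHeight
  | _ => none

/-- The entry of the flush vector that the receipt of a packet sets. -/
def Content.flushOf : Cnt → Option ℕ
  | .flush v => some v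
  | .donation d => some d.flushHeight
  | .codonation d => some d.flushHeight
  | _ => none

/-- The ghost and flush vectors of two states agree. -/
def SameVectors (s s' : St) : Prop := s'.ghost = s.ghost ∧ s'.flush = s.flush

lemma SameVectors.trans {s'' : St} (h : SameVectors s s') (h' : SameVectors s' s'') :
    SameVectors s s'' := ⟨h'.1.trans h.1, h'.2.trans h.2⟩

lemma checkFlush_vectors (s : St) : SameVectors s (checkFlush s).1 := by
  obtain ⟨g, f, es, h, -⟩ := checkFlush_cases s
  rw [h]; exact ⟨rfl, rfl⟩

lemma forEach_vectors {α : Type*} {p : α → Act Proc Body} (h : ∀ x s, SameVectors s (p x s).1)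
    (l : List α) (s : St) :
    SameVectors s (Act.forEach p l s).1 := by
  induction l generalizing s with
  | nil => exact ⟨rfl, rfl⟩
  | cons x l ih => exact (h x s).trans (ih _)

lemma protBroadcast_vectors (x : Body) (s : St) : SameVectors s (protBroadcast x s).1 := by
  unfold protBroadcast; split <;> exact ⟨rfl, rfl⟩

lemma tryToInstall_vectors (s : St) : SameVectors s (tryToInstall s).1 := by
  unfold tryToInstall
  split
  · exact ⟨rfl, rfl⟩
  · obtain ⟨v, l, q, p, ms, h, -⟩ := install_frame s.vGap s le_rfl
    simp only [h]
    exact SameVectors.trans (s' := { s with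
      vt := v, receiveSet := l, fwdQueue := q, pendViewQueue := p, mset := ms,
      curView := s.curView + s.vGap, vGap := s.vGap - s.vGap, launchQueue := [] })
      ⟨rfl, rfl⟩ (forEach_vectors protBroadcast_vectors _ _)

lemma receiveMessage_vectors (m : Msg) (S : Proc) (s : St) :
    SameVectors s (receiveMessage m S s).1 := by
  unfold receiveMessage
  refine SameVectors.trans (s' := (Act.seq (Act.emit (.ack m) {S}) (Act.modify fun s => { s with
          mpktIn := Function.update s.mpktIn S ((s.mpktIn S).map fun c =>
            if m.orig = S then { c with b := c.b + 1 } else { c with f := c.f + 1 }) }) s).1)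
    ⟨rfl, rfl⟩ ?_
  simp only [Act.seq]
  generalize (Act.modify _ _ : St × List Eff).1 = s1
  unfold Act.modify
  dsimp only
  split_ifs
  · exact ⟨rfl, rfl⟩
  · exact ⟨rfl, rfl⟩
  · exact ⟨rfl, rfl⟩
  · generalize hs2 : ({ s1 with receiveSet := _, fwdQueue := _ } : St) = s2
    obtain ⟨v, l, h⟩ := scan_frame s2
    rw [h, ← hs2]; exact ⟨rfl, rfl⟩

lemma receiveAck_vectors (m : Msg) (S : Proc) (s : St) : SameVectors s (receiveAck m S s).1 := by
  rcases receiveAck_eq m S s with h | h <;> rw [h]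
  · exact SameVectors.trans (s' := afterAck m S s) ⟨rfl, rfl⟩ (checkFlush_vectors _)
  · exact ⟨rfl, rfl⟩

lemma processRecords_vectors (d : Dnt) (S : Proc) (n : ℕ) (l : List (Bool × Rec)) (s : St) :
    SameVectors s (processRecords d S n l s).1 := by
  induction l generalizing n s with
  | nil => exact ⟨rfl, rfl⟩
  | cons x l ih =>
    obtain ⟨b, r⟩ := x
    cases b <;> simp only [processRecords] <;> split
    · exact (receiveMessage_vectors _ _ _).trans (ih _ _)
    · exact ih _ _
    · exact (receiveAck_vectors _ _ _).trans (ih _ _)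
    · exact ih _ _

lemma processDonation_vectors (d : Dnt) (S : Proc) (s : St) :
    (processDonation d S s).1.ghost = Function.update s.ghost S (some d.ghostHeight) ∧
    (processDonation d S s).1.flush = Function.update s.flush S (some d.flushHeight) := by
  unfold processDonation
  simp only [Act.seq, Act.modify]
  exact ⟨congrArg (fun g => Function.update g S _) (processRecords_vectors d S 0 _ s).1,
    congrArg (fun g => Function.update g S _) (processRecords_vectors d S 0 _ s).2⟩

lemma protPacket_vectors (c : Cnt) (S : Proc) (s : St) : (protPacket c S s).1.ghost =
      (c.ghostOf).elim s.ghost (fun v => Function.update s.ghost S (some v)) ∧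
    (protPacket c S s).1.flush =
      (c.flushOf).elim s.flush (fun v => Function.update s.flush S (some v)) := by
  cases c with
  | msg m => exact receiveMessage_vectors m S s
  | ack m => exact receiveAck_vectors m S s
  | ghost v => exact ⟨rfl, rfl⟩
  | flush v =>
    exact SameVectors.trans (s := { s with flush := Function.update s.flush S (some v) })
      ⟨rfl, rfl⟩ (tryToInstall_vectors _)
  | donation d => exact processDonation_vectors d S _
  | codonation d =>
    obtain ⟨h1, h2⟩ := processDonation_vectors d S s
    obtain ⟨h3, h4⟩ := tryToInstall_vectors (processDonation d S s).1
    exact ⟨h3.trans h1, h4.trans h2⟩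

lemma finishRemove_rank (R : Proc) (s : St) : ∀ ε ∈ (finishRemove R s).2, 4 ≤ ε.content.rank := by
  intro ε hε
  simp only [finishRemove, Act.seq, Act.modify, List.nil_append, List.mem_append] at hε
  rcases hε with h | h
  · refine forEach_mem (Q := fun ε => 4 ≤ ε.content.rank) ?_ _ _ ε h
    intro m s ε h
    simp only [forward, List.mem_singleton] at h
    subst h; simp [Content.rank]
  · exact checkFlush_ack_lt _ ε h

lemma forEach_forward_vectors (l : List Msg) (s : St) :
    SameVectors s (Act.forEach forward l s).1 := forEach_vectors (fun _ _ => ⟨rfl, rfl⟩) l s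

lemma finishRemove_vectors (R : Proc) (s : St) :
    (finishRemove R s).1.ghost = Function.update s.ghost R none ∧
    (finishRemove R s).1.flush = Function.update s.flush R none := by
  simp only [finishRemove, Act.seq, Act.modify]
  obtain ⟨h1, h2⟩ := forEach_forward_vectors ((s.fwdQueue R).getD []) s
  generalize hs : State.mk _ _ _ _ _ _ _ _ _ _ _ _ _ _ _ _ _ _ _ = s'
  obtain ⟨h3, h4⟩ := checkFlush_vectors s'
  rw [h3, h4, ← hs]; exact ⟨by rw [h1], by rw [h2]⟩

lemma protJoin_vectors (J E : Proc) (s : St) :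
    (protJoin J E s).1.ghost = Function.update s.ghost J (s.ghost E) ∧
    (protJoin J E s).1.flush = Function.update s.flush J (s.ghost E) := by
  rw [protJoin_eq]; exact checkFlush_vectors (beforeDonate J E s)

lemma protRun_vectors (J : Proc) (s : St) :
    (protRun J s).1.ghost = Function.update s.ghost J (some s.ghostHeight) ∧
    (protRun J s).1.flush = Function.update s.flush J (some s.ghostHeight) := by
  rw [protRun_eq]; exact checkFlush_vectors (newborn J s)

end Vectors

lemma Content.rank_codonation (h : c.IsCoDonation) :
    c.rank = 1 := by cases c <;> first | exact h.elim | rfl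

lemma Content.rank_donation (h : c.IsDonation) :
    c.rank = 2 := by cases c <;> first | exact h.elim | rfl

namespace Execution

lemma effects_joined (hh : handle H (.notify (H.joinView J) P) = protJoin J (H.parent J)) :
    X.effects (.notify (H.joinView J) P) =
      ⟨.donation (beforeDonate J (H.parent J) (X.pre (.notify (H.joinView J) P))).donated, {J}, .main⟩ ::
        (checkFlush (beforeDonate J (H.parent J) (X.pre (.notify (H.joinView J) P)))).2 := by
  rw [effects, hh, protJoin_eq]

lemma effects_received (hc : H.content k = .donation d) : X.effects (.dequeue k) =
      ⟨.codonation (X.pre (.dequeue k)).donated, {H.source k}, .main⟩ ::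
        (processDonation d (H.source k) { X.pre (.dequeue k) with
          contactSet := insert (H.source k) (X.pre (.dequeue k)).contactSet }).2 := by
  simp only [effects, handle, hc]; rfl

variable (hH : H.IsHistory)
include hH

lemma donation_cases (he : e ∈ H.eventsAt P) (ht : e.IsTrigger) (h : (X.effects e)[n]? = some ε) :
    3 ≤ ε.content.rank ∨ (∃ J, e = .notify (H.joinView J) P ∧ H.joinView P < H.joinView J ∧
      (H.joinView J : ℕ∞) < H.deathView P ∧ n = 0 ∧
      ε = ⟨.donation (beforeDonate J (H.parent J) (X.pre e)).donated, {J}, .main⟩) ∨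
    (∃ k d, e = .dequeue k ∧ k ∈ H.channel (H.source k) P ∧ H.content k = .donation d ∧ n = 0 ∧
      ε = ⟨.codonation (X.pre e).donated, {H.source k}, .main⟩) := by
  have hε : ε ∈ X.effects e := List.mem_of_getElem? h
  rcases hH.triggerCase he ht with
    ⟨k, hk⟩ | ⟨r⟩ | ⟨h0, hh⟩ | ⟨h0, hh⟩ | ⟨J, h1, h2, hv, hn, hh⟩ | ⟨R, i, h0, h1, h2, hv, hn, hh⟩ |
    ⟨i, h0, hh⟩
  · by_cases hd : ∃ d, H.content k = .donation d
    · obtain ⟨d, hd⟩ := hd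
      rw [effects_received hd] at h
      cases n with
      | zero => exact .inr (.inr ⟨k, d, rfl, hk, hd, rfl, by simpa using h.symm⟩)
      | succ n =>
        obtain ⟨h1, -⟩ := (processDonation_effects _ _ _).2 ε (List.mem_of_getElem? (by simpa using h))
        exact .inl h1.1
    · left
      rcases hph : ε.phase with _ | m | _
      · rcases protPacket_main hε hph with ⟨m, -, -, rfl⟩ | ⟨m, -, h | h⟩ | ⟨v, -, h⟩ | ⟨d, hd', -⟩
        · simp [Content.rank]
        · cases hc : ε.content <;> simp_all [Content.IsGhost, Content.rank]
        · cases hc : ε.content <;> simp_all [Content.IsFlush, Content.rank]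
        · cases hc : ε.content <;> simp_all [Content.IsMsg, Content.rank]
        · exact absurd ⟨d, hd'⟩ hd
      · exact (protPacket_sub hε hph).1.1
      · have h := (protPacket_install hε hph).1
        cases hc : ε.content <;> simp_all [Content.IsMsg, Content.rank]
  · have := (protBroadcast_effects _ _ ε hε).2
    cases hc : ε.content <;> simp_all [Content.IsMsg, Content.rank]
  · rw [effects, hh] at hε; cases hε
  · rw [effects, hh] at hε
    have := checkFlush_ack_lt _ ε hε
    left; omega
  · rw [effects_joined hh] at h
    cases n with
    | zero => exact .inr (.inl ⟨J, rfl, h1, h2, rfl, by simpa using h.symm⟩)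
    | succ n =>
      have := checkFlush_ack_lt _ ε (List.mem_of_getElem? (by simpa using h))
      left; omega
  · rw [effects, hh, protRemove_eq] at hε
    have := finishRemove_rank _ _ ε hε
    left; omega
  · rw [effects, hh] at hε; cases hε

lemma height_pre (he : .dequeue k ∈ H.eventsAt P) :
    (X.pre (.dequeue k)).Sound ∧ (X.pre (.dequeue k)).self = P ∧
    (X.pre (.dequeue k)).height = H.eventView (.dequeue k) ∧
    (X.pre (.dequeue k)).liveSet = H.view (H.eventView (.dequeue k)) := by
  obtain ⟨e', hc, hp, hi⟩ := exists_pre hH he trivial (by simp)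
  have := hc.eventView_eq hH (by simp)
  exact ⟨hp ▸ hi.sound, hp ▸ hi.self_eq, by rw [hp, hi.height_eq, this], by rw [hp, hi.live_eq, this]⟩

lemma effects_ok (he : e ∈ H.eventsAt P) (ht : e.IsTrigger) (hε : ε ∈ X.effects e) :
    ∃ S n M s, Evol S n M s (X.post e) (X.effects e) := by
  have hl := live_of_effect hH he hε
  rcases hH.triggerCase he ht with
    ⟨k, hk⟩ | ⟨r⟩ | ⟨h0, hh⟩ | ⟨h0, hh⟩ | ⟨J, h1, h2, hv, hn, hh⟩ | ⟨R, i, h0, h1, h2, hv, hn, hh⟩ |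
    ⟨i, h0, hh⟩
  · exact ⟨_, _, _, _, protPacket_evol (H.content k) (H.source k) (X.pre _)⟩
  · exact ⟨_, _, _, _, protBroadcast_evol P ∅ (H.body r) (X.pre _)⟩
  · rw [effects, hh] at hε; cases hε
  · refine ⟨P, true, ∅, newborn P (X.pre (.notify (H.joinView P) P)), ?_⟩
    rw [post, effects, hh]; exact protRun_evol _ _
  · refine ⟨J, true, ∅, beforeDonate J (H.parent J) (X.pre (.notify (H.joinView J) P)), ?_⟩
    rw [post, effects, hh]; exact protJoin_evol _ _ _
  · obtain ⟨e', hc, hp, hi⟩ := exists_pre hH he trivial (by intro h; cases h; exact lt_irrefl _ h1)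
    refine ⟨R, true, ∅, beforeForward R (X.pre (.notify i P)), ?_⟩
    rw [post, effects, hh]; exact protRemove_evol R (hp ▸ hi.sound)
  · exact absurd rfl (hl i h0)

lemma content_le (he : e ∈ H.eventsAt P) (ht : e.IsTrigger) (hε : ε ∈ X.effects e) {v : ℕ}
    (h : ε.content.ghostOf = some v ∨ ε.content.flushOf = some v) : v ≤ H.eventView e := by
  have hi : StateInv X P e := stateInv hH he ht (live_of_effect hH he hε)
  obtain ⟨n, hn⟩ := List.getElem?_of_mem hε
  rcases donation_cases hH he ht hn with h' | ⟨J, rfl, h1, h2, -, rfl⟩ | ⟨k, d, rfl, hk, hd, -, rfl⟩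
  · obtain ⟨S, n, M, s, hE⟩ := effects_ok hH he ht hε
    have h2 := (hE.eff ε hε).2
    have := hi.sound.ghost_le
    have := hi.sound.flush_le
    have := hi.height_eq
    cases hc : ε.content <;> simp_all [Content.ghostOf, Content.flushOf, Content.rank]
    · omega
    · omega
  · obtain ⟨e', hc, hp, hi'⟩ := exists_pre (X := X) hH he trivial (by
      intro h; injection h with h; omega)
    have hs := beforeDonate_sound (J := J) (E := H.parent J) (hp ▸ hi'.sound)
    have hh : (beforeDonate J (H.parent J) (X.pre (.notify (H.joinView J) P))).height
        = H.eventView (.notify (H.joinView J) P) := by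
      have a := hi'.height_eq
      have b := hc.eventView_succ hH
      rw [← hp] at a
      rw [hH.eventView_notify he.1]
      simp only [beforeDonate, State.height] at *; omega
    have h3 := hs.ghost_le
    have h4 := hs.flush_le
    rw [hh] at h3 h4
    rcases h with h | h <;> obtain rfl := Option.some.inj h <;> assumption
  · obtain ⟨h1, -, h2, -⟩ := height_pre (X := X) hH he
    rcases h with h | h <;> obtain rfl := Option.some.inj h
    · exact h1.ghost_le.trans h2.le
    · exact h1.flush_le.trans h2.le

lemma packet_le (hk : k ∈ H.channel P Q) {v : ℕ}
    (h : (H.content k).ghostOf = some v ∨ (H.content k).flushOf = some v) :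
    v ≤ H.eventView (𝔱 k) := by
  obtain ⟨ε, h1, h2, -⟩ := X.exists_effect hH hk
  have hq := queue_mem hH hk
  exact content_le hH (trigger_mem hq) (trigger_isTrigger hq) (List.mem_of_getElem? h1) (h2 ▸ h)

lemma trigger_view_le (hk : k ∈ H.channel P Q) (hd : .dequeue k ∈ H.events) :
    H.eventView (𝔱 k) ≤ H.eventView (.dequeue k) := by
  have hq := queue_mem hH hk
  exact hH.eventView_mono (trigger_mem hq).1 hd
    (hH.le_trans _ (trigger_mem hq).1 _ hq.1 _ hd (trigger_lt hq).1 (hH.packet_dequeued k hd).2.1)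

lemma vectors_le (he : e ∈ H.eventsAt P) (ht : e.IsTrigger) (hl : Live H P e) :
    (∀ Q, ((X.post e).ghost Q).getD 0 ≤ H.eventView e) ∧
    (∀ Q, ((X.post e).flush Q).getD 0 ≤ H.eventView e) := by
  have hupd : ∀ (g : Proc → Option ℕ) (J : Proc) (x : Option ℕ) (n : ℕ),
      (∀ Q, (g Q).getD 0 ≤ n) → x.getD 0 ≤ n → ∀ Q, (Function.update g J x Q).getD 0 ≤ n := by
    intro g J x n h1 h2 Q
    by_cases h : Q = J
    · subst h; simpa using h2
    · simpa [h] using h1 Q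
  refine state_induction (X := X) hH (Φ := fun P e => (∀ Q, ((X.post e).ghost Q).getD 0 ≤ H.eventView e) ∧
    (∀ Q, ((X.post e).flush Q).getD 0 ≤ H.eventView e)) ?_ ?_ ?_ ?_ ?_ ?_ he ht hl
  · intro P _ _ hp
    rw [hp]
    constructor <;> intro Q <;> simp only [protStart] <;> split <;> simp
  · intro J e' hJ hm hc hi hp ih
    have hs := hc.eventView_succ hH
    rw [hp, (protRun_vectors J _).1, (protRun_vectors J _).2, hH.eventView_notify hm, hs]
    have hg := hi.sound.ghost_le.trans hi.height_eq.le
    exact ⟨hupd _ _ _ _ (fun Q => (ih.1 Q).trans (by omega)) (by simpa using hg.trans (by omega)),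
      hupd _ _ _ _ (fun Q => (ih.2 Q).trans (by omega)) (by simpa using hg.trans (by omega))⟩
  · intro P e' k hc hk hi hp _ ih
    have hv := hc.eventView_eq hH (by simp)
    rw [hp, (protPacket_vectors _ _ _).1, (protPacket_vectors _ _ _).2]
    have hle : ∀ v, ((H.content k).ghostOf = some v ∨ (H.content k).flushOf = some v) →
        v ≤ H.eventView (.dequeue k) := fun v h =>
      (packet_le (X := X) hH hk h).trans (trigger_view_le hH hk hc.right.1)
    rw [← hv] at ih
    constructor
    · rcases h : (H.content k).ghostOf with _ | v
      · exact ih.1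
      · exact hupd _ _ _ _ ih.1 (hle v (.inl h))
    · rcases h : (H.content k).flushOf with _ | v
      · exact ih.2
      · exact hupd _ _ _ _ ih.2 (hle v (.inr h))
  · intro P e' r hc hi hp ih
    obtain ⟨h1, h2⟩ := protBroadcast_vectors (H.body r) (X.post e')
    rw [hp, h1, h2, hc.eventView_eq hH (by simp)]
    exact ih
  · intro P e' J hc _ _ hi hp ih
    rw [hp, (protJoin_vectors _ _ _).1, (protJoin_vectors _ _ _).2,
      hH.eventView_notify hc.right.1, hc.eventView_succ hH]
    exact ⟨hupd _ _ _ _ (fun Q => (ih.1 Q).trans (by omega)) ((ih.1 _).trans (by omega)),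
      hupd _ _ _ _ (fun Q => (ih.2 Q).trans (by omega)) ((ih.1 _).trans (by omega))⟩
  · intro P e' R i hc _ _ _ hi hp ih
    rw [hp, protRemove_eq, (finishRemove_vectors _ _).1, (finishRemove_vectors _ _).2,
      hH.eventView_notify hc.right.1, hc.eventView_succ hH]
    exact ⟨hupd _ _ _ _ (fun Q => (ih.1 Q).trans (by omega)) (by simp),
      hupd _ _ _ _ (fun Q => (ih.2 Q).trans (by omega)) (by simp)⟩

end Execution

lemma finishRemove_contactSet (R : Proc) (s : St) :
    (finishRemove R s).1.contactSet = s.contactSet := by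
  have h : ∀ (l : List Msg) (s : St), (Act.forEach forward l s).1.contactSet = s.contactSet := by
    intro l
    induction l with
    | nil => exact fun s => rfl
    | cons m l ih => exact fun s => ih _
  simp only [finishRemove, Act.seq, Act.modify]
  generalize hs : State.mk _ _ _ _ _ _ _ _ _ _ _ _ _ _ _ _ _ _ _ = s'
  obtain ⟨g, f, es, h', -⟩ := checkFlush_cases s'
  rw [h', ← hs]; exact h _ _

namespace Execution

variable (hH : H.IsHistory)
include hH

lemma donation_packet (hk : k ∈ H.channel P Q) (hc : (H.content k).IsDonation) :
    𝔱 k = .notify (H.joinView Q) P ∧ X.position (H.queuing k) = 0 ∧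
    H.joinView P < H.joinView Q ∧ (H.joinView Q : ℕ∞) < H.deathView P ∧
    H.content k = .donation (beforeDonate Q (H.parent Q)
      (X.pre (.notify (H.joinView Q) P))).donated := by
  obtain ⟨ε, h1, h2, h3⟩ := X.exists_effect hH hk
  have hq := queue_mem hH hk
  have hr := Content.rank_donation hc
  rcases donation_cases hH (trigger_mem hq) (trigger_isTrigger hq) h1 with
    h | ⟨J, h4, h5, h6, h7, rfl⟩ | ⟨k', d, h4, h5, h6, h7, rfl⟩
  · rw [h2] at h; omega
  · obtain rfl : Q = J := h3
    exact ⟨h4, h7, h5, h6, by rw [← h2, h4]⟩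
  · rw [← h2] at hr; simp [Content.rank] at hr

lemma codonation_packet (hk : k ∈ H.channel S P) (hc : (H.content k).IsCoDonation) :
    ∃ k₀ ∈ H.channel P S, (H.content k₀).IsDonation ∧ 𝔱 k = .dequeue k₀ ∧
      .dequeue k₀ ∈ H.events ∧ X.position (H.queuing k) = 0 ∧
      H.content k = .codonation (X.pre (.dequeue k₀)).donated := by
  obtain ⟨ε, h1, h2, h3⟩ := X.exists_effect hH hk
  have hq := queue_mem hH hk
  have hr := Content.rank_codonation hc
  rcases donation_cases hH (trigger_mem hq) (trigger_isTrigger hq) h1 with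
    h | ⟨J, h4, h5, h6, h7, rfl⟩ | ⟨k', d, h4, h5, h6, h7, rfl⟩
  · rw [h2] at h; omega
  · rw [← h2] at hr; simp [Content.rank] at hr
  · obtain rfl : P = H.source k' := h3
    exact ⟨k', h5, by rw [h6]; trivial, h4, h4 ▸ (trigger_mem hq).1, h7, by rw [← h2, h4]⟩

lemma packet_eq_of_queuing {k' : Pkt} (hk : k ∈ H.channel P Q) (hk' : k' ∈ H.channel P Q)
    (h1 : 𝔱 k = 𝔱 k') (h2 : X.position (H.queuing k) = X.position (H.queuing k')) : k = k' :=
  hH.multicast_target k hk.1 k' hk'.1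
    (X.effect_inj _ _ (queue_mem hH hk).1 (queue_mem hH hk').1 h1 h2) (hk.2.2.trans hk'.2.2.symm)

include X in
lemma donation_unique {k' : Pkt} (hk : k ∈ H.channel P Q) (hk' : k' ∈ H.channel P Q)
    (hc : (H.content k).IsDonation) (hc' : (H.content k').IsDonation) :
    k = k' := by
  obtain ⟨h1, h2, -⟩ := donation_packet (X := X) hH hk hc
  obtain ⟨h1', h2', -⟩ := donation_packet (X := X) hH hk' hc'
  exact packet_eq_of_queuing hH hk hk' (h1.trans h1'.symm) (h2.trans h2'.symm)

include X in
lemma codonation_unique {k' : Pkt} (hk : k ∈ H.channel P Q) (hk' : k' ∈ H.channel P Q)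
    (hc : (H.content k).IsCoDonation) (hc' : (H.content k').IsCoDonation) : k = k' := by
  obtain ⟨d, hd, h0, h1, -, h2, -⟩ := codonation_packet (X := X) hH hk hc
  obtain ⟨d', hd', h0', h1', -, h2', -⟩ := codonation_packet (X := X) hH hk' hc'
  obtain rfl := donation_unique (X := X) hH hd hd' h0 h0'
  exact packet_eq_of_queuing hH hk hk' (h1.trans h1'.symm) (h2.trans h2'.symm)

lemma handle_join (h1 : H.joinView P < H.joinView J) (h2 : (H.joinView J : ℕ∞) < H.deathView P) :
    handle H (.notify (H.joinView J) P) = protJoin J (H.parent J) := by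
  simp [handle, hH.notice_joined _ P J h1 h2 rfl]

lemma donation_first (hk : k ∈ H.channel P S) (hj : H.joinView P < H.joinView S)
    (hd : .dequeue k ∈ H.events) :
    ∃ k₀ ∈ H.channel P S, (H.content k₀).IsDonation ∧
      𝔱 k₀ = .notify (H.joinView S) P ∧
      .dequeue k₀ ∈ H.events ∧ H.le (.dequeue k₀) (.dequeue k) := by
  have hq := queue_mem hH hk
  have h1 : (.notify (H.joinView S) P : Evt) ∈ H.events ∧
      H.lt (.notify (H.joinView S) P) (.queue (H.queuing k)) := by
    refine (hH.liveness_join P S k hk).resolve_left fun h => ?_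
    exact absurd ((hH.mem_view_iff ((hH.join_lt_death P).trans_le (hH.deathView_le P)) S).1 h).1
      (by omega)
  have hm := notify_at h1.1
  have h2 : (H.joinView S : ℕ∞) < H.deathView P := by
    refine lt_of_le_of_ne (hH.notify_range h1.1).2 fun h => h1.2.2 (hH.halt_last P _ h.symm h1.1 _ hq)
  have heff := effects_joined (X := X) (handle_join hH hj h2)
  obtain ⟨k₀, hk₀, h3, h4, h5⟩ := X.exists_packet hH (Q := S) hm trivial (n := 0) (by rw [heff]; rfl)
    (Set.mem_singleton _)
  refine ⟨k₀, hk₀, by rw [h5]; trivial, h3, ?_⟩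
  by_cases he : k₀ = k
  · subst he; exact ⟨hd, hH.le_refl _ hd⟩
  · have hq₀ := queue_mem hH hk₀
    have hle := (lt_queue_iff hH hq hm trivial (X := X)).1 h1.2
    have hlt : H.lt (.queue (H.queuing k₀)) (.queue (H.queuing k)) := by
      rw [queue_lt_queue_iff (X := X) hH hq₀ hq, h3, h4]
      by_cases h6 : 𝔱 k = .notify (H.joinView S) P
      · refine .inr ⟨h6.symm, Nat.pos_of_ne_zero fun h7 => he ?_⟩
        exact packet_eq_of_queuing hH hk₀ hk (h3.trans h6.symm) (h4.trans h7.symm)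
      · exact .inl (hH.lt_of_ne hm (trigger_mem hq) hle (Ne.symm h6))
    obtain ⟨h8, h9⟩ := hH.packet_order P S k₀ hk₀ k hk hlt hd
    exact ⟨h8, h9.1⟩

lemma contact_cases (he : e ∈ H.eventsAt S) (ht : e.IsTrigger) (hl : Live H S e) :
    ∀ Q ∈ (X.post e).contactSet, H.joinView S ≤ H.joinView Q ∨
      ∃ k ∈ H.channel Q S, .dequeue k ∈ H.events ∧ H.le (.dequeue k) e := by
  have key : ∀ {S e e'} {V : Set Proc}, H.Consec S e' e → (∀ Q ∈ V, H.joinView S ≤ H.joinView Q ∨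
        ∃ k ∈ H.channel Q S, .dequeue k ∈ H.events ∧ H.le (.dequeue k) e') →
      (∀ Q ∈ V, H.joinView S ≤ H.joinView Q ∨
        ∃ k ∈ H.channel Q S, .dequeue k ∈ H.events ∧ H.le (.dequeue k) e) := by
    intro S e e' V hc h Q hQ
    exact (h Q hQ).imp_right fun ⟨k, h1, h2, h3⟩ =>
      ⟨k, h1, h2, hH.le_trans _ h2 _ hc.left.1 _ hc.right.1 h3 hc.lt.1⟩
  refine state_induction (X := X) hH (Φ := fun S e => ∀ Q ∈ (X.post e).contactSet,
    H.joinView S ≤ H.joinView Q ∨ ∃ k ∈ H.channel Q S, .dequeue k ∈ H.events ∧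
      H.le (.dequeue k) e) ?_ ?_ ?_ ?_ ?_ ?_ he ht hl
  · intro P h0 _ _ Q _; exact .inl (by omega)
  · intro J e' hJ hm hc hi hp ih Q hQ
    rw [hp] at hQ
    rcases (protRun_evol J (X.post e')).contact_new hQ with h | h <;>
    · obtain rfl : Q = J := h
      exact .inl le_rfl
  · intro P e' k hc hk hi hp _ ih Q hQ
    rw [hp] at hQ
    rcases (protPacket_evol (H.content k) (H.source k) (X.post e')).contact_new hQ with rfl | h
    · exact .inr ⟨k, hk, hc.right.1, hH.le_refl _ hc.right.1⟩
    · exact key hc ih Q h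
  · intro P e' r hc hi hp ih Q hQ
    rw [hp] at hQ
    rcases (protBroadcast_evol P ∅ (H.body r) (X.post e')).contact_new hQ with rfl | h
    · exact .inl le_rfl
    · exact key hc ih Q h
  · intro P e' J hc h1 _ hi hp ih Q hQ
    rw [hp] at hQ
    rcases (protJoin_evol J (H.parent J) (X.post e')).contact_new hQ with rfl | rfl | h
    · exact .inl h1.le
    · exact .inl h1.le
    · exact key hc ih Q h
  · intro P e' R i hc _ _ _ hi hp ih Q hQ
    rw [hp, protRemove_eq, finishRemove_contactSet] at hQ; exact key hc ih Q hQ.1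

lemma effect_targets (he : e ∈ H.eventsAt S) (ht : e.IsTrigger) (hε : ε ∈ X.effects e)
    (hP : P ∈ ε.targets) (hj : H.joinView P < H.joinView S) :
    ∃ k ∈ H.channel P S, .dequeue k ∈ H.events ∧ H.le (.dequeue k) e := by
  have hl := live_of_effect hH he hε
  have hcon : ∀ {V : Set Proc}, (∀ Q ∈ V, H.joinView S ≤ H.joinView Q) →
      ε.targets ⊆ V ∪ (X.post e).contactSet →
      ∃ k ∈ H.channel P S, .dequeue k ∈ H.events ∧ H.le (.dequeue k) e := by
    intro V hV h
    rcases h hP with h | h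
    · exact absurd (hV P h) (by omega)
    · exact (contact_cases hH he ht hl P h).resolve_left (by omega)
  rcases hH.triggerCase he ht with
    ⟨k, hk⟩ | ⟨r⟩ | ⟨h0, hh⟩ | ⟨h0, hh⟩ | ⟨J, h1, h2, hv, hn, hh⟩ | ⟨R, i, h0, h1, h2, hv, hn, hh⟩ |
    ⟨i, h0, hh⟩
  · rcases ((protPacket_evol (H.content k) (H.source k) (X.pre _)).eff ε hε).1 hP with rfl | h
    · exact ⟨k, hk, he.1, hH.le_refl _ he.1⟩
    · exact (contact_cases hH he ht hl P h).resolve_left (by omega)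
  · exact hcon (V := {S}) (by simp) ((protBroadcast_evol S ∅ (H.body r) (X.pre _)).eff ε hε).1
  · rw [effects, hh] at hε; cases hε
  · refine hcon (V := {S}) (by simp) ?_
    rw [effects, hh] at hε
    rw [post, hh]; exact ((protRun_evol S (X.pre _)).eff ε hε).1
  · refine hcon (V := {J}) (by simpa using h1.le) ?_
    rw [effects, hh] at hε
    rw [post, hh]; exact ((protJoin_evol J (H.parent J) (X.pre _)).eff ε hε).1
  · refine hcon (V := ∅) (by simp) ?_
    rw [Set.empty_union]
    rw [effects, hh, protRemove_eq] at hε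
    rw [post, hh, protRemove_eq, finishRemove_contactSet]
    simp only [finishRemove, Act.seq, Act.modify, List.nil_append, List.mem_append] at hε
    have hcs : ∀ (l : List Msg) (s : St),
        (Act.forEach forward l s).1.contactSet = s.contactSet := by
      intro l
      induction l with
      | nil => exact fun s => rfl
      | cons m l ih => exact fun s => ih _
    rcases hε with h | h
    · have : ∀ (l : List Msg) (s : St),
          ∀ ε ∈ (Act.forEach forward l s).2, ε.targets = s.contactSet := by
        intro l
        induction l with
        | nil => intro s ε h; cases h
        | cons m l ih =>
          intro s ε h
          simp only [Act.forEach, Act.seq, List.mem_append] at h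
          rcases h with h | h
          · rw [List.mem_singleton.1 h]
          · exact ih (forward m s).1 ε h
      rw [this _ _ ε h]
    · revert h
      generalize hs : State.mk _ _ _ _ _ _ _ _ _ _ _ _ _ _ _ _ _ _ _ = s'
      intro h
      obtain ⟨g, f, es, h', -, -, -, -, h5⟩ := checkFlush_cases s'
      rw [h'] at h
      have : ε.targets = s'.contactSet := by
        rcases h5 with rfl | ⟨-, rfl | rfl | rfl⟩ <;> simp at h
        · rw [h]
        · rw [h]
        · rcases h with rfl | rfl <;> rfl
      rw [this, ← hs]; exact (hcs _ _).subset
  · rw [effects, hh] at hε; cases hε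

lemma codonation_first (hk : k ∈ H.channel S P) (hj : H.joinView P < H.joinView S) :
    ∃ k₀ ∈ H.channel P S, (H.content k₀).IsDonation ∧
      𝔱 k₀ = .notify (H.joinView S) P ∧ .dequeue k₀ ∈ H.events ∧
    ∃ k₁ ∈ H.channel S P, 𝔱 k₁ = .dequeue k₀ ∧
      H.content k₁ = .codonation (X.pre (.dequeue k₀)).donated ∧
      H.le (.dequeue k₀) (𝔱 k) ∧
      (k₁ = k ∨ H.lt (.queue (H.queuing k₁)) (.queue (H.queuing k))) := by
  have hq := queue_mem hH hk
  obtain ⟨ε, h1, -, h2⟩ := X.exists_effect hH hk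
  obtain ⟨k', hk', h3, h4⟩ := effect_targets hH (trigger_mem hq) (trigger_isTrigger hq)
    (List.mem_of_getElem? h1) h2 hj
  obtain ⟨k₀, hk₀, h5, h6, h7, h8⟩ := donation_first (X := X) hH hk' hj h3
  have hm : .dequeue k₀ ∈ H.eventsAt S := ⟨h7, hk₀.1, hk₀.2.2⟩
  have hle := hH.le_trans _ h7 _ h3 _ (trigger_mem hq).1 h8 h4
  obtain ⟨d, hd⟩ : ∃ d, H.content k₀ = .donation d := by
    cases hc : H.content k₀ <;> rw [hc] at h5 <;> first | exact h5.elim | exact ⟨_, rfl⟩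
  have heff := effects_received (X := X) hd
  rw [hk₀.2.1] at heff
  obtain ⟨k₁, hk₁, h9, h10, h11⟩ := X.exists_packet hH (Q := P) hm trivial (n := 0)
    (by rw [heff]; rfl) (Set.mem_singleton _)
  refine ⟨k₀, hk₀, h5, h6, h7, k₁, hk₁, h9, h11, hle, ?_⟩
  by_cases he : k₁ = k
  · exact .inl he
  right
  rw [queue_lt_queue_iff (X := X) hH (queue_mem hH hk₁) hq, h9, h10]
  by_cases h6 : 𝔱 k = .dequeue k₀
  · refine .inr ⟨h6.symm, Nat.pos_of_ne_zero fun h7 => he ?_⟩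
    exact packet_eq_of_queuing hH hk₁ hk (h9.trans h6.symm) (h10.trans h7.symm)
  · exact .inl (hH.lt_of_ne hm (trigger_mem hq) hle (Ne.symm h6))

lemma flushHeight_mono (he : e ∈ H.eventsAt P) (ht : e.IsTrigger) (hf : f ∈ H.eventsAt P)
    (ht' : f.IsTrigger) (hle : H.le e f) (hl : Live H P f) :
    (X.post e).flushHeight ≤ (X.post f).flushHeight := by
  refine hH.trigger_induction (Φ := fun f => Live H P f →
    (X.post e).flushHeight ≤ (X.post f).flushHeight) he ht (fun _ => le_rfl) ?_ hf ht' hle hl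
  intro e' f hc hle ih hl
  have hl' := live_of_lt hH hc.left hc.right hc.lt
  refine (ih hl').trans ?_
  have hpost : X.post f = (handle H f (X.post e')).1 := by rw [← X.pre_eq hc]; rfl
  rcases hH.triggerCase hc.right hc.right_trigger with
    ⟨k, hk⟩ | ⟨r⟩ | ⟨h, hh⟩ | ⟨h, hh⟩ | ⟨J, h1, h2, hv, hn, hh⟩ | ⟨R, i, h, h1, h2, hv, hn, hh⟩ |
    ⟨i, h, hh⟩
  · rw [hpost]; exact (protPacket_evol (H.content k) (H.source k) (X.post e')).flushH_mono
  · rw [hpost]; exact (protBroadcast_evol P ∅ (H.body r) (X.post e')).flushH_mono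
  · exact absurd (hc.joinView_lt hH) (by omega)
  · exact absurd (hc.joinView_lt hH) (lt_irrefl _)
  · rw [hpost, hh]; exact (protJoin_evol J (H.parent J) (X.post e')).flushH_mono
  · rw [hpost, hh]
    exact (protRemove_evol R (stateInv hH hc.left hc.left_trigger hl').sound).flushH_mono
  · exact absurd rfl (hl i h)

lemma flush_self_le (he : e ∈ H.eventsAt P) (ht : e.IsTrigger) (hl : Live H P e) :
    ((X.post e).flush P).getD 0 ≤ (X.post e).flushHeight := by
  refine state_induction (X := X) hH (Φ := fun P e =>
    ((X.post e).flush P).getD 0 ≤ (X.post e).flushHeight) ?_ ?_ ?_ ?_ ?_ ?_ he ht hl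
  · intro P _ _ hp
    rw [hp]
    simp only [protStart]; split <;> simp
  · intro J e' hJ hm hc hi hp ih
    rw [hp, (protRun_vectors J _).2]
    rw [Function.update_self]; exact (protRun_evol J (X.post e')).flushH_mono
  · intro P e' k hc hk hi hp _ ih
    have hmono := (protPacket_evol (H.content k) (H.source k) (X.post e')).flushH_mono
    rw [← hp] at hmono
    refine le_trans ?_ hmono
    rw [hp, (protPacket_vectors _ _ _).2]
    rcases hf : (H.content k).flushOf with _ | v
    · exact ih
    by_cases hP : P = H.source k
    swap
    · simpa [hP] using ih
    rw [← hP] at hk ⊢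
    simp only [Option.elim_some, Function.update_self, Option.getD_some]
    have hq := queue_mem hH hk
    have hlt : H.lt (𝔱 k) (.dequeue k) :=
      hH.lt_trans' (trigger_mem hq).1 hq.1 hc.right.1 (trigger_lt hq)
        (hH.packet_dequeued k hc.right.1).2
    have hle := hc.le_left _ (trigger_mem hq) (trigger_isTrigger hq) hlt
    refine le_trans ?_ (flushHeight_mono hH (trigger_mem hq) (trigger_isTrigger hq) hc.left
      hc.left_trigger hle (live_of_lt hH hc.left hc.right hc.lt))
    obtain ⟨ε, h1, h2, h3⟩ := X.exists_effect hH hk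
    cases hcon : H.content k with
    | flush w =>
      obtain ⟨S, n, M, s, hE⟩ := effects_ok hH (trigger_mem hq) (trigger_isTrigger hq)
        (List.mem_of_getElem? h1)
      have h4 := (hE.eff ε (List.mem_of_getElem? h1)).2
      rw [h2, hcon] at h4
      rw [hcon] at hf; exact (Option.some.inj hf) ▸ h4
    | donation d =>
      have := (donation_packet (X := X) hH hk (by rw [hcon]; trivial)).2.2.1
      omega
    | codonation d =>
      obtain ⟨k', hk', hd, -⟩ := codonation_packet (X := X) hH hk (by rw [hcon]; trivial)
      have := (donation_packet (X := X) hH hk' hd).2.2.1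
      omega
    | _ => rw [hcon] at hf; cases hf
  · intro P e' r hc hi hp ih
    have := (protBroadcast_evol P ∅ (H.body r) (X.post e')).flushH_mono
    rw [hp, (protBroadcast_vectors (H.body r) (X.post e')).2]; exact ih.trans this
  · intro P e' J hc h1 _ hi hp ih
    have := (protJoin_evol J (H.parent J) (X.post e')).flushH_mono
    have hne : P ≠ J := by rintro rfl; omega
    rw [hp, (protJoin_vectors _ _ _).2]; simpa [hne] using ih.trans this
  · intro P e' R i hc _ h2 h3 hi hp ih
    have := (protRemove_evol R hi.sound).flushH_mono
    have hne : P ≠ R := by rintro rfl; exact h2.ne h3.symm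
    rw [protRemove_eq] at this
    have hf : (beforeForward R (X.post e')).flush = (X.post e').flush := rfl
    rw [hp, protRemove_eq, (finishRemove_vectors _ _).2, hf]; simpa [hne] using ih.trans this

end Execution

lemma finishRemove_frame (R : Proc) (s : St) :
    (finishRemove R s).1.curView = s.curView ∧ (finishRemove R s).1.mpktIn = s.mpktIn := by
  have h : ∀ (l : List Msg) (s : St), (Act.forEach forward l s).1.curView = s.curView ∧
      (Act.forEach forward l s).1.mpktIn = s.mpktIn := by
    intro l
    induction l with
    | nil => exact fun s => ⟨rfl, rfl⟩
    | cons m l ih => exact fun s => ih (forward m s).1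
  simp only [finishRemove, Act.seq, Act.modify]
  generalize hs : State.mk _ _ _ _ _ _ _ _ _ _ _ _ _ _ _ _ _ _ _ = s'
  obtain ⟨g, f, es, h', -⟩ := checkFlush_cases s'
  rw [h', ← hs]; exact h _ _

lemma protJoin_frame (J E : Proc) (s : St) :
    (protJoin J E s).1.curView = s.curView ∧ (protJoin J E s).1.mpktIn =
      Function.update s.mpktIn J (some ⟨((s.mpktIn E).map Count.f).getD 0, 0⟩) := by
  rw [protJoin_eq]
  obtain ⟨g, f, es, h', -⟩ := checkFlush_cases (beforeDonate J E s)
  rw [h']; exact ⟨rfl, rfl⟩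

lemma protRun_frame (J : Proc) (s : St) :
    (protRun J s).1.curView = s.curView ∧ (protRun J s).1.mpktIn =
      Function.update s.mpktIn J (some { s.mpktOut with b := 0 }) := by
  rw [protRun_eq]
  obtain ⟨g, f, es, h', -⟩ := checkFlush_cases (newborn J s)
  rw [h']; exact ⟨rfl, rfl⟩

namespace Execution

lemma view_dequeue_lt (hH : H.IsConforming) (hk : k ∈ H.channel P Q) (hd : .dequeue k ∈ H.events) :
    (H.eventView (.dequeue k) : ℕ∞) < H.deathView P :=
  hH.toIsHistory.eventView_dequeue_lt hk
    (fun i h1 h2 => hH.conforming_packet Q P i h1 h2 k hk hd) hd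

/-- Nothing concerning `B` changes at `A` before the first packet from `B` is dequeued. -/
lemma window (hC : H.IsConforming) {A B : Proc} (hAB : A ≠ B) {j : ℕ} (hj : H.joinView B ≤ j)
    (hm : .notify j A ∈ H.events) (h1 : ((X.post (.notify j A)).flush B).getD 0 < j)
    (h2 : (X.post (.notify j A)).curView < j) (hk : k ∈ H.channel B A) (hd : .dequeue k ∈ H.events)
    (hle : H.le (.notify j A) (.dequeue k))
    (hfirst : ∀ k' ∈ H.channel B A, .dequeue k' ∈ H.events → H.le (.dequeue k) (.dequeue k')) :
    ((X.pre (.dequeue k)).flush B).getD 0 < j ∧ (X.pre (.dequeue k)).curView < j ∧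
      (X.pre (.dequeue k)).mpktIn B = (X.post (.notify j A)).mpktIn B := by
  have hH := hC.toIsHistory
  have hk' : .dequeue k ∈ H.eventsAt A := ⟨hd, hk.1, hk.2.2⟩
  have hm' := notify_at hm
  have hne : (.dequeue k : Evt) ≠ .notify (H.joinView A) A := by simp
  obtain ⟨e, hc⟩ := hH.exists_consec hk' trivial hne
  have hle' := hc.le_left _ hm' trivial (hH.lt_of_ne hm' hk' hle (by simp))
  rw [X.pre_eq hc]
  have hdeath := view_dequeue_lt hC hk hd
  have key : ∀ f ∈ H.eventsAt A, f.IsTrigger → H.le (.notify j A) f → H.lt f (.dequeue k) →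
      ((X.post f).flush B).getD 0 < j ∧ (X.post f).curView < j ∧
      (X.post f).mpktIn B = (X.post (.notify j A)).mpktIn B := by
    intro f hf ht hle hlt
    refine hH.trigger_induction (Φ := fun f => H.lt f (.dequeue k) →
      ((X.post f).flush B).getD 0 < j ∧ (X.post f).curView < j ∧
      (X.post f).mpktIn B = (X.post (.notify j A)).mpktIn B) hm' trivial (fun _ => ⟨h1, h2, rfl⟩)
      ?_ hf ht hle hlt
    intro e' f hc hle ih hlt
    obtain ⟨i1, i2, i3⟩ := ih (hH.lt_trans' hc.left.1 hc.right.1 hd hc.lt hlt)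
    have hi : StateInv X A e' :=
      stateInv hH hc.left hc.left_trigger (live_of_lt hH hc.left hc.right hc.lt)
    have hjv := hH.le_eventView hc.left hm hle
    have hve := hH.eventView_mono hc.left.1 hd
      (hH.le_trans _ hc.left.1 _ hc.right.1 _ hd hc.lt.1 hlt.1)
    have hvf := hH.eventView_mono hc.right.1 hd hlt.1
    have hB : B ∈ (X.post e').liveSet := by
      rw [hi.live_eq]
      exact hH.mem_view (hj.trans hjv) (lt_of_le_of_lt (by exact_mod_cast hve) hdeath)
    have hh : ((X.post e').flush B).getD 0 < (X.post e').height := by rw [hi.height_eq]; omega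
    have hpost : X.post f = (handle H f (X.post e')).1 := by rw [← X.pre_eq hc]; rfl
    rcases hH.triggerCase hc.right hc.right_trigger with
      ⟨k', hk'⟩ | ⟨r⟩ | ⟨h, hh⟩ | ⟨h, hh⟩ | ⟨J, h1, h2, hv, hn, hh'⟩ |
      ⟨R, i, h, h1, h2, hv, hn, hh'⟩ | ⟨i, h, hh'⟩
    · have hne : B ≠ H.source k' := by
        rintro rfl; exact hlt.2 (hfirst k' hk' hc.right.1)
      have hE := protPacket_evol (H.content k') (H.source k') (X.post e')
      rw [hpost]
      exact ⟨by rw [handle, hE.flush_eq B hne]; exact i1,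
        by rw [handle, hE.curView_eq B hne hB hh]; exact i2,
        by rw [handle, hE.mpktIn_eq B hne]; exact i3⟩
    · have hE := protBroadcast_evol A ∅ (H.body r) (X.post e')
      rw [hpost]
      exact ⟨by rw [handle, hE.flush_eq B hAB.symm]; exact i1,
        by rw [handle, hE.curView_eq B hAB.symm hB hh]; exact i2,
        by rw [handle, hE.mpktIn_eq B hAB.symm]; exact i3⟩
    · exact absurd (hc.joinView_lt hH) (by omega)
    · exact absurd (hc.joinView_lt hH) (lt_irrefl _)
    · have hJ : B ≠ J := by
        rintro rfl
        have := hc.eventView_succ hH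
        omega
      rw [hpost, hh', (protJoin_vectors _ _ _).2, (protJoin_frame _ _ _).1, (protJoin_frame _ _ _).2,
        Function.update_of_ne hJ, Function.update_of_ne hJ]
      exact ⟨i1, i2, i3⟩
    · have hR : B ≠ R := by
        rintro rfl
        rw [hH.eventView_notify hc.right.1] at hvf
        rw [h] at hdeath; exact absurd (by exact_mod_cast hdeath) (not_lt.2 hvf)
      rw [hpost, hh', protRemove_eq, (finishRemove_vectors _ _).2, (finishRemove_frame _ _).1,
        (finishRemove_frame _ _).2, Function.update_of_ne hR]
      refine ⟨i1, i2, ?_⟩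
      simp only [beforeForward, Function.update_of_ne hR]; exact i3
    · rw [hpost, hh']; exact ⟨i1, i2, i3⟩
  exact key e hc.left hc.left_trigger hle' hc.lt

lemma window_old (hC : H.IsConforming) (hj : H.joinView P < H.joinView S) (hk : k ∈ H.channel S P)
    (hd : .dequeue k ∈ H.events) (hm : .notify (H.joinView S) P ∈ H.events)
    (hle : H.le (.notify (H.joinView S) P) (.dequeue k))
    (hfirst : ∀ k' ∈ H.channel S P, .dequeue k' ∈ H.events → H.le (.dequeue k) (.dequeue k')) :
    (X.pre (.dequeue k)).curView < H.joinView S ∧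
      (X.pre (.dequeue k)).mpktIn S = (X.post (.notify (H.joinView S) P)).mpktIn S := by
  have hH := hC.toIsHistory
  have hm' := notify_at hm
  have hk' : .dequeue k ∈ H.eventsAt P := ⟨hd, hk.1, hk.2.2⟩
  have hl := live_of_lt hH hm' hk' (hH.lt_of_ne hm' hk' hle (by simp))
  have hdP : (H.joinView S : ℕ∞) < H.deathView P :=
    lt_of_le_of_ne (hH.notify_range hm).2 fun h => hl _ h.symm rfl
  obtain ⟨e', hc, hp, hi⟩ := exists_pre (X := X) hH hm' trivial (by
    intro h; injection h with h; omega)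
  have hs := hc.eventView_succ hH
  have hpost : X.post (.notify (H.joinView S) P) = (protJoin S (H.parent S) (X.post e')).1 := by
    rw [post, handle_join hH hj hdP, hp]
  have hv := (vectors_le (X := X) hH hc.left hc.left_trigger
    (live_of_lt hH hc.left hc.right hc.lt)).1 (H.parent S)
  have hh := hi.height_eq
  simp only [State.height] at hh
  refine (window hC (by rintro rfl; omega) le_rfl hm ?_ ?_ hk hd hle hfirst).2
  · rw [hpost, (protJoin_vectors _ _ _).2, Function.update_self]; omega
  · rw [hpost, (protJoin_frame _ _ _).1]; omega

lemma window_new (hC : H.IsConforming) (hj : H.joinView P < H.joinView S) (hk : k ∈ H.channel P S)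
    (hd : .dequeue k ∈ H.events)
    (hfirst : ∀ k' ∈ H.channel P S, .dequeue k' ∈ H.events → H.le (.dequeue k) (.dequeue k')) :
    (X.pre (.dequeue k)).curView < H.joinView S ∧
      (X.pre (.dequeue k)).mpktIn P = (X.post (.notify (H.joinView S) S)).mpktIn P := by
  have hH := hC.toIsHistory
  have hk' : .dequeue k ∈ H.eventsAt S := ⟨hd, hk.1, hk.2.2⟩
  obtain ⟨hm, hle⟩ := hH.join_first S ⟨_, hk'⟩
  have hJ : 0 < H.joinView S := by omega
  have hm2 := (hH.parent_event S hJ hm).1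
  have hpar := (hH.mem_view_iff (i := H.joinView S - 1) (lt_of_le_of_lt (by exact_mod_cast Nat.sub_le _ _)
    ((hH.join_lt_death S).trans_le (hH.deathView_le S))) (H.parent S)).1
    (hH.parent_member S hJ)
  obtain ⟨e', hc, hp, hi⟩ := exists_pre (X := X) hH (notify_at hm2) trivial (by
    intro h; injection h with h; omega)
  have hs := hc.eventView_succ hH
  have hpost : X.post (.notify (H.joinView S) S) = (protRun S (X.post e')).1 := by
    rw [← hp, ← X.fork S hJ hm, post]; simp [handle, hH.notice_join S, hJ.ne']
  have hv := (vectors_le (X := X) hH hc.left hc.left_trigger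
    (live_of_lt hH hc.left hc.right hc.lt)).2 P
  have hh := hi.height_eq
  have hne : P ≠ S := by rintro rfl; omega
  simp only [State.height] at hh
  refine (window hC hne.symm hj.le hm ?_ ?_ hk hd (hle _ hk') hfirst).2
  · rw [hpost, (protRun_vectors _ _).2, Function.update_of_ne hne]; omega
  · rw [hpost, (protRun_frame _ _).1]; omega

lemma not_old_of_donation (hH : H.IsHistory) {k₀ : Pkt} (hk : k₀ ∈ H.channel P S)
    (hc : (H.content k₀).IsDonation) (X : Execution H) : H.joinView P < H.joinView S :=
  (donation_packet (X := X) hH hk hc).2.2.1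

lemma donation_le (hH : H.IsHistory) (X : Execution H) {k₀ : Pkt} (hk : k₀ ∈ H.channel P S)
    (hc : (H.content k₀).IsDonation) (hk' : k ∈ H.channel P S) (hd : .dequeue k ∈ H.events) :
    H.le (.dequeue k₀) (.dequeue k) := by
  obtain ⟨k₁, h1, h2, -, -, h3⟩ := donation_first (X := X) hH hk' (not_old_of_donation hH hk hc X) hd
  rwa [donation_unique (X := X) hH hk h1 hc h2]

lemma codonation_le (hH : H.IsHistory) (X : Execution H) {k₁ : Pkt} (hk : k₁ ∈ H.channel S P)
    (hc : (H.content k₁).IsCoDonation) (hk' : k ∈ H.channel S P) (hd : .dequeue k ∈ H.events) :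
    H.le (.dequeue k₁) (.dequeue k) := by
  obtain ⟨k₀, h1, h2, -⟩ := codonation_packet (X := X) hH hk hc
  obtain ⟨_, _, _, _, _, k₂, h3, _, h4, _, h5⟩ :=
    codonation_first (X := X) hH hk' (not_old_of_donation hH h1 h2 X)
  rw [codonation_unique (X := X) hH hk h3 hc (by rw [h4]; trivial)]
  rcases h5 with rfl | h5
  · exact hH.le_refl _ hd
  · exact (hH.packet_order S P k₂ h3 k hk' h5 hd).2.1

/-- A co-donation from which views are installed finds no untimely records. -/
lemma simCount_of_install (hC : H.IsConforming) (hk : k ∈ H.channel S P)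
    (hd : .dequeue k ∈ H.events) (hε : ε ∈ X.effects (.dequeue k)) (hph : ε.phase = .install)
    (hc : H.content k = .codonation d) :
    simCount d S (X.pre (.dequeue k)) = 0 := by
  have hH := hC.toIsHistory
  have hcod : (H.content k).IsCoDonation := by rw [hc]; trivial
  obtain ⟨k₀, hk₀, hdon, ht, hd₀, hpos, hcon⟩ := codonation_packet (X := X) hH hk hcod
  have hj := not_old_of_donation hH hk₀ hdon X
  obtain ⟨htr, -, -, hdP, -⟩ := donation_packet (X := X) hH hk₀ hdon
  obtain ⟨-, d', hc', h1, h2⟩ := protPacket_install hε hph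
  obtain rfl : d = d' := by rw [hc] at hc'; exact Content.codonation.inj hc'
  rw [hk.2.1] at h1 h2
  have hdeq : .dequeue k ∈ H.eventsAt P := ⟨hd, hk.1, hk.2.2⟩
  have hdeq₀ : .dequeue k₀ ∈ H.eventsAt S := ⟨hd₀, hk₀.1, hk₀.2.2⟩
  obtain ⟨hs, hself, hh, hlive⟩ := height_pre (X := X) hH hdeq
  obtain ⟨hs₀, hself₀, hh₀, hlive₀⟩ := height_pre (X := X) hH hdeq₀
  have hq := queue_mem hH hk
  have hq₀ := queue_mem hH hk₀
  have hview : H.eventView (.dequeue k₀) ≤ H.eventView (.dequeue k) := by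
    rw [← ht]; exact trigger_view_le hH hk hd
  have hm := (htr ▸ trigger_mem hq₀ : .notify (H.joinView S) P ∈ H.eventsAt P)
  have hle : H.le (.notify (H.joinView S) P) (.dequeue k) := by
    refine hH.le_trans _ hm.1 _ hd₀ _ hd ?_ ?_
    · exact hH.le_trans _ hm.1 _ hq₀.1 _ hd₀ (htr ▸ (trigger_lt hq₀).1) (hH.packet_dequeued k₀ hd₀).2.1
    · exact hH.le_trans _ hd₀ _ hq.1 _ hd (ht ▸ (trigger_lt hq).1) (hH.packet_dequeued k hd).2.1
  have hSlive : S ∈ (X.pre (.dequeue k)).liveSet := by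
    rw [hlive]
    exact hH.mem_view ((hH.eventView_notify hm.1).symm.le.trans (hH.eventView_mono hm.1 hd hle))
      (view_dequeue_lt hC hk hd)
  have hPlive : P ∈ (X.pre (.dequeue k)).liveSet := by
    rw [hlive]
    exact hH.mem_view (hH.joinView_le_eventView hdeq) (hH.eventView_lt_deathView hdeq (by simp))
  have hne : P ≠ S := by rintro rfl; omega
  have hw := (window_old (X := X) hC hj hk hd hm.1 hle
    (fun k' hk' hd' => codonation_le hH X hk hcod hk' hd')).1
  have hw₀ := (window_new (X := X) hC hj hk₀ hd₀
    (fun k' hk' hd' => donation_le hH X hk₀ hdon hk' hd')).1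
  have hdd : d = (X.pre (.dequeue k₀)).donated := by rw [hc] at hcon; exact Content.codonation.inj hcon
  have hf₀ : d.flushHeight = (X.pre (.dequeue k₀)).flushHeight := by rw [hdd]; rfl
  have ha := h1 hSlive
  have hb := h2 P hPlive hne
  obtain ⟨e', hc', hp, hi⟩ := exists_pre (X := X) hH hdeq trivial (by simp)
  have hfs := flush_self_le (X := X) hH hc'.left hc'.left_trigger (live_of_lt hH hc'.left hc'.right hc'.lt)
  rw [← hp] at hfs
  have hfl := hs.flush_le
  have hfl₀ := hs₀.flush_le
  have hSv := hH.joinView_le_eventView hdeq₀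
  have q1 := hs.quiet (by omega) (by simp only [State.height] at *; omega)
  have q2 := hs₀.quiet (by omega) (by simp only [State.height] at *; omega)
  have hw1 : (X.pre (.dequeue k)).waitSet = [] := by simp [State.waitSet, q1]
  have hw2 : d.waitSet = [] := by rw [hdd]; simp [State.donated, State.waitSet, q2]
  simp [simCount, untimelyRecords, hw1, hw2]

end Execution

/-- The trigger is a notification event. -/
def Ev.isNotify : Evt → Bool
  | .notify _ _ => true
  | _ => false

/-- The forwarded messages (`true`) or all messages (`false`) that are counted by a counter. -/
def Count.cnt : Bool → Count → ℕ
  | true, c => c.f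
  | false, c => c.total

lemma Count.cnt_plus (n n' : Bool) (c : Count) (k : ℕ) :
    (c.plus n' k).cnt n = if n = true → n' = true then c.cnt n + k else c.cnt n := by
  cases n <;> cases n' <;> simp [Count.cnt, Count.plus, Count.total] <;> omega

lemma Count.le_cnt_plus (n n' : Bool) (c : Count) (k : ℕ) : c.cnt n ≤ (c.plus n' k).cnt n := by
  rw [cnt_plus]; split_ifs <;> omega

section Lists

lemma countMsg_take_le (es : List Eff) (n : ℕ) : countMsg (es.take n) ≤ countMsg es := by
  conv_rhs => rw [← List.take_append_drop n es, countMsg_append]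
  omega

lemma countMsg_take_mono (es : List Eff) {m : ℕ} (h : n ≤ m) :
    countMsg (es.take n) ≤ countMsg (es.take m) := by
  have : es.take n = (es.take m).take n := by rw [List.take_take, min_eq_left h]
  rw [this]; exact countMsg_take_le _ _

lemma countMsg_take_succ (h : es[n]? = some ε) (hm : ε.content.IsMsg) :
    countMsg (es.take (n + 1)) = countMsg (es.take n) + 1 := by
  rw [List.take_add_one, h, countMsg_append]; simp [countMsg, hm]

lemma countMsg_exists (h0 : 0 < i) (h : i ≤ countMsg es) :
    ∃ (n : ℕ) (ε : Eff), es[n]? = some ε ∧ ε.content.IsMsg ∧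
      countMsg (es.take (n + 1)) = i := by
  induction es generalizing i with
  | nil => simp [countMsg] at h; omega
  | cons x es ih =>
    have hx : countMsg (x :: es) = countMsg [x] + countMsg es := countMsg_append [x] es
    by_cases hm : x.content.IsMsg
    · have h1 : countMsg [x] = 1 := by simp [countMsg, hm]
      rcases Nat.lt_or_ge 1 i with h2 | h2
      · obtain ⟨n, ε, h3, h4, h5⟩ := ih (i := i - 1) (by omega) (by omega)
        refine ⟨n + 1, ε, by simpa using h3, h4, ?_⟩
        have : countMsg (x :: es.take (n + 1)) = countMsg [x] + countMsg (es.take (n + 1)) :=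
          countMsg_append [x] _
        rw [List.take_succ_cons, this]; omega
      · refine ⟨0, x, rfl, hm, ?_⟩
        simp only [zero_add, List.take_succ_cons, List.take_zero]; omega
    · have h1 : countMsg [x] = 0 := countMsg_singleton_of_not hm
      obtain ⟨n, ε, h3, h4, h5⟩ := ih h0 (by omega)
      refine ⟨n + 1, ε, by simpa using h3, h4, ?_⟩
      have : countMsg (x :: es.take (n + 1)) = countMsg [x] + countMsg (es.take (n + 1)) :=
        countMsg_append [x] _
      rw [List.take_succ_cons, this]; omega

end Lists

lemma checkFlush_not_msg (s : St) : ∀ ε ∈ (checkFlush s).2, ¬ ε.content.IsMsg := by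
  obtain ⟨g, f, es, h, -, -, -, -, h5⟩ := checkFlush_cases s
  rw [h]
  rcases h5 with rfl | ⟨-, rfl | rfl | rfl⟩ <;> simp [Content.IsMsg]

lemma checkFlush_frame (s : St) :
    (checkFlush s).1.waitSet = s.waitSet ∧ (checkFlush s).1.fwdWaitSet = s.fwdWaitSet ∧
    (checkFlush s).1.mpktOut = s.mpktOut := by
  obtain ⟨g, f, es, h, -⟩ := checkFlush_cases s
  rw [h]; exact ⟨rfl, rfl, rfl⟩

namespace Execution

/-- The index of a message that is queued. -/
noncomputable def idx (X : Execution H) (q : Que) : Count :=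
  (X.pre (X.trigger q)).mpktOut.plus (X.trigger q).isNotify
    (countMsg ((X.effects (X.trigger q)).take (X.position q + 1)))

/-- The evolution of the state in the transaction of the trigger `e` at `P`, after its preparatory part
that leads to the state `s`. -/
structure TriggerEvol (X : Execution H) (P : Proc) (e : Evt) (S : Proc) (M : Set Msg) (s : St) : Prop where
  evol : Evol S e.isNotify M s (X.post e) (X.effects e)
  out_eq : s.mpktOut = (X.pre e).mpktOut
  self_eq : s.self = P
  contact_self : P ∈ s.contactSet
  contact : H.Original P → ∀ Q ∈ H.view (H.eventView e), Q ∈ s.contactSet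
  fwdQueue_eq : e.isNotify = false → s = X.pre e
  bcast : ∀ r' ∈ s.bcastWaitSet, ∃ r ∈ (X.pre e).bcastWaitSet,
    WaitRec.Desc {J | e = .notify (H.joinView J) P} r r'
  fwd : ∀ r' ∈ s.fwdWaitSet, ∃ r ∈ (X.pre e).fwdWaitSet,
    WaitRec.Desc {J | e = .notify (H.joinView J) P} r r'

/-- The record `r` was created in the transaction of the trigger `e`. -/
def Created (X : Execution H) (P : Proc) (e : Evt) (r : Rec) : Prop :=
  ∃ k ∈ H.channel P P, X.trigger (H.queuing k) = e ∧ H.content k = .msg r.msg ∧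
    X.idx (H.queuing k) = r.index

variable (hH : H.IsHistory)
include hH

lemma trigger_evol (he : e ∈ H.eventsAt P) (ht : e.IsTrigger) (hl : Live H P e)
    (hne : e ≠ .notify (H.joinView P) P) : ∃ S M s, TriggerEvol X P e S M s := by
  obtain ⟨e', hc, hp, hi⟩ := exists_pre (X := X) hH he ht hne
  rcases hH.triggerCase he ht with
    ⟨k, hk⟩ | ⟨r⟩ | ⟨h0, hh⟩ | ⟨h0, hh⟩ | ⟨J, h1, h2, hv, hn, hh⟩ | ⟨R, i, h0, h1, h2, hv, hn, hh⟩ |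
    ⟨i, h0, hh⟩
  · have hv := hc.eventView_eq hH (by simp)
    refine ⟨_, _, _, protPacket_evol (H.content k) (H.source k) (X.pre _), rfl, hp ▸ hi.self_eq,
      hp ▸ hi.contact_self, ?_, fun _ => rfl, fun r h => ⟨r, h, .refl _ _⟩, fun r h => ⟨r, h, .refl _ _⟩⟩
    intro ho Q hQ
    rw [hp]
    rw [hv, ← hi.live_eq] at hQ; exact hi.original ho hQ
  · have hv := hc.eventView_eq hH (by simp)
    refine ⟨_, _, _, protBroadcast_evol P ∅ (H.body r) (X.pre _), rfl, hp ▸ hi.self_eq,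
      hp ▸ hi.contact_self, ?_, fun _ => rfl, fun r h => ⟨r, h, .refl _ _⟩, fun r h => ⟨r, h, .refl _ _⟩⟩
    intro ho Q hQ
    rw [hp]
    rw [hv, ← hi.live_eq] at hQ; exact hi.original ho hQ
  · exact absurd (by rw [h0]) hne
  · exact absurd rfl hne
  · have hs := hc.eventView_succ hH
    have hw := hH.eventView_notify he.1
    refine ⟨J, ∅, beforeDonate J (H.parent J) (X.pre (.notify (H.joinView J) P)), ?_, rfl,
      hp ▸ hi.self_eq, .inr (hp ▸ hi.contact_self), ?_, by simp [Ev.isNotify], ?_, ?_⟩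
    · rw [post, effects, hh]; exact protJoin_evol J (H.parent J) _
    · intro ho Q hQ
      rw [hw, hv, hs, Nat.add_sub_cancel, ← hi.live_eq] at hQ
      rw [hp]; exact hQ.imp_right fun h => hi.original ho h
    · intro r' hr'
      obtain ⟨r, hr, hd⟩ := (beforeDonate_shrink J (H.parent J) _).1.desc r' hr'
      refine ⟨r, hr, hd.mono ?_⟩
      rintro _ rfl; rfl
    · intro r' hr'
      obtain ⟨r, hr, hd⟩ := (beforeDonate_shrink J (H.parent J) _).2.desc r' hr'
      refine ⟨r, hr, hd.mono ?_⟩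
      rintro _ rfl; rfl
  · have hs := hc.eventView_succ hH
    have hw := hH.eventView_notify he.1
    have hRP : P ≠ R := by rintro rfl; exact h2.ne h0.symm
    refine ⟨R, ∅, beforeForward R (X.pre (.notify i P)), ?_, rfl,
      hp ▸ hi.self_eq, ⟨hp ▸ hi.contact_self, hRP⟩, ?_, by simp [Ev.isNotify], ?_, ?_⟩
    · rw [post, effects, hh]; exact protRemove_evol R (hp ▸ hi.sound)
    · intro ho Q hQ
      rw [hw, hv, hs, Nat.add_sub_cancel, ← hi.live_eq] at hQ
      rw [hp]; exact ⟨hi.original ho hQ.1, hQ.2⟩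
    · intro r' hr'
      obtain ⟨r, hr, hd⟩ := (beforeForward_shrink R _).1.desc r' hr'
      exact ⟨r, hr, hd.mono (Set.empty_subset _)⟩
    · intro r' hr'
      obtain ⟨r, hr, hd⟩ := (beforeForward_shrink R _).2.desc r' hr'
      exact ⟨r, hr, hd.mono (Set.empty_subset _)⟩
  · exact absurd rfl (hl i h0)

lemma first_effects (P : Proc) :
    ∀ ε ∈ X.effects (.notify (H.joinView P) P), ¬ ε.content.IsMsg := by
  intro ε hε
  have hn := hH.notice_join P
  rcases Nat.eq_zero_or_pos (H.joinView P) with h0 | h0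
  · have : X.effects (.notify (H.joinView P) P) = [] := by
      rw [h0] at hn ⊢
      simp only [effects, handle, hn]; rfl
    rw [this] at hε; cases hε
  · have : X.effects (.notify (H.joinView P) P) = (checkFlush (newborn P (X.pre (.notify (H.joinView P) P)))).2 := by
      simp only [effects, handle, hn, h0.ne', if_false]; rw [protRun_eq]
    rw [this] at hε; exact checkFlush_not_msg _ ε hε

lemma msg_trigger (he : e ∈ H.eventsAt P) (ht : e.IsTrigger) (hε : ε ∈ X.effects e)
    (hm : ε.content.IsMsg) : ∃ S M s, TriggerEvol X P e S M s := by
  refine trigger_evol hH he ht (live_of_effect hH he hε) ?_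
  rintro rfl; exact first_effects hH P ε hε hm

lemma mpktOut_post (hc : H.Consec P e f) (hl : Live H P f) :
    (X.post f).mpktOut = (X.post e).mpktOut.plus f.isNotify (countMsg (X.effects f)) := by
  obtain ⟨S, M, s, h⟩ := trigger_evol hH hc.right hc.right_trigger hl
    (by rintro rfl; exact absurd (hc.joinView_lt hH) (lt_irrefl _))
  rw [h.evol.out_eq, h.out_eq, X.pre_eq hc]

lemma mpktOut_mono (n : Bool) (he : e ∈ H.eventsAt P) (ht : e.IsTrigger) (hf : f ∈ H.eventsAt P)
    (ht' : f.IsTrigger) (hle : H.le e f) (hl : Live H P f) :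
    (X.post e).mpktOut.cnt n ≤ (X.post f).mpktOut.cnt n := by
  refine hH.trigger_induction (Φ := fun f => Live H P f →
    (X.post e).mpktOut.cnt n ≤ (X.post f).mpktOut.cnt n) he ht (fun _ => le_rfl) ?_ hf ht' hle hl
  intro e' f hc hle ih hl
  refine (ih (live_of_lt hH hc.left hc.right hc.lt)).trans ?_
  rw [mpktOut_post hH hc hl]; exact Count.le_cnt_plus _ _ _ _

lemma mpktOut_pre_le (n : Bool) (he : e ∈ H.eventsAt P) (ht : e.IsTrigger) (hf : f ∈ H.eventsAt P)
    (ht' : f.IsTrigger) (hlt : H.lt e f) : (X.post e).mpktOut.cnt n ≤ (X.pre f).mpktOut.cnt n := by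
  obtain ⟨e', hc, hp, -⟩ := exists_pre hH hf ht' (by
    rintro rfl; exact hlt.2 ((hH.join_first P ⟨_, hf⟩).2 e he))
  rw [hp]
  exact mpktOut_mono hH n he ht hc.left hc.left_trigger (hc.le_left e he ht hlt)
    (live_of_lt hH hc.left hf hc.lt)

section Packet

variable {P Q : Proc} {k : Pkt}

lemma msg_packet (hk : k ∈ H.channel P Q) (hm : (H.content k).IsMsg) :
    ∃ ε, (X.effects (𝔱 k))[X.position (H.queuing k)]? = some ε ∧
      ε.content = H.content k ∧ ε.content.IsMsg := by
  obtain ⟨ε, h1, h2, h3⟩ := X.exists_effect hH hk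
  exact ⟨ε, h1, h2, h2 ▸ hm⟩

lemma idx_le_post (n : Bool) (hk : k ∈ H.channel P Q) (hm : (H.content k).IsMsg) :
    (X.idx (H.queuing k)).cnt n ≤ (X.post (𝔱 k)).mpktOut.cnt n := by
  have hq := queue_mem hH hk
  obtain ⟨ε, h1, h2, h3⟩ := msg_packet hH hk hm
  obtain ⟨S, M, s, h⟩ := msg_trigger hH (trigger_mem hq) (trigger_isTrigger hq)
    (List.mem_of_getElem? h1) h3
  rw [h.evol.out_eq, h.out_eq, idx, Count.cnt_plus, Count.cnt_plus]
  have := countMsg_take_le (X.effects (𝔱 k)) (X.position (H.queuing k) + 1)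
  split_ifs <;> omega

lemma pre_lt_idx (n : Bool) (hk : k ∈ H.channel P Q) (hm : (H.content k).IsMsg)
    (hn : n = true → (𝔱 k).isNotify = true) :
    (X.pre (𝔱 k)).mpktOut.cnt n < (X.idx (H.queuing k)).cnt n := by
  obtain ⟨ε, h1, h2, h3⟩ := msg_packet hH hk hm
  rw [idx, Count.cnt_plus, if_pos hn, countMsg_take_succ h1 h3]; omega

lemma idx_le_pre (n : Bool) (hk : k ∈ H.channel P Q) (hm : (H.content k).IsMsg)
    (he : e ∈ H.eventsAt P) (ht : e.IsTrigger) (hlt : H.lt (𝔱 k) e) :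
    (X.idx (H.queuing k)).cnt n ≤ (X.pre e).mpktOut.cnt n :=
  (idx_le_post hH n hk hm).trans (mpktOut_pre_le hH n (trigger_mem (queue_mem hH hk))
    (trigger_isTrigger (queue_mem hH hk)) he ht hlt)

lemma idx_lt (n : Bool) {Q' : Proc} {k' : Pkt} (hk : k ∈ H.channel P Q) (hm : (H.content k).IsMsg)
    (hk' : k' ∈ H.channel P Q') (hm' : (H.content k').IsMsg)
    (hn' : n = true → (𝔱 k').isNotify = true)
    (hlt : H.lt (.queue (H.queuing k)) (.queue (H.queuing k'))) :
    (X.idx (H.queuing k)).cnt n < (X.idx (H.queuing k')).cnt n := by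
  have hq := queue_mem hH hk
  have hq' := queue_mem hH hk'
  rcases (queue_lt_queue_iff hH hq hq').1 hlt with h | ⟨h, h'⟩
  · exact (idx_le_pre hH n hk hm (trigger_mem hq') (trigger_isTrigger hq') h).trans_lt
      (pre_lt_idx hH n hk' hm' hn')
  · obtain ⟨ε, h1, h2, h3⟩ := msg_packet hH hk' hm'
    rw [idx, idx, h, Count.cnt_plus, Count.cnt_plus, if_pos hn', if_pos hn', countMsg_take_succ h1 h3]
    have := countMsg_take_mono (X.effects (𝔱 k')) h'
    simp only [Nat.succ_eq_add_one] at this; omega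

lemma queuing_eq_of_idx (n : Bool) {Q' : Proc} {k' : Pkt} (hk : k ∈ H.channel P Q)
    (hm : (H.content k).IsMsg) (hk' : k' ∈ H.channel P Q') (hm' : (H.content k').IsMsg)
    (hn : n = true → (𝔱 k).isNotify = true) (hn' : n = true → (𝔱 k').isNotify = true)
    (h : (X.idx (H.queuing k)).cnt n = (X.idx (H.queuing k')).cnt n) :
    H.queuing k = H.queuing k' := by
  rcases hH.trichotomy (queue_mem hH hk) (queue_mem hH hk') with h1 | h1 | h1
  · exact absurd (idx_lt hH n hk hm hk' hm' hn' h1) (by omega)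
  · simpa using h1
  · exact absurd (idx_lt hH n hk' hm' hk hm hn h1) (by omega)

lemma msg_targets (ho : H.Original P) (he : e ∈ H.eventsAt P) (ht : e.IsTrigger)
    (hε : ε ∈ X.effects e) (hm : ε.content.IsMsg) (hQ : Q ∈ H.view (H.eventView e)) :
    Q ∈ ε.targets := by
  obtain ⟨S, M, s, h⟩ := msg_trigger hH he ht hε hm
  have h2 := (h.evol.eff ε hε).2
  cases hc : ε.content <;> rw [hc] at hm h2 <;> first | exact hm.elim | skip
  exact h2.1 (h.contact ho Q hQ)

lemma exists_idx (n : Bool) (ho : H.Original P) (he : e ∈ H.eventsAt P) (ht : e.IsTrigger) (hl : Live H P e) (h0 : 0 < i) (hi : i ≤ (X.post e).mpktOut.cnt n) (hQ : ∀ f, H.le f e → f ∈ H.eventsAt P →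
      Q ∈ H.view (H.eventView f)) :
    ∃ k ∈ H.channel P Q, (H.content k).IsMsg ∧ H.le (𝔱 k) e ∧
      (X.idx (H.queuing k)).cnt n = i ∧ (n = true → (𝔱 k).isNotify = true) := by
  have hm := (hH.join_first P ⟨e, he⟩)
  have hm' := notify_at hm.1
  refine hH.trigger_induction (Φ := fun e => Live H P e → i ≤ (X.post e).mpktOut.cnt n →
    (∀ f, H.le f e → f ∈ H.eventsAt P → Q ∈ H.view (H.eventView f)) →
    ∃ k ∈ H.channel P Q, (H.content k).IsMsg ∧ H.le (𝔱 k) e ∧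
      (X.idx (H.queuing k)).cnt n = i ∧ (n = true → (𝔱 k).isNotify = true))
    hm' trivial ?_ ?_ he ht (hm.2 e he) hl hi hQ
  · intro _ h _
    exfalso
    have hn := hH.notice_join P
    have h1 : (X.post (.notify (H.joinView P) P)).mpktOut = ⟨0, 0⟩ := by
      have ho' : H.joinView P = 0 := ho
      rw [ho'] at hn ⊢
      simp only [post, handle, hn]; rfl
    rw [h1] at h
    cases n <;> simp [Count.cnt, Count.total] at h <;> omega
  · intro e' f hc _ ih hl hi hQ
    have hl' := live_of_lt hH hc.left hc.right hc.lt
    by_cases hcase : i ≤ (X.post e').mpktOut.cnt n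
    · obtain ⟨k, h1, h2, h3, h4⟩ := ih hl' hcase fun g hg hge =>
        hQ g (hH.le_trans _ hge.1 _ hc.left.1 _ hc.right.1 hg hc.lt.1) hge
      exact ⟨k, h1, h2, hH.le_trans _ (trigger_mem (queue_mem hH h1)).1 _ hc.left.1 _ hc.right.1 h3 hc.lt.1,
        h4⟩
    rw [mpktOut_post hH hc hl, Count.cnt_plus] at hi
    split_ifs at hi with hn
    swap
    · exact absurd hi hcase
    obtain ⟨p, ε, h1, h2, h3⟩ := countMsg_exists (i := i - (X.post e').mpktOut.cnt n)
      (by omega) (by omega : _ ≤ countMsg (X.effects f))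
    have hT := msg_targets hH ho hc.right hc.right_trigger (List.mem_of_getElem? h1) h2
      (hQ f (hH.le_refl _ hc.right.1) hc.right)
    obtain ⟨k, hk, h4, h5, h6⟩ := X.exists_packet hH hc.right hc.right_trigger h1 hT
    refine ⟨k, hk, h6 ▸ h2, by rw [h4]; exact hH.le_refl _ hc.right.1, ?_, fun h => h4 ▸ hn h⟩
    rw [idx, h4, h5, h3, X.pre_eq hc, Count.cnt_plus, if_pos hn]; omega

end Packet

lemma created_of_newRec {M : Set Msg} (h : TriggerEvol X P e S M s) (he : e ∈ H.eventsAt P)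
    (ht : e.IsTrigger) (hr : NewRec e.isNotify s (X.effects e) r) : Created X P e r := by
  obtain ⟨p, ε, h1, h2, h3⟩ := hr
  have h4 := (h.evol.eff ε (List.mem_of_getElem? h1)).2
  rw [h2] at h4
  obtain ⟨k, hk, h5, h6, h7⟩ := X.exists_packet hH he ht h1 (h4.1 h.contact_self)
  exact ⟨k, hk, h5, h7.trans h2, by rw [idx, h5, h6, h3, h.out_eq]⟩

/-- The origin of the records of the wait sets: `n = true` for the forwarded messages. -/
lemma provenance_step (he : e ∈ H.eventsAt P) (ht : e.IsTrigger) (hl : Live H P e)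
    (hne : e ≠ .notify (H.joinView P) P) :
    (∀ r' ∈ (X.post e).bcastWaitSet,
      (∃ r ∈ (X.pre e).bcastWaitSet, WaitRec.Desc {J | e = .notify (H.joinView J) P} r r') ∨
      (e.isNotify = false ∧ Created X P e r')) ∧ (∀ r' ∈ (X.post e).fwdWaitSet,
      (∃ r ∈ (X.pre e).fwdWaitSet, WaitRec.Desc {J | e = .notify (H.joinView J) P} r r') ∨
      (e.isNotify = true ∧ Created X P e r')) := by
  obtain ⟨S, M, s, h⟩ := trigger_evol hH he ht hl hne
  constructor
  · intro r' hr'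
    rcases h.evol.bcast_rec r' hr' with ⟨r, hr, hd⟩ | ⟨h1, h2⟩
    · obtain ⟨r0, hr0, hd0⟩ := h.bcast r hr
      exact .inl ⟨r0, hr0, hd0.trans (hd.mono (Set.empty_subset _))⟩
    · exact .inr ⟨h1, created_of_newRec hH h he ht (h1 ▸ h2)⟩
  · intro r' hr'
    rcases h.evol.fwd_rec r' hr' with ⟨r, hr, hd⟩ | ⟨h1, h2⟩
    · obtain ⟨r0, hr0, hd0⟩ := h.fwd r hr
      exact .inl ⟨r0, hr0, hd0.trans (hd.mono (Set.empty_subset _))⟩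
    · exact .inr ⟨h1, created_of_newRec hH h he ht (h1 ▸ h2)⟩

lemma provenance (he : e ∈ H.eventsAt P) (ht : e.IsTrigger) (hf : f ∈ H.eventsAt P)
    (ht' : f.IsTrigger) (hle : H.le e f) (hl : Live H P f) :
    (∀ r' ∈ (X.post f).bcastWaitSet,
      (∃ r ∈ (X.post e).bcastWaitSet, WaitRec.Desc {J | H.eventView e < H.joinView J} r r') ∨
      ∃ g, H.lt e g ∧ H.le g f ∧ g.isNotify = false ∧ Created X P g r') ∧
    (∀ r' ∈ (X.post f).fwdWaitSet,
      (∃ r ∈ (X.post e).fwdWaitSet, WaitRec.Desc {J | H.eventView e < H.joinView J} r r') ∨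
      ∃ g, H.lt e g ∧ H.le g f ∧ g.isNotify = true ∧ Created X P g r') := by
  refine hH.trigger_induction (Φ := fun f => Live H P f → (∀ r' ∈ (X.post f).bcastWaitSet,
      (∃ r ∈ (X.post e).bcastWaitSet, WaitRec.Desc {J | H.eventView e < H.joinView J} r r') ∨
      ∃ g, H.lt e g ∧ H.le g f ∧ g.isNotify = false ∧ Created X P g r') ∧
    (∀ r' ∈ (X.post f).fwdWaitSet,
      (∃ r ∈ (X.post e).fwdWaitSet, WaitRec.Desc {J | H.eventView e < H.joinView J} r r') ∨
      ∃ g, H.lt e g ∧ H.le g f ∧ g.isNotify = true ∧ Created X P g r')) he ht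
    (fun _ => ⟨fun r hr => .inl ⟨r, hr, .refl _ _⟩, fun r hr => .inl ⟨r, hr, .refl _ _⟩⟩) ?_ hf ht' hle hl
  intro e' f hc hle ih hl
  have ih := ih (live_of_lt hH hc.left hc.right hc.lt)
  have hlt : H.lt e f := hH.lt_of_le_of_lt' he.1 hc.left.1 hc.right.1 hle hc.lt
  have hstep := provenance_step (X := X) hH hc.right hc.right_trigger hl
    (by rintro rfl; exact absurd (hc.joinView_lt hH) (lt_irrefl _))
  rw [X.pre_eq hc] at hstep
  have hE : {J | f = .notify (H.joinView J) P} ⊆ {J | H.eventView e < H.joinView J} := by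
    rintro J rfl; exact (hH.lt_notify_iff he hc.right.1).1 hlt
  have hdesc : ∀ {r r' r'' : Rec}, WaitRec.Desc {J | H.eventView e < H.joinView J} r r' →
      WaitRec.Desc {J | f = .notify (H.joinView J) P} r' r'' →
      WaitRec.Desc {J | H.eventView e < H.joinView J} r r'' := fun h h' => h.trans (h'.mono hE)
  have hcr : ∀ {g} {r r' : Rec}, Created X P g r →
      WaitRec.Desc {J | f = .notify (H.joinView J) P} r r' → Created X P g r' := by
    rintro g r r' ⟨k, h1, h2, h3, h4⟩ hd
    exact ⟨k, h1, h2, by rw [hd.msg]; exact h3, by rw [hd.index]; exact h4⟩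
  have hgf : ∀ {g} {r : Rec}, Created X P g r → H.le g e' → H.le g f := by
    rintro g r ⟨k, h1, rfl, h3, h4⟩ h
    exact hH.le_trans _ (trigger_mem (queue_mem hH h1)).1 _ hc.left.1 _ hc.right.1 h hc.lt.1
  constructor
  · intro r'' hr''
    rcases hstep.1 r'' hr'' with ⟨r', hr', hd⟩ | h
    · rcases ih.1 r' hr' with ⟨r, hr, hd'⟩ | ⟨g, h1, h2, h3, h4⟩
      · exact .inl ⟨r, hr, hdesc hd' hd⟩
      · exact .inr ⟨g, h1, hgf h4 h2, h3, hcr h4 hd⟩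
    · exact .inr ⟨f, hlt, hH.le_refl _ hc.right.1, h⟩
  · intro r'' hr''
    rcases hstep.2 r'' hr'' with ⟨r', hr', hd⟩ | h
    · rcases ih.2 r' hr' with ⟨r, hr, hd'⟩ | ⟨g, h1, h2, h3, h4⟩
      · exact .inl ⟨r, hr, hdesc hd' hd⟩
      · exact .inr ⟨g, h1, hgf h4 h2, h3, hcr h4 hd⟩
    · exact .inr ⟨f, hlt, hH.le_refl _ hc.right.1, h⟩

end Execution

section Frames

lemma checkFlush_mpktIn (s : St) : (checkFlush s).1.mpktIn = s.mpktIn := by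
  obtain ⟨g, f, es, h, -⟩ := checkFlush_cases s
  rw [h]

lemma protBroadcast_mpktIn (x : Body) (s : St) : (protBroadcast x s).1.mpktIn = s.mpktIn := by
  unfold protBroadcast; split <;> rfl

lemma tryToInstall_mpktIn (s : St) : (tryToInstall s).1.mpktIn = s.mpktIn := by
  have hf : ∀ (l : List Body) (s : St), (Act.forEach protBroadcast l s).1.mpktIn = s.mpktIn := by
    intro l
    induction l with
    | nil => exact fun s => rfl
    | cons x l ih => exact fun s => (ih _).trans (protBroadcast_mpktIn x s)
  unfold tryToInstall
  split
  · rfl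
  · obtain ⟨v, l, q, p, ms, h, -⟩ := install_frame s.vGap s le_rfl
    simp only [h]; exact hf _ _

lemma receiveMessage_mpktIn (m : Msg) (S : Proc) (s : St) :
    (receiveMessage m S s).1.mpktIn = Function.update s.mpktIn S ((s.mpktIn S).map fun c =>
      if m.orig = S then { c with b := c.b + 1 } else { c with f := c.f + 1 }) := by
  have h : ∀ s1 : St, (if m.view < s1.curView then s1
        else if m.view = s1.curView ∧ (m.vt m.orig).getD 0 ≤ (s1.vt m.orig).getD 0 then s1
        else if m ∈ s1.receiveSet then s1 else scan { s1 with
            receiveSet := s1.receiveSet ++ [m]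
            fwdQueue := Function.update s1.fwdQueue S
              ((s1.fwdQueue S).map fun l => l ++ [m]) }).mpktIn = s1.mpktIn := by
    intro s1
    split_ifs
    · rfl
    · rfl
    · rfl
    · generalize hs2 : ({ s1 with receiveSet := _, fwdQueue := _ } : St) = s2
      obtain ⟨v, l, h⟩ := scan_frame s2
      rw [h, ← hs2]
  exact h _

lemma receiveAck_mpktIn (m : Msg) (S : Proc) (s : St) :
    (receiveAck m S s).1.mpktIn = s.mpktIn := by
  rcases receiveAck_eq m S s with h | h <;> rw [h]
  · exact checkFlush_mpktIn _
  · rfl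

lemma protPacket_mpktIn (hc : 3 ≤ c.rank) (hm : ¬ c.IsMsg) (S : Proc) (s : St) :
    (protPacket c S s).1.mpktIn = s.mpktIn := by
  cases c with
  | msg m => exact (hm trivial).elim
  | ack m => exact receiveAck_mpktIn m S s
  | ghost v => rfl
  | flush v => exact tryToInstall_mpktIn _
  | donation d => simp [Content.rank] at hc
  | codonation d => simp [Content.rank] at hc

lemma protPacket_fwdQueue (hc : 3 ≤ c.rank) (S : Proc) (s : St) :
    ∀ R m, m ∈ ((protPacket c S s).1.fwdQueue R).getD [] →
      m ∈ (s.fwdQueue R).getD [] ∨ (R = S ∧ c = .msg m) := by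
  intro R m h
  cases c with
  | msg m' =>
    exact ((receiveMessage_evol m' S {m'} rfl s).fwdQueue_sub R m h).imp_right
      fun ⟨h1, h2⟩ => ⟨h1, congrArg _ (Set.mem_singleton_iff.1 h2).symm⟩
  | ack m' =>
    exact .inl (((receiveAck_evol m' S ∅ s).fwdQueue_sub R m h).resolve_right fun h => h.2)
  | ghost v => exact .inl h
  | flush v =>
    exact .inl (((receiveFlush_evol v S ∅ s).fwdQueue_sub R m h).resolve_right fun h => h.2)
  | donation d => simp [Content.rank] at hc
  | codonation d => simp [Content.rank] at hc

end Frames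

namespace Execution

section Early

variable {c : ℕ} (hc : ∀ J, 0 < H.joinView J → c ≤ H.joinView J)
include hc

lemma original_of_lt (h : H.joinView P < c) : H.Original P := by
  by_contra h0
  exact absurd (hc P (Nat.pos_of_ne_zero h0)) (by omega)

lemma early_rank (hH : H.IsHistory) (hk : k ∈ H.channel P Q) (hv : H.eventView (𝔱 k) < c) :
    3 ≤ (H.content k).rank := by
  have hq := queue_mem hH hk
  have hdon : ∀ {P Q k}, k ∈ H.channel P Q → (H.content k).IsDonation →
      c ≤ H.eventView (𝔱 k) := by
    intro P Q k hk hd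
    obtain ⟨h1, -, h2, -⟩ := donation_packet (X := X) hH hk hd
    have hm := trigger_mem (X := X) (queue_mem hH hk)
    rw [h1] at hm ⊢
    rw [hH.eventView_notify hm.1]; exact hc Q (by omega)
  by_contra hr
  cases hcon : H.content k <;> simp [hcon, Content.rank] at hr
  · exact absurd (hdon hk (by rw [hcon]; trivial)) (by omega)
  · obtain ⟨k₀, hk₀, hd, h1, hm, -⟩ := codonation_packet (X := X) hH hk (by rw [hcon]; trivial)
    have := trigger_view_le (X := X) hH hk₀ hm
    have := hdon hk₀ hd
    rw [h1] at hv; omega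

lemma orig_cases (hH : H.IsHistory) {v : ℕ} (hv : v < c) (hk : k ∈ H.channel P Q)
    (hm : H.content k = .msg m) (hT : H.eventView (𝔱 k) ≤ v) :
    ((𝔱 k).isNotify = false ∧ m.orig = P) ∨
    ((𝔱 k).isNotify = true ∧ m.orig ≠ P ∧
      H.deathView m.orig ≤ H.eventView (𝔱 k)) := by
  induction v using Nat.strong_induction_on generalizing P Q k m with
  | _ v ih =>
  have hq := queue_mem hH hk
  have hTm := trigger_mem (X := X) hq
  obtain ⟨ε, h1, h2, h3⟩ := msg_packet (X := X) hH hk (by rw [hm]; trivial)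
  have hε := List.mem_of_getElem? h1
  cases hn : (𝔱 k).isNotify
  · left
    obtain ⟨S, M, s, h⟩ := msg_trigger (X := X) hH hTm (trigger_isTrigger hq) hε h3
    have h4 := (h.evol.eff ε hε).2
    rw [h2, hm] at h4; exact ⟨rfl, (h4.2.1 hn).trans h.self_eq⟩
  right
  refine ⟨rfl, ?_⟩
  have hcase := hH.triggerCase hTm (trigger_isTrigger hq)
  have hlive := live_trigger (X := X) hH hq
  revert hTm hε hcase hlive hn hT
  generalize 𝔱 k = e
  intro hT hTm hε hn hcase hlive
  rcases hcase with
    ⟨k, hk⟩ | ⟨r⟩ | ⟨h0, hh⟩ | ⟨h0, hh⟩ | ⟨J, h1, h2, hv, hn, hh⟩ | ⟨R, i, h0, h1, h2', hv', hn, hh⟩ |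
    ⟨i, h0, hh⟩
  · cases hn
  · cases hn
  · rw [effects, hh] at hε; cases hε
  · exact absurd h3 (first_effects hH P ε hε)
  · rw [effects_joined hh] at hε
    rcases List.mem_cons.1 hε with rfl | hε
    · exact h3.elim
    · exact absurd h3 (checkFlush_not_msg _ _ hε)
  · obtain ⟨e', hc', hp, hi⟩ := exists_pre (X := X) hH hTm trivial (by
      intro h; cases h; exact lt_irrefl _ h1)
    have hs := hc'.eventView_succ hH
    rw [hH.eventView_notify hTm.1] at hT ⊢
    have hE := protRemove_evol R (s := X.pre (.notify i P)) (hp ▸ hi.sound)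
    rw [effects, hh] at hε
    have h4 := (hE.eff ε hε).2
    rw [h2, hm] at h4
    have h5 : m ∈ ((X.pre (.notify i P)).fwdQueue R).getD [] := (h4.2.2 rfl).resolve_right fun h => h
    rw [hp] at h5
    have key : ∀ P e, e ∈ H.eventsAt P → e.IsTrigger → Live H P e → H.eventView e < i →
        ∀ R m, m ∈ ((X.post e).fwdQueue R).getD [] →
          m.orig = R ∨ H.deathView m.orig ≤ H.eventView e := by
      intro P e he ht hl hvi
      refine state_induction (X := X) hH (Φ := fun P e => H.eventView e < i →
        ∀ R m, m ∈ ((X.post e).fwdQueue R).getD [] →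
          m.orig = R ∨ H.deathView m.orig ≤ H.eventView e) ?_ ?_ ?_ ?_ ?_ ?_ he ht hl hvi
      · intro P _ _ hp _ R m h
        rw [hp] at h
        simp only [protStart] at h
        split_ifs at h <;> simp at h
      · intro J e' hJ hm _ _ _ _ h
        rw [hH.eventView_notify hm] at h; exact absurd (hc J hJ) (by omega)
      · intro P e' k hcs hk _ hp _ ih' h R m hR
        have hve := hcs.eventView_eq hH (by simp)
        have hvT := trigger_view_le (X := X) hH hk hcs.right.1
        rw [hp] at hR
        rcases protPacket_fwdQueue (early_rank (X := X) hc hH hk (by omega)) _ _ R m hR with h' | ⟨rfl, h'⟩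
        · rw [hve]; exact ih' (by omega) R m h'
        · rcases ih _ (by omega : H.eventView (Ev.dequeue k) < v) (by omega) hk h' hvT with ⟨-, h6⟩ | ⟨-, -, h6⟩
          · exact .inl h6
          · exact .inr (h6.trans (by exact_mod_cast hvT))
      · intro P e' r hcs _ hp ih' h R m hR
        have hve := hcs.eventView_eq hH (by simp)
        rw [hp] at hR
        rw [hve]
        exact ih' (by omega) R m (((protBroadcast_evol P ∅ (H.body r) (X.post e')).fwdQueue_sub R m
          hR).resolve_right fun h => h.2)
      · intro P e' J hcs hJ _ _ _ _ h
        rw [hH.eventView_notify hcs.right.1] at h; exact absurd (hc J (by omega)) (by omega)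
      · intro P e' R' i' hcs _ _ _ hi' hp ih' h R m hR
        have hve := hcs.eventView_succ hH
        rw [hp] at hR
        rw [hH.eventView_notify hcs.right.1] at h ⊢
        refine (ih' (by omega) R m (((protRemove_evol R' hi'.sound).fwdQueue_sub R m
          hR).resolve_right fun h => h.2)).imp_right fun h => h.trans ?_
        exact_mod_cast (by omega)
    rcases key P e' hc'.left hc'.left_trigger (live_of_lt hH hc'.left hc'.right hc'.lt) (by omega) R m h5
      with h6 | h6
    · rw [h6]
      refine ⟨?_, h0.le⟩
      rintro rfl; exact h2'.ne h0.symm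
    · refine ⟨?_, h6.trans (by exact_mod_cast (by omega))⟩
      intro h7
      rw [h7] at h6; exact absurd (h2'.trans_le h6) (by exact_mod_cast (by omega))
  · exact absurd rfl (hlive i h0)

/-- The counter `x` is the index of a message from `P` that `Q` has dequeued. -/
def LastCount (X : Execution H) (n : Bool) (P Q : Proc) (e : Evt) (x : Count) : Prop :=
  x.cnt n = 0 ∨ ∃ k ∈ H.channel P Q, (H.content k).IsMsg ∧
    (n = true → (X.trigger (H.queuing k)).isNotify = true) ∧ .dequeue k ∈ H.events ∧
    H.le (.dequeue k) e ∧ (X.idx (H.queuing k)).cnt n = x.cnt n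

/-- The early counter of the messages from `P` tells which of them have been dequeued:
`n = true` for the forwarded ones. -/
def Counted (X : Execution H) (n : Bool) (P Q : Proc) (e : Evt) : Prop :=
  ∃ x, (X.post e).mpktIn P = some x ∧ LastCount X n P Q e x ∧
    ∀ k ∈ H.channel P Q, (H.content k).IsMsg →
      (n = true → (X.trigger (H.queuing k)).isNotify = true) →
      ((.dequeue k ∈ H.events ∧ H.le (.dequeue k) e) ↔ (X.idx (H.queuing k)).cnt n ≤ x.cnt n)

lemma dequeue_iff (hH : H.IsConforming) (n : Bool) (hPo : H.Original P) (hQo : H.Original Q)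
    (he : e ∈ H.eventsAt Q) (ht : e.IsTrigger) (hl : Live H Q e) (hv : H.eventView e < c)
    (hP : (H.eventView e : ℕ∞) < H.deathView P) :
    Counted X n P Q e := by
  have hH' := hH.toIsHistory
  have hm := hH'.join_first Q ⟨e, he⟩
  have hm' := notify_at hm.1
  refine hH'.trigger_induction (Φ := fun e => Live H Q e → H.eventView e < c →
    (H.eventView e : ℕ∞) < H.deathView P →
    Counted X n P Q e)
    hm' trivial ?_ ?_ he ht (hm.2 e he) hl hv hP
  · intro _ _ _
    refine ⟨⟨0, 0⟩, ?_, .inl (by cases n <;> rfl), ?_⟩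
    · have hn := hH'.notice_join Q
      have hQ0 : H.joinView Q = 0 := hQo
      have hP0 : P ∈ H.view 0 := hH'.mem_view (le_of_eq hPo) (by
        have := hH'.join_lt_death P
        rwa [show H.joinView P = 0 from hPo] at this)
      rw [hQ0] at hn ⊢
      simp only [post, handle, hn, if_true, protStart]; rw [if_pos hP0]
    · intro k hk hkm hfl
      have h1 := pre_lt_idx (X := X) hH' n hk hkm hfl
      constructor
      · rintro ⟨h2, h3⟩
        have h4 : .dequeue k ∈ H.eventsAt Q := ⟨h2, hk.1, hk.2.2⟩
        have := hH'.process_antisymm Q _ h4 _ hm' h3 (hm.2 _ h4)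
        cases this
      · intro h2
        exfalso
        cases n <;> simp [Count.cnt, Count.total] at h2 h1 <;> omega
  · intro e' e hcs hle ih hl hv hP
    have hmono := hH'.eventView_mono hcs.left.1 hcs.right.1 hcs.lt.1
    have hl' := live_of_lt hH' hcs.left hcs.right hcs.lt
    obtain ⟨x, hx, hlast, hiff⟩ := ih hl' (by omega) (lt_of_le_of_lt (by exact_mod_cast hmono) hP)
    have hpost : X.post e = (handle H e (X.post e')).1 := by rw [← X.pre_eq hcs]; rfl
    have hlast' : ∀ {y : Count}, y.cnt n = x.cnt n → LastCount X n P Q e y := by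
      intro y hy
      refine hlast.imp (fun h => hy.trans h) ?_
      rintro ⟨k, h1, h2, h3, h4, h5, h6⟩
      exact ⟨k, h1, h2, h3, h4, hH'.le_trans _ h4 _ hcs.left.1 _ hcs.right.1 h5 hcs.lt.1, h6.trans hy.symm⟩
    have hback : ∀ k ∈ H.channel P Q, e ≠ .dequeue k →
        ((.dequeue k ∈ H.events ∧ H.le (.dequeue k) e) ↔
          (.dequeue k ∈ H.events ∧ H.le (.dequeue k) e')) := by
      intro k hk hne
      refine ⟨fun ⟨h1, h2⟩ => ⟨h1, ?_⟩, fun ⟨h1, h2⟩ =>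
        ⟨h1, hH'.le_trans _ h1 _ hcs.left.1 _ hcs.right.1 h2 hcs.lt.1⟩⟩
      have h3 : .dequeue k ∈ H.eventsAt Q := ⟨h1, hk.1, hk.2.2⟩
      exact hcs.le_left _ h3 trivial (hH'.lt_of_ne h3 hcs.right h2 (Ne.symm hne))
    have hsame : (X.post e).mpktIn P = (X.post e').mpktIn P →
        (∀ k ∈ H.channel P Q, (H.content k).IsMsg →
          (n = true → (𝔱 k).isNotify = true) → e ≠ .dequeue k) →
        Counted X n P Q e := by
      intro h1 h2
      exact ⟨x, h1.trans hx, hlast' rfl, fun k hk hkm hfl =>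
        (hback k hk (h2 k hk hkm hfl)).trans (hiff k hk hkm hfl)⟩
    rcases hH'.triggerCase hcs.right hcs.right_trigger with
      ⟨k, hk⟩ | ⟨r⟩ | ⟨h, hh⟩ | ⟨h, hh⟩ | ⟨J, h1, h2, hv', hn, hh⟩ | ⟨R, i, h, h1, h2, hv', hn, hh⟩ |
      ⟨i, h, hh⟩
    · have hvT := trigger_view_le (X := X) hH' hk hcs.right.1
      have hrank := early_rank (X := X) hc hH' hk (by omega)
      by_cases hS : H.source k = P
      swap
      · refine hsame ?_ ?_
        · rw [hpost]
          exact (protPacket_evol (H.content k) (H.source k) (X.post e')).mpktIn_eq P (Ne.symm hS)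
        · rintro k' hk' - - h
          cases h
          exact hS hk'.2.1
      rw [hS] at hk
      by_cases hkm : (H.content k).IsMsg
      swap
      · refine hsame ?_ ?_
        · rw [hpost, handle, protPacket_mpktIn hrank hkm]
        · rintro k' hk' hm' - h
          cases h
          exact hkm hm'
      obtain ⟨m, hmc⟩ : ∃ m, H.content k = .msg m := by
        cases hcc : H.content k <;> rw [hcc] at hkm <;> first | exact hkm.elim | exact ⟨_, rfl⟩
      have hin : (X.post (.dequeue k)).mpktIn P =
          some (x.plus (𝔱 k).isNotify 1) := by
        rw [hpost, handle, hmc, hS]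
        simp only [protPacket]
        rw [receiveMessage_mpktIn, Function.update_self, hx, Option.map_some]
        rcases orig_cases (X := X) hc hH' hv hk hmc hvT with ⟨h1, h2⟩ | ⟨h1, h2, -⟩
        · rw [h1, if_pos h2]; rfl
        · rw [h1, if_neg h2]; rfl
      by_cases hfl : n = true → (𝔱 k).isNotify = true
      swap
      · refine ⟨_, hin, hlast' (by rw [Count.cnt_plus, if_neg hfl]), fun k' hk' hm' hfl' => ?_⟩
        rw [Count.cnt_plus, if_neg hfl]
        refine (hback k' hk' ?_).trans (hiff k' hk' hm' hfl')
        intro h; cases h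
        exact hfl hfl'
      have hnot : ¬ (.dequeue k ∈ H.events ∧ H.le (.dequeue k) e') := fun h => hcs.lt.2 h.2
      rw [hiff k hk hkm hfl] at hnot
      have hdk := hcs.right.1
      have hQd : ∀ f, H.le f (𝔱 k) → f ∈ H.eventsAt P →
          Q ∈ H.view (H.eventView f) := by
        intro f hf hfP
        refine hH'.mem_view (le_of_eq_of_le hQo (Nat.zero_le _)) (lt_of_le_of_lt ?_
          (hH'.eventView_lt_deathView hcs.right (by simp)))
        exact_mod_cast (hH'.eventView_mono hfP.1 (trigger_mem (queue_mem hH' hk)).1 hf).trans hvT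
      have hidx : (X.idx (H.queuing k)).cnt n = x.cnt n + 1 := by
        by_contra hne
        have hq := queue_mem hH' hk
        obtain ⟨k₂, hk₂, hm₂, hle₂, hi₂, hf₂⟩ := exists_idx (X := X) hH' n hPo (trigger_mem hq)
          (trigger_isTrigger hq) (live_trigger hH' hq) (i := x.cnt n + 1) (by omega)
          ((by omega : _ ≤ (X.idx (H.queuing k)).cnt n).trans (idx_le_post hH' n hk hkm)) hQd
        have hlt : H.lt (.queue (H.queuing k₂)) (.queue (H.queuing k)) := by
          rcases hH'.trichotomy (queue_mem hH' hk₂) hq with h | h | h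
          · exact h
          · rw [Ev.queue.inj h] at hi₂; omega
          · have := idx_lt (X := X) hH' n hk hkm hk₂ hm₂ hf₂ h
            omega
        obtain ⟨h5, h6⟩ := hH'.packet_order P Q k₂ hk₂ k hk hlt hdk
        have h7 := hcs.le_left _ ⟨h5, hk₂.1, hk₂.2.2⟩ trivial h6
        have := (hiff k₂ hk₂ hm₂ hf₂).1 ⟨h5, h7⟩
        omega
      refine ⟨_, hin, .inr ⟨k, hk, hkm, hfl, hdk, hH'.le_refl _ hdk,
        by rw [Count.cnt_plus, if_pos hfl, hidx]⟩, fun k' hk' hm' hfl' => ?_⟩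
      rw [Count.cnt_plus, if_pos hfl]
      by_cases hkk : k' = k
      · subst hkk; exact ⟨fun _ => hidx.le, fun _ => ⟨hdk, hH'.le_refl _ hdk⟩⟩
      rw [hback k' hk' (fun h => hkk (Ev.dequeue.inj h).symm), hiff k' hk' hm' hfl']
      refine ⟨fun h => by omega, fun h => ?_⟩
      rcases Nat.lt_or_ge (x.cnt n) ((X.idx (H.queuing k')).cnt n) with h8 | h8
      · exfalso
        have h9 := queuing_eq_of_idx (X := X) hH' n hk' hm' hk hkm hfl' hfl (by omega)
        exact hkk (hH'.multicast_target k' hk'.1 k hk.1 h9 (hk'.2.2.trans hk.2.2.symm))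
      · exact h8
    · refine hsame ?_ (by simp)
      rw [hpost, handle, protBroadcast_mpktIn]
    · exact absurd (hcs.joinView_lt hH') (by omega)
    · exact absurd (hcs.joinView_lt hH') (lt_irrefl _)
    · rw [hH'.eventView_notify hcs.right.1] at hv; exact absurd (hc J (by omega)) (by omega)
    · have hR : P ≠ R := by
        rintro rfl
        rw [hH'.eventView_notify hcs.right.1, h] at hP; exact lt_irrefl _ hP
      refine hsame ?_ (by simp)
      rw [hpost, hh, protRemove_eq, (finishRemove_frame _ _).2]
      simp only [beforeForward, Function.update_of_ne hR]
    · exact absurd rfl (hl i h)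

end Early

end Execution

open Execution

/-- `G` is the first process that joins in the transactional history `H`. -/
structure Critical (H : Computation Proc Pkt Que Req Cnt Body) (G : Proc) : Prop where
  trans : H.IsTransactional
  joins : 0 < H.joinView G
  first : ∀ J, 0 < H.joinView J → H.joinView G ≤ H.joinView J

local notation "𝔠" => Computation.joinView H G
local notation "𝔇" => Computation.parent H G

namespace Critical

variable (C : Critical H G)
include C

lemma conf : H.IsConforming := C.trans.toIsConforming
lemma hist : H.IsHistory := C.trans.toIsConforming.toIsHistory

lemma original_of_lt (h : H.joinView P < 𝔠) : H.Original P := Execution.original_of_lt C.first h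

lemma lt_numView : (𝔠 : ℕ∞) < H.numView :=
  (C.hist.join_lt_death G).trans_le (C.hist.deathView_le G)

lemma not_original : ¬ H.Original G := C.joins.ne'

lemma ne_of_original (h : H.Original P) : P ≠ G := by rintro rfl; exact C.not_original h

lemma lt_of_original (h : H.Original P) : H.joinView P < 𝔠 := by
  rw [show H.joinView P = 0 from h]; exact C.joins

lemma joinView_eq (h : H.joinView J = 𝔠) : J = G := C.hist.joinView_inj C.joins h

lemma death_ne (P : Proc) : H.deathView P ≠ (𝔠 : ℕ) := C.hist.deathView_ne_joinView C.joins

lemma parent_spec : H.Original 𝔇 ∧ (𝔠 : ℕ∞) < H.deathView 𝔇 := by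
  have h := (C.hist.mem_view_iff (i := 𝔠 - 1)
    (lt_of_le_of_lt (by exact_mod_cast Nat.sub_le _ _) C.lt_numView) 𝔇).1
    (C.hist.parent_member G C.joins)
  have hj := C.joins
  refine ⟨C.original_of_lt (by omega), lt_of_le_of_ne ?_ (C.death_ne _).symm⟩
  have h1 : ((𝔠 - 1 : ℕ) : ℕ∞) + 1 ≤ H.deathView 𝔇 := Order.add_one_le_of_lt h.2
  have h2 : ((𝔠 - 1 : ℕ) : ℕ∞) + 1 = 𝔠 := by exact_mod_cast (by omega : 𝔠 - 1 + 1 = 𝔠)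
  rwa [h2] at h1

lemma notify_mem (h1 : H.joinView P ≤ i) (h2 : (i : ℕ∞) < H.deathView P) :
    .notify i P ∈ H.events := by
  refine C.trans.all_notices i P ?_
  rcases h1.eq_or_lt with rfl | h1
  · rw [C.hist.notice_join]; simp
  · rcases C.hist.notice_cases h1 h2 with ⟨J, -, h, -⟩ | ⟨R, -, h, -⟩ <;> rw [h] <;> simp

lemma notify_critical (ho : H.Original P) (hd : (𝔠 : ℕ∞) < H.deathView P) :
    .notify 𝔠 P ∈ H.eventsAt P := notify_at (C.notify_mem (C.lt_of_original ho).le hd)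

lemma notify_new : .notify 𝔠 G ∈ H.eventsAt G :=
  notify_at (C.notify_mem le_rfl (C.hist.join_lt_death G))

end Critical

lemma preCritical_iff (hH : H.IsHistory) (G : Proc) (he : e ∈ H.eventsAt P) :
    PreCritical H G e ↔ H.eventView e < (H.joinView G) := by
  cases e with
  | notify i Q => rw [hH.eventView_notify he.1]; rfl
  | _ => rfl

namespace Execution

variable (hH : H.IsHistory)
include hH

lemma ack_of_msg (hk : k ∈ H.channel P Q) (hm : H.content k = .msg m) (hd : .dequeue k ∈ H.events) :
    ∃ a ∈ H.channel Q P, H.content a = .ack m ∧ 𝔱 a = .dequeue k := by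
  have he : .dequeue k ∈ H.eventsAt Q := ⟨hd, hk.1, hk.2.2⟩
  have heff : X.effects (.dequeue k) = [⟨.ack m, {P}, .main⟩] := by
    simp only [effects, handle, hm, hk.2.1, protPacket, receiveMessage_effects]
  obtain ⟨a, ha, h1, -, h2⟩ := X.exists_packet hH (Q := P) he trivial (n := 0) (by rw [heff]; rfl)
    (Set.mem_singleton _)
  exact ⟨a, ha, h2, h1⟩

lemma clone_packet {Q' : Proc} (ho : H.Original P) (hk : k ∈ H.channel P Q)
    (hm : (H.content k).IsMsg) (hQ : Q' ∈ H.view (H.eventView (𝔱 k))) :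
    ∃ k' ∈ H.channel P Q', H.queuing k' = H.queuing k ∧ H.content k' = H.content k := by
  have hq := queue_mem hH hk
  obtain ⟨ε, h1, h2, h3⟩ := msg_packet hH hk hm
  have hT := msg_targets hH ho (trigger_mem hq) (trigger_isTrigger hq)
    (List.mem_of_getElem? h1) h3 hQ
  obtain ⟨k', hk', h4, h5, h6⟩ := X.exists_packet hH (trigger_mem hq) (trigger_isTrigger hq) h1 hT
  exact ⟨k', hk', X.effect_inj _ _ (queue_mem hH hk').1 hq.1 h4 h5, h6.trans h2⟩

lemma trigger_lt_of_ack {a : Pkt} (hk : k ∈ H.channel P Q) (ha : a ∈ H.channel Q P)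
    (ht : 𝔱 a = .dequeue k) (hd : .dequeue a ∈ H.events) : H.lt (𝔱 k) (.dequeue a) := by
  have hq := queue_mem hH hk
  have hqa := queue_mem hH ha
  have hdk := ht ▸ trigger_mem (X := X) hqa
  have h1 := hH.lt_trans' (trigger_mem (X := X) hq).1 hq.1 hdk.1 (trigger_lt hq)
    (hH.packet_dequeued k hdk.1).2
  have h2 := hH.lt_trans' hdk.1 hqa.1 hd (ht ▸ trigger_lt (X := X) hqa) (hH.packet_dequeued a hd).2
  exact hH.lt_trans' (trigger_mem hq).1 hdk.1 hd h1 h2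

end Execution

namespace Critical

variable (C : Critical H G)
include C

lemma clean (he : e ∈ H.eventsAt P) (ht : e.IsTrigger) (hl : Live H P e) (hv : H.eventView e < 𝔠) :
    (X.post e).mpktIn G = none ∧ ∀ r ∈ (X.post e).waitSet, r.iset G = none := by
  have hH := C.hist
  refine state_induction (X := X) hH (Φ := fun P e => H.eventView e < 𝔠 →
    (X.post e).mpktIn G = none ∧ ∀ r ∈ (X.post e).waitSet, r.iset G = none)
    ?_ ?_ ?_ ?_ ?_ ?_ he ht hl hv
  · intro P h0 _ hp _
    rw [hp]
    refine ⟨?_, by simp [protStart, State.waitSet]⟩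
    simp only [protStart]
    rw [if_neg]
    intro hG
    have := ((hH.mem_view_iff (by exact_mod_cast hH.numView_pos) G).1 hG).1
    have := C.joins
    omega
  · intro J e' hJ hm _ _ _ _ h
    rw [hH.eventView_notify hm] at h; exact absurd (C.first J hJ) (by omega)
  · intro P e' k hc hk _ hp _ ih hv
    have hve := hc.eventView_eq hH (by simp)
    obtain ⟨h1, h2⟩ := ih (by omega)
    have hS : G ≠ H.source k := by
      intro h
      have h3 := hH.joinView_le_eventView (trigger_mem (X := X) (queue_mem hH hk))
      have h4 := trigger_view_le (X := X) hH hk hc.right.1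
      rw [← h] at h3; omega
    have hE := protPacket_evol (H.content k) (H.source k) (X.post e')
    rw [hp]; exact ⟨by rw [hE.mpktIn_eq G hS, h1], hE.clean G hS h1 h2⟩
  · intro P e' r hc _ hp ih hv
    have hve := hc.eventView_eq hH (by simp)
    obtain ⟨h1, h2⟩ := ih (by omega)
    have hP : G ≠ P := by
      rintro rfl
      have h3 := hH.joinView_le_eventView hc.right
      omega
    have hE := protBroadcast_evol P ∅ (H.body r) (X.post e')
    rw [hp]; exact ⟨by rw [hE.mpktIn_eq G hP, h1], hE.clean G hP h1 h2⟩
  · intro P e' J hc hJ _ _ _ _ h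
    rw [hH.eventView_notify hc.right.1] at h; exact absurd (C.first J (by omega)) (by omega)
  · intro P e' R i hc _ _ hR hi hp ih hv
    rw [hH.eventView_notify hc.right.1] at hv
    have hs := hc.eventView_succ hH
    obtain ⟨h1, h2⟩ := ih (by omega)
    have hRG : G ≠ R := by
      rintro rfl
      have h3 := hH.join_lt_death G
      rw [hR] at h3; exact absurd (by exact_mod_cast h3) (not_lt.2 hv.le)
    have hE := protRemove_evol R hi.sound
    have h3 : (beforeForward R (X.post e')).mpktIn G = none := by
      simp only [beforeForward, Function.update_of_ne hRG, h1]
    have h4 : ∀ r ∈ (beforeForward R (X.post e')).waitSet, r.iset G = none := by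
      intro r hr
      have : ∃ r0 ∈ (X.post e').waitSet, r0.Desc ∅ r := by
        rcases List.mem_append.1 hr with hr | hr
        · obtain ⟨r0, h, hd⟩ := (beforeForward_shrink R (X.post e')).1.desc r hr
          exact ⟨r0, List.mem_append_left _ h, hd⟩
        · obtain ⟨r0, h, hd⟩ := (beforeForward_shrink R (X.post e')).2.desc r hr
          exact ⟨r0, List.mem_append_right _ h, hd⟩
      obtain ⟨r0, hr0, hd⟩ := this
      by_contra hne
      have := hd.iset G (by simp) (Option.isSome_iff_ne_none.2 hne)
      rw [h2 r0 hr0] at this; exact absurd this (by simp)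
    rw [hp]; exact ⟨by rw [hE.mpktIn_eq G hRG, h3], hE.clean G hRG h3 h4⟩

lemma acked (hQ : H.Original Q) (he : e ∈ H.eventsAt P) (ht : e.IsTrigger) (hl : Live H P e)
    (hv : H.eventView e < 𝔠) (hr : r ∈ (X.post e).waitSet) {a : Pkt} (hk : k ∈ H.channel P Q)
    (hm : H.content k = .msg r.msg) (hidx : (X.idx (H.queuing k)).total = r.index.total)
    (ha : a ∈ H.channel Q P) (hta : 𝔱 a = .dequeue k) (hca : H.content a = .ack r.msg)
    (hda : .dequeue a ∈ H.events) (hle : H.le (.dequeue a) e) : r.iset Q = none := by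
  have hH := C.hist
  have hm0 := hH.join_first P ⟨e, he⟩
  have ha' : .dequeue a ∈ H.eventsAt P := ⟨hda, ha.1, ha.2.2⟩
  refine hH.trigger_induction (Φ := fun e => Live H P e → H.eventView e < 𝔠 →
    ∀ r ∈ (X.post e).waitSet, H.content k = .msg r.msg →
    (X.idx (H.queuing k)).total = r.index.total → H.content a = .ack r.msg → H.le (.dequeue a) e →
    r.iset Q = none) (notify_at hm0.1) trivial ?_ ?_ he ht (hm0.2 e he) hl hv r hr hm hidx
    hca hle
  · intro _ _ r _ _ _ _ h
    have := hH.process_antisymm P _ ha' _ (notify_at hm0.1) h (hm0.2 _ ha')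
    cases this
  · intro e' f hc _ ih hl hv r hr hm hidx hca hle
    have hPo := C.original_of_lt ((hH.joinView_le_eventView hc.right).trans_lt hv)
    by_cases hfa : f = .dequeue a
    · subst hfa
      have hpost : X.post (.dequeue a) = (receiveAck r.msg Q (X.pre (.dequeue a))).1 := by
        simp only [post, handle, hca, ha.2.1, protPacket]
      rw [hpost] at hr; exact receiveAck_discard _ _ _ hr rfl
    have hle' := hc.le_left _ ha' trivial (hH.lt_of_ne ha' hc.right hle (Ne.symm hfa))
    have hmono := hH.eventView_mono hc.left.1 hc.right.1 hc.lt.1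
    have hne : f ≠ .notify (H.joinView P) P := by
      rintro rfl; exact absurd (hc.joinView_lt hH) (lt_irrefl _)
    obtain ⟨hb, hf⟩ := provenance_step hH hc.right hc.right_trigger hl hne
    have hcase : (∃ r0 ∈ (X.pre f).waitSet, WaitRec.Desc {J | f = .notify (H.joinView J) P} r0 r) ∨
        Created X P f r := by
      rcases List.mem_append.1 hr with hr | hr
      · rcases hb r hr with ⟨r0, h1, h2⟩ | ⟨-, h⟩
        · exact .inl ⟨r0, List.mem_append_left _ h1, h2⟩
        · exact .inr h
      · rcases hf r hr with ⟨r0, h1, h2⟩ | ⟨-, h⟩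
        · exact .inl ⟨r0, List.mem_append_right _ h1, h2⟩
        · exact .inr h
    rcases hcase with ⟨r0, hr0, hd⟩ | ⟨kn, hkn, htn, hcn, hin⟩
    · rw [X.pre_eq hc] at hr0
      have h0 := ih (live_of_lt hH hc.left hc.right hc.lt) (by omega) r0 hr0 (by rw [hm, hd.msg])
        (by rw [hidx, hd.index]) (by rw [hca, hd.msg]) hle'
      by_contra hsome
      have := hd.iset Q ?_ (Option.isSome_iff_ne_none.2 hsome)
      · rw [h0] at this; exact absurd this (by simp)
      · intro hJ
        apply hne
        rw [show f = .notify (H.joinView Q) P from hJ, show H.joinView Q = 0 from hQ,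
          show H.joinView P = 0 from hPo]
    · exfalso
      have hq := queuing_eq_of_idx hH false hk (by rw [hm]; trivial) hkn
        (by rw [hcn]; trivial) (by simp) (by simp) (by
          show (X.idx (H.queuing k)).total = (X.idx (H.queuing kn)).total
          rw [hin, hidx])
      have h1 := trigger_lt_of_ack hH hk ha hta hda
      rw [hq, htn] at h1; exact h1.2 hle

end Critical

lemma length_add_length_le {α β : Type*} {S : Set α} (hS : S.Finite) {l₁ l₂ : List β} {κ : β → ℕ}
    (h₁ : (l₁.map κ).Nodup) (h₂ : (l₂.map κ).Nodup) {R₁ R₂ : ℕ → α → Prop}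
    (e₁ : ∀ r ∈ l₁, ∃ q ∈ S, R₁ (κ r) q) (e₂ : ∀ r ∈ l₂, ∃ q ∈ S, R₂ (κ r) q)
    (f₁ : ∀ n n' q, R₁ n q → R₁ n' q → n = n') (f₂ : ∀ n n' q, R₂ n q → R₂ n' q → n = n')
    (d : ∀ n n' q, R₁ n q → R₂ n' q → False) : l₁.length + l₂.length ≤ S.ncard := by
  have key : ∀ {l : List β} {R : ℕ → α → Prop}, (l.map κ).Nodup → (∀ r ∈ l, ∃ q ∈ S, R (κ r) q) →
      (∀ n n' q, R n q → R n' q → n = n') → l.length ≤ {q | q ∈ S ∧ ∃ n, R n q}.ncard := by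
    intro l R h e f
    have hfin : {q | q ∈ S ∧ ∃ n, R n q}.Finite := hS.subset fun q h => h.1
    rcases isEmpty_or_nonempty α with hα | hα
    · rcases l with _ | ⟨r, l⟩
      · exact Nat.zero_le _
      · exact hα.elim (e r (by simp)).choose
    choose! g hg using e
    have hnd : (l.map g).Nodup := by
      have hp := List.pairwise_map.1 h
      refine List.pairwise_map.2 ((List.Pairwise.and_mem.1 hp).imp ?_)
      rintro a b ⟨ha, hb, hne⟩ hab; exact hne (f _ _ _ (hg a ha).2 (hab ▸ (hg b hb).2))
    rw [← List.length_map (f := g), ← List.toFinset_card_of_nodup hnd, ← Set.ncard_coe_finset]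
    refine Set.ncard_le_ncard ?_ hfin
    intro q hq
    obtain ⟨r, hr, rfl⟩ := List.mem_map.1 (List.mem_toFinset.1 hq)
    exact ⟨(hg r hr).1, _, (hg r hr).2⟩
  have hdis : Disjoint {q | q ∈ S ∧ ∃ n, R₁ n q} {q | q ∈ S ∧ ∃ n, R₂ n q} := by
    rw [Set.disjoint_left]
    rintro q ⟨-, n, h⟩ ⟨-, n', h'⟩; exact d n n' q h h'
  calc _ ≤ {q | q ∈ S ∧ ∃ n, R₁ n q}.ncard + {q | q ∈ S ∧ ∃ n, R₂ n q}.ncard :=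
        add_le_add (key h₁ e₁ f₁) (key h₂ e₂ f₂)
    _ = ({q | q ∈ S ∧ ∃ n, R₁ n q} ∪ {q | q ∈ S ∧ ∃ n, R₂ n q}).ncard :=
        (Set.ncard_union_eq hdis (hS.subset fun q h => h.1) (hS.subset fun q h => h.1)).symm
    _ ≤ S.ncard := Set.ncard_le_ncard (by rintro q (h | h) <;> exact h.1) hS

lemma exists_isNth {S : Set Que} (hS : S.Finite) (htr : ∀ a ∈ S, ∀ b ∈ S, ∀ c ∈ S, H.lt (.queue a) (.queue b) → H.lt (.queue b) (.queue c) →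
      H.lt (.queue a) (.queue c)) (htot : ∀ a ∈ S, ∀ b ∈ S, a = b ∨ H.lt (.queue a) (.queue b) ∨ H.lt (.queue b) (.queue a)) (hn : n < S.ncard) : ∃ q, IsNth H S n q := by
  let g : Que → ℕ := fun q => {q' | q' ∈ S ∧ H.lt (.queue q') (.queue q)}.ncard
  have hfin : ∀ q, {q' | q' ∈ S ∧ H.lt (.queue q') (.queue q)}.Finite := fun q =>
    hS.subset fun q h => h.1
  have hmono : ∀ a ∈ S, ∀ b ∈ S, H.lt (.queue a) (.queue b) → g a < g b := by
    intro a ha b hb hab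
    refine Set.ncard_lt_ncard ⟨fun q hq => ⟨hq.1, htr q hq.1 a ha b hb hq.2 hab⟩, fun h => ?_⟩ (hfin b)
    have := (h (show a ∈ {q' | q' ∈ S ∧ H.lt (.queue q') (.queue b)} from ⟨ha, hab⟩)).2
    exact this.2 this.1
  have hlt : ∀ a ∈ S, g a < S.ncard := by
    intro a ha
    refine Set.ncard_lt_ncard ⟨fun q hq => hq.1, fun h => ?_⟩ hS
    have := (h ha).2
    exact this.2 this.1
  have hinj : Set.InjOn g (hS.toFinset : Set Que) := by
    intro a ha b hb hab
    rw [Set.Finite.coe_toFinset] at ha hb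
    rcases htot a ha b hb with h | h | h
    · exact h
    · exact absurd (hmono a ha b hb h) (by omega)
    · exact absurd (hmono b hb a ha h) (by omega)
  have hsurj := Finset.surjOn_of_injOn_of_card_le (s := hS.toFinset) (t := Finset.range S.ncard) g
    (fun a ha => by
      have : a ∈ S := by simpa using ha
      simpa using hlt a this) hinj (by rw [Finset.card_range, Set.ncard_eq_toFinset_card S hS])
  obtain ⟨q, hq, hgq⟩ := hsurj (by simpa using hn : n ∈ (Finset.range S.ncard : Set ℕ))
  exact ⟨q, by simpa using hq, hfin q, hgq⟩

namespace Critical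

variable (C : Critical H G)
include C

lemma exists_last (X : Execution H) (ho : H.Original P) (hd : (𝔠 : ℕ∞) < H.deathView P) :
    ∃ e, H.Consec P e (.notify 𝔠 P) ∧ X.pre (.notify 𝔠 P) = X.post e ∧
      StateInv X P e ∧ Live H P e ∧ H.eventView e < 𝔠 := by
  have hm := C.notify_critical ho hd
  obtain ⟨e, h1, h2, h3⟩ := exists_pre C.hist hm trivial (by
    intro h; injection h with h; exact absurd (C.lt_of_original ho) (by omega))
  exact ⟨e, h1, h2, h3, live_of_lt C.hist h1.left h1.right h1.lt, by
    have := h1.eventView_succ C.hist; omega⟩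

lemma timely_iff (X : Execution H) (hP : H.Original P) (hQ : H.Original Q)
    (hdP : (𝔠 : ℕ∞) < H.deathView P) (hdQ : (𝔠 : ℕ∞) < H.deathView Q) :
    ∃ x, (X.pre (.notify 𝔠 Q)).mpktIn P = some x ∧ ∀ n, (∀ k ∈ H.channel P Q, (H.content k).IsMsg →
        (n = true → (X.trigger (H.queuing k)).isNotify = true) →
        ((.dequeue k ∈ H.events ∧ PreCritical H G (.dequeue k)) ↔
          (X.idx (H.queuing k)).cnt n ≤ x.cnt n)) ∧
      x.cnt n ≤ (X.pre (.notify 𝔠 P)).mpktOut.cnt n := by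
  have hH := C.hist
  obtain ⟨e, hc, hp, hi, hl, hv⟩ := C.exists_last X hQ hdQ
  obtain ⟨eP, hcP, hpP, -, hlP, hvP⟩ := C.exists_last X hP hdP
  have hdv : (H.eventView e : ℕ∞) < H.deathView P := lt_trans (by exact_mod_cast hv) hdP
  have hle : ∀ k ∈ H.channel P Q, (.dequeue k ∈ H.events ∧ H.le (.dequeue k) e) ↔
      (.dequeue k ∈ H.events ∧ PreCritical H G (.dequeue k)) := by
    intro k hk
    refine and_congr_right fun hdk => ?_
    have hke : .dequeue k ∈ H.eventsAt Q := ⟨hdk, hk.1, hk.2.2⟩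
    rw [preCritical_iff hH G hke, ← hH.lt_notify_iff hke hc.right.1]
    exact ⟨fun h => hH.lt_of_le_of_lt' hdk hc.left.1 hc.right.1 h hc.lt,
      fun h => hc.le_left _ hke trivial h⟩
  obtain ⟨x, hx, -⟩ := dequeue_iff (X := X) C.first C.conf false hP hQ hc.left hc.left_trigger hl hv hdv
  refine ⟨x, hp ▸ hx, fun n => ?_⟩
  obtain ⟨y, hy, hlast, hiff⟩ :=
    dequeue_iff (X := X) C.first C.conf n hP hQ hc.left hc.left_trigger hl hv hdv
  obtain rfl : x = y := Option.some.inj (hx.symm.trans hy)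
  refine ⟨fun k hk hm hfl => (hle k hk).symm.trans (hiff k hk hm hfl), ?_⟩
  rcases hlast with h | ⟨k, hk, hm, hfl, hdk, hle', hidx⟩
  · rw [h]; exact Nat.zero_le _
  · rw [← hidx]
    have hq := queue_mem hH hk
    have hT := trigger_mem (X := X) hq
    refine idx_le_pre hH n hk hm hcP.right trivial ((hH.lt_notify_iff hT hcP.right.1).2 ?_)
    exact ((trigger_view_le (X := X) hH hk hdk).trans (hH.eventView_mono hdk hc.left.1 hle')).trans_lt hv

lemma early_record (X : Execution H) (hP : H.Original P) (hQ : H.Original Q)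
    (hdP : (𝔠 : ℕ∞) < H.deathView P) (hdQ : (𝔠 : ℕ∞) < H.deathView Q)
    (hr : r ∈ (X.pre (.notify 𝔠 P)).waitSet) :
    ∃ k ∈ H.channel P Q, H.content k = .msg r.msg ∧ X.idx (H.queuing k) = r.index ∧
      H.eventView (X.trigger (H.queuing k)) < 𝔠 ∧ (r ∈ (X.pre (.notify 𝔠 P)).fwdWaitSet →
        (X.trigger (H.queuing k)).isNotify = true) := by
  have hH := C.hist
  obtain ⟨e, hc, hp, hi, hl, hv⟩ := C.exists_last X hP hdP
  have hm0 := hH.join_first P ⟨e, hc.left⟩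
  have h0 : (X.post (.notify (H.joinView P) P)).waitSet = [] := by
    have hn := hH.notice_join P
    rw [show H.joinView P = 0 from hP] at hn ⊢
    simp only [post, handle, hn]; rfl
  have h0' := List.append_eq_nil_iff.1 h0
  obtain ⟨hb, hf⟩ := provenance hH (notify_at hm0.1) trivial hc.left
    hc.left_trigger (hm0.2 e hc.left) hl
  rw [h0'.1] at hb
  rw [h0'.2] at hf
  rw [hp] at hr ⊢
  have key : ∀ {g}, H.le g e → Created X P g r →
      ∃ k ∈ H.channel P Q, H.content k = .msg r.msg ∧ X.idx (H.queuing k) = r.index ∧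
      H.eventView (X.trigger (H.queuing k)) < 𝔠 ∧ X.trigger (H.queuing k) = g := by
    rintro g hge ⟨k, hk, rfl, h2, h3⟩
    have hvg := (hH.eventView_mono (trigger_mem (queue_mem hH hk)).1 hc.left.1 hge).trans_lt hv
    obtain ⟨k', hk', h4, h5⟩ := clone_packet (Q' := Q) hH hP hk (by rw [h2]; trivial)
      (hH.mem_view (le_of_eq_of_le hQ (Nat.zero_le _)) (lt_trans (by exact_mod_cast hvg) hdQ))
    exact ⟨k', hk', h5.trans h2, by rw [h4, h3], by rw [h4]; exact hvg, by rw [h4]⟩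
  have hfwd : r ∈ (X.post e).fwdWaitSet → ∃ k ∈ H.channel P Q, H.content k = .msg r.msg ∧
      X.idx (H.queuing k) = r.index ∧ H.eventView (X.trigger (H.queuing k)) < 𝔠 ∧
      (X.trigger (H.queuing k)).isNotify = true := by
    intro h
    rcases hf r h with ⟨_, h, -⟩ | ⟨g, -, h2, h3, h4⟩
    · cases h
    · obtain ⟨k, a, b, c, d, rfl⟩ := key h2 h4
      exact ⟨k, a, b, c, d, h3⟩
  by_cases hrf : r ∈ (X.post e).fwdWaitSet
  · obtain ⟨k, a, b, c, d, h⟩ := hfwd hrf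
    exact ⟨k, a, b, c, d, fun _ => h⟩
  · rcases hb r ((List.mem_append.1 hr).resolve_right hrf) with ⟨_, h, -⟩ | ⟨g, -, h2, h3, h4⟩
    · cases h
    · obtain ⟨k, a, b, c, d, -⟩ := key h2 h4
      exact ⟨k, a, b, c, d, fun h => absurd h hrf⟩

lemma untimely_ack (X : Execution H) (hP : H.Original P) (hQ : H.Original Q)
    (hdP : (𝔠 : ℕ∞) < H.deathView P) (hr : r ∈ (X.pre (.notify 𝔠 P)).waitSet)
    (hs : (r.iset Q).isSome) (hk : k ∈ H.channel P Q) (hm : H.content k = .msg r.msg)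
    (hi : X.idx (H.queuing k) = r.index) (hd : .dequeue k ∈ H.events)
    (hpc : PreCritical H G (.dequeue k)) :
    ∃ a ∈ H.channel Q P, H.content a = .ack r.msg ∧ X.trigger (H.queuing a) = .dequeue k ∧
      Untimely H G a := by
  have hH := C.hist
  obtain ⟨a, ha, hca, hta⟩ := ack_of_msg hH hk hm hd
  have hqa := queue_mem hH ha
  refine ⟨a, ha, hca, hta, ha.1, ?_, ?_⟩
  · rw [preCritical_iff hH G hqa, eventView_queue hH hqa, hta]; exact hpc
  · rintro ⟨hda, hpa⟩
    have hae : .dequeue a ∈ H.eventsAt P := ⟨hda, ha.1, ha.2.2⟩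
    obtain ⟨e, hc, hp, -, hl, hv⟩ := C.exists_last X hP hdP
    rw [preCritical_iff hH G hae, ← hH.lt_notify_iff hae hc.right.1] at hpa
    rw [hp] at hr
    have := C.acked hQ hc.left hc.left_trigger hl hv hr hk hm (by rw [hi]) ha hta hca hda
      (hc.le_left _ hae trivial hpa)
    rw [this] at hs; cases hs

/-- The records that `G` may have. -/
lemma new_record (X : Execution H) (hf : f ∈ H.eventsAt G) (ht : f.IsTrigger)
    (hne : f ≠ .notify 𝔠 G) (hr : r ∈ (X.pre f).waitSet) :
    (∃ r₀ ∈ (X.pre (.notify 𝔠 𝔇)).fwdWaitSet, r.msg = r₀.msg ∧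
      r.index.total = r₀.index.f ∧ ∀ Q, H.Original Q → (r.iset Q).isSome → (r₀.iset Q).isSome) ∨
    (∃ k ∈ H.channel G G, H.content k = .msg r.msg ∧ X.idx (H.queuing k) = r.index ∧
      H.lt (.notify 𝔠 G) (X.trigger (H.queuing k)) ∧ H.lt (.queue (H.queuing k)) f ∧
      (X.pre (.notify 𝔠 𝔇)).mpktOut.f < r.index.total) := by
  have hH := C.hist
  obtain ⟨e, hc, hp, hi⟩ := exists_pre (X := X) hH hf ht hne
  have hm := C.notify_new
  have hpost : X.post (.notify 𝔠 G) = (protRun G (X.pre (.notify 𝔠 𝔇))).1 := by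
    rw [← X.fork G C.joins hm.1, post]; simp [handle, hH.notice_join G, C.joins.ne']
  have hw : (X.post (.notify 𝔠 G)).waitSet = (newborn G (X.pre (.notify 𝔠 𝔇))).waitSet := by
    rw [hpost, protRun_eq]; exact (checkFlush_frame _).1
  have ho : (X.post (.notify 𝔠 G)).mpktOut = (newborn G (X.pre (.notify 𝔠 𝔇))).mpktOut := by
    rw [hpost, protRun_eq]; exact (checkFlush_frame _).2.2
  have hprov := provenance (X := X) hH hm trivial hc.left hc.left_trigger
    ((hH.join_first G ⟨_, hm⟩).2 e hc.left) (live_of_lt hH hc.left hc.right hc.lt)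
  have hcase : (∃ r0 ∈ (X.post (.notify 𝔠 G)).waitSet,
      WaitRec.Desc {J | H.eventView (.notify 𝔠 G) < H.joinView J} r0 r) ∨
      ∃ g, H.lt (.notify 𝔠 G) g ∧ H.le g e ∧ Created X G g r := by
    rw [hp] at hr
    rcases List.mem_append.1 hr with hr | hr
    · rcases hprov.1 r hr with ⟨r0, h1, h2⟩ | ⟨g, h1, h2, -, h4⟩
      · exact .inl ⟨r0, List.mem_append_left _ h1, h2⟩
      · exact .inr ⟨g, h1, h2, h4⟩
    · rcases hprov.2 r hr with ⟨r0, h1, h2⟩ | ⟨g, h1, h2, -, h4⟩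
      · exact .inl ⟨r0, List.mem_append_right _ h1, h2⟩
      · exact .inr ⟨g, h1, h2, h4⟩
  rcases hcase with ⟨r0, hr0, hd⟩ | ⟨g, h1, h2, k, hk, rfl, h3, h4⟩
  · left
    rw [hw] at hr0
    simp only [newborn, State.waitSet, List.nil_append, List.mem_map] at hr0
    obtain ⟨r1, hr1, rfl⟩ := hr0
    refine ⟨r1, hr1, hd.msg, by rw [hd.index]; simp [Count.total], fun Q hQ hs => ?_⟩
    refine hd.iset Q ?_ hs
    simp [show H.joinView Q = 0 from hQ]
  · right
    have hq := queue_mem hH hk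
    refine ⟨k, hk, h3, h4, h1, ?_, ?_⟩
    · exact (queue_lt_iff (X := X) hH hq hf ht).2
        (hH.lt_of_le_of_lt' (trigger_mem hq).1 hc.left.1 hf.1 h2 hc.lt)
    · have h5 := pre_lt_idx (X := X) hH false hk (by rw [h3]; trivial) (by simp)
      have h6 := mpktOut_pre_le (X := X) hH false hm trivial (trigger_mem hq) (trigger_isTrigger hq) h1
      rw [ho] at h6
      rw [← h4]
      simp only [Count.cnt, newborn, Count.total] at h5 h6 ⊢; omega

/-- The records that an original process may have after the critical view change. -/
lemma old_record (X : Execution H) (hP : H.Original P) (hdP : (𝔠 : ℕ∞) < H.deathView P)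
    (hf : f ∈ H.eventsAt P) (ht : f.IsTrigger) (hlt : H.lt (.notify 𝔠 P) f)
    (hr : r ∈ (X.pre f).waitSet) :
    (∃ r₀ ∈ (X.pre (.notify 𝔠 P)).waitSet, r.msg = r₀.msg ∧ r.index = r₀.index ∧
      ((r.iset G).isSome → (r₀.iset 𝔇).isSome)) ∨
    (X.pre (.notify 𝔠 P)).mpktOut.total < r.index.total := by
  have hH := C.hist
  have hm := C.notify_critical hP hdP
  have hne : f ≠ .notify (H.joinView P) P := by
    rintro rfl; exact hlt.2 ((hH.join_first P ⟨_, hm⟩).2 _ hm)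
  obtain ⟨e, hc, hp, hi⟩ := exists_pre (X := X) hH hf ht hne
  have hpost : X.post (.notify 𝔠 P) = (protJoin G 𝔇 (X.pre (.notify 𝔠 P))).1 := by
    rw [post, handle_join hH (C.lt_of_original hP) hdP]
  have hw : (X.post (.notify 𝔠 P)).waitSet = (beforeDonate G 𝔇 (X.pre (.notify 𝔠 P))).waitSet := by
    rw [hpost, protJoin_eq]; exact (checkFlush_frame _).1
  have ho : (X.post (.notify 𝔠 P)).mpktOut = (X.pre (.notify 𝔠 P)).mpktOut := by
    rw [hpost, protJoin_eq]; exact (checkFlush_frame _).2.2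
  have hprov := provenance (X := X) hH hm trivial hc.left hc.left_trigger
    (hc.le_left _ hm trivial hlt) (live_of_lt hH hc.left hc.right hc.lt)
  have hcase : (∃ r0 ∈ (X.post (.notify 𝔠 P)).waitSet,
      WaitRec.Desc {J | H.eventView (.notify 𝔠 P) < H.joinView J} r0 r) ∨
      ∃ g, H.lt (.notify 𝔠 P) g ∧ H.le g e ∧ Created X P g r := by
    rw [hp] at hr
    rcases List.mem_append.1 hr with hr | hr
    · rcases hprov.1 r hr with ⟨r0, h1, h2⟩ | ⟨g, h1, h2, -, h4⟩
      · exact .inl ⟨r0, List.mem_append_left _ h1, h2⟩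
      · exact .inr ⟨g, h1, h2, h4⟩
    · rcases hprov.2 r hr with ⟨r0, h1, h2⟩ | ⟨g, h1, h2, -, h4⟩
      · exact .inl ⟨r0, List.mem_append_right _ h1, h2⟩
      · exact .inr ⟨g, h1, h2, h4⟩
  rcases hcase with ⟨r0, hr0, hd⟩ | ⟨g, h1, h2, k, hk, rfl, h3, h4⟩
  · left
    rw [hw] at hr0
    have hr0' : ∃ r1 ∈ (X.pre (.notify 𝔠 P)).waitSet, r1.inherit G 𝔇 = r0 := by
      rcases List.mem_append.1 hr0 with h | h <;> obtain ⟨r1, h1, h2⟩ := List.mem_map.1 h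
      · exact ⟨r1, List.mem_append_left _ h1, h2⟩
      · exact ⟨r1, List.mem_append_right _ h1, h2⟩
    obtain ⟨r1, hr1, rfl⟩ := hr0'
    have hdd := WaitRec.desc_inherit G 𝔇 r1
    refine ⟨r1, hr1, hd.msg.trans hdd.msg, hd.index.trans hdd.index, fun hs => ?_⟩
    have h5 := hd.iset G (by simp [hH.eventView_notify hm.1]) hs
    obtain ⟨e0, hc0, hp0, -, hl0, hv0⟩ := C.exists_last X hP hdP
    have h6 := (C.clean hc0.left hc0.left_trigger hl0 hv0).2 r1 (hp0 ▸ hr1)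
    rcases hpar : r1.iset 𝔇 with _ | c
    · rw [WaitRec.inherit, hpar] at h5
      simp only at h5; rw [h6] at h5; cases h5
    · rfl
  · right
    have hq := queue_mem hH hk
    have h5 := pre_lt_idx (X := X) hH false hk (by rw [h3]; trivial) (by simp)
    have h6 := mpktOut_pre_le (X := X) hH false hm trivial (trigger_mem hq) (trigger_isTrigger hq) h1
    rw [ho] at h6
    rw [← h4]; exact h6.trans_lt h5

end Critical

lemma simCount_le {α : Type*} {S : Set α} (hS : S.Finite) (h₁ : (s.waitSet.map fun r => r.index.total).Nodup) (h₂ : (d.waitSet.map fun r => r.index.total).Nodup) {R₁ R₂ : ℕ → α → Prop} (e₁ : ∀ r ∈ s.waitSet, (r.iset P).isSome → r.index.total ≤ totalOf (d.mpktIn s.self) →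
      ∃ q ∈ S, R₁ r.index.total q) (e₂ : ∀ r ∈ d.waitSet, (r.iset s.self).isSome → totalOf (s.mpktIn P) < r.index.total →
      ∃ q ∈ S, R₂ r.index.total q) (f₁ : ∀ n n' q, R₁ n q → R₁ n' q → n = n') (f₂ : ∀ n n' q, R₂ n q → R₂ n' q → n = n') (h : ∀ n n' q, R₁ n q → R₂ n' q → False) : simCount d P s ≤ S.ncard := by
  rw [simCount, untimelyRecords, List.countP_append, List.countP_map, List.countP_map,
    List.countP_eq_length_filter, List.countP_eq_length_filter]
  refine length_add_length_le hS (κ := fun r => r.index.total) ?_ ?_ (fun r hr => ?_)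
    (fun r hr => ?_) f₁ f₂ h
  · exact (((List.filter_sublist).trans List.filter_sublist).map _).nodup h₁
  · exact (((List.filter_sublist).trans List.filter_sublist).map _).nodup h₂
  · simp only [List.mem_filter, Function.comp, decide_eq_true_eq] at hr
    exact e₁ r hr.1.1 hr.1.2 hr.2
  · simp only [List.mem_filter, Function.comp, decide_eq_true_eq] at hr
    exact e₂ r hr.1.1 hr.1.2 hr.2

/-- The pre-critical events at the critical parent and the events at the new process. -/
def Spine (H : Computation Proc Pkt Que Req Cnt Body) (G : Proc) : Set Evt :=
  {e | (e ∈ H.eventsAt (H.parent G) ∧ H.eventView e < (H.joinView G)) ∨ e ∈ H.eventsAt G}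

namespace Critical

variable (C : Critical H G)
include C

lemma le_view (he : e ∈ H.eventsAt G) : 𝔠 ≤ H.eventView e := C.hist.joinView_le_eventView he

lemma parent_ne : 𝔇 ≠ G := C.ne_of_original C.parent_spec.1

lemma spine_lt (he : e ∈ H.eventsAt 𝔇) (hv : H.eventView e < 𝔠) (hf : f ∈ H.eventsAt G) :
    H.lt e f := by
  have hH := C.hist
  obtain ⟨h1, h2, h3⟩ := hH.parent_event G C.joins C.notify_new.1
  exact hH.lt_of_lt_of_le' he.1 h1 hf.1 ((hH.lt_notify_iff he h1).2 hv)
    (hH.le_trans _ h1 _ C.notify_new.1 _ hf.1 h2 ((hH.join_first G ⟨_, hf⟩).2 f hf))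

lemma spine_trichotomy (he : e ∈ Spine H G) (hf : f ∈ Spine H G) :
    H.lt e f ∨ e = f ∨ H.lt f e := by
  rcases he with ⟨he, hv⟩ | he <;> rcases hf with ⟨hf, hv'⟩ | hf
  · exact C.hist.trichotomy he hf
  · exact .inl (C.spine_lt he hv hf)
  · exact .inr (.inr (C.spine_lt hf hv' he))
  · exact C.hist.trichotomy he hf

lemma spine_events (he : e ∈ Spine H G) : e ∈ H.events := he.elim (fun h => h.1.1) fun h => h.1

lemma finite_lt (he : e ∈ H.eventsAt P) :
    {q : Que | .queue q ∈ H.eventsAt P ∧ H.lt (.queue q) e}.Finite :=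
  Set.Finite.of_finite_image (f := Ev.queue)
    ((C.hist.foundation P e he).subset (by rintro _ ⟨q, h, rfl⟩; exact h))
    fun _ _ _ _ h => Ev.queue.inj h

lemma pre_finite (ho : H.Original P) (hd : (𝔠 : ℕ∞) < H.deathView P) :
    {q : Que | .queue q ∈ H.eventsAt P ∧ H.eventView (.queue q) < 𝔠}.Finite :=
  (C.finite_lt (C.notify_critical ho hd)).subset fun _ h =>
    ⟨h.1, (C.hist.lt_notify_iff h.1 (C.notify_critical ho hd).1).2 h.2⟩

lemma untimely_spec (hk : k ∈ H.channel P Q) (hu : Untimely H G k) :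
    .queue (H.queuing k) ∈ H.eventsAt P ∧ H.eventView (.queue (H.queuing k)) < 𝔠 :=
  ⟨queue_mem C.hist hk, (preCritical_iff C.hist G (queue_mem C.hist hk)).1 hu.2.1⟩

lemma donationQueuings_spec (hq : q ∈ donationQueuings H G P) :
    .queue q ∈ H.eventsAt P ∧ H.eventView (.queue q) < 𝔠 := by
  obtain ⟨k, hk, rfl, hu, -⟩ := hq
  exact C.untimely_spec hk hu

lemma coDonationQueuings_spec (hq : q ∈ coDonationQueuings H G P) : .queue q ∈ Spine H G := by
  obtain ⟨k, hk, rfl, hu, -⟩ | ⟨k, hk, rfl, -⟩ := hq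
  · exact .inl (C.untimely_spec hk hu)
  · exact .inr (queue_mem C.hist hk)

lemma untimely_of_idx (X : Execution H) (hP : H.Original P) (hQ : H.Original Q)
    (hdP : (𝔠 : ℕ∞) < H.deathView P) (hdQ : (𝔠 : ℕ∞) < H.deathView Q) (n : Bool) {x : Count}
    (hx : (X.pre (.notify 𝔠 Q)).mpktIn P = some x) (hk : k ∈ H.channel P Q)
    (hm : (H.content k).IsMsg) (hn : n = true → (X.trigger (H.queuing k)).isNotify = true)
    (hv : H.eventView (X.trigger (H.queuing k)) < 𝔠) (hi : x.cnt n < (X.idx (H.queuing k)).cnt n) :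
    Untimely H G k := by
  obtain ⟨y, hy, h⟩ := C.timely_iff X hP hQ hdP hdQ
  obtain rfl := Option.some.inj (hx.symm.trans hy)
  have hq := queue_mem C.hist hk
  refine ⟨hk.1, ?_, fun h' => ?_⟩
  · rw [preCritical_iff C.hist G hq, eventView_queue C.hist hq]; exact hv
  · have := ((h n).1 k hk hm hn).1 h'
    omega

lemma donation_state (X : Execution H) (h : DonationTime H G P k) :
    (𝔠 : ℕ∞) < H.deathView P ∧ .notify 𝔠 P ∈ H.events ∧
    H.lt (.notify 𝔠 P) (.dequeue k) ∧ .dequeue k ∈ H.eventsAt G ∧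
    (∃ x, (X.pre (.notify 𝔠 P)).mpktIn 𝔇 = some x ∧ H.content k = .donation (beforeDonate G 𝔇
        (X.pre (.notify 𝔠 P))).donated ∧ (beforeDonate G 𝔇 (X.pre (.notify 𝔠 P))).donated.mpktIn G =
        some ⟨x.f, 0⟩ ∧ x.f ≤ (X.pre (.notify 𝔠 𝔇)).mpktOut.f) ∧
    ∃ x, (X.pre (.notify 𝔠 𝔇)).mpktIn P = some x ∧ (X.pre (.dequeue k)).mpktIn P = some x := by
  have hH := C.hist
  obtain ⟨⟨hk, hP, hc⟩, hd⟩ := h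
  obtain ⟨h1, -, h3, h4, h5⟩ := donation_packet (X := X) hH hk hc
  obtain ⟨hD, hdD⟩ := C.parent_spec
  have hq := queue_mem hH hk
  have hm := C.notify_critical hP h4
  obtain ⟨x, hx, hx'⟩ := C.timely_iff X hD hP hdD h4
  obtain ⟨y, hy, -⟩ := C.timely_iff X hP hD h4 hdD
  have hlt := trigger_lt (X := X) hq
  rw [h1] at hlt
  refine ⟨h4, hm.1, hH.lt_trans' hm.1 hq.1 hd hlt (hH.packet_dequeued k hd).2,
    ⟨hd, hk.1, hk.2.2⟩, ⟨x, hx, h5, ?_, (hx' true).2⟩, y, hy, ?_⟩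
  · simp [beforeDonate, State.donated, hx]
  · rw [(window_new (X := X) C.conf h3 hk hd fun k' hk' hd' => donation_le hH X hk hc hk' hd').2, post]
    rw [show handle H (.notify 𝔠 G) = protRun G by
      funext s; simp [handle, hH.notice_join G, C.joins.ne'], (protRun_frame _ _).2,
      Function.update_of_ne (C.ne_of_original hP), X.fork G C.joins C.notify_new.1, hy]

lemma donation_sub (X : Execution H) (h : DonationTime H G P k) (hd : H.content k = .donation d)
    (hn : n < simCount d P (X.pre (.dequeue k))) : ∃ q, IsNth H (donationQueuings H G P) n q := by
  have hH := C.hist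
  obtain ⟨hdP, hm, hlt, hkG, ⟨x, hx, hdx, hin, hxle⟩, y, hy, hy'⟩ := C.donation_state X h
  have hP := h.1.2.1
  obtain ⟨hD, hdD⟩ := C.parent_spec
  obtain rfl := Content.donation.inj (hd.symm.trans hdx)
  obtain ⟨hsound, hself, -⟩ := height_pre hH hkG
  obtain ⟨e, hce, hpe, hie, -⟩ := C.exists_last X hP hdP
  have hsp := fun q (hq : q ∈ donationQueuings H G P) => C.donationQueuings_spec hq
  have hfin : (donationQueuings H G P).Finite := (C.pre_finite hP hdP).subset hsp
  refine exists_isNth hfin (fun a ha b hb c hc => hH.lt_trans' (hsp a ha).1.1 (hsp b hb).1.1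
    (hsp c hc).1.1) (fun a ha b hb => ?_) (hn.trans_le ?_)
  · rcases hH.trichotomy (hsp a ha).1 (hsp b hb).1 with h | h | h
    · exact .inr (.inl h)
    · exact .inl (Ev.queue.inj h)
    · exact .inr (.inr h)
  refine simCount_le hfin hsound.nodup (beforeDonate_sound (hpe ▸ hie.sound)).nodup
    (R₁ := fun n q => (∃ a ∈ H.packets, H.queuing a = q ∧ (H.content a).IsAck) ∧
      ∃ k, X.trigger q = .dequeue k ∧ (X.idx (H.queuing k)).f = n)
    (R₂ := fun n q => (∃ a ∈ H.packets, H.queuing a = q ∧ (H.content a).IsMsg) ∧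
      (X.idx q).total = n) ?_ ?_ ?_ ?_ ?_
  · intro r hr hs hle
    rw [hself, hin] at hle
    rcases C.new_record X hkG trivial (by simp) hr with ⟨r₀, h1, h2, h3, h4⟩ | ⟨_, _, _, _, _, _, h5⟩
    · have hs₀ := List.mem_append_right (X.pre (.notify 𝔠 𝔇)).bcastWaitSet h1
      obtain ⟨k', hk', hm', hi', hv', hn'⟩ := C.early_record X hD hP hdD hdP hs₀
      obtain ⟨x', hx', ht⟩ := C.timely_iff X hD hP hdD hdP
      obtain rfl := Option.some.inj (hx.symm.trans hx')
      have htm := ((ht true).1 k' hk' (by rw [hm']; trivial) fun _ => hn' h1).2 (by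
        rw [hi']; simp only [Count.cnt]; rw [← h3]; simpa [totalOf, Count.total] using hle)
      obtain ⟨a, ha, hca, hta, hu⟩ := C.untimely_ack X hD hP hdD hs₀ (h4 P hP hs) hk' hm' hi' htm.1 htm.2
      refine ⟨_, ⟨a, ha, rfl, hu, .inr ?_⟩, ⟨a, ha.1, rfl, by rw [hca]; trivial⟩, k', hta, ?_⟩
      · rcases orig_cases C.first hH hv' hk' hm' le_rfl with h6 | h6
        · rw [hn' h1] at h6; simp at h6
        · rw [hca]; exact h6.2.1
      · rw [hi', h3]
    · simp only [totalOf, Option.map_some, Option.getD_some, Count.total] at hle h5; omega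
  · intro r hr hs hlt'
    rw [hself] at hs
    rw [hy'] at hlt'
    have hr' : ∃ r₀ ∈ (X.pre (.notify 𝔠 P)).waitSet, r₀.inherit G 𝔇 = r := by
      rcases List.mem_append.1 hr with h | h <;> obtain ⟨r₀, h1, h2⟩ := List.mem_map.1 h
      · exact ⟨r₀, List.mem_append_left _ h1, h2⟩
      · exact ⟨r₀, List.mem_append_right _ h1, h2⟩
    obtain ⟨r₀, hr₀, rfl⟩ := hr'
    rw [(WaitRec.desc_inherit G 𝔇 r₀).index] at hlt' ⊢
    obtain ⟨k', hk', hm', hi', hv', hn'⟩ := C.early_record X hP hD hdP hdD hr₀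
    refine ⟨_, ⟨k', hk', rfl, C.untimely_of_idx X hP hD hdP hdD false hy hk' (by rw [hm']; trivial)
      (by simp) hv' ?_, .inl (by rw [hm']; trivial)⟩, ⟨k', hk'.1, rfl, by rw [hm']; trivial⟩, by rw [hi']⟩
    rw [hi']; exact hlt'
  · rintro n n' q ⟨-, k, h1, rfl⟩ ⟨-, k', h2, rfl⟩; rw [Ev.dequeue.inj (h1.symm.trans h2)]
  · rintro n n' q ⟨-, rfl⟩ ⟨-, rfl⟩; rfl
  · rintro n n' q ⟨⟨a, h1, h2, h3⟩, -⟩ ⟨⟨b, h4, rfl, h5⟩, -⟩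
    rw [(hH.multicast_same a h1 b h4 h2).1] at h3
    cases hc : H.content b <;> simp_all [Content.IsAck, Content.IsMsg]

lemma codonation_state (X : Execution H) (h : CoDonationTime H G P k) :
    ∃ k₀, DonationTime H G P k₀ ∧ X.trigger (H.queuing k) = .dequeue k₀ ∧
      H.content k = .codonation (X.pre (.dequeue k₀)).donated ∧
      H.lt (.notify 𝔠 P) (.dequeue k) ∧ .dequeue k ∈ H.eventsAt P ∧
      H.lt (.dequeue k₀) (.dequeue k) := by
  have hH := C.hist
  obtain ⟨⟨hk, hP, hc⟩, hd⟩ := h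
  obtain ⟨k₀, hk₀, hc₀, ht, hd₀, -, hck⟩ := codonation_packet (X := X) hH hk hc
  have h₀ : DonationTime H G P k₀ := ⟨⟨hk₀, hP, hc₀⟩, hd₀⟩
  obtain ⟨-, hm, hlt, -⟩ := C.donation_state X h₀
  have hq := queue_mem hH hk
  have h1 := trigger_lt (X := X) hq
  rw [ht] at h1
  have h2 := hH.lt_trans' hd₀ hq.1 hd h1 (hH.packet_dequeued k hd).2
  exact ⟨k₀, h₀, ht, hck, hH.lt_trans' hm hd₀ hd hlt h2, ⟨hd, hk.1, hk.2.2⟩, h2⟩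

lemma codonation_sub (X : Execution H) (h : CoDonationTime H G P k)
    (hd : H.content k = .codonation d) (hn : n < simCount d G (X.pre (.dequeue k))) :
    ∃ q, IsNth H (coDonationQueuings H G P) n q := by
  have hH := C.hist
  obtain ⟨k₀, h₀, ht, hck, hlt, hkP, -⟩ := C.codonation_state X h
  obtain ⟨hdP, hm, -, hkG, ⟨x, hx, hdx, hin, hxle⟩, y, hy, hy'⟩ := C.donation_state X h₀
  have hP := h.1.2.1
  obtain ⟨hD, hdD⟩ := C.parent_spec
  obtain rfl := Content.codonation.inj (hd.symm.trans hck)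
  obtain ⟨hsound, hself, -⟩ := height_pre (X := X) hH hkP
  obtain ⟨hsound₀, hself₀, -⟩ := height_pre (X := X) hH hkG
  have hsp := fun q (hq : q ∈ coDonationQueuings H G P) => C.coDonationQueuings_spec hq
  have hev := fun q (hq : q ∈ coDonationQueuings H G P) => C.spine_events (hsp q hq)
  have hfin : (coDonationQueuings H G P).Finite := by
    refine ((C.pre_finite hD hdD).union (C.finite_lt hkG)).subset ?_
    rintro q (⟨k, hk, rfl, hu, -⟩ | ⟨k, hk, rfl, -, -, k₁, h₁, hlt'⟩)
    · exact .inl (C.untimely_spec hk hu)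
    · exact .inr ⟨queue_mem hH hk, by rwa [donation_unique (X := X) hH h₀.1.1 h₁.1.1 h₀.1.2.2 h₁.1.2.2]⟩
  have hinG : (X.pre (.dequeue k)).mpktIn G = some ⟨x.f, 0⟩ := by
    rw [(window_old (X := X) C.conf (C.lt_of_original hP) h.1.1 h.2 hm hlt.1 fun k' hk' hd' =>
      codonation_le hH X h.1.1 h.1.2.2 hk' hd').2, post, handle_join hH (C.lt_of_original hP) hdP,
      (protJoin_frame _ _ _).2]
    simp [hx]
  refine exists_isNth hfin (fun a ha b hb c hc => hH.lt_trans' (hev a ha) (hev b hb) (hev c hc))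
    (fun a ha b hb => ?_) (hn.trans_le ?_)
  · rcases C.spine_trichotomy (hsp a ha) (hsp b hb) with h | h | h
    · exact .inr (.inl h)
    · exact .inl (Ev.queue.inj h)
    · exact .inr (.inr h)
  refine simCount_le hfin hsound.nodup hsound₀.nodup
    (R₁ := fun n q => (∃ a ∈ H.packets, H.queuing a = q ∧ (H.content a).IsAck) ∧
      ∃ k, X.trigger q = .dequeue k ∧ (X.idx (H.queuing k)).total = n)
    (R₂ := fun n q => ∃ a ∈ H.packets, H.queuing a = q ∧ (H.content a).IsMsg ∧
      if H.source a = G then (X.idx q).total = n else (X.idx q).f = n) ?_ ?_ ?_ ?_ ?_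
  · intro r hr hs hle
    rw [hself] at hle
    rw [show (X.pre (.dequeue k₀)).donated.mpktIn P = some y from hy'] at hle
    obtain ⟨y', hy₁, ht₁⟩ := C.timely_iff X hP hD hdP hdD
    obtain rfl := Option.some.inj (hy.symm.trans hy₁)
    rcases C.old_record X hP hdP hkP trivial hlt hr with ⟨r₀, h1, h2, h3, h4⟩ | h5
    · obtain ⟨k', hk', hm', hi', hv', hn'⟩ := C.early_record X hP hD hdP hdD h1
      have htm := ((ht₁ false).1 k' hk' (by rw [hm']; trivial) (by simp)).2 (by
        rw [hi', ← h3]; exact hle)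
      obtain ⟨a, ha, hca, hta, hu⟩ := C.untimely_ack X hP hD hdP h1 (h4 hs) hk' hm' hi' htm.1 htm.2
      exact ⟨_, .inl ⟨a, ha, rfl, hu, .inr (by rw [hca]; trivial)⟩,
        ⟨a, ha.1, rfl, by rw [hca]; trivial⟩, k', hta, by rw [hi', h3]⟩
    · have := (ht₁ false).2
      simp only [totalOf, Option.map_some, Option.getD_some, Count.cnt] at hle this; omega
  · intro r hr hs hlt'
    rw [hself] at hs
    rw [hinG] at hlt'
    rcases C.new_record X hkG trivial (by simp) hr with ⟨r₀, h1, h2, h3, h4⟩ | ⟨a, ha, hma, hia, hla, hqa, -⟩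
    · have hs₀ := List.mem_append_right (X.pre (.notify 𝔠 𝔇)).bcastWaitSet h1
      obtain ⟨k', hk', hm', hi', hv', hn'⟩ := C.early_record X hD hP hdD hdP hs₀
      have hmm : (H.content k').IsMsg := by rw [hm']; trivial
      refine ⟨_, .inl ⟨k', hk', rfl, C.untimely_of_idx X hD hP hdD hdP true hx hk' hmm
        (fun _ => hn' h1) hv' ?_, .inl ?_⟩, k', hk'.1, rfl, hmm, ?_⟩
      · rw [hi']
        simp only [totalOf, Option.map_some, Option.getD_some, Count.total, Count.cnt] at hlt' h3 ⊢
        omega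
      · rcases orig_cases (X := X) C.first hH hv' hk' hm' le_rfl with h6 | h6
        · rw [hn' h1] at h6; simp at h6
        · rw [hm']; exact h6.2.1
      · rw [if_neg (by rw [hk'.2.1]; exact C.parent_ne), hi', h3]
    · have hmm : (H.content a).IsMsg := by rw [hma]; trivial
      refine ⟨_, .inr ⟨a, ha, rfl, hmm, ?_, k₀, h₀, hqa⟩, a, ha.1, rfl, hmm, ?_⟩
      · have := C.le_view (queue_mem hH ha)
        rw [preCritical_iff hH G (queue_mem hH ha)]; omega
      · rw [if_pos ha.2.1, hia]
  · rintro n n' q ⟨-, k, h1, rfl⟩ ⟨-, k', h2, rfl⟩; rw [Ev.dequeue.inj (h1.symm.trans h2)]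
  · rintro n n' q ⟨a, h1, h2, -, h3⟩ ⟨b, h4, rfl, -, h5⟩
    rw [(hH.multicast_same a h1 b h4 h2).2] at h3
    split_ifs at h3 h5 <;> exact h3.symm.trans h5
  · rintro n n' q ⟨⟨a, h1, h2, h3⟩, -⟩ ⟨b, h4, rfl, h5, -⟩
    rw [(hH.multicast_same a h1 b h4 h2).1] at h3
    cases hc : H.content b <;> simp_all [Content.IsAck, Content.IsMsg]

end Critical

section Order

/-- The view of a clean event. -/
noncomputable def cview (H : Computation Proc Pkt Que Req Cnt Body) : Cln → ℕ
  | .view i => i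
  | .event e => H.eventView e

def Clean.Valid (H : Computation Proc Pkt Que Req Cnt Body) : Cln → Prop
  | .view _ => True
  | .event e => e ∈ H.events

lemma cleanOf_valid (h : e ∈ H.events) : (cleanOf e).Valid H := by cases e <;> trivial

lemma cview_cleanOf (hH : H.IsHistory) (h : e ∈ H.events) :
    cview H (cleanOf e) = H.eventView e := by
  cases e with
  | notify i P => exact (hH.eventView_notify h).symm
  | _ => rfl

lemma cleanLT.cview_le {a b : Cln} (h : cleanLT H a b) : cview H a ≤ cview H b := by
  cases a <;> cases b <;> simp only [cleanLT, cview] at h ⊢ <;> omega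

lemma cleanLT_of_cview {a b : Cln} (h : cview H a < cview H b) : cleanLT H a b := by
  cases a <;> cases b <;> simp only [cleanLT, cview] at h ⊢ <;> omega

lemma cleanLT_irrefl (a : Cln) : ¬ cleanLT H a a := by cases a <;> simp [cleanLT, Computation.lt]

lemma cleanLT_trans (hH : H.IsHistory) {a b c : Cln} (ha : a.Valid H) (hb : b.Valid H)
    (hc : c.Valid H) (h : cleanLT H a b) (h' : cleanLT H b c) : cleanLT H a c := by
  rcases (h.cview_le.trans h'.cview_le).lt_or_eq with h1 | h1
  · exact cleanLT_of_cview h1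
  have h2 := h.cview_le
  have h3 := h'.cview_le
  cases a <;> cases b <;> cases c <;> simp only [cleanLT, cview] at * <;> try omega
  refine .inr ⟨h1, hH.lt_trans' ha hb hc (h.resolve_left (by omega)).2 (h'.resolve_left (by omega)).2⟩

lemma Adj.rank_inj {a b : Adj} (h : a.rank = b.rank) : a = b := by
  rcases a with (_ | _) | (_ | _) | (_ | _) | _ | (_ | _) <;>
    rcases b with (_ | _) | (_ | _) | (_ | _) | _ | (_ | _) <;> first | rfl | cases h

/-- The sub-transaction coordinates that go with a first coordinate. -/
inductive SubOK (H : Computation Proc Pkt Que Req Cnt Body) (G : Proc) :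
    Cln → Sub Proc Pkt Que Req → Prop
  | zero (c : Cln) : SubOK H G c .zero
  | don {P : Proc} {k : Pkt} {q : Que} (h : DonationTime H G P k) (hq : .queue q ∈ H.eventsAt P)
      (hv : H.eventView (.queue q) < (H.joinView G)) :
      SubOK H G (.event (.dequeue k)) (.ev (.event (.queue q)))
  | cod {P : Proc} {k : Pkt} {q : Que} (h : CoDonationTime H G P k) (hq : .queue q ∈ Spine H G) :
      SubOK H G (.event (.dequeue k)) (.ev (.event (.queue q)))
  | serial {k : Pkt} (n : ℕ) (h₁ : ∀ P, ¬ IsCritDonation H G P k) (h₂ : ∀ P, ¬ IsCritCoDonation H G P k) :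
      SubOK H G (.event (.dequeue k)) (.serial n)

/-- A label whose first two coordinates belong to events. -/
structure Label.Valid (H : Computation Proc Pkt Que Req Cnt Body) (G : Proc) (l : Label Proc Pkt Que Req) : Prop where
  con : l.con.Valid H
  sub : SubOK H G l.con l.sub

lemma subLT_irrefl (a : Sub Proc Pkt Que Req) : ¬ subLT H a a := by
  cases a <;> simp [subLT, cleanLT_irrefl]

lemma labelLT_irrefl (a : Label Proc Pkt Que Req) : ¬ labelLT H a a := by
  simp [labelLT, cleanLT_irrefl, subLT_irrefl]

end Order

namespace Critical

variable (C : Critical H G)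
include C

lemma subLT_trans {c : Cln} {a b s : Sub Proc Pkt Que Req} (ha : SubOK H G c a) (hb : SubOK H G c b)
    (hs : SubOK H G c s) (h : subLT H a b) (h' : subLT H b s) : subLT H a s := by
  have key : ∀ {c x}, SubOK H G c (.ev x) → x.Valid H := by
    intro c x h
    cases h with
    | don h hq hv => exact hq.1
    | cod h hq => exact C.spine_events hq
  cases a <;> cases b <;> cases s <;> simp only [subLT] at h h' ⊢
  · exact cleanLT_trans C.hist (key ha) (key hb) (key hs) h h'
  · omega

lemma labelLT_trans {a b d : Label Proc Pkt Que Req} (ha : a.Valid H G) (hb : b.Valid H G)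
    (hd : d.Valid H G) (h : labelLT H a b) (h' : labelLT H b d) : labelLT H a d := by
  rcases h with h | ⟨h1, h⟩
  · rcases h' with h' | ⟨h1', -⟩
    · exact .inl (cleanLT_trans C.hist ha.con hb.con hd.con h h')
    · exact .inl (h1' ▸ h)
  · rcases h' with h' | ⟨h1', h'⟩
    · exact .inl (h1 ▸ h')
    · refine .inr ⟨h1.trans h1', ?_⟩
      rcases h with h | ⟨h2, h⟩
      · rcases h' with h' | ⟨h2', -⟩
        · exact .inl (C.subLT_trans ha.sub (h1 ▸ hb.sub) ((h1.trans h1') ▸ hd.sub) h h')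
        · exact .inl (h2' ▸ h)
      · rcases h' with h' | ⟨h2', h'⟩
        · exact .inl (h2 ▸ h')
        · refine .inr ⟨h2.trans h2', ?_⟩
          rcases h with h | ⟨h3, h⟩ <;> rcases h' with h' | ⟨h3', h'⟩
          · exact .inl (h.trans h')
          · exact .inl (h3' ▸ h)
          · exact .inl (h3 ▸ h')
          · exact .inr ⟨h3.trans h3', h.trans h'⟩

lemma cleanLT_of_lt_at (he : e ∈ H.eventsAt P) (hf : f ∈ H.eventsAt P) (h : H.lt e f) :
    cleanLT H (cleanOf e) (cleanOf f) :=
  C.hist.cleanLT_of_lt he.1 hf.1 h fun i Q hQ => by subst hQ; exact hf.2 ▸ he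

lemma cleanLT_of_spine (he : e ∈ Spine H G) (hf : f ∈ Spine H G) (h : H.lt e f) :
    cleanLT H (cleanOf e) (cleanOf f) := by
  have key : ∀ {e}, e ∈ H.eventsAt G → 𝔠 ≤ H.eventView e := C.le_view
  rcases he with ⟨he, hv⟩ | he <;> rcases hf with ⟨hf, hv'⟩ | hf
  · exact C.cleanLT_of_lt_at he hf h
  · refine cleanLT_of_cview ?_
    rw [cview_cleanOf C.hist he.1, cview_cleanOf C.hist hf.1]; exact hv.trans_le (key hf)
  · have := C.hist.eventView_mono he.1 hf.1 h.1
    have := key he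
    omega
  · exact C.cleanLT_of_lt_at he hf h

lemma sub_trichotomy {c : Cln} {a b : Sub Proc Pkt Que Req} (ha : SubOK H G c a)
    (hb : SubOK H G c b) : subLT H a b ∨ a = b ∨ subLT H b a := by
  cases ha with
  | zero =>
    cases hb with
    | zero => exact .inr (.inl rfl)
    | _ => exact .inl trivial
  | don h hq hv =>
    cases hb with
    | zero => exact .inr (.inr trivial)
    | don h' hq' hv' =>
      obtain rfl := h.1.1.2.1.symm.trans h'.1.1.2.1
      rcases C.hist.trichotomy hq hq' with h1 | h1 | h1
      · exact .inl (C.cleanLT_of_lt_at hq hq' h1)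
      · exact .inr (.inl (by rw [h1]))
      · exact .inr (.inr (C.cleanLT_of_lt_at hq' hq h1))
    | cod h' _ => exact absurd (h.1.1.2.1.symm.trans h'.1.1.2.1) (C.ne_of_original h.1.2.1)
    | serial _ h₁ => exact (h₁ _ h.1).elim
  | cod h hq =>
    cases hb with
    | zero => exact .inr (.inr trivial)
    | don h' _ _ => exact absurd (h'.1.1.2.1.symm.trans h.1.1.2.1) (C.ne_of_original h'.1.2.1)
    | cod h' hq' =>
      rcases C.spine_trichotomy hq hq' with h1 | h1 | h1
      · exact .inl (C.cleanLT_of_spine hq hq' h1)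
      · exact .inr (.inl (by rw [h1]))
      · exact .inr (.inr (C.cleanLT_of_spine hq' hq h1))
    | serial _ _ h₂ => exact (h₂ _ h.1).elim
  | serial n h₁ h₂ =>
    cases hb with
    | zero => exact .inr (.inr trivial)
    | don h' _ _ => exact (h₁ _ h'.1).elim
    | cod h' _ => exact (h₂ _ h'.1).elim
    | serial m =>
      rcases lt_trichotomy n m with h | h | h
      · exact .inl h
      · exact .inr (.inl (by rw [h]))
      · exact .inr (.inr h)

section Effects

variable {P : Proc} {q q' : Que}

lemma effectAt_spec (X : Execution H) (hq : .queue q ∈ H.eventsAt P) :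
    ∃ ε, effectAt H X q = some ε ∧ (X.effects (X.trigger q))[X.position q]? = some ε ∧
      ∀ k ∈ H.packets, H.queuing k = q → H.content k = ε.content :=
  (X.effect_of q hq.1).imp fun _ h => ⟨h.1, h.1, h.2.1⟩

/-- The sub-transaction coordinate of a simulated receipt. -/
lemma subCoord_sub (hq : .queue q ∈ H.eventsAt P) (hε : effectAt H X q = some ε)
    (hn : ε.phase = .sub n) :
    ∃ k, X.trigger q = .dequeue k ∧
    ((∃ Q q', DonationTime H G Q k ∧ IsNth H (donationQueuings H G Q) n q' ∧
        subCoord H X G q = .ev (.event (.queue q'))) ∨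
      (∃ Q q', CoDonationTime H G Q k ∧ IsNth H (coDonationQueuings H G Q) n q' ∧
        subCoord H X G q = .ev (.event (.queue q'))) ∨
      (subCoord H X G q = .serial (n + 1) ∧ (∀ Q, ¬ IsCritDonation H G Q k) ∧
        ∀ Q, ¬ IsCritCoDonation H G Q k)) := by
  have hT := trigger_mem (X := X) hq
  have hmem : ε ∈ X.effects (X.trigger q) := List.mem_of_getElem? hε
  have hk : ∃ k, X.trigger q = .dequeue k := by
    by_contra h
    push Not at h
    have := handle_main H h _ ε hmem
    rw [hn] at this; cases this
  obtain ⟨k, hk⟩ := hk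
  rw [hk] at hmem hT
  have hval : subCoord H X G q = if IsCritDonation H G (H.source k) k then
        subOf fun q' => IsNth H (donationQueuings H G (H.source k)) n q'
      else if IsCritCoDonation H G (H.target k) k then
        subOf fun q' => IsNth H (coDonationQueuings H G (H.target k)) n q'
      else .serial (n + 1) := by simp only [subCoord, hε, Option.map_some, hn, hk]
  obtain ⟨-, d, hd, hlt⟩ := protPacket_sub hmem hn
  refine ⟨k, hk, ?_⟩
  split_ifs at hval with h1 h2
  · have hdd : H.content k = .donation d := by
      have := h1.2.2
      rcases hd with hd | hd <;> rw [hd] at this ⊢ <;> exact this.elim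
    have hex := C.donation_sub X ⟨h1, hT.1⟩ hdd hlt
    exact .inl ⟨_, hex.choose, ⟨h1, hT.1⟩, hex.choose_spec, by rw [hval, subOf, dif_pos hex]; rfl⟩
  · have hdd : H.content k = .codonation d := by
      have := h2.2.2
      rcases hd with hd | hd <;> rw [hd] at this ⊢ <;> exact this.elim
    have hex := C.codonation_sub X ⟨h2, hT.1⟩ hdd (by rwa [h2.1.2.1] at hlt)
    exact .inr (.inl ⟨_, hex.choose, ⟨h2, hT.1⟩, hex.choose_spec, by rw [hval, subOf, dif_pos hex]; rfl⟩)
  · refine .inr (.inr ⟨hval, fun Q h => h1 (by rwa [h.1.2.1]), fun Q h => h2 (by rwa [h.1.2.2])⟩)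

lemma subCoord_main (hε : effectAt H X q = some ε) (hn : ε.phase = .main) :
    subCoord H X G q = .zero := by simp only [subCoord, hε, Option.map_some, hn]

lemma subCoord_ok (hq : .queue q ∈ H.eventsAt P) :
    SubOK H G (cleanOf (X.trigger q)) (subCoord H X G q) := by
  obtain ⟨ε, hε, hmem, -⟩ := C.effectAt_spec X hq
  have hT := trigger_mem (X := X) hq
  rcases hph : ε.phase with _ | n | _
  · rw [C.subCoord_main hε hph]; exact .zero _
  · obtain ⟨k, hk, ⟨Q, q', h, hn, hs⟩ | ⟨Q, q', h, hn, hs⟩ | ⟨hs, h1, h2⟩⟩ :=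
      C.subCoord_sub hq hε hph <;> rw [hk, hs]
    · have := C.donationQueuings_spec hn.1
      exact .don h this.1 this.2
    · exact .cod h (C.coDonationQueuings_spec hn.1)
    · exact .serial _ h1 h2
  · simp only [subCoord, hε, Option.map_some, hph]
    split
    · rename_i k hk
      rw [hk] at hT ⊢
      split_ifs with h
      · unfold subOf
        split_ifs with hex
        · obtain ⟨⟨k', hk', h1, -⟩, -⟩ := hex.choose_spec
          exact .cod ⟨h, hT.1⟩ (h1 ▸ .inr (queue_mem C.hist hk'))
        · exact .zero _
      · exact .zero _
    · exact .zero _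

lemma isNth_lt {S : Set Que} (htr : ∀ a ∈ S, ∀ b ∈ S, ∀ c ∈ S, H.lt (.queue a) (.queue b) →
      H.lt (.queue b) (.queue c) → H.lt (.queue a) (.queue c)) (htot : ∀ a ∈ S, ∀ b ∈ S, H.lt (.queue a) (.queue b) ∨
      (.queue a : Evt) = .queue b ∨
      H.lt (.queue b) (.queue a)) {m : ℕ} (h : n < m) {a b : Que} (ha : IsNth H S n a) (hb : IsNth H S m b) : H.lt (.queue a) (.queue b) := by
  rcases htot a ha.1 b hb.1 with h1 | h1 | h1
  · exact h1
  · obtain rfl := Ev.queue.inj h1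
    have := ha.2.2.symm.trans hb.2.2
    omega
  · have := Set.ncard_le_ncard (s := {q' | q' ∈ S ∧ H.lt (.queue q') (.queue b)})
      (t := {q' | q' ∈ S ∧ H.lt (.queue q') (.queue a)})
      (fun q hq => ⟨hq.1, htr q hq.1 b hb.1 a ha.1 hq.2 h1⟩) ha.2.1
    rw [ha.2.2, hb.2.2] at this; omega

lemma sideCoord_rank (hε : effectAt H X q = some ε) (hm : ¬ ε.content.IsMsg) :
    (sideCoord H X q).rank = ε.content.rank ∧ ε.content.rank < 6 := by
  simp only [sideCoord, hε, Option.map_some]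
  cases hc : ε.content <;> simp_all [Side.rank, Content.rank, Content.IsMsg]

lemma sideCoord_msg (hε : effectAt H X q = some ε) (hm : ε.content.IsMsg) :
    sideCoord H X q = .bcast (countMsg ((X.effects (X.trigger q)).take (X.position q)) + 1) := by
  have h := countMsg_take_succ (es := X.effects (X.trigger q)) (n := X.position q) hε hm
  obtain ⟨m, hc⟩ : ∃ m, ε.content = .msg m := by cases hc : ε.content <;> simp_all [Content.IsMsg]
  rw [← h]
  simp only [sideCoord, hε, Option.map_some, hc]; rfl

lemma side_pos (hq : .queue q ∈ H.eventsAt P) : 0 < (sideCoord H X q).rank := by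
  obtain ⟨ε, hε, -⟩ := C.effectAt_spec X hq
  by_cases hm : ε.content.IsMsg
  · rw [C.sideCoord_msg hε hm]; simp [Side.rank]
  · rw [(C.sideCoord_rank hε hm).1]; cases ε.content <;> simp [Content.rank]

lemma side_lt {ε' : Eff} (hε : effectAt H X q = some ε) (hε' : effectAt H X q' = some ε')
    (ht : X.trigger q = X.trigger q') (hp : X.position q < X.position q')
    (h : ε.content.Before ε'.content) :
    (sideCoord H X q).rank < (sideCoord H X q').rank := by
  by_cases hm : ε.content.IsMsg <;> by_cases hm' : ε'.content.IsMsg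
  · rw [C.sideCoord_msg hε hm, C.sideCoord_msg hε' hm']
    have h1 := countMsg_take_succ (es := X.effects (X.trigger q)) (n := X.position q) hε hm
    have h2 := countMsg_take_mono (X.effects (X.trigger q)) (n := X.position q + 1) (m := X.position q') hp
    rw [ht] at h1 h2 ⊢
    simp only [Side.rank]; omega
  · have := (C.sideCoord_rank hε' hm').2
    rcases h with h | h
    · cases hc : ε.content <;> simp_all [Content.rank, Content.IsMsg]
      omega
    · exact absurd h.2 hm'
  · rw [(C.sideCoord_rank hε hm).1, C.sideCoord_msg hε' hm']
    have := (C.sideCoord_rank hε hm).2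
    simp only [Side.rank]; omega
  · rw [(C.sideCoord_rank hε hm).1, (C.sideCoord_rank hε' hm').1]
    exact h.resolve_right fun h => hm h.1

/-- The labels of the side effects of one transaction are in order. -/
lemma coord_lt (hq : .queue q ∈ H.eventsAt P) (hq' : .queue q' ∈ H.eventsAt P)
    (ht : X.trigger q = X.trigger q') (hp : X.position q < X.position q') :
    subLT H (subCoord H X G q) (subCoord H X G q') ∨ (subCoord H X G q = subCoord H X G q' ∧
        (sideCoord H X q).rank < (sideCoord H X q').rank) := by
  have hH := C.hist
  obtain ⟨ε, hε, hm, -⟩ := C.effectAt_spec X hq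
  obtain ⟨ε', hε', hm', -⟩ := C.effectAt_spec X hq'
  have hB : ε.Before ε' := by
    have h1 := hm
    have h2 := hm'
    rw [← ht] at h2
    rw [List.getElem?_eq_some_iff] at h1 h2
    obtain ⟨a, rfl⟩ := h1
    obtain ⟨b, rfl⟩ := h2
    exact List.pairwise_iff_getElem.1 (handle_before H (X.trigger q) _) _ _ _ _ hp
  have hmem : ε ∈ X.effects (X.trigger q) := List.mem_of_getElem? hm
  have hmem' : ε' ∈ X.effects (X.trigger q) := by rw [ht]; exact List.mem_of_getElem? hm'
  have hsame : ε.phase = ε'.phase → subCoord H X G q = subCoord H X G q' := by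
    intro h; simp only [subCoord, hε, hε', Option.map_some, ht, h]
  unfold Effect.Before at hB
  have hinst : ε'.phase = .install → ∃ k d, X.trigger q = .dequeue k ∧ H.content k = .codonation d ∧
      simCount d (H.source k) (X.pre (.dequeue k)) = 0 := by
    intro h
    have hk : ∃ k, X.trigger q = .dequeue k := by
      by_contra hne
      push Not at hne
      have := handle_main H hne _ ε' hmem'
      rw [h] at this; cases this
    obtain ⟨k, hk⟩ := hk
    have hT := trigger_mem (X := X) hq
    rw [hk] at hmem' hT
    obtain ⟨-, d, hd, -⟩ := protPacket_install hmem' h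
    exact ⟨k, d, hk, hd, simCount_of_install (X := X) C.conf (mem_channel_self hT.2.1) hT.1 hmem' h hd⟩
  rcases h1 : ε.phase with _ | n | _ <;> rcases h2 : ε'.phase with _ | n' | _ <;>
    simp only [h1, h2] at hB
  · exact .inr ⟨hsame (h1.trans h2.symm), C.side_lt hε hε' ht hp hB⟩
  · left
    rw [C.subCoord_main hε h1]
    obtain ⟨k, -, ⟨_, _, _, _, hs⟩ | ⟨_, _, _, _, hs⟩ | ⟨hs, _⟩⟩ := C.subCoord_sub hq' hε' h2 <;>
      rw [hs] <;> trivial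
  · obtain ⟨k, d, hk, hd, h0⟩ := hinst h2
    rw [hk] at hmem
    rcases protPacket_main hmem h1 with ⟨_, h, -⟩ | ⟨_, h, -⟩ | ⟨_, h, -⟩ | ⟨_, h, -⟩ <;>
      cases hd.symm.trans h
  · rcases hB with hlt | ⟨rfl, hB⟩
    · left
      obtain ⟨k, hk, hs⟩ := C.subCoord_sub hq hε h1
      obtain ⟨k', hk', hs'⟩ := C.subCoord_sub hq' hε' h2
      obtain rfl := Ev.dequeue.inj (hk.symm.trans (ht.trans hk'))
      rcases hs with ⟨Q, a, hd, ha, hs⟩ | ⟨Q, a, hd, ha, hs⟩ | ⟨hs, hn1, hn2⟩ <;>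
        rcases hs' with ⟨Q', b, hd', hb, hs'⟩ | ⟨Q', b, hd', hb, hs'⟩ | ⟨hs', hn1', hn2'⟩
      · obtain rfl := hd.1.1.2.1.symm.trans hd'.1.1.2.1
        have hsp := fun q (hq : q ∈ donationQueuings H G Q) => C.donationQueuings_spec hq
        rw [hs, hs']
        exact C.cleanLT_of_lt_at (hsp a ha.1).1 (hsp b hb.1).1 (C.isNth_lt
          (fun a ha b hb c hc => hH.lt_trans' (hsp a ha).1.1 (hsp b hb).1.1 (hsp c hc).1.1)
          (fun a ha b hb => hH.trichotomy (hsp a ha).1 (hsp b hb).1) hlt ha hb)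
      · exact absurd (hd.1.1.2.1.symm.trans hd'.1.1.2.1) (C.ne_of_original hd.1.2.1)
      · exact (hn1' _ hd.1).elim
      · exact absurd (hd'.1.1.2.1.symm.trans hd.1.1.2.1) (C.ne_of_original hd'.1.2.1)
      · obtain rfl := hd.1.1.2.2.symm.trans hd'.1.1.2.2
        have hsp := fun q (hq : q ∈ coDonationQueuings H G Q) => C.coDonationQueuings_spec hq
        have hev := fun q hq => C.spine_events (hsp q hq)
        rw [hs, hs']
        exact C.cleanLT_of_spine (hsp a ha.1) (hsp b hb.1) (C.isNth_lt
          (fun a ha b hb c hc => hH.lt_trans' (hev a ha) (hev b hb) (hev c hc))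
          (fun a ha b hb => C.spine_trichotomy (hsp a ha) (hsp b hb)) hlt ha hb)
      · exact (hn2' _ hd.1).elim
      · exact (hn1 _ hd'.1).elim
      · exact (hn2 _ hd'.1).elim
      · rw [hs, hs']; exact Nat.succ_lt_succ hlt
    · exact .inr ⟨hsame (h1.trans h2.symm), C.side_lt hε hε' ht hp hB⟩
  · obtain ⟨k, d, hk, hd, h0⟩ := hinst h2
    rw [hk] at hmem
    obtain ⟨-, d', hd', hlt⟩ := protPacket_sub hmem h1
    rcases hd' with hd' | hd'
    · cases hd.symm.trans hd'
    · obtain rfl := Content.codonation.inj (hd.symm.trans hd')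
      exact absurd hlt (by rw [h0]; exact Nat.not_lt_zero _)
  · exact .inr ⟨hsame (h1.trans h2.symm), C.side_lt hε hε' ht hp hB⟩

lemma clean_trigger_inj (hq : .queue q ∈ H.eventsAt P) (hq' : .queue q' ∈ H.eventsAt P)
    (h : cleanOf (X.trigger q) = cleanOf (X.trigger q')) : X.trigger q = X.trigger q' := by
  have h1 := trigger_mem (X := X) hq
  have h2 := trigger_mem (X := X) hq'
  rcases C.hist.trichotomy h1 h2 with h3 | h3 | h3
  · exact absurd (C.cleanLT_of_lt_at h1 h2 h3) (h ▸ cleanLT_irrefl _)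
  · exact h3
  · exact absurd (C.cleanLT_of_lt_at h2 h1 h3) (h ▸ cleanLT_irrefl _)

lemma label_valid (hq : .queue q ∈ H.eventsAt P) : (label H X G (.queue q)).Valid H G :=
  ⟨cleanOf_valid (trigger_mem hq).1, C.subCoord_ok hq⟩

/-- The labels of the queuing events at one process are in order. -/
lemma label_queue_lt (hq : .queue q ∈ H.eventsAt P) (hq' : .queue q' ∈ H.eventsAt P) :
    labelLT H (label H X G (.queue q)) (label H X G (.queue q')) ↔ H.lt (.queue q) (.queue q') := by
  have key : ∀ {q q'}, Ev.queue q ∈ H.eventsAt P → Ev.queue q' ∈ H.eventsAt P →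
      H.lt (.queue q) (.queue q') →
      labelLT H (label H X G (.queue q)) (label H X G (.queue q')) := by
    intro q q' hq hq' h
    rcases (queue_lt_queue_iff C.hist hq hq').1 h with h | ⟨h, hp⟩
    · exact .inl (C.cleanLT_of_lt_at (trigger_mem hq) (trigger_mem hq') h)
    · refine .inr ⟨congrArg cleanOf h, ?_⟩
      rcases C.coord_lt hq hq' h hp with h | ⟨h1, h2⟩
      · exact .inl h
      · exact .inr ⟨h1, .inr ⟨rfl, h2⟩⟩
  refine ⟨fun h => ?_, key hq hq'⟩
  rcases C.hist.trichotomy hq hq' with h1 | h1 | h1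
  · exact h1
  · rw [h1] at h; exact absurd h (labelLT_irrefl _)
  · exact absurd (C.labelLT_trans (C.label_valid hq) (C.label_valid hq') (C.label_valid hq) h
      (key hq' hq h1)) (labelLT_irrefl _)

lemma early_sub (hq : .queue q ∈ H.eventsAt P) (hv : H.eventView (.queue q) < 𝔠) :
    subCoord H X G q = .zero := by
  obtain ⟨ε, hε, hm, -⟩ := C.effectAt_spec X hq
  have hT := trigger_mem (X := X) hq
  rw [eventView_queue (X := X) C.hist hq] at hv
  refine C.subCoord_main hε ?_
  by_cases hk : ∃ k, X.trigger q = .dequeue k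
  · obtain ⟨k, hk⟩ := hk
    rw [hk] at hv hT
    have hmem : ε ∈ X.effects (X.trigger q) := List.mem_of_getElem? hm
    rw [hk] at hmem
    have hch := mem_channel_self hT.2.1
    have hr := early_rank (X := X) C.first C.hist hch ((trigger_view_le (X := X) C.hist hch hT.1).trans_lt hv)
    rcases h : ε.phase with _ | n | _
    · rfl
    · obtain ⟨-, d, hd | hd, -⟩ := protPacket_sub hmem h <;> rw [hd] at hr <;> simp [Content.rank] at hr
    · obtain ⟨-, d, hd, -⟩ := protPacket_install hmem h
      rw [hd] at hr; simp [Content.rank] at hr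
  · push Not at hk
    exact handle_main H hk _ ε (List.mem_of_getElem? hm)

lemma early_ack (hq : .queue q ∈ H.eventsAt P) (hq' : .queue q' ∈ H.eventsAt P)
    (hv : H.eventView (.queue q) < 𝔠) (ht : X.trigger q = X.trigger q') (hk : k ∈ H.packets)
    (hkq : H.queuing k = q) (ha : (H.content k).IsAck) : q = q' := by
  obtain ⟨ε, hε, hm, hc⟩ := C.effectAt_spec X hq
  have h1 := C.early_sub (X := X) hq hv
  rw [hc k hk hkq] at ha
  have hmem : ε ∈ X.effects (X.trigger q) := List.mem_of_getElem? hm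
  have hone : X.effects (X.trigger q) = [ε] := by
    revert hmem
    generalize X.trigger q = e
    intro hmem
    match e with
    | .queue _ => cases hmem
    | .dequeue k' =>
      rcases hp : ε.phase with _ | n | _
      · rcases protPacket_main hmem hp with ⟨_, _, h, -⟩ | ⟨_, _, h⟩ | ⟨_, _, h⟩ | ⟨_, _, h⟩
        · exact h
        all_goals cases hx : ε.content <;>
          simp_all [Content.IsAck, Content.IsGhost, Content.IsFlush, Content.IsMsg]
      · obtain ⟨k₁, -, ⟨_, _, _, _, hs⟩ | ⟨_, _, _, _, hs⟩ | ⟨hs, _⟩⟩ := C.subCoord_sub hq hε hp <;>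
          rw [hs] at h1 <;> cases h1
      · have := (protPacket_install hmem hp).1
        cases hx : ε.content <;> simp_all [Content.IsAck, Content.IsMsg]
    | .request r =>
      have := (protBroadcast_effects _ _ ε hmem).2
      cases hx : ε.content <;> simp_all [Content.IsAck, Content.IsMsg]
    | .notify i P =>
      have hr : ε.content.rank = 3 := by
        cases hx : ε.content <;> simp_all [Content.IsAck, Content.rank]
      exfalso
      rw [effects] at hmem
      rcases handle_notify H i P with ⟨Q, h⟩ | ⟨Q, h⟩ | ⟨J, E, h⟩ | ⟨R, h⟩ | h <;> rw [h] at hmem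
      · cases hmem
      · have := checkFlush_ack_lt _ ε hmem; omega
      · rw [protJoin_eq] at hmem
        rcases List.mem_cons.1 hmem with rfl | hmem
        · cases hr
        · have := checkFlush_ack_lt _ ε hmem; omega
      · rw [protRemove_eq] at hmem
        have := finishRemove_rank _ _ ε hmem; omega
      · cases hmem
  obtain ⟨ε', -, hm', -⟩ := C.effectAt_spec X hq'
  rw [← ht, hone] at hm'
  rw [hone] at hm
  refine X.effect_inj q q' hq.1 hq'.1 ht ?_
  have h2 := (List.getElem?_eq_some_iff.1 hm).1
  have h3 := (List.getElem?_eq_some_iff.1 hm').1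
  simp at h2 h3
  omega

end Effects

end Critical

section Data

/-- The packet of the given history from which a packet of the reduced history arises. -/
def RPkt.base : RPkt Proc Pkt → Pkt
  | .orig k | .into _ k | .outof _ k | .outofZombie _ k | .within _ _ k | .withinZombie _ _ k
  | .late _ k => k

def RQue.base : RQue Que → Que
  | .orig q | .shift _ q | .clone _ q | .cloneShift _ _ q | .zombie _ q => q

def RQue.adj : RQue Que → Adj
  | .orig _ | .clone _ _ | .zombie _ _ => .zero
  | .shift s _ | .cloneShift _ s _ => .msg s

variable (H X G)

noncomputable def RQue.side : RQue Que → Side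
  | .zombie _ _ => .flush
  | y => sideCoord H X y.base

/-- The packet is dequeued in the transaction in which its base is dequeued. -/
def RPkt.Direct : RPkt Proc Pkt → Prop
  | .orig _ => True
  | .late _ _ => False
  | x => Timely H G x.base

/-- The critical donation or co-donation that stands in for an untimely packet. -/
def RPkt.Delay : RPkt Proc Pkt → Pkt → Prop
  | .into s k, d => s = .pos ∧ DonationTime H G (H.source k) d
  | .outof s k, d | .outofZombie s k, d => s = .pos ∧ CoDonationTime H G (H.target k) d
  | .late P _, d => CoDonationTime H G P d
  | _, _ => False

def RPkt.adj : RPkt Proc Pkt → Adj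
  | .outof s k | .within s _ k => adjOf s (H.content k)
  | .outofZombie s _ | .withinZombie s _ _ => .flush s
  | _ => .zero

noncomputable def RPkt.delayAdj : RPkt Proc Pkt → Adj
  | .outof s k => if (H.content k).IsGhost then .ghost s else .zero
  | .outofZombie s _ => .flush s
  | _ => .zero

/-- The events of the given history that the first coordinates at a process come from. -/
def Line : Option Proc → Set Evt
  | some P => if P = G then Spine H G else H.eventsAt P
  | none => {e | e ∈ H.eventsAt 𝔇 ∧ H.eventView e < 𝔠}

variable {H X G}

lemma mem_line_proc (s : Sign) (h : e ∈ H.eventsAt 𝔇) (hv : H.eventView e < 𝔠) :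
    e ∈ Line H G (s.proc G) := by
  cases s
  · rw [Sign.proc, Line, if_pos rfl]; exact .inl ⟨h, hv⟩
  · exact ⟨h, hv⟩

lemma line_of_ne (h : P ≠ G) : Line H G (some P) = H.eventsAt P := if_neg h

lemma mem_line (h : e ∈ H.eventsAt P) : e ∈ Line H G (some P) := by
  by_cases hP : P = G
  · subst hP; rw [Line, if_pos rfl]; exact .inr h
  · rwa [line_of_ne hP]

lemma rLabel_queue (y : RQue Que) : rLbl (.queue y) =
    ⟨cleanOf (X.trigger y.base), subCoord H X G y.base, y.adj, y.side H X⟩ := by cases y <;> rfl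

lemma rQueuing_base (x : RPkt Proc Pkt) : (rQueuing H x).base = H.queuing x.base := by
  cases x <;> simp only [rQueuing] <;> (try split_ifs) <;> rfl

lemma rEventsAt_iff {R : Option Proc} {e : REvt} : e ∈ (Hʳ).eventsAt R ↔ e ∈ rEvts ∧ match e with
      | .queue q => ∃ k ∈ rPkts, rQueuing H k = q ∧ rSrc k = R
      | .dequeue k => k ∈ rPkts ∧ rTgt k = R
      | .notify _ X => X = R
      | .request r => some (H.issuer r) = R := by
  cases e <;> exact Iff.rfl

lemma proc_inj {s t : Sign} (h : s.proc G = t.proc G) : s = t := by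
  cases s <;> cases t <;> first | rfl | cases h

end Data

namespace Critical

variable (C : Critical H G)
include C

lemma pre_iff (hk : k ∈ H.packets) : PreCritical H G (.queue (H.queuing k)) ↔
    H.eventView (.queue (H.queuing k)) < 𝔠 :=
  preCritical_iff C.hist G (queue_mem C.hist (mem_channel_self hk))

lemma pre_source (hk : k ∈ H.packets) (h : PreCritical H G (.queue (H.queuing k))) :
    H.source k ≠ G ∧ H.target k ≠ G ∧ H.Original (H.source k) := by
  have hH := C.hist
  have hq := hH.packet_queued _ hk
  rw [C.pre_iff hk] at h
  have hj := (hH.joinView_le_eventView hq).trans_lt h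
  have ho := C.original_of_lt hj
  refine ⟨C.ne_of_original ho, fun ht => ?_, ho⟩
  rcases hH.liveness_join _ _ k (mem_channel_self hk) with h1 | ⟨h1, h2⟩ <;> rw [ht] at h1
  · rw [hH.mem_view_iff ((hH.join_lt_death _).trans_le (hH.deathView_le _))] at h1; omega
  · rw [ht] at h2
    have := hH.eventView_mono h1 hq.1 h2.1
    rw [hH.eventView_notify h1] at this; omega

lemma early_content (X : Execution H) (hk : k ∈ H.packets)
    (h : PreCritical H G (.queue (H.queuing k))) : 3 ≤ (H.content k).rank := by
  rw [C.pre_iff hk, eventView_queue (X := X) C.hist (queue_mem C.hist (mem_channel_self hk))] at h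
  exact early_rank C.first C.hist (mem_channel_self hk) h

lemma not_critical_of_rank {k' : Pkt} (hk : k ∈ H.packets) (hk' : k' ∈ H.packets)
    (h : H.queuing k' = H.queuing k) (hr : 3 ≤ (H.content k).rank) :
    (∀ P, ¬ IsCritDonation H G P k') ∧ ∀ P, ¬ IsCritCoDonation H G P k' := by
  rw [← (C.hist.multicast_same _ hk' _ hk h).1] at hr
  constructor <;> intro P hP <;> have := hP.2.2 <;> cases hc : H.content k' <;>
    simp_all [Content.rank, Content.IsDonation, Content.IsCoDonation]

lemma self_timely (hk : k ∈ H.channel 𝔇 𝔇) (h : PreCritical H G (.queue (H.queuing k))) :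
    Timely H G k := by
  have hH := C.hist
  have hn := C.notify_critical C.parent_spec.1 C.parent_spec.2
  have h1 := hH.self_channel _ k hk _ hn.1
    ((hH.lt_notify_iff (queue_mem hH hk) hn.1).2 ((C.pre_iff hk.1).1 h))
  have hd : .dequeue k ∈ H.eventsAt 𝔇 := ⟨h1.1, hk.1, hk.2.2⟩
  exact ⟨hk.1, h, h1.1, (preCritical_iff hH G hd).2 ((hH.lt_notify_iff hd hn.1).1 h1.2)⟩

lemma timely_view (h : Timely H G k) :
    .dequeue k ∈ H.eventsAt (H.target k) ∧ H.eventView (.dequeue k) < 𝔠 := by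
  have hd : .dequeue k ∈ H.eventsAt (H.target k) := ⟨h.2.2.1, h.1, rfl⟩
  exact ⟨hd, (preCritical_iff C.hist G hd).1 h.2.2.2⟩

lemma rQueued_of_mem {x : RPkt Proc Pkt} (hx : x ∈ rPkts) :
    rQueued H G (rQueuing H x) := by
  have hH := C.hist
  have main : ∀ {k}, k ∈ H.packets → 3 ≤ (H.content k).rank → rQueued H G (.orig (H.queuing k)) :=
    fun hk hr => ⟨(hH.packet_queued _ hk).1, fun k' hk' h =>
      C.not_critical_of_rank hk hk' h hr⟩
  cases x with
  | orig k =>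
    obtain ⟨hk, h1, h2⟩ := hx
    refine ⟨(hH.packet_queued _ hk).1, fun k' hk' hq => ?_⟩
    by_cases hr : 3 ≤ (H.content k).rank
    · exact C.not_critical_of_rank hk hk' hq hr
    · have hT := trigger_mem (X := X) (hH.packet_queued _ hk)
      obtain ⟨ε, h3, h4, h5⟩ := X.exists_effect hH (mem_channel_self hk)
      obtain ⟨ε', h3', h4', h5'⟩ := X.exists_effect hH (mem_channel_self hk')
      rw [hq] at h3'
      obtain rfl := Option.some.inj (h3.symm.trans h3')
      have : H.target k' = H.target k := by
        rcases donation_cases hH hT (trigger_isTrigger (hH.packet_queued _ hk)) h3 with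
          h | ⟨_, -, -, -, -, h⟩ | ⟨_, _, -, -, -, -, h⟩
        · rw [h4] at h; exact absurd h hr
        all_goals
          rw [h] at h5 h5'
          exact (Set.mem_singleton_iff.1 h5').trans (Set.mem_singleton_iff.1 h5).symm
      rw [hH.multicast_target _ hk' _ hk hq this]; exact ⟨h1, h2⟩
  | into s k =>
    obtain ⟨hk, ht, hs, hp, hc⟩ := hx
    simp only [rQueuing]
    split_ifs with ha
    · refine ⟨hp, k, hk, rfl, ht, ?_⟩
      cases hx : H.content k <;>
        simp_all [Content.IsAck, Content.IsGhost, Content.IsFlush, Content.IsMsg]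
    · exact main hk (C.early_content X hk hp)
  | outof s k => exact ⟨hx.2.2.2.1, k, hx.1, rfl, hx.2.1, hx.2.2.2.2⟩
  | outofZombie s k => exact ⟨hx.2.2.2.1, k, hx.1, rfl, hx.2.1, hx.2.2.2.2⟩
  | within s t k =>
    obtain ⟨hk, ht, hc⟩ := hx
    simp only [rQueuing]
    split_ifs with ha
    · refine ⟨ht.2.1, k, hk, rfl, ?_⟩
      rcases hc with hc | hc | hc
      · cases hx : H.content k <;> simp_all [Content.IsAck, Content.IsMsgNotFrom]
      · exact hc
      · cases hx : H.content k <;> simp_all [Content.IsAck, Content.IsGhost]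
    · refine ⟨ht.2.1, k, hk.1, rfl, hk.2.1, ?_⟩
      rcases hc with hc | hc | hc
      · exact .inl hc
      · cases hx : H.content k <;> simp_all [Content.IsAck, Content.IsAckNotFrom]
      · exact .inr (.inr hc)
  | withinZombie s t k => exact ⟨hx.2.1.2.1, k, hx.1.1, rfl, hx.1.2.1, hx.2.2⟩
  | late P k =>
    obtain ⟨-, -, hk, -, -, -, hc⟩ := hx
    refine main hk.1 ?_
    cases hx : H.content k <;>
      simp_all [Content.rank, Content.IsGhost, Content.IsFlush, Content.IsMsg]

lemma exists_rPacket {y : RQue Que} (hy : rQueued H G y) : ∃ x ∈ rPkts, rQueuing H x = y := by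
  cases y with
  | orig q =>
    obtain ⟨P, -, k, hk, hq, -⟩ := C.hist.event_located _ hy.1
    exact ⟨.orig k, ⟨hk, hy.2 k hk hq⟩, congrArg _ hq⟩
  | shift s q =>
    obtain ⟨hp, k, hk, rfl, ht, ha⟩ := hy
    refine ⟨.into s k, ⟨hk, ht, (C.pre_source hk hp).1, hp, .inr (.inr (.inr ha))⟩, if_pos ?_⟩
    cases hx : H.content k <;> simp_all [Content.IsAck, Content.IsAckNotFrom]
  | clone s q =>
    obtain ⟨hp, k, hk, rfl, hs, hc⟩ := hy
    exact ⟨.outof s k, ⟨hk, hs, (C.pre_source hk hp).2.1, hp, hc⟩, rfl⟩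
  | cloneShift s t q =>
    obtain ⟨hp, k, hk, rfl, ha⟩ := hy
    refine ⟨.within s t k, ⟨hk, C.self_timely hk hp, .inr (.inl ha)⟩, if_pos ?_⟩
    cases hx : H.content k <;> simp_all [Content.IsAck, Content.IsAckNotFrom]
  | zombie s q =>
    obtain ⟨hp, k, hk, rfl, hs, hc⟩ := hy
    exact ⟨.outofZombie s k, ⟨hk, hs, (C.pre_source hk hp).2.1, hp, hc⟩, rfl⟩

lemma mem_pre (hk : k ∈ H.packets) (hs : H.source k = 𝔇)
    (hp : PreCritical H G (.queue (H.queuing k))) :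
    .queue (H.queuing k) ∈ H.eventsAt 𝔇 ∧ H.eventView (.queue (H.queuing k)) < 𝔠 :=
  ⟨hs ▸ queue_mem C.hist (mem_channel_self hk), (C.pre_iff hk).1 hp⟩

lemma queue_at {R : Option Proc} {y : RQue Que} (h : .queue y ∈ (Hʳ).eventsAt R) :
    (∃ P, R = some P ∧ .queue y.base ∈ H.eventsAt P ∧ (y = .orig y.base ∨ ∃ s, y = .shift s y.base ∧
      P ≠ G ∧ H.eventView (.queue y.base) < 𝔠 ∧
      ∃ k ∈ H.packets, H.queuing k = y.base ∧ (H.content k).IsAck)) ∨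
    (∃ s, R = s.proc G ∧ .queue y.base ∈ H.eventsAt 𝔇 ∧ H.eventView (.queue y.base) < 𝔠 ∧
      ((y = .clone s y.base ∧ ∃ k ∈ H.packets, H.queuing k = y.base ∧ ¬ (H.content k).IsFlush) ∨
       (∃ t, y = .cloneShift s t y.base ∧
        ∃ k ∈ H.packets, H.queuing k = y.base ∧ (H.content k).IsAck) ∨
       (y = .zombie s y.base ∧ ∃ k ∈ H.packets, H.queuing k = y.base ∧ (H.content k).IsGhost))) := by
  have hH := C.hist
  obtain ⟨hy, x, hx, rfl, rfl⟩ := rEventsAt_iff.1 h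
  cases x with
  | orig k => exact .inl ⟨_, rfl, hH.packet_queued _ hx.1, .inl rfl⟩
  | into s k =>
    obtain ⟨hk, ht, hs, hp, hc⟩ := hx
    have hq := hH.packet_queued _ hk
    simp only [rQueuing]
    split_ifs with ha
    · exact .inl ⟨_, rfl, hq, .inr ⟨s, rfl, hs, (C.pre_iff hk).1 hp, k, hk, rfl, ha⟩⟩
    · exact .inl ⟨_, rfl, hq, .inl rfl⟩
  | outof s k =>
    obtain ⟨hk, hs, -, hp, hc⟩ := hx
    obtain ⟨h1, h2⟩ := C.mem_pre hk hs hp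
    refine .inr ⟨s, rfl, h1, h2, .inl ⟨rfl, k, hk, rfl, ?_⟩⟩
    rcases hc with hc | hc | hc <;> cases hx : H.content k <;>
      simp_all [Content.IsAck, Content.IsGhost, Content.IsFlush, Content.IsMsgNotFrom]
  | outofZombie s k =>
    obtain ⟨hk, hs, -, hp, hc⟩ := hx
    obtain ⟨h1, h2⟩ := C.mem_pre hk hs hp
    exact .inr ⟨s, rfl, h1, h2, .inr (.inr ⟨rfl, k, hk, rfl, hc⟩)⟩
  | within s t k =>
    obtain ⟨hk, ht, hc⟩ := hx
    obtain ⟨h1, h2⟩ := C.mem_pre hk.1 hk.2.1 ht.2.1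
    simp only [rQueuing]
    split_ifs with ha
    · exact .inr ⟨s, rfl, h1, h2, .inr (.inl ⟨t, rfl, k, hk.1, rfl, ha⟩)⟩
    · refine .inr ⟨s, rfl, h1, h2, .inl ⟨rfl, k, hk.1, rfl, ?_⟩⟩
      rcases hc with hc | hc | hc <;> cases hx : H.content k <;>
        simp_all [Content.IsAckNotFrom, Content.IsGhost, Content.IsFlush, Content.IsMsgNotFrom]
  | withinZombie s t k =>
    obtain ⟨hk, ht, hc⟩ := hx
    obtain ⟨h1, h2⟩ := C.mem_pre hk.1 hk.2.1 ht.2.1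
    exact .inr ⟨s, rfl, h1, h2, .inr (.inr ⟨rfl, k, hk.1, rfl, hc⟩)⟩
  | late P k => exact .inl ⟨G, rfl, queue_mem hH hx.2.2.1, .inl rfl⟩

lemma delay_unique (X : Execution H) {d d' : Pkt} (h : DonationTime H G P d)
    (h' : DonationTime H G P d') : d = d' :=
  donation_unique (X := X) C.hist h.1.1 h'.1.1 h.1.2.2 h'.1.2.2

lemma codelay_unique (X : Execution H) {d d' : Pkt} (h : CoDonationTime H G P d)
    (h' : CoDonationTime H G P d') : d = d' :=
  codonation_unique (X := X) C.hist h.1.1 h'.1.1 h.1.2.2 h'.1.2.2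

/-- The two ways in which packets are dequeued. -/
lemma dequeue_cases {x : RPkt Proc Pkt} (hx : rDeqs x) :
    (x.Direct H G ∧ .dequeue x.base ∈ H.events ∧
      rLbl (.dequeue x) = ⟨.event (.dequeue x.base), .zero, x.adj H, .trigger⟩) ∨
    (¬ x.Direct H G ∧ ∃ d, x.Delay H G d ∧ rLbl (.dequeue x) =
      ⟨.event (.dequeue d), .ev (.event (.queue (H.queuing x.base))), x.delayAdj H, .trigger⟩) := by
  have key : ∀ {p : Pkt → Prop} {q : Que} {a k}, (∀ d d', p d → p d' → d = d') → ∀ d, p d →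
      subLabel (Proc := Proc) (Req := Req) p q a k =
        ⟨.event (.dequeue d), .ev (.event (.queue (Proc := Proc) (Req := Req) q)), a, .trigger⟩ := by
    intro p q a k hu d hd
    have hex : ∃ d, p d := ⟨d, hd⟩
    rw [subLabel, dif_pos hex, hu _ _ hex.choose_spec hd]; rfl
  have hdon := fun P d d' => C.delay_unique X (P := P) (d := d) (d' := d')
  have hcod := fun P d d' => C.codelay_unique X (P := P) (d := d) (d' := d')
  obtain ⟨hm, hx⟩ := hx
  cases x with
  | orig k => exact .inl ⟨trivial, hx, rfl⟩
  | late P k =>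
    obtain ⟨d, hd⟩ := hx
    exact .inr ⟨id, d, hd, key (hcod _) d hd⟩
  | within s t k => exact .inl ⟨hm.2.1, hm.2.1.2.2.1, rfl⟩
  | withinZombie s t k => exact .inl ⟨hm.2.1, hm.2.1.2.2.1, rfl⟩
  | into s k =>
    by_cases ht : Timely H G k
    · exact .inl ⟨ht, ht.2.2.1, if_pos ht⟩
    · obtain ⟨rfl, d, hd⟩ := hx.resolve_left ht
      exact .inr ⟨ht, d, ⟨rfl, hd⟩, (if_neg ht).trans (key (hdon _) d hd)⟩
  | outof s k =>
    by_cases ht : Timely H G k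
    · exact .inl ⟨ht, ht.2.2.1, if_pos ht⟩
    · obtain ⟨rfl, d, hd⟩ := hx.resolve_left ht
      exact .inr ⟨ht, d, ⟨rfl, hd⟩, (if_neg ht).trans (key (hcod _) d hd)⟩
  | outofZombie s k =>
    by_cases ht : Timely H G k
    · exact .inl ⟨ht, ht.2.2.1, if_pos ht⟩
    · obtain ⟨rfl, d, hd⟩ := hx.resolve_left ht
      exact .inr ⟨ht, d, ⟨rfl, hd⟩, (if_neg ht).trans (key (hcod _) d hd)⟩

lemma dequeued_of_direct {x : RPkt Proc Pkt} (hx : x ∈ rPkts) (h : x.Direct H G)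
    (hd : .dequeue x.base ∈ H.events) : rDeqs x := by
  cases x <;> first | exact ⟨hx, hd⟩ | exact ⟨hx, .inl h⟩ | exact ⟨hx, trivial⟩ | exact h.elim

lemma dequeued_of_delay {x : RPkt Proc Pkt} (hx : x ∈ rPkts) {d : Pkt} (h : x.Delay H G d) :
    rDeqs x := by
  cases x <;> first | exact ⟨hx, .inr ⟨h.1, d, h.2⟩⟩ | exact ⟨hx, d, h⟩ | exact h.elim

lemma delay_spec {x : RPkt Proc Pkt} (hx : x ∈ rPkts) {d : Pkt} (h : x.Delay H G d) :
    (∃ P, rTgt x = some P ∧ .dequeue d ∈ H.eventsAt P) ∧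
    SubOK H G (.event (.dequeue d)) (.ev (.event (.queue (H.queuing x.base)))) ∧
    cleanLT H (cleanOf (𝔱 x.base)) (.event (.dequeue d)) ∧
    𝔠 ≤ H.eventView (.dequeue d) := by
  have hH := C.hist
  have don : ∀ {P d}, DonationTime H G P d → .dequeue d ∈ H.eventsAt G :=
    fun h => ⟨h.2, h.1.1.1, h.1.1.2.2⟩
  have cod : ∀ {P d}, CoDonationTime H G P d → .dequeue d ∈ H.eventsAt P ∧
      𝔠 ≤ H.eventView (.dequeue d) := by
    intro P d h
    obtain ⟨_, h₀, -, -, hlt, hd, -⟩ := C.codonation_state X h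
    have hm := (C.donation_state X h₀).2.1
    have := hH.eventView_mono hm hd.1 hlt.1
    rw [hH.eventView_notify hm] at this; exact ⟨hd, this⟩
  have pre : ∀ {k}, k ∈ H.packets → PreCritical H G (.queue (H.queuing k)) → ∀ {e : Evt},
      𝔠 ≤ H.eventView e → cleanLT H (cleanOf (𝔱 k)) (.event e) := by
    intro k hk hp e he
    have hq := hH.packet_queued _ hk
    refine cleanLT_of_cview ?_
    rw [cview_cleanOf hH (trigger_mem hq).1, ← eventView_queue hH hq]
    exact ((C.pre_iff hk).1 hp).trans_le he
  cases x with
  | into s k =>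
    obtain ⟨hk, ht, hs, hp, hc⟩ := hx
    obtain ⟨rfl, h⟩ := h
    have hd := don h
    have hv := C.le_view hd
    exact ⟨⟨_, rfl, hd⟩, .don h (hH.packet_queued _ hk) ((C.pre_iff hk).1 hp), pre hk hp hv, hv⟩
  | outof s k =>
    obtain ⟨hk, hs, ht, hp, hc⟩ := hx
    obtain ⟨hd, hv⟩ := cod h.2
    exact ⟨⟨_, rfl, hd⟩, .cod h.2 (.inl (C.mem_pre hk hs hp)), pre hk hp hv, hv⟩
  | outofZombie s k =>
    obtain ⟨hk, hs, ht, hp, hc⟩ := hx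
    obtain ⟨hd, hv⟩ := cod h.2
    exact ⟨⟨_, rfl, hd⟩, .cod h.2 (.inl (C.mem_pre hk hs hp)), pre hk hp hv, hv⟩
  | late P k =>
    obtain ⟨-, -, hk, -, -, hl, -⟩ := hx
    obtain ⟨hd, hv⟩ := cod h
    have hq := queue_mem hH hk
    obtain ⟨k₀, h₀, -, -, -, -, hlt⟩ := C.codonation_state X h
    refine ⟨⟨_, rfl, hd⟩, .cod h (.inr hq), cleanLT_trans hH (cleanOf_valid (trigger_mem hq).1)
      (b := cleanOf (.dequeue k₀)) h₀.2 hd.1 (hl k₀ h₀) ?_, hv⟩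
    exact hH.cleanLT_of_lt h₀.2 hd.1 hlt (by simp)
  | _ => exact h.elim

end Critical

lemma adjOf_spec (h : 3 ≤ c.rank) (s : Sign) :
    adjOf s c ≠ .zero ∧ (c.IsGhost ∨ c.IsMsg ∨ c.IsAck → ∀ t, adjOf s c ≠ .flush t) ∧
      ∀ t, adjOf s c = adjOf t c → s = t := by
  cases c <;> simp_all [adjOf, Content.rank, Content.IsGhost, Content.IsMsg, Content.IsAck]

namespace Critical

variable (C : Critical H G)
include C

lemma direct_mem {x : RPkt Proc Pkt} (hx : x ∈ rPkts) (h : x.Direct H G)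
    (hd : .dequeue x.base ∈ H.events) : .dequeue x.base ∈ Line H G (rTgt x) := by
  cases x with
  | orig k => exact mem_line ⟨hd, hx.1, rfl⟩
  | into s k =>
    obtain ⟨h1, h2⟩ := C.timely_view h
    exact mem_line_proc s (hx.2.1 ▸ h1) h2
  | outof s k => exact mem_line (C.timely_view h).1
  | outofZombie s k => exact mem_line (C.timely_view h).1
  | within s t k =>
    obtain ⟨h1, h2⟩ := C.timely_view h
    exact mem_line_proc t (hx.1.2.2 ▸ h1) h2
  | withinZombie s t k =>
    obtain ⟨h1, h2⟩ := C.timely_view h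
    exact mem_line_proc t (hx.1.2.2 ▸ h1) h2
  | late P k => exact h.elim

lemma early_notify (hi : i < 𝔠) : .notify i 𝔇 ∈ H.eventsAt 𝔇 ∧ H.eventView (.notify i 𝔇) < 𝔠 := by
  have h := C.notify_mem (i := i) (P := 𝔇) (by rw [C.parent_spec.1]; exact Nat.zero_le _)
    (lt_trans (by exact_mod_cast hi) C.parent_spec.2)
  exact ⟨notify_at h, by rwa [C.hist.eventView_notify h]⟩

lemma queue_line {R : Option Proc} {y : RQue Que} (h : .queue y ∈ (Hʳ).eventsAt R) :
    .queue y.base ∈ Line H G R ∧ X.trigger y.base ∈ Line H G R ∧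
      ∃ P, .queue y.base ∈ H.eventsAt P := by
  rcases C.queue_at h with ⟨P, rfl, hq, -⟩ | ⟨s, rfl, hq, hv, -⟩
  · exact ⟨mem_line hq, mem_line (trigger_mem hq), P, hq⟩
  · exact ⟨mem_line_proc s hq hv, mem_line_proc s (trigger_mem hq)
      (by rwa [← eventView_queue C.hist hq]), _, hq⟩

lemma home {R : Option Proc} {e : REvt} (he : e ∈ (Hʳ).eventsAt R) :
    (∃ g ∈ Line H G R, (rLbl e).con = cleanOf g) ∧ (rLbl e).Valid H G := by
  cases e with
  | queue y =>
    rw [rLabel_queue]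
    obtain ⟨-, h, P, hq⟩ := C.queue_line he
    exact ⟨⟨_, h, rfl⟩, cleanOf_valid (trigger_mem hq).1, C.subCoord_ok hq⟩
  | dequeue x =>
    obtain ⟨hx, hm, rfl⟩ := rEventsAt_iff.1 he
    rcases C.dequeue_cases hx with ⟨h1, h2, h3⟩ | ⟨h1, d, h2, h3⟩ <;> rw [h3]
    · exact ⟨⟨_, C.direct_mem hm h1 h2, rfl⟩, h2, .zero _⟩
    · obtain ⟨⟨P, h4, h5⟩, h6, -⟩ := C.delay_spec hm h2
      exact ⟨⟨_, h4 ▸ mem_line h5, rfl⟩, h5.1, h6⟩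
  | notify i P =>
    obtain ⟨hx, rfl⟩ := rEventsAt_iff.1 he
    refine ⟨?_, trivial, .zero _⟩
    cases P with
    | none => exact ⟨_, C.early_notify hx, rfl⟩
    | some P =>
      rcases hx with h | ⟨rfl, h⟩
      · exact ⟨_, mem_line (notify_at h), rfl⟩
      · exact ⟨_, by rw [Line, if_pos rfl]; exact .inl (C.early_notify h), rfl⟩
  | request r =>
    obtain ⟨hx, rfl⟩ := rEventsAt_iff.1 he
    have hr : .request r ∈ H.eventsAt (H.issuer r) := ⟨hx, rfl⟩
    exact ⟨⟨_, mem_line hr, rfl⟩, hx, .zero _⟩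

lemma line_trichotomy {R : Option Proc} (he : e ∈ Line H G R) (hf : f ∈ Line H G R) :
    cleanLT H (cleanOf e) (cleanOf f) ∨ e = f ∨
      cleanLT H (cleanOf f) (cleanOf e) := by
  have spine : e ∈ Spine H G → f ∈ Spine H G → _ := fun he hf =>
    (C.spine_trichotomy he hf).imp (C.cleanLT_of_spine he hf) (Or.imp id (C.cleanLT_of_spine hf he))
  cases R with
  | none => exact spine (.inl he) (.inl hf)
  | some P =>
    by_cases h : P = G
    · rw [Line, if_pos h] at he hf; exact spine he hf
    · rw [line_of_ne h] at he hf
      exact (C.hist.trichotomy he hf).imp (C.cleanLT_of_lt_at he hf)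
        (Or.imp id (C.cleanLT_of_lt_at hf he))

lemma label_cases {R : Option Proc} {e f : REvt} (he : e ∈ (Hʳ).eventsAt R)
    (hf : f ∈ (Hʳ).eventsAt R) :
    labelLT H (rLbl e) (rLbl f) ∨ labelLT H (rLbl f) (rLbl e) ∨
    ((rLbl e).con = (rLbl f).con ∧ (rLbl e).sub = (rLbl f).sub ∧ (rLbl e).adj = (rLbl f).adj ∧
      (rLbl e).side.rank = (rLbl f).side.rank) := by
  obtain ⟨⟨g, hg, h1⟩, hv⟩ := C.home he
  obtain ⟨⟨g', hg', h1'⟩, hv'⟩ := C.home hf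
  have hcon := C.line_trichotomy hg hg'
  rw [← h1, ← h1'] at hcon
  rcases hcon with h | h | h
  · exact .inl (.inl h)
  · have h2 : (rLbl e).con = (rLbl f).con := by rw [h1, h1', h]
    have hvs := hv'.sub
    rw [← h2] at hvs
    rcases C.sub_trichotomy hv.sub hvs with h3 | h3 | h3
    · exact .inl (.inr ⟨h2, .inl h3⟩)
    · rcases lt_trichotomy (rLbl e).adj.rank (rLbl f).adj.rank with h4 | h4 | h4
      · exact .inl (.inr ⟨h2, .inr ⟨h3, .inl h4⟩⟩)
      · have h4 := Adj.rank_inj h4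
        rcases lt_trichotomy (rLbl e).side.rank (rLbl f).side.rank with h5 | h5 | h5
        · exact .inl (.inr ⟨h2, .inr ⟨h3, .inr ⟨h4, h5⟩⟩⟩)
        · exact .inr (.inr ⟨h2, h3, h4, h5⟩)
        · exact .inr (.inl (.inr ⟨h2.symm, .inr ⟨h3.symm, .inr ⟨h4.symm, h5⟩⟩⟩))
      · exact .inr (.inl (.inr ⟨h2.symm, .inr ⟨h3.symm, .inl h4⟩⟩))
    · exact .inr (.inl (.inr ⟨h2.symm, .inl h3⟩))
  · exact .inr (.inl (.inl h))

lemma base_inj (hq : .queue q ∈ H.eventsAt P) (hq' : .queue q' ∈ H.eventsAt P)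
    (h1 : cleanOf (X.trigger q) = cleanOf (X.trigger q'))
    (h2 : subCoord H X G q = subCoord H X G q')
    (h3 : (sideCoord H X q).rank = (sideCoord H X q').rank) : q = q' := by
  have ht := C.clean_trigger_inj hq hq' h1
  rcases lt_trichotomy (X.position q) (X.position q') with h | h | h
  · rcases C.coord_lt hq hq' ht h with h | h
    · exact absurd h (h2 ▸ subLT_irrefl _)
    · omega
  · exact X.effect_inj q q' hq.1 hq'.1 ht h
  · rcases C.coord_lt hq' hq ht.symm h with h | h
    · exact absurd h (h2 ▸ subLT_irrefl _)
    · omega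

lemma side_content (hq : .queue q ∈ H.eventsAt P) (hk : k ∈ H.packets) (h : H.queuing k = q) :
    ((sideCoord H X q).rank = 5 ↔ (H.content k).IsFlush) ∧
    ((sideCoord H X q).rank = 4 ↔ (H.content k).IsGhost) ∧
    ((sideCoord H X q).rank = 3 ↔ (H.content k).IsAck) := by
  obtain ⟨ε, hε, -, hc⟩ := C.effectAt_spec X hq
  rw [hc k hk h]
  by_cases hm : ε.content.IsMsg
  · rw [C.sideCoord_msg hε hm]
    cases hx : ε.content <;>
      simp_all [Content.IsMsg, Content.IsFlush, Side.rank, Content.IsGhost, Content.IsAck]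
    omega
  · rw [(C.sideCoord_rank hε hm).1]
    cases hx : ε.content <;>
      simp_all [Content.rank, Content.IsFlush, Content.IsGhost, Content.IsAck]

lemma clean_pre_ne (hq : .queue q ∈ H.eventsAt 𝔇) (hv : H.eventView (.queue q) < 𝔠)
    (hq' : .queue q' ∈ H.eventsAt G) :
    cleanOf (X.trigger q) ≠ cleanOf (X.trigger q') := by
  intro h
  have h1 := congrArg (cview H) h
  rw [cview_cleanOf C.hist (trigger_mem hq).1,
    cview_cleanOf C.hist (trigger_mem hq').1, ← eventView_queue C.hist hq,
    ← eventView_queue C.hist hq'] at h1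
  have := C.le_view hq'
  omega

lemma queue_inj {R : Option Proc} {y y' : RQue Que} (hy : .queue y ∈ (Hʳ).eventsAt R)
    (hy' : .queue y' ∈ (Hʳ).eventsAt R)
    (h1 : cleanOf (X.trigger y.base) = cleanOf (X.trigger y'.base))
    (h2 : subCoord H X G y.base = subCoord H X G y'.base) (h3 : y.adj = y'.adj)
    (h4 : (y.side H X).rank = (y'.side H X).rank) : y = y' := by
  have spos : ∀ {P : Proc} {s t : Sign}, some P = s.proc G → P = G := by
    intro P s t h; cases s <;> simp_all [Sign.proc]
  rcases C.queue_at hy with ⟨P, rfl, hq, hc⟩ | ⟨s, rfl, hq, hv, hc⟩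
  · rcases C.queue_at hy' with ⟨P', hP, hq', hc'⟩ | ⟨s', hs, hq', hv', hc'⟩
    · obtain rfl := Option.some.inj hP
      generalize hb : y.base = b at *
      generalize hb' : y'.base = b' at *
      rcases hc with rfl | ⟨s, rfl, -⟩ <;> rcases hc' with rfl | ⟨s', rfl, -⟩ <;>
        simp only [RQue.adj, RQue.side, RQue.base] at h3 h4 <;> cases h3
      · rw [C.base_inj hq hq' h1 h2 h4]
      · rw [C.base_inj hq hq' h1 h2 h4]
    · obtain rfl := spos (t := s') hs
      exact absurd h1.symm (C.clean_pre_ne hq' hv' hq)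
  · rcases C.queue_at hy' with ⟨P', hP, hq', hc'⟩ | ⟨s', hs, hq', hv', hc'⟩
    · obtain rfl := spos (t := s) hP.symm
      exact absurd h1 (C.clean_pre_ne hq hv hq')
    · obtain rfl := proc_inj hs
      generalize hb : y.base = b at *
      generalize hb' : y'.base = b' at *
      have hz : ∀ {q k}, .queue q ∈ H.eventsAt 𝔇 → k ∈ H.packets → H.queuing k = q →
          (H.content k).IsGhost → (sideCoord H X q).rank = 4 := fun h hk hkq hg =>
        (C.side_content h hk hkq).2.1.2 hg
      rcases hc with ⟨rfl, k, hk, hkq, hkc⟩ | ⟨t, rfl, k, hk, hkq, hkc⟩ | ⟨rfl, k, hk, hkq, hkc⟩ <;>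
        rcases hc' with ⟨rfl, k', hk', hkq', hkc'⟩ | ⟨t', rfl, k', hk', hkq', hkc'⟩ |
          ⟨rfl, k', hk', hkq', hkc'⟩ <;>
        simp only [RQue.adj, RQue.side, RQue.base] at h3 h4 <;> cases h3
      · rw [C.base_inj hq hq' h1 h2 h4]
      · exact absurd ((C.side_content hq hk hkq).1.1 h4) hkc
      · rw [C.base_inj hq hq' h1 h2 h4]
      · exact absurd ((C.side_content hq' hk' hkq').1.1 h4.symm) hkc'
      · rw [C.base_inj hq hq' h1 h2 ((hz hq hk hkq hkc).trans (hz hq' hk' hkq' hkc').symm)]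

lemma direct_inj {x x' : RPkt Proc Pkt} (hx : x ∈ rPkts) (hx' : x' ∈ rPkts) (h : x.Direct H G)
    (h' : x'.Direct H G) (hb : x.base = x'.base) (ha : x.adj H = x'.adj H) (ht : rTgt x = rTgt x') :
    x = x' := by
  have hne := C.parent_ne
  have hr := fun k hk hp => C.early_content (k := k) X hk hp
  have hs : ∀ {P : Proc} {s : Sign}, some P = s.proc G → P = G := by
    intro P s h; cases s <;> simp_all [Sign.proc]
  have out : ∀ {k}, ClonedOut H G k → (H.content k).IsGhost ∨ (H.content k).IsMsg ∨
      (H.content k).IsAck := by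
    rintro k (h | h | h) <;> cases hx : H.content k <;>
      simp_all [Content.IsMsgNotFrom, Content.IsMsg, Content.IsAck, Content.IsGhost]
  have wi : ∀ {k}, ClonedWithin H G k → (H.content k).IsGhost ∨ (H.content k).IsMsg ∨
      (H.content k).IsAck := by
    rintro k (h | h | h) <;> cases hx : H.content k <;>
      simp_all [Content.IsMsgNotFrom, Content.IsMsg, Content.IsAck, Content.IsGhost,
        Content.IsAckNotFrom]
  cases x <;> cases x' <;> simp only [RPkt.base] at hb <;> (try subst hb) <;>
    simp only [RPkt.adj, rTarget] at ha ht <;> (try exact h.elim) <;> (try exact h'.elim)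
  case orig.orig => rfl
  case into.into => rw [proc_inj ht]
  case outof.outof =>
    rw [(adjOf_spec (hr _ hx.1 hx.2.2.2.1) _).2.2 _ ha]
  case outofZombie.outofZombie => rw [Adj.flush.inj ha]
  case within.within =>
    rw [proc_inj ht, (adjOf_spec (hr _ hx.1.1 hx.2.1.2.1) _).2.2 _ ha]
  case withinZombie.withinZombie => rw [proc_inj ht, Adj.flush.inj ha]
  all_goals first
    | exact absurd (hx'.2.1.symm.trans (hs ht)) hne
    | exact absurd (hx.2.1.symm.trans (hs ht.symm)) hne
    | exact absurd (hs ht) hx.2.2.1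
    | exact absurd (hs ht.symm) hx'.2.2.1
    | exact absurd ha.symm (adjOf_spec (hr _ hx'.1 hx'.2.2.2.1) _).1
    | exact absurd ha (adjOf_spec (hr _ hx.1 hx.2.2.2.1) _).1
    | exact absurd ha.symm (adjOf_spec (hr _ hx'.1.1 hx'.2.1.2.1) _).1
    | exact absurd ha (adjOf_spec (hr _ hx.1.1 hx.2.1.2.1) _).1
    | exact absurd ha ((adjOf_spec (hr _ hx.1 hx.2.2.2.1) _).2.1 (out hx.2.2.2.2) _)
    | exact absurd ha.symm ((adjOf_spec (hr _ hx'.1 hx'.2.2.2.1) _).2.1 (out hx'.2.2.2.2) _)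
    | exact absurd ha ((adjOf_spec (hr _ hx.1.1 hx.2.1.2.1) _).2.1 (wi hx.2.2) _)
    | exact absurd ha.symm ((adjOf_spec (hr _ hx'.1.1 hx'.2.1.2.1) _).2.1 (wi hx'.2.2) _)
    | cases ha

lemma delay_inj {x x' : RPkt Proc Pkt} (hx : x ∈ rPkts) (hx' : x' ∈ rPkts) {d d' : Pkt}
    (h : x.Delay H G d) (h' : x'.Delay H G d') (hb : H.queuing x.base = H.queuing x'.base)
    (ha : x.delayAdj H = x'.delayAdj H) (ht : rTgt x = rTgt x') : x = x' := by
  have hH := C.hist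
  have key : ∀ {k k'}, k ∈ H.packets → k' ∈ H.packets → H.queuing k = H.queuing k' →
      H.target k = H.target k' → k = k' := fun hk hk' => hH.multicast_target _ hk _ hk'
  have src : ∀ {k k'}, k ∈ H.packets → k' ∈ H.channel G G → H.queuing k = H.queuing k' →
      H.source k = 𝔇 → False := fun hk hk' hq hs =>
    C.parent_ne (hs.symm.trans ((hH.multicast_same _ hk _ hk'.1 hq).2.trans hk'.2.1))
  cases x <;> cases x' <;> simp only [RPkt.base, rTarget, RPkt.delayAdj] at hb ha ht <;>
    (try exact h.elim) <;> (try exact h'.elim)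
  case into.into => rw [key hx.1 hx'.1 hb (hx.2.1.trans hx'.2.1.symm), h.1, h'.1]
  case outof.outof => rw [key hx.1 hx'.1 hb (Option.some.inj ht), h.1, h'.1]
  case outofZombie.outofZombie => rw [key hx.1 hx'.1 hb (Option.some.inj ht), h.1, h'.1]
  case late.late =>
    rw [key hx.2.2.1.1 hx'.2.2.1.1 hb (hx.2.2.1.2.2.trans hx'.2.2.1.2.2.symm), Option.some.inj ht]
  all_goals first
    | exact (src hx.1 hx'.2.2.1 hb hx.2.1).elim
    | exact (src hx'.1 hx.2.2.1 hb.symm hx'.2.1).elim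
    | (rw [h.1] at ht; exact absurd (Option.some.inj ht).symm hx'.2.2.1)
    | (rw [h.1] at ht; exact absurd (Option.some.inj ht).symm hx'.1)
    | (rw [h'.1] at ht; exact absurd (Option.some.inj ht) hx.2.2.1)
    | (rw [h'.1] at ht; exact absurd (Option.some.inj ht) hx.1)
    | split_ifs at ha

lemma side_ne {y : RQue Que} {R : Option Proc} (hy : .queue y ∈ (Hʳ).eventsAt R) :
    (y.side H X).rank ≠ 0 := by
  obtain ⟨-, -, P, hq⟩ := C.queue_line hy
  have := C.side_pos (X := X) hq
  cases y <;> first | exact this.ne' | simp [RQue.side, Side.rank]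

/-- At each process of the reduced history the labels order the events linearly. -/
lemma label_trichotomy {R : Option Proc} {e f : REvt} (he : e ∈ (Hʳ).eventsAt R)
    (hf : f ∈ (Hʳ).eventsAt R) :
    labelLT H (rLbl e) (rLbl f) ∨ e = f ∨ labelLT H (rLbl f) (rLbl e) := by
  rcases C.label_cases he hf with h | h | ⟨h1, h2, h3, h4⟩
  · exact .inl h
  · exact .inr (.inr h)
  refine .inr (.inl ?_)
  have hs : ∀ {e}, e ∈ (Hʳ).eventsAt R → (∃ y, e = .queue y) ∨ (rLbl e).side.rank = 0 := by
    intro e he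
    cases e with
    | queue y => exact .inl ⟨y, rfl⟩
    | dequeue x =>
      rcases C.dequeue_cases (rEventsAt_iff.1 he).1 with ⟨-, -, h⟩ | ⟨-, _, -, h⟩ <;> rw [h] <;>
        exact .inr rfl
    | _ => exact .inr rfl
  rcases hs he with ⟨y, rfl⟩ | h0
  · rcases hs hf with ⟨y', rfl⟩ | h0'
    · rw [rLabel_queue, rLabel_queue] at h1 h2 h3 h4; rw [C.queue_inj he hf h1 h2 h3 h4]
    · rw [h0', rLabel_queue] at h4; exact absurd h4 (C.side_ne he)
  · rcases hs hf with ⟨y', rfl⟩ | h0'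
    · rw [h0, rLabel_queue] at h4; exact absurd h4.symm (C.side_ne hf)
    · have ev : ∀ {x}, .dequeue x ∈ (Hʳ).eventsAt R → ∃ k,
          (rLbl (.dequeue x)).con = .event (.dequeue k) := by
        intro x hx
        rcases C.dequeue_cases (rEventsAt_iff.1 hx).1 with ⟨-, -, h⟩ | ⟨-, _, -, h⟩ <;> rw [h] <;>
          exact ⟨_, rfl⟩
      cases e <;> cases f <;> first
        | exact absurd (by rw [rLabel_queue] at h0; exact h0) (C.side_ne he)
        | exact absurd (by rw [rLabel_queue] at h0'; exact h0') (C.side_ne hf)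
        | (cases h1; done)
        | (cases h1; rfl)
        | (obtain ⟨k, h⟩ := ev hf; cases h1.trans h)
        | (obtain ⟨k, h⟩ := ev he; cases h.symm.trans h1)
        | skip
      · obtain ⟨hx, hm, ht⟩ := rEventsAt_iff.1 he
        obtain ⟨hx', hm', ht'⟩ := rEventsAt_iff.1 hf
        rcases C.dequeue_cases hx with ⟨a1, a2, a3⟩ | ⟨a1, d, a2, a3⟩ <;>
          rcases C.dequeue_cases hx' with ⟨b1, b2, b3⟩ | ⟨b1, d', b2, b3⟩ <;>
          rw [a3, b3] at h1 h2 h3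
        · rw [C.direct_inj hm hm' a1 b1 (Ev.dequeue.inj (Clean.event.inj h1)) h3 (ht.trans ht'.symm)]
        · cases h2
        · cases h2
        · rw [C.delay_inj hm hm' a2 b2 (Ev.queue.inj (Clean.event.inj (Sub.ev.inj h2))) h3
            (ht.trans ht'.symm)]
      · obtain rfl := Clean.view.inj h1
        rw [show _ = _ from (rEventsAt_iff.1 he).2.trans (rEventsAt_iff.1 hf).2.symm]

end Critical

section Data

lemma interval_views {Cont : Type*} {H : Computation Proc Pkt Que Req Cont Body} {a : ℕ} {b : ℕ∞}
    (hab : (a : ℕ∞) < b) (h : H.memberViews P = {i | a ≤ i ∧ (i : ℕ∞) < b}) :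
    H.joinView P = a ∧ H.deathView P = b := by
  refine ⟨?_, le_antisymm ?_ (le_of_forall_lt fun x hx => ?_)⟩
  · rw [joinView, h]
    exact le_antisymm (Nat.sInf_le ⟨le_rfl, hab⟩) (Nat.sInf_mem (s := {i | a ≤ i ∧ (i : ℕ∞) < b})
      ⟨a, le_rfl, hab⟩).1
  · rw [deathView, h]; exact iSup₂_le fun i hi => Order.add_one_le_of_lt hi.2
  · rw [deathView, h]
    obtain ⟨n, rfl⟩ := ENat.ne_top_iff_exists.1 hx.ne_top
    refine lt_of_lt_of_le (b := ((max a n : ℕ) : ℕ∞) + 1)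
      (by exact_mod_cast Nat.lt_succ_of_le (le_max_right a n))
      (le_iSup₂_of_le (max a n) ⟨le_max_left a n, ?_⟩ le_rfl)
    rcases max_choice a n with h | h <;> rwa [h]

variable (H X G)

/-- The order of the labels of the events of the reduced history. -/
abbrev rLT (e f : REvt) : Prop := labelLT H (rLbl e) (rLbl f)

/-- The view of an event of the reduced history. -/
noncomputable abbrev rView (e : REvt) : ℕ := cview H (rLbl e).con

/-- The first view of a process of the reduced history. -/
noncomputable def rJoin : Option Proc → ℕ
  | some P => if P = G then 0 else H.joinView P
  | none => 0

/-- The end of the interval of views of a process of the reduced history. -/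
noncomputable def rDeath : Option Proc → ℕ∞
  | some P => H.deathView P
  | none => 𝔠

end Data

local notation "rLt" => rLT H X G
local notation "rVw" => rView H X G
local notation "rJn" => rJoin H G
local notation "rDth" => rDeath H G

namespace Critical

variable (C : Critical H G)
  {e f g : Ev (Option Proc) (RPkt Proc Pkt) (RQue Que) Req} {R : Option Proc}
include C

lemma located (he : e ∈ rEvts) : ∃ R, e ∈ (Hʳ).eventsAt R := by
  cases e with
  | queue y =>
    obtain ⟨x, hx, rfl⟩ := C.exists_rPacket he
    exact ⟨_, he, x, hx, rfl, rfl⟩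
  | dequeue x => exact ⟨_, he, he.1, rfl⟩
  | notify i P => exact ⟨P, he, rfl⟩
  | request r => exact ⟨_, he, rfl⟩

lemma valid (he : e ∈ rEvts) : (rLbl e).Valid H G := (C.home (C.located he).choose_spec).2

lemma queue_eventsAt {x : RPkt Proc Pkt} (hx : x ∈ rPkts) :
    .queue (rQueuing H x) ∈ (Hʳ).eventsAt (rSrc x) := ⟨C.rQueued_of_mem hx, x, hx, rfl, rfl⟩

lemma queue_cleanLT {x : RPkt Proc Pkt} (hx : rDeqs x) :
    cleanLT H (rLbl (.queue (rQueuing H x))).con (rLbl (.dequeue x)).con := by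
  rw [rLabel_queue, rQueuing_base]
  rcases C.dequeue_cases hx with ⟨h1, h2, h3⟩ | ⟨h1, d, h2, h3⟩ <;> rw [h3]
  · obtain ⟨hk, hl⟩ := C.hist.packet_dequeued _ h2
    have hq := queue_mem C.hist (mem_channel_self hk)
    have ht := trigger_mem (X := X) hq
    exact C.hist.cleanLT_of_lt (f := .dequeue x.base) ht.1 h2
      (C.hist.lt_trans' ht.1 hq.1 h2 (trigger_lt hq) hl) (by simp)
  · exact (C.delay_spec hx.1 h2).2.2.1

lemma rPrim_cases (h : rPrim H X G e f) : rLt e f ∨ (rLbl e = rLbl f ∧ rPrim H X G f e) := by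
  obtain ⟨he, hf, ⟨x, hx, rfl, rfl⟩ | ⟨P, -, -, h⟩ | ⟨J, h1, h2, h3⟩⟩ := h
  · exact .inl (.inl (C.queue_cleanLT hf))
  · exact .inl h
  · refine .inr ⟨?_, hf, he, .inr (.inr ⟨J, h1, h2, h3.symm.imp And.symm And.symm⟩)⟩
    rcases h3 with ⟨rfl, rfl⟩ | ⟨rfl, rfl⟩ <;> rfl

lemma le_spec (h : (Hʳ).le e f) (he : e ∈ rEvts) : f ∈ rEvts ∧
    (rLt e f ∨ (rLbl e = rLbl f ∧ (Hʳ).le f e)) := by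
  induction h with
  | refl => exact ⟨he, .inr ⟨rfl, .refl⟩⟩
  | tail _ hb ih =>
    refine ⟨hb.2.1, ?_⟩
    rcases ih.2 with h1 | ⟨h1, h2⟩ <;> rcases C.rPrim_cases hb with h3 | ⟨h3, h4⟩
    · exact .inl (C.labelLT_trans (C.valid he) (C.valid hb.1) (C.valid hb.2.1) h1 h3)
    · exact .inl (by rw [rLT, ← h3]; exact h1)
    · exact .inl (by rw [rLT, h1]; exact h3)
    · exact .inr ⟨h1.trans h3, .head h4 h2⟩

lemma rLT_trans (he : e ∈ rEvts) (hf : f ∈ rEvts) (hg : g ∈ rEvts) (h : rLt e f) (h' : rLt f g) :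
    rLt e g :=
  C.labelLT_trans (C.valid he) (C.valid hf) (C.valid hg) h h'

lemma rLT_asymm (he : e ∈ rEvts) (hf : f ∈ rEvts) (h : rLt e f) :
    ¬ rLt f e := fun h' => labelLT_irrefl _ (C.rLT_trans he hf he h h')

lemma rLT_of_lt (he : e ∈ rEvts) (h : (Hʳ).lt e f) : rLt e f :=
  (C.le_spec h.1 he).2.resolve_right fun h' => h.2 h'.2

lemma lt_of_le_rLT (he : e ∈ rEvts) (h : (Hʳ).le e f) (h' : rLt e f) : (Hʳ).lt e f := by
  have hf := (C.le_spec h he).1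
  refine ⟨h, fun h2 => ?_⟩
  rcases (C.le_spec h2 hf).2 with h3 | h3
  · exact C.rLT_asymm he hf h' h3
  · rw [rLT, h3.1] at h'; exact labelLT_irrefl _ h'

lemma lt_iff_at (he : e ∈ (Hʳ).eventsAt R) (hf : f ∈ (Hʳ).eventsAt R) : (Hʳ).lt e f ↔ rLt e f :=
  ⟨C.rLT_of_lt he.1, fun h =>
    C.lt_of_le_rLT he.1 (.single ⟨he.1, hf.1, .inr (.inl ⟨R, he, hf, h⟩)⟩) h⟩

lemma le_or_eq_at (he : e ∈ (Hʳ).eventsAt R) (hf : f ∈ (Hʳ).eventsAt R) (h : (Hʳ).le e f) :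
    rLt e f ∨ e = f := by
  rcases C.label_trichotomy he hf with h1 | h1 | h1
  · exact .inl h1
  · exact .inr h1
  · exact absurd h ((C.lt_iff_at hf he).2 h1).2

lemma le_at (he : e ∈ (Hʳ).eventsAt R) (hf : f ∈ (Hʳ).eventsAt R) (h : ¬ rLt f e) :
    (Hʳ).le e f := by
  rcases C.label_trichotomy he hf with h1 | rfl | h1
  · exact ((C.lt_iff_at he hf).2 h1).1
  · exact .refl
  · exact absurd h1 h

omit C in
lemma rJoin_some (P : Proc) : rJn (some P) ≤ H.joinView P := by rw [rJoin]; split_ifs <;> omega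

lemma rJoin_lt (R : Option Proc) : (rJn R : ℕ∞) < rDth R := by
  cases R with
  | none => exact Nat.cast_lt.2 C.joins
  | some P => exact lt_of_le_of_lt (by exact_mod_cast rJoin_some P) (C.hist.join_lt_death P)

lemma rMember (R : Option Proc) : (Hʳ).memberViews R =
    {i | rJn R ≤ i ∧ (i : ℕ∞) < rDth R} := by
  have hH := C.hist
  have h0 := C.lt_numView
  have hview : ∀ {i : ℕ} {P}, (i : ℕ∞) < H.numView →
      (P ∈ H.view i ↔ H.joinView P ≤ i ∧ (i : ℕ∞) < H.deathView P) :=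
    fun h => hH.mem_view_iff h _
  ext i
  change ((i : ℕ∞) < H.numView ∧ R ∈ if i < 𝔠 then _ else _) ↔ _
  cases R with
  | none =>
    simp only [rJoin, rDeath, Set.mem_ofPred_eq, Nat.cast_lt, zero_le, true_and]
    split_ifs with h
    · simp [h, lt_trans (Nat.cast_lt.2 h) h0]
    · simp [h]
  | some P =>
    simp only [rJoin, rDeath, Set.mem_ofPred_eq]
    have hd := hH.deathView_le P
    split_ifs with h hP hP
    · have := hH.join_lt_death P
      subst hP; simp [lt_trans (Nat.cast_lt.2 h) h0, lt_trans (Nat.cast_lt.2 h) this]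
    · simp only [Set.mem_union, Set.mem_image, Option.some.injEq, exists_eq_right, Set.mem_insert_iff,
        Set.mem_singleton_iff, hP, reduceCtorEq, or_false]
      exact ⟨fun ⟨h1, h2⟩ => (hview h1).1 h2, fun h2 => ⟨h2.2.trans_le hd, (hview (h2.2.trans_le hd)).2 h2⟩⟩
    all_goals
      simp only [Set.mem_image, Option.some.injEq, exists_eq_right]
      refine ⟨fun ⟨h1, h2⟩ => ?_, fun h2 => ⟨h2.2.trans_le hd, (hview (h2.2.trans_le hd)).2 ?_⟩⟩
    · exact ⟨Nat.zero_le _, ((hview h1).1 h2).2⟩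
    · exact ⟨by subst hP; omega, h2.2⟩
    · exact (hview h1).1 h2
    · exact h2

lemma rJoin_eq (R : Option Proc) : (Hʳ).joinView R = rJn R :=
  (interval_views (C.rJoin_lt R) (C.rMember R)).1

lemma rDeath_eq (R : Option Proc) : (Hʳ).deathView R = rDth R :=
  (interval_views (C.rJoin_lt R) (C.rMember R)).2

lemma anchor (he : e ∈ (Hʳ).eventsAt R) (hn : ∀ i, e ≠ .notify i R) :
    rJn R ≤ rVw e ∧ (rVw e : ℕ∞) < rDth R ∧ ∀ i, rJn R ≤ i → i ≤ rVw e → .notify i R ∈ rEvts := by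
  have hH := C.hist
  have main : ∀ {g : Evt}, g ∈ Line H G R → (∀ i P, g ≠ .notify i P) →
      rVw e = H.eventView g → rJn R ≤ rVw e ∧ (rVw e : ℕ∞) < rDth R ∧
      ∀ i, rJn R ≤ i → i ≤ rVw e → .notify i R ∈ rEvts := by
    intro g hg hng hv
    rw [hv]
    cases R with
    | none => exact ⟨Nat.zero_le _, Nat.cast_lt.2 hg.2, fun i _ hi => lt_of_le_of_lt hi hg.2⟩
    | some P =>
      have at_P : g ∈ H.eventsAt P → rJn (some P) ≤ H.eventView g ∧
          (H.eventView g : ℕ∞) < rDth (some P) ∧ ∀ i, rJn (some P) ≤ i →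
          i ≤ H.eventView g → .notify i (some P) ∈ rEvts := fun hg =>
        ⟨(rJoin_some P).trans (hH.joinView_le_eventView hg),
          hH.eventView_lt_deathView hg fun i _ => hng i P, fun i h1 h2 => ?_⟩
      · by_cases hP : P = G
        · subst hP
          rw [Line, if_pos rfl] at hg
          rcases hg with hg | hg
          · exact ⟨by simp [rJoin], lt_trans (Nat.cast_lt.2 hg.2) (hH.join_lt_death P),
              fun i _ hi => .inr ⟨rfl, lt_of_le_of_lt hi hg.2⟩⟩
          · exact at_P hg
        · rw [line_of_ne hP] at hg; exact at_P hg
      · by_cases hi : H.joinView P ≤ i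
        · exact .inl (hH.notify_mem_of_le hg hi h2)
        · have : P = G := by by_contra h; rw [rJoin, if_neg h] at h1; exact hi h1
          subst this; exact .inr ⟨rfl, not_le.1 hi⟩
  cases e with
  | queue y =>
    obtain ⟨h1, h2, P, h3⟩ := C.queue_line he
    refine main h1 (by simp) ?_
    rw [rView, rLabel_queue, eventView_queue hH h3, cview_cleanOf hH (trigger_mem h3).1]
  | dequeue x =>
    obtain ⟨hx, hm, rfl⟩ := rEventsAt_iff.1 he
    rcases C.dequeue_cases hx with ⟨h1, h2, h3⟩ | ⟨h1, d, h2, h3⟩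
    · exact main (C.direct_mem hm h1 h2) (by simp) (by rw [rView, h3]; rfl)
    · obtain ⟨⟨P, h4, h5⟩, -⟩ := C.delay_spec hm h2
      exact main (h4 ▸ mem_line h5) (by simp) (by rw [rView, h3]; rfl)
  | notify i P => exact absurd (he.2 ▸ rfl) (hn i)
  | request r =>
    obtain ⟨hx, rfl⟩ := rEventsAt_iff.1 he
    exact main (mem_line (P := H.issuer r) ⟨hx, rfl⟩) (by simp) rfl

lemma notify_rLT_iff (he : e ∈ (Hʳ).eventsAt R) (hn : ∀ i, e ≠ .notify i R) {R' : Option Proc}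
    (hi : .notify i R' ∈ rEvts) :
    (rLt (.notify i R') e ↔ i ≤ rVw e) ∧
    (rLt e (.notify i R') ↔ rVw e < i) := by
  have h1 : rVw e < i → rLt e (.notify i R') := fun h => .inl (cleanLT_of_cview h)
  have h2 : i ≤ rVw e → rLt (.notify i R') e := by
    intro h
    cases hc : (rLbl e).con with
    | event g => exact .inl (by rw [rView, hc] at h; rw [hc]; exact h)
    | view j =>
      rw [rView, hc] at h
      rcases (show i ≤ j from h).lt_or_eq with h | rfl
      · exact .inl (by rw [hc]; exact h)
      · cases e with
        | queue y =>
          have hv := (C.valid he.1).sub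
          rw [hc] at hv
          have hs := C.side_ne he
          rw [rLabel_queue] at hc hv
          rw [rLT, rLabel_queue]
          refine .inr ⟨hc.symm, .inr ⟨?_, ?_⟩⟩
          · generalize subCoord H X G y.base = s at hv ⊢
            cases hv; rfl
          · cases y <;> first | exact .inr ⟨rfl, Nat.pos_of_ne_zero hs⟩ | skip
            all_goals
              rename_i t _
              cases t <;> exact .inl (by simp [rLabel, RQue.adj, Adj.rank])
        | dequeue x =>
          rcases C.dequeue_cases he.1 with ⟨-, -, h3⟩ | ⟨-, d, -, h3⟩ <;> rw [h3] at hc <;> cases hc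
        | notify i P => exact absurd (he.2 ▸ rfl) (hn i)
        | request r => cases hc
  refine ⟨⟨fun h => ?_, h2⟩, fun h => ?_, h1⟩ <;> by_contra h'
  · exact C.rLT_asymm hi he.1 h (h1 (not_le.1 h'))
  · exact C.rLT_asymm he.1 hi h (h2 (not_lt.1 h'))

omit C in
lemma notify_notify {j : ℕ} {R R' : Option Proc} : rLt (.notify i R) (.notify j R') ↔ i < j := by
  simp [rLT, labelLT, rLabel, cleanLT, subLT]

end Critical

/-- The clones and zombies of pre-critical packets. -/
def RPkt.Old : RPkt Proc Pkt → Prop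
  | .orig _ | .late _ _ => False
  | _ => True

namespace Critical

variable (C : Critical H G) {x x' : RPkt Proc Pkt}
include C

omit C in
lemma base_mem (hx : x ∈ rPkts) : x.base ∈ H.packets := by
  cases x with
  | within | withinZombie => exact hx.1.1
  | late => exact hx.2.2.1.1
  | _ => exact hx.1

omit C in
lemma old_spec (hx : x ∈ rPkts) (h : x.Old) :
    PreCritical H G (.queue (H.queuing x.base)) ∧ (x.Direct H G ↔ Timely H G x.base) := by
  cases x with
  | orig | late => exact h.elim
  | within | withinZombie => exact ⟨hx.2.1.2.1, .rfl⟩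
  | _ => exact ⟨hx.2.2.2.1, .rfl⟩

lemma pre_target (hk : k ∈ H.packets) (h : PreCritical H G (.queue (H.queuing k))) :
    H.Original (H.target k) := by
  have hH := C.hist
  have hq := hH.packet_queued _ hk
  have ho := (C.pre_source hk h).2.2
  rw [C.pre_iff hk] at h
  refine C.original_of_lt ?_
  rcases hH.liveness_join _ _ k (mem_channel_self hk) with h1 | ⟨h1, h2⟩
  · rw [hH.mem_view_iff ((hH.join_lt_death _).trans_le (hH.deathView_le _))] at h1
    exact h1.1.trans_lt (C.lt_of_original ho)
  · exact (hH.le_eventView hq h1 h2.1).trans_lt h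

omit C in
lemma delay_eq (X : Execution H) (C : Critical H G) {d d' : Pkt} (h : x.Delay H G d)
    (h' : x.Delay H G d') : d = d' := by
  cases x with
  | into => exact C.delay_unique X h.2 h'.2
  | outof | outofZombie => exact C.codelay_unique X h.2 h'.2
  | late => exact C.codelay_unique X h h'
  | _ => exact h.elim

lemma direct_label (hx : x ∈ rPkts) (h : x.Direct H G) (hd : .dequeue x.base ∈ H.events) :
    rDeqs x ∧ rLbl (.dequeue x) =
      ⟨.event (.dequeue x.base), .zero, x.adj H, .trigger⟩ := by
  have := C.dequeued_of_direct hx h hd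
  exact ⟨this, (C.dequeue_cases this).elim (·.2.2) fun h' => absurd h h'.1⟩

lemma delay_label (hx : x ∈ rPkts) (h : ¬ x.Direct H G) {d : Pkt} (hd : x.Delay H G d) :
    rDeqs x ∧ rLbl (.dequeue x) =
      ⟨.event (.dequeue d), .ev (.event (.queue (H.queuing x.base))), x.delayAdj H, .trigger⟩ := by
  have := C.dequeued_of_delay hx hd
  refine ⟨this, (C.dequeue_cases this).elim (fun h' => absurd h'.1 h) fun ⟨_, d', h1, h2⟩ => ?_⟩
  rw [delay_eq X C hd h1, h2]

lemma timely_lt (hx : x ∈ rPkts) (ho : x.Old) (h : x.Direct H G) {f : REvt} (hf : 𝔠 ≤ rVw f) :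
    rDeqs x ∧ rLt (.dequeue x) f := by
  have ht := (old_spec hx ho).2.1 h
  obtain ⟨h1, h2⟩ := C.direct_label hx h ht.2.2.1
  refine ⟨h1, .inl (cleanLT_of_cview (lt_of_lt_of_le ?_ hf))⟩
  rw [h2]; exact (C.timely_view ht).2

/-- Two clones of pre-critical packets on one channel. -/
lemma old_pair (hx : x ∈ rPkts) (hx' : x' ∈ rPkts) (ho : x.Old) (ho' : x'.Old)
    (hs : rSrc x = rSrc x') (ht : rTgt x = rTgt x') :
    H.source x.base = H.source x'.base ∧ H.target x.base = H.target x'.base ∧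
    (∀ d, x'.Delay H G d → x.Delay H G d) ∧ (x.base = x'.base → x = x' ∨
      ((x.adj H).rank < (x'.adj H).rank ∧
        ∀ d, x'.Delay H G d → (x.delayAdj H).rank < (x'.delayAdj H).rank) ∨
      (∃ s, rQueuing H x = .zombie s (H.queuing x.base)) ∧
        (H.content x'.base).IsGhost ∧ (rQueuing H x').side H X = sideCoord H X (H.queuing x'.base)) := by
  have key : ∀ {P : Proc} {s : Sign}, P ≠ G → s.proc G ≠ some P := by
    rintro P (_ | _) h h' <;> simp_all [Sign.proc]
  have adj : ∀ {c : Cnt} {s : Sign}, c.IsGhost →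
      (adjOf s c).rank < (Adj.flush s).rank ∧ (Adj.ghost s).rank < (Adj.flush s).rank := by
    intro c s h
    cases c <;> cases s <;> simp_all [Content.IsGhost, adjOf, Adj.rank]
  have ack : ∀ {c : Cnt}, c.IsGhost → ¬ c.IsAck := by
    intro c; cases c <;> simp [Content.IsGhost, Content.IsAck]
  have h1 := fun (x : RPkt Proc Pkt) (hx : x ∈ rPkts) (h : x.Old) =>
    C.pre_source (base_mem hx) (old_spec hx h).1
  have hn := h1 x hx ho
  have hn' := h1 x' hx' ho'
  cases x <;> cases x' <;> first | exact ho.elim | exact ho'.elim | skip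
  all_goals
    simp only [rSource, rTarget, RPkt.base] at hs ht hn hn'
  all_goals first
    | exact absurd hs (key hn'.1)
    | exact absurd hs.symm (key hn.1)
    | exact absurd ht (key hn'.2.1)
    | exact absurd ht.symm (key hn.2.1)
    | skip
  case into.into s k s' k' =>
    obtain rfl := proc_inj ht
    have := Option.some.inj hs
    exact ⟨this, hx.2.1.trans hx'.2.1.symm, fun d h => ⟨h.1, this ▸ h.2⟩, fun h => .inl (by cases h; rfl)⟩
  case within.within | within.withinZombie | withinZombie.within | withinZombie.withinZombie =>
    obtain rfl := proc_inj hs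
    obtain rfl := proc_inj ht
    refine ⟨hx.1.2.1.trans hx'.1.2.1.symm, hx.1.2.2.trans hx'.1.2.2.symm, fun d h => h.elim, fun h => ?_⟩
    cases h
    first
      | exact .inl rfl
      | exact .inr (.inl ⟨(adj hx'.2.2).1, fun _ h => h.elim⟩)
      | exact .inr (.inr ⟨⟨_, rfl⟩, hx.2.2, by rw [rQueuing, if_neg (ack hx.2.2)]; rfl⟩)
  all_goals
    obtain rfl := proc_inj hs
    have := Option.some.inj ht
    refine ⟨hx.2.1.trans hx'.2.1.symm, this, fun d h => ⟨h.1, this ▸ h.2⟩, fun h => ?_⟩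
    cases h
    first
      | exact .inl rfl
      | exact .inr (.inl ⟨(adj hx'.2.2.2.2).1, fun _ _ => by rw [RPkt.delayAdj, if_pos hx'.2.2.2.2]; exact (adj hx'.2.2.2.2).2⟩)
      | exact .inr (.inr ⟨⟨_, rfl⟩, hx.2.2.2.2, rfl⟩)

omit C in
lemma adj_ack (x : RPkt Proc Pkt) : (rQueuing H x).adj = .zero ∨ (H.content x.base).IsAck := by
  cases x <;> simp only [rQueuing, RPkt.base] <;> (try split_ifs with h) <;>
    first | exact .inl rfl | exact .inr h

lemma side_bounds (X : Execution H) (hx : x ∈ rPkts) :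
    (sideCoord H X (H.queuing x.base)).rank ≤ ((rQueuing H x).side H X).rank ∧
      ((rQueuing H x).side H X).rank ≤ (sideCoord H X (H.queuing x.base)).rank + 1 := by
  have zombie : (H.content x.base).IsGhost → (sideCoord H X (H.queuing x.base)).rank = 4 := fun h =>
    (C.side_content (queue_mem C.hist (mem_channel_self (base_mem hx))) (base_mem hx) rfl).2.1.2 h
  cases x with
  | outofZombie s k => exact ⟨(zombie hx.2.2.2.2).trans_le (Nat.le_succ 4), (zombie hx.2.2.2.2).symm ▸ le_rfl⟩
  | withinZombie s t k => exact ⟨(zombie hx.2.2).trans_le (Nat.le_succ 4), (zombie hx.2.2).symm ▸ le_rfl⟩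
  | _ =>
    simp only [rQueuing, RPkt.base]
    try split_ifs
    all_goals exact ⟨le_rfl, Nat.le_succ _⟩

lemma old_queue (hx : x ∈ rPkts) (hx' : x' ∈ rPkts) (ho : x.Old) (ho' : x'.Old)
    (hs : rSrc x = rSrc x') (ht : rTgt x = rTgt x')
    (h : rLt (.queue (rQueuing H x)) (.queue (rQueuing H x'))) :
    H.lt (.queue (H.queuing x.base)) (.queue (H.queuing x'.base)) ∨ (x.base = x'.base ∧
      (x.adj H).rank < (x'.adj H).rank ∧
        ∀ d, x'.Delay H G d → (x.delayAdj H).rank < (x'.delayAdj H).rank) := by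
  have hH := C.hist
  obtain ⟨p1, p2, -, p3⟩ := C.old_pair hx hx' ho ho' hs ht
  have hq := hH.packet_queued _ (base_mem hx)
  have hq' := p1 ▸ hH.packet_queued _ (base_mem hx')
  have hv := (C.pre_iff (base_mem hx)).1 (old_spec hx ho).1
  have hv' := (C.pre_iff (base_mem hx')).1 (old_spec hx' ho').1
  have h0 := h
  rw [rLT, rLabel_queue, rLabel_queue] at h
  simp only [rQueuing_base] at h
  rcases hH.trichotomy hq hq' with h1 | h1 | h1
  · exact .inl h1
  · have hb := hH.multicast_target _ (base_mem hx) _ (base_mem hx') (Ev.queue.inj h1) p2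
    rcases p3 hb with rfl | h2 | ⟨⟨s, h2⟩, h3, h4⟩
    · exact absurd h0 (labelLT_irrefl _)
    · exact .inr ⟨hb, h2⟩
    · have ha := (adj_ack (H := H) x').resolve_right (by
        cases hc : H.content x'.base <;> simp_all [Content.IsGhost, Content.IsAck])
      have h5 := (C.side_content (X := X) hq' (base_mem hx') rfl).2.1.2 h3
      rw [h2, ha, h4, hb] at h
      rcases h with h | ⟨-, h | ⟨-, h | ⟨-, h⟩⟩⟩
      · exact absurd h (cleanLT_irrefl _)
      · exact absurd h (subLT_irrefl _)
      · exact absurd h (lt_irrefl _)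
      · rw [h5] at h; exact absurd (show 5 < 4 from h) (by decide)
  · exfalso
    have b := C.side_bounds X hx
    have b' := C.side_bounds X hx'
    rcases (C.label_queue_lt (X := X) hq' hq).2 h1 with h2 | ⟨h2, h3⟩
    · exact C.rLT_asymm (C.rQueued_of_mem hx) (C.rQueued_of_mem hx') h0 (.inl (by
        simpa only [rLabel_queue, rQueuing_base] using! h2))
    · change subLT H (subCoord H X G _) (subCoord H X G _) ∨ (_ ∧ (_ < _ ∨ (_ ∧
        (sideCoord H X _).rank < (sideCoord H X _).rank))) at h3
      rw [C.early_sub hq hv, C.early_sub hq' hv'] at h3 h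
      have h3 := ((h3.resolve_left id).2.resolve_left (lt_irrefl _)).2
      rcases h with h | ⟨-, h | ⟨-, h | ⟨-, h⟩⟩⟩
      · exact cleanLT_irrefl _ ((show cleanOf _ = cleanOf _ from h2) ▸ h)
      · exact h
      · have hack : (H.content x'.base).IsAck := (adj_ack x').resolve_left fun ha => by
          rw [ha] at h
          cases ha' : (rQueuing H x).adj with
          | zero => rw [ha'] at h; exact absurd h (lt_irrefl _)
          | msg s => rw [ha'] at h; cases s <;> simp [Adj.rank] at h
          | _ => cases hy : rQueuing H x <;> rw [hy] at ha' <;> cases ha'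
        have := C.early_ack hq' hq hv' (C.clean_trigger_inj hq' hq h2) (base_mem hx') rfl hack
        rw [this] at h1; exact h1.2 h1.1
      · change ((rQueuing H x).side H X).rank < ((rQueuing H x').side H X).rank at h
        omega

lemma old_order (hx : x ∈ rPkts) (hd : rDeqs x') (ho : x.Old) (ho' : x'.Old) (hs : rSrc x = rSrc x')
    (ht : rTgt x = rTgt x') (h : rLt (.queue (rQueuing H x)) (.queue (rQueuing H x'))) :
    rDeqs x ∧ rLt (.dequeue x) (.dequeue x') := by
  have hH := C.hist
  have hx' := hd.1
  obtain ⟨p1, p2, p3, -⟩ := C.old_pair hx hx' ho ho' hs ht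
  obtain ⟨hp, hiff⟩ := old_spec hx ho
  obtain ⟨hp', hiff'⟩ := old_spec hx' ho'
  have hq := C.old_queue hx hx' ho ho' hs ht h
  rcases C.dequeue_cases hd with ⟨h1, h2, h3⟩ | ⟨h1, d, h2, h3⟩
  · have ht' := hiff'.1 h1
    obtain ⟨he', hv'⟩ := C.timely_view ht'
    rcases hq with hq | ⟨hb, ha, -⟩
    · obtain ⟨h4, h5⟩ := hH.packet_order _ _ _ (mem_channel_self (base_mem hx)) _
        ⟨base_mem hx', p1.symm, p2.symm⟩ hq h2
      have he : .dequeue x.base ∈ H.eventsAt (H.target x'.base) := ⟨h4, base_mem hx, p2⟩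
      obtain ⟨h6, h7⟩ := C.direct_label hx (hiff.2 ⟨base_mem hx, hp, h4,
        (preCritical_iff hH G he).2 ((hH.eventView_mono h4 h2 h5.1).trans_lt hv')⟩) h4
      exact ⟨h6, .inl (by rw [h7, h3]; exact C.cleanLT_of_lt_at he he' h5)⟩
    · obtain ⟨h6, h7⟩ := C.direct_label hx (hiff.2 (hb ▸ ht')) (hb ▸ h2)
      exact ⟨h6, .inr (by rw [h7, h3, hb]; exact ⟨rfl, .inr ⟨rfl, .inl ha⟩⟩)⟩
  · by_cases hd' : x.Direct H G
    · refine C.timely_lt hx ho hd' ?_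
      rw [rView, h3]; exact (C.delay_spec hx' h2).2.2.2
    · obtain ⟨h6, h7⟩ := C.delay_label hx hd' (p3 d h2)
      refine ⟨h6, .inr ?_⟩
      rw [h7, h3]
      refine ⟨rfl, ?_⟩
      rcases hq with hq | ⟨hb, -, ha⟩
      · exact .inl (C.cleanLT_of_lt_at (hH.packet_queued _ (base_mem hx))
          (p1 ▸ hH.packet_queued _ (base_mem hx')) hq)
      · exact .inr ⟨by rw [hb], .inl (ha d h2)⟩

lemma post_view (hk : k ∈ H.packets) (h : H.source k = G ∨ H.target k = G) :
    𝔠 ≤ H.eventView (.queue (H.queuing k)) := by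
  by_contra h'
  have := C.pre_source hk ((C.pre_iff hk).2 (not_le.1 h'))
  exact h.elim this.1 this.2.1

lemma post_of_not_old (hx : x ∈ rPkts) (ho : ¬ x.Old) (ho' : x'.Old) (hs : rSrc x = rSrc x')
    (ht : rTgt x = rTgt x') :
    𝔠 ≤ H.eventView (.queue (H.queuing x.base)) := by
  refine C.post_view (base_mem hx) ?_
  have key : ∀ {P : Proc} {s : Sign}, some P = s.proc G → P = G := by
    rintro P (_ | _) h <;> simp_all [Sign.proc]
  cases x <;> first | exact absurd trivial ho | exact .inl hx.2.2.1.2.1 | skip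
  cases x' <;> first | exact ho'.elim | exact .inl (key hs) | exact .inr (key ht)

lemma rView_queue (hx : x ∈ rPkts) : rVw (.queue (rQueuing H x)) =
    H.eventView (.queue (H.queuing x.base)) := by
  have hq := queue_mem C.hist (mem_channel_self (base_mem hx))
  rw [rView, rLabel_queue, rQueuing_base, eventView_queue C.hist hq,
    cview_cleanOf C.hist (trigger_mem hq).1]

lemma orig_post (hx : x ∈ rPkts) (hx' : x' ∈ rPkts) (ho : ¬ x.Old) (ho' : x'.Old)
    (hs : rSrc x = rSrc x') (ht : rTgt x = rTgt x') :
    ¬ rLt (.queue (rQueuing H x)) (.queue (rQueuing H x')) := by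
  have hv' := (C.pre_iff (base_mem hx')).1 (old_spec hx' ho').1
  have hv := C.post_of_not_old hx ho ho' hs ht
  rw [← C.rView_queue hx] at hv
  rw [← C.rView_queue hx'] at hv'
  exact fun h => C.rLT_asymm (C.rQueued_of_mem hx) (C.rQueued_of_mem hx') h
    (.inl (cleanLT_of_cview (hv'.trans_le hv)))

lemma orig_after (hx : x ∈ rPkts) (hd : rDeqs (.orig k)) (hx0 : ∀ k, x ≠ .orig k)
    (hs : rSrc x = some (H.source k)) (ht : rTgt x = some (H.target k)) :
    rDeqs x ∧ rLt (.dequeue x) (.dequeue (.orig k)) := by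
  have hH := C.hist
  obtain ⟨⟨hk, hn, hn'⟩, hd⟩ := hd
  have hkc := mem_channel_self (H := H) hk
  have key : ∀ {P : Proc} {s : Sign}, s.proc G = some P → s = .pos ∧ P = G := by
    rintro P (_ | _) h <;> simp_all [Sign.proc]
  have hde : .dequeue k ∈ H.eventsAt (H.target k) := ⟨hd, hk, rfl⟩
  have hv : H.source k = G ∨ H.target k = G → 𝔠 ≤ H.eventView (.dequeue k) := fun h => by
    have := trigger_view_le (X := X) hH hkc hd
    rw [← eventView_queue hH (queue_mem hH hkc)] at this; exact (C.post_view hk h).trans this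
  have delay : ∀ d, x.Delay H G d → H.lt (.dequeue d) (.dequeue k) → d ∈ H.channel (H.source k) (H.target k) →
      H.source k = G ∨ H.target k = G → rDeqs x ∧ rLt (.dequeue x) (.dequeue (.orig k)) := by
    intro d h1 h2 h3 h4
    by_cases h : x.Direct H G
    · exact C.timely_lt hx (by cases x <;> first | exact trivial | exact (hx0 _ rfl).elim | exact h.elim) h (hv h4)
    · obtain ⟨h6, h7⟩ := C.delay_label hx h h1
      obtain ⟨⟨P, -, h5⟩, -⟩ := C.delay_spec hx h1
      refine ⟨h6, .inl ?_⟩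
      rw [h7]; exact C.cleanLT_of_lt_at (P := H.target k) ⟨h5.1, h3.1, h3.2.2⟩ hde h2
  have co : H.source k = G → H.Original (H.target k) →
      ∃ d, CoDonationTime H G (H.target k) d ∧ H.lt (.dequeue d) (.dequeue k) := by
    intro h1 h2
    obtain ⟨k₀, -, -, -, -, k₁, h3, -, h4, -, h5⟩ := codonation_first (X := X) hH hkc
      (h1.symm ▸ C.lt_of_original h2)
    have hc : IsCritCoDonation H G (H.target k) k₁ := ⟨h1 ▸ h3, h2, by rw [h4]; trivial⟩
    have := hH.packet_order _ _ _ h3 _ hkc (h5.resolve_left fun h => hn' _ (h ▸ hc)) hd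
    exact ⟨k₁, ⟨hc, this.1⟩, this.2⟩
  cases x with
  | orig k => exact (hx0 _ rfl).elim
  | into s j =>
    obtain ⟨rfl, hG⟩ := key ht
    have hs := Option.some.inj hs
    have ho := (C.pre_source hx.1 hx.2.2.2.1).2.2
    rw [show H.source j = H.source k from hs] at ho
    obtain ⟨d, h1, h2, -, h3, h4⟩ := donation_first (X := X) hH hkc (hG.symm ▸ C.lt_of_original ho) hd
    have hc : IsCritDonation H G (H.source k) d := ⟨hG ▸ h1, ho, h2⟩
    refine delay d ⟨rfl, hs.symm ▸ ⟨hc, h3⟩⟩ (hH.lt_of_ne (P := H.target k) ⟨h3, h1.1, h1.2.2⟩ hde h4 ?_) h1 (.inr hG)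
    rintro h
    cases h
    exact hn _ hc
  | outof s j | outofZombie s j =>
    obtain ⟨rfl, hG⟩ := key hs
    have ht := Option.some.inj ht
    obtain ⟨d, h1, h2⟩ := co hG (ht ▸ C.pre_target hx.1 hx.2.2.2.1)
    exact delay d ⟨rfl, ht.symm ▸ h1⟩ h2 (hG.symm ▸ h1.1.1) (.inl hG)
  | within s t j | withinZombie s t j => exact C.timely_lt hx trivial hx.2.1 (hv (.inl (key hs).2))
  | late P j =>
    obtain rfl := Option.some.inj ht
    have hG := (Option.some.inj hs).symm
    obtain ⟨d, h1, h2⟩ := co hG hx.2.1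
    exact delay d h1 h2 (hG.symm ▸ h1.1.1) (.inl hG)

lemma order (hx : x ∈ rPkts) (hd : rDeqs x') (hs : rSrc x = rSrc x') (ht : rTgt x = rTgt x')
    (h : rLt (.queue (rQueuing H x)) (.queue (rQueuing H x'))) :
    rDeqs x ∧ rLt (.dequeue x) (.dequeue x') := by
  have hH := C.hist
  have hx' := hd.1
  by_cases ho' : x'.Old
  · by_cases ho : x.Old
    · exact C.old_order hx hd ho ho' hs ht h
    · exact absurd h (C.orig_post hx hx' ho ho' hs ht)
  cases x' with
  | orig k' =>
    by_cases hx0 : ∀ k, x ≠ .orig k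
    · exact C.orig_after hx hd hx0 hs ht
    · push Not at hx0
      obtain ⟨k, rfl⟩ := hx0
      have hc : k' ∈ H.channel (H.source k) (H.target k) :=
        ⟨hx'.1, (Option.some.inj hs).symm, (Option.some.inj ht).symm⟩
      have hc0 := mem_channel_self (H := H) hx.1
      obtain ⟨h1, h2⟩ := hH.packet_order _ _ _ hc0 _ hc
        ((C.label_queue_lt (queue_mem hH hc0) (queue_mem hH hc)).1 h) hd.2
      exact ⟨⟨hx, h1⟩, .inl (C.cleanLT_of_lt_at (P := H.target k) ⟨h1, hx.1, rfl⟩ ⟨hd.2, hc.1, hc.2.2⟩ h2)⟩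
  | late P k' =>
    obtain ⟨d, hd0⟩ := hd.2
    obtain ⟨-, d', hd', h3⟩ := (C.dequeue_cases hd).resolve_left fun h => h.1
    have hk' := hx'.2.2.1
    have hde := C.delay_spec hx' hd'
    have key : ∀ {P : Proc} {s : Sign}, s.proc G = some P → s = .pos ∧ P = G := by
      rintro P (_ | _) h <;> simp_all [Sign.proc]
    have delay : x.Delay H G d' → .queue (H.queuing x.base) ∈ Spine H G →
        H.lt (.queue (H.queuing x.base)) (.queue (H.queuing k')) →
        rDeqs x ∧ rLt (.dequeue x) (.dequeue (.late P k')) := by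
      intro h1 h2 h4
      by_cases h : x.Direct H G
      · refine C.timely_lt hx (by cases x <;> first | exact trivial | exact h1.elim | exact h.elim) h ?_
        rw [rView, h3]; exact hde.2.2.2
      · obtain ⟨h6, h7⟩ := C.delay_label hx h h1
        refine ⟨h6, .inr ?_⟩
        rw [h7, h3]; exact ⟨rfl, .inl (C.cleanLT_of_spine h2 (.inr (queue_mem hH hk')) h4)⟩
    cases x with
    | orig k =>
      exfalso
      have hk : k ∈ H.channel G P := ⟨hx.1, Option.some.inj hs, Option.some.inj ht⟩
      have ho := hx'.2.1
      obtain ⟨k₀, h1, h2, -, h4, k₁, -, -, -, h5, -⟩ := codonation_first (X := X) hH hk (C.lt_of_original ho)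
      have hc := hx'.2.2.2.2.2.1 k₀ ⟨⟨h1, ho, h2⟩, h4⟩
      have hT := trigger_mem (X := X) (queue_mem hH hk)
      have hT' := trigger_mem (X := X) (queue_mem hH hk')
      have h0 : .dequeue k₀ ∈ H.eventsAt G := ⟨h4, h1.1, h1.2.2⟩
      refine C.rLT_asymm (C.rQueued_of_mem hx) (C.rQueued_of_mem hx') h (.inl ?_)
      by_cases he : (.dequeue k₀) = 𝔱 k
      · rw [he] at hc; exact hc
      · exact cleanLT_trans hH (cleanOf_valid hT'.1) (cleanOf_valid h4) (cleanOf_valid hT.1) hc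
          (C.cleanLT_of_lt_at h0 hT (hH.lt_of_ne h0 hT h5 he))
    | into s k => exact absurd (key ht).2 hx'.1
    | outof s k | outofZombie s k =>
      obtain ⟨rfl, -⟩ := key hs
      obtain rfl := Option.some.inj ht
      obtain ⟨h1, h2⟩ := C.mem_pre hx.1 hx.2.1 hx.2.2.2.1
      exact delay ⟨rfl, hd'⟩ (.inl ⟨h1, h2⟩) (C.spine_lt h1 h2 (queue_mem hH hk'))
    | within s t k | withinZombie s t k => exact absurd (key ht).2 hx'.1
    | late P k =>
      obtain rfl := Option.some.inj ht
      have hk := queue_mem hH hx.2.2.1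
      exact delay hd' (.inr hk) ((C.label_queue_lt hk (queue_mem hH hk')).1 h)
  | _ => exact absurd trivial ho'

variable {x x' : RPkt Proc Pkt} {R : Option Proc} {i : ℕ}

lemma rView_change (hi : ((i + 1 : ℕ) : ℕ∞) < H.numView) : ∃ R, (R ∉ (Hʳ).view i ∧
        (Hʳ).view (i + 1) = insert R ((Hʳ).view i)) ∨ (R ∈ (Hʳ).view i ∧
        (Hʳ).view (i + 1) = (Hʳ).view i \ {R}) := by
  have hH := C.hist
  have hG : ∀ {n}, n < 𝔠 → (n : ℕ∞) < H.numView → G ∉ H.view n := fun h h' h'' => by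
    have := ((hH.mem_view_iff h' G).1 h'').1
    omega
  have hi' : (i : ℕ∞) < H.numView := lt_trans (Nat.cast_lt.2 i.lt_succ_self) hi
  have hv : ∀ n, (Hʳ).view n = if n < 𝔠 then some '' H.view n ∪ {some G, none}
    else some '' H.view n := fun _ => rfl
  simp only [hv]
  by_cases hc : i + 1 = 𝔠
  · refine ⟨none, .inr ?_⟩
    rw [if_pos (by omega), if_neg (by omega)]
    rcases hH.view_step hi with ⟨J, h1, h2, -⟩ | ⟨-, -, -, -, h⟩
    · rw [h2, C.joinView_eq (h1.trans hc)]
      refine ⟨by simp, ?_⟩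
      ext (_ | Q) <;> simp
    · exact absurd hc.symm (h G)
  · obtain ⟨P, h⟩ := hH.view_change i hi
    refine ⟨some P, ?_⟩
    by_cases h1 : i + 1 < 𝔠
    · have g1 := hG h1 hi
      have g2 := hG (show i < _ by omega) hi'
      have hP : P ≠ G := by
        rintro rfl
        rcases h with ⟨-, h⟩ | ⟨h, -⟩
        · rw [h] at g1; exact g1 (.inl rfl)
        · exact g2 h
      rw [if_pos (by omega), if_pos h1]
      refine h.imp (fun ⟨h2, h3⟩ => ⟨by simp [h2, hP], ?_⟩) (fun ⟨h2, h3⟩ => ⟨by simp [h2], ?_⟩) <;> rw [h3]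
      · ext (_ | Q) <;> simp
        tauto
      · ext (_ | Q) <;> simp
        by_cases hQ : Q = G
        · simp [hQ, hP.symm]
        · simp [hQ]
    · rw [if_neg (by omega), if_neg h1]
      refine h.imp (fun ⟨h2, h3⟩ => ⟨by simp [h2], ?_⟩) (fun ⟨h2, h3⟩ => ⟨by simp [h2], ?_⟩) <;> rw [h3] <;>
        ext (_ | Q) <;> simp

omit C in
lemma rSource_eq (hx : x ∈ rPkts) (hx' : x' ∈ rPkts) (h : rQueuing H x = rQueuing H x')
    (hs : H.source x.base = H.source x'.base) :
    rSrc x = rSrc x' := by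
  have key : ∀ x ∈ rPkts, rSrc x = match rQueuing H x with
      | .orig _ | .shift _ _ => some (H.source x.base)
      | .clone s _ | .cloneShift s _ _ | .zombie s _ => s.proc G := by
    intro x hx
    cases x <;> simp only [rQueuing] <;> (try split_ifs) <;> first | rfl | skip
    exact congrArg some hx.2.2.1.2.1.symm
  rw [key x hx, key x' hx', h, hs]

omit C in
lemma rContent_eq (h : rQueuing H x = rQueuing H x') (hs : H.content x.base = H.content x'.base) :
    rContent H G x = rContent H G x' := by
  have key : ∀ x, rContent H G x = match rQueuing H x with
      | .zombie _ _ => zombify (redContent G 𝔠 (H.content x.base))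
      | _ => redContent G 𝔠 (H.content x.base) := by
    intro x
    cases x <;> simp only [rQueuing] <;> (try split_ifs) <;> rfl
  rw [key x, key x', h, hs]

omit C in
lemma queuing_base (h : rQueuing H x = rQueuing H x') : H.queuing x.base = H.queuing x'.base := by
  rw [← rQueuing_base, h, rQueuing_base]

lemma rMulticast_same (hx : x ∈ rPkts) (hx' : x' ∈ rPkts) (h : rQueuing H x = rQueuing H x') :
    rContent H G x = rContent H G x' ∧ rSrc x = rSrc x' := by
  have := C.hist.multicast_same _ (base_mem hx) _ (base_mem hx') (queuing_base h)
  exact ⟨rContent_eq h this.1, rSource_eq hx hx' h this.2⟩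

lemma rMulticast_target (hx : x ∈ rPkts) (hx' : x' ∈ rPkts) (h : rQueuing H x = rQueuing H x')
    (ht : rTgt x = rTgt x') : x = x' := by
  have hH := C.hist
  have hb := queuing_base h
  have hs := (C.rMulticast_same hx hx' h).2
  have mixed : ∀ {x x' : RPkt Proc Pkt}, x ∈ rPkts → x' ∈ rPkts →
      H.queuing x.base = H.queuing x'.base → rSrc x = rSrc x' →
      rTgt x = rTgt x' → ¬ x.Old → ¬ x'.Old := fun {x x'} hx hx' hb hs ht ho ho' => by
    have h1 := C.post_of_not_old hx ho ho' hs ht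
    have h2 := (C.pre_iff (base_mem hx')).1 (old_spec hx' ho').1
    rw [hb] at h1; omega
  have late : ∀ {k k' P}, .orig k ∈ rPkts → .late P k' ∈ rPkts →
      H.queuing k = H.queuing k' → k ∈ H.channel G P → False := by
    intro k k' P hx hx' hb hk
    obtain ⟨k₀, h1, h2, -, h4, _, -, -, -, h5, -⟩ :=
      codonation_first (X := X) hH hk (C.lt_of_original hx'.2.1)
    have h6 := hx'.2.2.2.2.2.1 k₀ ⟨⟨h1, hx'.2.1, h2⟩, h4⟩
    rw [← hb] at h6
    have hT := trigger_mem (X := X) (queue_mem hH hk)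
    have h0 : .dequeue k₀ ∈ H.eventsAt G := ⟨h4, h1.1, h1.2.2⟩
    rcases hH.trichotomy h0 hT with h | h | h
    · exact cleanLT_irrefl _ (cleanLT_trans hH (cleanOf_valid h4) (cleanOf_valid hT.1)
        (cleanOf_valid h4) (C.cleanLT_of_lt_at h0 hT h) h6)
    · exact cleanLT_irrefl _ (h ▸ h6)
    · exact h.2 h5
  by_cases ho : x.Old
  · have ho' : x'.Old := by
      by_contra ho'
      exact mixed hx' hx hb.symm hs.symm ht.symm ho' ho
    have zombie : ∀ {x x' : RPkt Proc Pkt} {s : Sign}, x' ∈ rPkts →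
        rQueuing H x = rQueuing H x' → rQueuing H x = .zombie s (H.queuing x.base) →
        (H.content x'.base).IsGhost →
        (rQueuing H x').side H X ≠ sideCoord H X (H.queuing x'.base) := by
      intro x x' s hx' h h1 h2 h3
      have := (C.side_content (X := X) (hH.packet_queued _ (base_mem hx')) (base_mem hx') rfl).2.1.2 h2
      rw [← h3, ← h, h1] at this; cases this
    obtain ⟨p1, p2, -, p3⟩ := C.old_pair hx hx' ho ho' hs ht
    obtain ⟨-, -, -, p4⟩ := C.old_pair hx' hx ho' ho hs.symm ht.symm
    have hb := hH.multicast_target _ (base_mem hx) _ (base_mem hx') hb p2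
    rcases p3 hb with h1 | ⟨h1, -⟩ | ⟨⟨s, h1⟩, h2, h3⟩
    · exact h1
    · rcases p4 hb.symm with h2 | ⟨h2, -⟩ | ⟨⟨s, h2⟩, h3, h4⟩
      · exact h2.symm
      · omega
      · exact absurd h4 (zombie hx h.symm h2 h3)
    · exact absurd h3 (zombie hx' h h1 h2)
  · have ho' := mixed hx hx' hb hs ht ho
    cases x <;> first | exact absurd trivial ho | skip
    all_goals cases x' <;> first | exact absurd trivial ho' | skip
    · exact congrArg _ (hH.multicast_target _ hx.1 _ hx'.1 hb (Option.some.inj ht))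
    · exact (late hx hx' hb ⟨hx.1, Option.some.inj hs, Option.some.inj ht⟩).elim
    · exact (late hx' hx hb.symm ⟨hx'.1, Option.some.inj hs.symm, Option.some.inj ht.symm⟩).elim
    · cases ht
      exact congrArg _ (hH.multicast_target _ hx.2.2.1.1 _ hx'.2.2.1.1 hb
        (hx.2.2.1.2.2.trans hx'.2.2.1.2.2.symm))

lemma rMulticast_finite (hx : x ∈ rPkts) :
    {x' | x' ∈ rPkts ∧ rQueuing H x' = rQueuing H x}.Finite := by
  have hH := C.hist
  refine Set.Finite.of_injOn (f := rTgt) (t := some '' (H.target '' {k' | k' ∈ H.packets ∧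
      H.queuing k' = H.queuing x.base} ∪ {P | H.Original P}) ∪ {some G, none}) ?_
    (fun a ha b hb h => C.rMulticast_target ha.1 hb.1 (ha.2.trans hb.2.symm) h)
    ((((hH.multicast_finite _ (base_mem hx)).image _).union hH.original_finite).image _ |>.union
      (Set.toFinite _))
  rintro a ⟨ha, h⟩
  have hb : a.base ∈ {k' | k' ∈ H.packets ∧ H.queuing k' = H.queuing x.base} :=
    ⟨base_mem ha, queuing_base h⟩
  have key : ∀ s : Sign, s.proc G ∈ ({some G, none} : Set _) := by rintro (_ | _) <;> simp [Sign.proc]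
  cases a <;> first
    | exact .inr (key _)
    | exact .inl ⟨_, .inl ⟨_, hb, rfl⟩, rfl⟩
    | exact .inl ⟨_, .inr ha.2.1, rfl⟩

omit C in
lemma rNotice_of (h1 : P = G → 𝔠 ≤ i) (hj : 0 < 𝔠)
    (h2 : i = 𝔠 → H.notice i P ≠ some (.joined G 𝔇) ∧ H.notice i P ≠ some (.new G)) :
    rNtc i (some P) = (H.notice i P).map (Notice.map some) := by
  rw [rNotice, if_neg, if_neg, if_neg]
  · exact fun ⟨h, h'⟩ => h'.elim (h2 h).1 (h2 h).2
  all_goals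
    rintro ⟨h, h'⟩
    have := h1 h
    omega

omit C in
lemma rNotice_proc (h1 : 0 < i) (h2 : i < 𝔠) (s : Sign) :
    rNtc i (s.proc G) = (H.notice i 𝔇).map (Notice.map some) := by
  cases s
  · rw [Sign.proc, rNotice, if_neg (by omega), if_pos ⟨rfl, h2⟩]
  · rw [Sign.proc, rNotice, if_neg (by omega), if_pos h2]

lemma rNotice_before (h : i < rJn R) : rNtc i R = none := by
  cases R with
  | none => exact absurd h (Nat.not_lt_zero i)
  | some P =>
    rw [rJoin] at h
    split_ifs at h with hP
    · exact absurd h (Nat.not_lt_zero i)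
    · have := C.hist.notice_before i P h
      rw [rNotice_of (fun h => absurd h hP) C.joins (by simp [this]), this]
      rfl

lemma rNotice_join : rNtc (rJn R) R = some (.new R) := by
  cases R with
  | none => rfl
  | some P =>
    by_cases hP : P = G
    · subst hP; simp [rJoin, rNotice]
    · have := C.hist.notice_join P
      rw [rJoin, if_neg hP, rNotice_of (fun h => absurd h hP) C.joins (by simp [this, hP]), this]
      rfl

lemma joiner {J : Option Proc} (h : 0 < (Hʳ).joinView J) : ∃ J', J = some J' ∧ J' ≠ G ∧
    0 < H.joinView J' ∧ (Hʳ).joinView J = H.joinView J' ∧ 𝔠 < H.joinView J' := by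
  rw [C.rJoin_eq] at h ⊢
  cases J with
  | none => exact absurd h (lt_irrefl 0)
  | some J =>
    rw [rJoin] at h ⊢
    split_ifs at h ⊢ with hJ
    · exact absurd h (lt_irrefl 0)
    · exact ⟨J, rfl, hJ, h, rfl, (C.first J h).lt_of_ne fun h => hJ (C.joinView_eq h.symm)⟩

lemma rNotice_joined {J : Option Proc} (h1 : rJn R < i) (h2 : (i : ℕ∞) < rDth R)
    (h3 : (Hʳ).joinView J = i) :
    rNtc i R = some (.joined J (J.map H.parent)) := by
  obtain ⟨J, rfl, h4, h5, h6, h7⟩ := C.joiner (J := J) (X := X) (by omega)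
  cases R with
  | none => have : i < 𝔠 := Nat.cast_lt.1 h2; omega
  | some P =>
    have hP : H.joinView P < i := by
      by_cases hP : P = G
      · subst hP; omega
      · rwa [rJoin, if_neg hP] at h1
    rw [rNotice_of (by omega) C.joins (by omega), C.hist.notice_joined i P J hP h2 (by omega)]
    rfl

lemma rNotice_removed {S : Option Proc} (h1 : rJn R < i) (h2 : (i : ℕ∞) < rDth R) (h3 : rDth S = i) :
    rNtc i R = some (.removed S) := by
  have hH := C.hist
  have hc := C.joins
  cases S with
  | none =>
    obtain rfl := Nat.cast_inj.1 (show (𝔠 : ℕ∞) = i from h3)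
    cases R with
    | none => exact absurd h2 (lt_irrefl _)
    | some P =>
      have : H.notice 𝔠 P = some (.joined G 𝔇) ∨ H.notice 𝔠 P = some (.new G) := by
        by_cases hP : P = G
        · exact .inr (hP ▸ hH.notice_join G)
        · rw [rJoin, if_neg hP] at h1; exact .inl (hH.notice_joined _ P G h1 h2 rfl)
      rw [rNotice, if_neg (by omega), if_neg (by omega), if_pos ⟨rfl, this⟩]
  | some S =>
    have hne : i ≠ 𝔠 := fun h => C.death_ne S (h ▸ h3)
    have early : ∀ s : Sign, i < 𝔠 → rNtc i (s.proc G) = some (.removed (some S)) := by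
      intro s h
      rw [rNotice_proc (by omega) h, hH.notice_removed i _ S (by rw [C.parent_spec.1]; omega)
        (lt_trans (Nat.cast_lt.2 h) C.parent_spec.2) h3]
      rfl
    cases R with
    | none => exact early .neg (Nat.cast_lt.1 h2)
    | some P =>
      by_cases h : P = G ∧ i < 𝔠
      · exact h.1 ▸ early .pos h.2
      · have hP : H.joinView P < i := by
          by_cases hP : P = G
          · subst hP; have : ¬ i < H.joinView P := fun h' => h ⟨rfl, h'⟩; omega
          · rwa [rJoin, if_neg hP] at h1
        rw [rNotice_of (by grind) hc (fun h => absurd h hne), hH.notice_removed i P S hP h2 h3]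
        rfl

lemma rNotice_last (h : rDth R = i ∨ rDth R < i) :
    (R = none ∧ rNtc i R = if i = 𝔠 then some .done else none) ∨
      ∃ P, R = some P ∧ rNtc i R = (H.notice i P).map (Notice.map some) := by
  have hc := C.joins
  cases R with
  | none =>
    have : 𝔠 ≤ i := by
      rcases h with h | h
      · exact (Nat.cast_inj.1 h).le
      · exact (Nat.cast_lt.1 h).le
    exact .inl ⟨rfl, by rw [rNotice, if_neg (by omega), if_neg (by omega)]⟩
  | some P =>
    refine .inr ⟨P, rfl, rNotice_of ?_ hc fun hi => ?_⟩
    · rintro rfl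
      exact_mod_cast (C.hist.join_lt_death P).le.trans (h.elim le_of_eq le_of_lt)
    · subst hi
      have := h.resolve_left (C.death_ne P)
      rw [C.hist.notice_after _ P this]; simp

omit C in
lemma mem_halting : some P ∈ (Hʳ).halting ↔ P ∈ H.halting := by
  change some P ∈ insert none (some '' H.halting) ↔ _
  simp

lemma rRemoved : (Hʳ).Removed (some P) ↔ H.Removed P := by rw [Removed, Removed, C.rDeath_eq]; rfl

lemma rNotice_done (h : rDth R = i) (h' : (Hʳ).Removed R ∨ R ∈ (Hʳ).halting) :
    rNtc i R = some .done := by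
  rcases C.rNotice_last (.inl h) with ⟨rfl, h1⟩ | ⟨P, rfl, h1⟩
  · rw [h1, if_pos (Nat.cast_inj.1 h).symm]
  · rw [h1, C.hist.notice_done i P h (by rwa [C.rRemoved, mem_halting] at h')]
    rfl

lemma rNotice_end (h : rDth R = i) (h1 : ¬ (Hʳ).Removed R) (h2 : R ∉ (Hʳ).halting) :
    rNtc i R = none := by
  rcases C.rNotice_last (.inl h) with ⟨rfl, h3⟩ | ⟨P, rfl, h3⟩
  · exact absurd (.inl rfl) h2
  · rw [h3, C.hist.notice_end i P h (by rwa [C.rRemoved] at h1) (by rwa [mem_halting] at h2)]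
    rfl

lemma rNotice_after (h : rDth R < i) : rNtc i R = none := by
  rcases C.rNotice_last (.inr h) with ⟨rfl, h3⟩ | ⟨P, rfl, h3⟩
  · rw [h3, if_neg (Nat.cast_lt.1 h).ne']
  · rw [h3, C.hist.notice_after i P h]; rfl

lemma rNotify_notice : .notify i R ∈ rEvts ↔ (R = none → i < 𝔠) ∧ rNtc i R ≠ none := by
  have hH := C.hist
  have early : i < 𝔠 → H.notice i 𝔇 ≠ none := fun h => hH.notify_notice _ _ (C.early_notify h).1.1
  cases R with
  | none =>
    change i < 𝔠 ↔ (_ → _) ∧ _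
    rw [rNotice]
    split_ifs <;> simp_all
  | some P =>
    change .notify i P ∈ H.events ∨ _ ↔ _
    have : .notify i P ∈ H.events ↔ H.notice i P ≠ none :=
      ⟨hH.notify_notice i P, C.trans.all_notices i P⟩
    have := C.joins
    rw [rNotice]
    split_ifs <;> simp_all; grind

lemma of_rNotice_removed {S : Option Proc} (h : rNtc i R = some (.removed S)) : rDth S = i := by
  have key : ∀ {P}, (H.notice i P).map (Notice.map some) = some (.removed S) → rDth S = i := by
    intro P h
    obtain ⟨n, h1, h2⟩ := Option.map_eq_some_iff.1 h
    cases n <;> cases h2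
    exact (C.hist.of_notice_removed h1).1
  cases R with
  | none =>
    rw [rNotice] at h
    split_ifs at h
    · simp at h
    · exact key h
    · simp at h
  | some P =>
    rw [rNotice] at h
    split_ifs at h with h1 h2 h3
    · simp at h
    · exact key h
    · cases h; rw [h3.1]; rfl
    · exact key h

variable {e f : Ev (Option Proc) (RPkt Proc Pkt) (RQue Que) Req}

lemma notify_rrange (h : .notify i R ∈ rEvts) : rJn R ≤ i ∧ (i : ℕ∞) ≤ rDth R := by
  cases R with
  | none => exact ⟨Nat.zero_le _, (Nat.cast_lt.2 (show i < 𝔠 from h)).le⟩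
  | some P =>
    rcases h with h | ⟨rfl, h⟩
    · have := C.hist.notify_range h
      exact ⟨(rJoin_some P).trans this.1, this.2⟩
    · exact ⟨by simp [rJoin], ((Nat.cast_lt.2 h).trans (C.hist.join_lt_death P)).le⟩

lemma dequeue_eventsAt (h : rDeqs x) : .dequeue x ∈ (Hʳ).eventsAt (rTgt x) := ⟨h, h.1, rfl⟩

lemma lt_notify (he : e ∈ (Hʳ).eventsAt R) (hn : ∀ i, e ≠ .notify i R) (hi : .notify i R ∈ rEvts) :
    ((Hʳ).lt (.notify i R) e ↔ i ≤ rVw e) ∧ ((Hʳ).lt e (.notify i R) ↔ rVw e < i) := by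
  have hi' : .notify i R ∈ (Hʳ).eventsAt R := ⟨hi, rfl⟩
  rw [C.lt_iff_at hi' he, C.lt_iff_at he hi']; exact C.notify_rLT_iff he hn hi

lemma rNotify_order {j : ℕ} (h1 : rJn R ≤ i) (h2 : i < j) (h3 : (j : ℕ∞) ≤ rDth R)
    (h : .notify j R ∈ rEvts) : .notify i R ∈ rEvts ∧
      (Hʳ).lt (.notify i R) (.notify j R) := by
  have hi : .notify i R ∈ rEvts := by
    cases R with
    | none => exact lt_trans h2 h
    | some P =>
      by_cases hP : P = G ∧ i < 𝔠
      · exact .inr hP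
      · refine .inl (C.hist.notify_order P i j ?_ h2 h3 (h.resolve_right (by grind))).1
        rw [rJoin] at h1
        split_ifs at h1 with hG
        · subst hG; exact not_lt.1 fun h => hP ⟨rfl, h⟩
        · exact h1
  exact ⟨hi, (C.lt_iff_at ⟨hi, rfl⟩ ⟨h, rfl⟩).2 (notify_notify.2 h2)⟩

lemma rJoin_ends (hx : x ∈ rPkts) : (rJn (rSrc x) = 0 ∧ rJn (rTgt x) = 0) ∨ ∃ k, x = .orig k := by
  have key : ∀ s : Sign, rJn (s.proc G) = 0 := by rintro (_ | _) <;> simp [rJoin, Sign.proc]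
  have orig : ∀ {P}, H.Original P → rJn (some P) = 0 := fun h =>
    Nat.le_zero.1 ((rJoin_some _).trans (le_of_eq h))
  cases x with
  | orig k => exact .inr ⟨k, rfl⟩
  | into s k => exact .inl ⟨orig (C.pre_source hx.1 hx.2.2.2.1).2.2, key _⟩
  | outof s k | outofZombie s k => exact .inl ⟨key _, orig (C.pre_target hx.1 hx.2.2.2.1)⟩
  | within | withinZombie => exact .inl ⟨key _, key _⟩
  | late P k => exact .inl ⟨key .pos, orig hx.2.1⟩

lemma rLiveness_join (hx : x ∈ rPkts) : rTgt x ∈ (Hʳ).view (rJn (rSrc x)) ∨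
    (.notify (rJn (rTgt x)) (rSrc x) ∈ rEvts ∧ (Hʳ).lt (.notify (rJn (rTgt x)) (rSrc x))
        (.queue (rQueuing H x))) := by
  have hH := C.hist
  have mem : ∀ {R : Option Proc} {i : ℕ}, rJn R ≤ i → (i : ℕ∞) < rDth R →
      R ∈ (Hʳ).view i := fun {R i} h h' => by
    have : i ∈ (Hʳ).memberViews R := by rw [C.rMember]; exact ⟨h, h'⟩
    exact this.2
  rcases C.rJoin_ends hx with ⟨h1, h2⟩ | ⟨k, rfl⟩
  · refine .inl (mem (h2.trans_le (Nat.zero_le _)) ?_)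
    rw [h1, ← h2]; exact C.rJoin_lt _
  · have hk := mem_channel_self (H := H) hx.1
    have hq := queue_mem hH hk
    have hl := hH.liveness_join _ _ k hk
    have hv := C.rView_queue hx
    simp only [rSource, rTarget] at hv ⊢
    by_cases hle : rJn (some (H.target k)) ≤ rJn (some (H.source k))
    · refine .inl (mem hle (lt_of_le_of_lt (Nat.cast_le.2 (rJoin_some _)) ?_))
      rcases hl with h | ⟨h, -⟩
      · exact ((hH.mem_view_iff ((hH.join_lt_death _).trans_le (hH.deathView_le _)) _).1 h).2
      · exact lt_of_le_of_lt (Nat.cast_le.2 (hH.notify_range h).1) (hH.join_lt_death _)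
    · have h1 : H.joinView (H.target k) ≤ H.eventView (.queue (H.queuing k)) := by
        rcases hl with h | ⟨h, h'⟩
        · exact ((hH.mem_view_iff ((hH.join_lt_death _).trans_le (hH.deathView_le _)) _).1 h).1.trans
            (hH.joinView_le_eventView hq)
        · exact hH.le_eventView hq h h'.1
      have h2 := (rJoin_some (G := G) (H := H) (H.target k)).trans h1
      have hq' := C.queue_eventsAt hx
      have h3 := (C.anchor hq' (by simp)).2.2 _ (not_le.1 hle).le (hv ▸ h2)
      exact .inr ⟨h3, (C.lt_notify hq' (by simp) h3).1.2 (hv ▸ h2)⟩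

lemma rLiveness_death (hx : x ∈ rPkts) (h : rDth (rTgt x) = i) (hi : .notify i (rSrc x) ∈ rEvts) :
    (Hʳ).lt (.queue (rQueuing H x)) (.notify i (rSrc x)) := by
  have hH := C.hist
  rw [(C.lt_notify (C.queue_eventsAt hx) (by simp) hi).2, C.rView_queue hx]
  have hq := hH.packet_queued _ (base_mem hx)
  by_cases hold : x.Old
  · have hv := (C.pre_iff (base_mem hx)).1 (old_spec hx hold).1
    by_cases hc : 𝔠 ≤ i
    · exact hv.trans_le hc
    have key : ∀ s : Sign, rDth (s.proc G) = i → False := by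
      rintro (_ | _) h
      · exact absurd (hH.join_lt_death G) (not_lt.2 ((le_of_eq h).trans (Nat.cast_le.2 (not_le.1 hc).le)))
      · exact hc (Nat.cast_le.1 (le_of_eq h))
    have main : H.source x.base = 𝔇 → rDth (some (H.target x.base)) = i →
        H.eventView (.queue (H.queuing x.base)) < i := fun h1 h2 => by
      have hn := (C.early_notify (not_le.1 hc)).1
      rw [h1] at hq
      exact (hH.lt_notify_iff hq hn.1).1 (hH.liveness_death _ _ _ ⟨base_mem hx, h1, rfl⟩ i h2 hn.1)
    cases x <;> first | exact hold.elim | exact (key _ h).elim | exact main hx.2.1 h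
  · cases x <;> first | exact absurd trivial hold | skip
    · rename_i k
      have hk := mem_channel_self (H := H) hx.1
      rcases hi with hi | ⟨h1, h2⟩
      · exact (hH.lt_notify_iff hq hi).1 (hH.liveness_death _ _ _ hk i h hi)
      · exfalso
        have h3 := hH.join_lt_death (H.target k)
        rw [show H.deathView (H.target k) = i from h, Nat.cast_lt] at h3
        rcases hH.liveness_join _ _ k hk with h4 | ⟨h4, -⟩
        · have := ((hH.mem_view_iff ((hH.join_lt_death _).trans_le (hH.deathView_le _)) _).1 h4).2
          rw [show H.deathView (H.target k) = i from h, Nat.cast_lt, h1] at this; omega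
        · have := (hH.notify_range h4).1
          rw [h1] at this; omega
    · rw [eventView_queue hH hq]
      have := hx.2.2.2.2.1
      rwa [show H.deathView _ = i from h, Nat.cast_lt] at this

lemma rPiggyback (hd : rDeqs x) (h : i ≤ rJn (rSrc x) ∨ (.notify i (rSrc x) ∈ rEvts ∧
      (Hʳ).lt (.notify i (rSrc x)) (.queue (rQueuing H x)))) :
    i ≤ rJn (rTgt x) ∨ (.notify i (rTgt x) ∈ rEvts ∧
      (Hʳ).lt (.notify i (rTgt x)) (.dequeue x)) := by
  by_cases hj : i ≤ rJn (rTgt x)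
  · exact .inl hj
  have hq := C.queue_eventsAt hd.1
  have hde := C.dequeue_eventsAt hd
  have h1 : i ≤ rVw (.queue (rQueuing H x)) := by
    rcases h with h | ⟨h, h'⟩
    · exact h.trans (C.anchor hq (by simp)).1
    · exact (C.lt_notify hq (by simp) h).1.1 h'
  have h2 := h1.trans (C.queue_cleanLT hd).cview_le
  have h3 := (C.anchor hde (by simp)).2.2 i (not_le.1 hj).le h2
  exact .inr ⟨h3, (C.lt_notify hde (by simp) h3).1.2 h2⟩

lemma rSelf_channel (hx : x ∈ rPkts) (ht : rSrc x = rTgt x) (hi : .notify i (rTgt x) ∈ rEvts)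
    (hl : (Hʳ).lt (.queue (rQueuing H x)) (.notify i (rTgt x))) :
    rDeqs x ∧ (Hʳ).lt (.dequeue x) (.notify i (rTgt x)) := by
  have hH := C.hist
  have hv := (C.lt_notify (ht ▸ C.queue_eventsAt hx) (by simp) hi).2.1 hl
  rw [C.rView_queue hx] at hv
  have key : ∀ {P : Proc} {s : Sign}, P ≠ G → s.proc G ≠ some P := by
    rintro P (_ | _) h h' <;> simp_all [Sign.proc]
  have fin : x.Direct H G → .dequeue x.base ∈ H.events → H.eventView (.dequeue x.base) < i →
      rDeqs x ∧ (Hʳ).lt (.dequeue x) (.notify i (rTgt x)) := by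
    intro h h' h2
    obtain ⟨h3, h4⟩ := C.direct_label hx h h'
    refine ⟨h3, (C.lt_notify (C.dequeue_eventsAt h3) (by simp) hi).2.2 ?_⟩
    rw [rView, h4]; exact h2
  have self : ∀ {P : Proc} {k : Pkt}, k ∈ H.channel P P → H.eventView (.queue (H.queuing k)) < i →
      .notify i P ∈ H.events → .dequeue k ∈ H.events ∧ H.eventView (.dequeue k) < i := by
    intro P k hk h h'
    obtain ⟨h1, h2⟩ := hH.self_channel P k hk i h' ((hH.lt_notify_iff (queue_mem hH hk) h').2 h)
    exact ⟨h1, (hH.lt_notify_iff ⟨h1, hk.1, hk.2.2⟩ h').1 h2⟩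
  have inner : ∀ {k : Pkt}, k ∈ H.channel 𝔇 𝔇 → Timely H G k →
      H.eventView (.queue (H.queuing k)) < i → H.eventView (.dequeue k) < i := by
    intro k hk ht h
    by_cases hc : i < 𝔠
    · exact (self hk h (C.early_notify hc).1.1).2
    · exact (C.timely_view ht).2.trans_le (not_lt.1 hc)
  cases x with
  | orig k =>
    have hk : k ∈ H.channel (H.target k) (H.target k) := ⟨hx.1, Option.some.inj ht, rfl⟩
    rcases hi with hi | ⟨h1, h2⟩
    · obtain ⟨h3, h4⟩ := self hk hv hi
      exact fin trivial h3 h4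
    · have := C.post_view hx.1 (.inr h1)
      simp only [RPkt.base] at hv; omega
  | into s k => exact absurd ht.symm (key (C.pre_source hx.1 hx.2.2.2.1).1)
  | outof s k | outofZombie s k => exact absurd ht (key hx.2.2.1)
  | within s t k | withinZombie s t k => exact fin hx.2.1 hx.2.1.2.2.1 (inner hx.1 hx.2.1 hv)
  | late P k => exact absurd (Option.some.inj ht).symm hx.1

lemma rView_dequeue_lt (hd : rDeqs x) : (rVw (.dequeue x) : ℕ∞) < rDth (rSrc x) := by
  have proc : ∀ s : Sign, rVw (.dequeue x) < 𝔠 → (rVw (.dequeue x) : ℕ∞) < rDth (s.proc G) := by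
    rintro (_ | _) h
    · exact (Nat.cast_lt.2 h).trans (C.hist.join_lt_death G)
    · exact Nat.cast_lt.2 h
  obtain ⟨hx, -⟩ := id hd
  rcases C.dequeue_cases hd with ⟨h1, h2, h3⟩ | ⟨h1, d, h2, h3⟩
  · have hv : rVw (.dequeue x) = H.eventView (.dequeue x.base) := by rw [rView, h3]; rfl
    have hbase := view_dequeue_lt C.conf (mem_channel_self (base_mem hx)) h2
    rw [← hv] at hbase
    by_cases ho : x.Old
    · have := (C.timely_view ((old_spec hx ho).2.1 h1)).2
      rw [← hv] at this
      cases x <;> first | exact ho.elim | exact proc _ this | exact hbase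
    · cases x <;> first | exact absurd trivial ho | exact h1.elim | exact hbase
  · have hv : rVw (.dequeue x) = H.eventView (.dequeue d) := by rw [rView, h3]; rfl
    rw [hv]
    have hcod : ∀ {P}, CoDonationTime H G P d → (H.eventView (.dequeue d) : ℕ∞) < rDth (some G) :=
      fun h => view_dequeue_lt C.conf h.1.1 h.2
    cases x with
    | into s k => exact view_dequeue_lt C.conf h2.2.1.1 h2.2.2
    | outof s k | outofZombie s k => obtain ⟨rfl, h2⟩ := h2; exact hcod h2
    | late P k => exact hcod h2
    | _ => exact h2.elim

lemma line_finite (hg : g ∈ Line H G R) :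
    {g' | g' ∈ Line H G R ∧ ¬ cleanLT H (cleanOf g) (cleanOf g')}.Finite := by
  have hH := C.hist
  have at_P : ∀ {P} {g : Evt}, g ∈ H.eventsAt P →
      {g' | g' ∈ H.eventsAt P ∧ ¬ cleanLT H (cleanOf g) (cleanOf g')}.Finite := by
    intro P g hg
    refine ((hH.foundation P g hg).union (Set.finite_singleton g)).subset fun g' ⟨h1, h2⟩ => ?_
    rcases hH.trichotomy h1 hg with h | h | h
    · exact .inl ⟨h1, h⟩
    · exact .inr h
    · exact absurd (C.cleanLT_of_lt_at hg h1 h) h2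
  have pre : {g' | g' ∈ H.eventsAt 𝔇 ∧ H.eventView g' < 𝔠}.Finite := by
    have hn := C.notify_critical C.parent_spec.1 C.parent_spec.2
    exact (hH.foundation _ _ hn).subset fun g' h => ⟨h.1, (hH.lt_notify_iff h.1 hn.1).2 h.2⟩
  cases R with
  | none => exact pre.subset fun g' h => h.1
  | some P =>
    by_cases hP : P = G
    · subst hP
      simp only [Line, if_pos] at hg ⊢
      rcases hg with hg | hg
      · refine pre.subset fun g' ⟨h1, h2⟩ => h1.resolve_right fun h3 => h2 ?_
        exact C.cleanLT_of_spine (.inl hg) (.inr h3) (C.spine_lt hg.1 hg.2 h3)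
      · exact (pre.union (at_P hg)).subset fun g' ⟨h1, h2⟩ => h1.imp id fun h3 => ⟨h3, h2⟩
    · simp only [line_of_ne hP] at hg ⊢; exact at_P hg

lemma queue_fibre (hg : g ∈ Line H G R) :
    {e | e ∈ (Hʳ).eventsAt R ∧ (rLbl e).con = cleanOf g ∧ ¬ e.IsTrigger}.Finite := by
  have h1 : {q | .queue q ∈ H.events ∧ X.trigger q = g}.Finite := by
    refine Set.Finite.of_injOn (f := X.position) (t := Set.Iio (X.effects g).length) ?_ ?_
      (Set.finite_Iio _)
    · rintro q ⟨hq, rfl⟩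
      obtain ⟨ε, h, -⟩ := X.effect_of q hq
      exact (List.getElem?_eq_some_iff.1 h).1
    · rintro q ⟨hq, rfl⟩ q' ⟨hq', h⟩ hp; exact X.effect_inj q q' hq hq' h.symm hp
  refine ((h1.preimage' (f := RQue.base) fun q _ => ?_).image .queue).subset ?_
  · refine (Set.toFinite {.orig q, .shift .pos q, .shift .neg q, .clone .pos q, .clone .neg q,
      .zombie .pos q, .zombie .neg q, .cloneShift .pos .pos q, .cloneShift .pos .neg q,
      .cloneShift .neg .pos q, .cloneShift .neg .neg q}).subset ?_
    rintro (_ | ⟨_ | _, _⟩ | ⟨_ | _, _⟩ | ⟨_ | _, _ | _, _⟩ | ⟨_ | _, _⟩) rfl <;> simp [RQue.base]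
  · rintro e ⟨he, hc, ht⟩
    cases e <;> first | exact absurd trivial ht | skip
    rename_i y
    obtain ⟨-, h2, P, h3⟩ := C.queue_line he
    refine ⟨y, ⟨h3.1, ?_⟩, rfl⟩
    rw [rLabel_queue] at hc
    rcases C.line_trichotomy h2 hg with h | h | h
    · exact absurd (hc ▸ h) (cleanLT_irrefl _)
    · exact h
    · exact absurd (hc ▸ h) (cleanLT_irrefl _)

lemma direct_fibre (k : Pkt) : {x | x ∈ rPkts ∧ x.Direct H G ∧ x.base = k}.Finite := by
  refine (Set.toFinite {.orig k, .into .pos k, .into .neg k, .outof .pos k, .outof .neg k,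
    .outofZombie .pos k, .outofZombie .neg k, .within .pos .pos k, .within .pos .neg k,
    .within .neg .pos k, .within .neg .neg k, .withinZombie .pos .pos k, .withinZombie .pos .neg k,
    .withinZombie .neg .pos k, .withinZombie .neg .neg k}).subset ?_
  rintro (_ | ⟨_ | _, _⟩ | ⟨_ | _, _⟩ | ⟨_ | _, _⟩ | ⟨_ | _, _ | _, _⟩ | ⟨_ | _, _ | _, _⟩ | _) ⟨-, h, rfl⟩ <;>
    first | exact h.elim | simp [RPkt.base]

lemma delay_fibre (d : Pkt) : {x | x ∈ rPkts ∧ x.Delay H G d ∧ rTgt x = R}.Finite := by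
  have hH := C.hist
  have hadj : (Set.univ : Set Adj).Finite :=
    (Set.toFinite {.ghost .pos, .ghost .neg, .flush .pos, .flush .neg, .ack .pos, .ack .neg, .zero,
      .msg .pos, .msg .neg}).subset (by
        rintro (⟨_ | _⟩ | ⟨_ | _⟩ | ⟨_ | _⟩ | _ | ⟨_ | _⟩) - <;> simp)
  have fin : ∀ {S : Set Que}, S.Finite → (∀ x ∈ rPkts, x.Delay H G d →
      H.queuing x.base ∈ S) → {x | x ∈ rPkts ∧ x.Delay H G d ∧ rTgt x = R}.Finite := by
    intro S hS h
    refine Set.Finite.of_injOn (f := fun x => (H.queuing x.base, x.delayAdj H)) (t := S ×ˢ Set.univ)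
      (fun x hx => ⟨h x hx.1 hx.2.1, trivial⟩) ?_ (hS.prod hadj)
    rintro x ⟨h1, h2, h3⟩ x' ⟨h1', h2', h3'⟩ h4
    exact C.delay_inj h1 h1' h2 h2' (congrArg Prod.fst h4) (congrArg Prod.snd h4) (h3.trans h3'.symm)
  have h1 : {q | ∃ P, DonationTime H G P d ∧ .queue q ∈ H.eventsAt P ∧
      H.eventView (.queue q) < 𝔠}.Finite := by
    by_cases h : ∃ P, DonationTime H G P d
    · obtain ⟨P, h⟩ := h
      refine (C.pre_finite h.1.2.1 (C.donation_state X h).1).subset fun q ⟨P', h', hq⟩ => ?_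
      rwa [← h'.1.1.2.1, h.1.1.2.1] at hq
    · exact Set.finite_empty.subset fun q ⟨P, h', _⟩ => h ⟨P, h'⟩
  have h2 : {q | ∃ P k, CoDonationTime H G P d ∧ DonationTime H G P k ∧ .queue q ∈ H.eventsAt G ∧
      H.lt (.queue q) (.dequeue k)}.Finite := by
    by_cases h : ∃ P k, CoDonationTime H G P d ∧ DonationTime H G P k
    · obtain ⟨P, k, h, hk⟩ := h
      refine (C.finite_lt (P := G) ⟨hk.2, hk.1.1.1, hk.1.1.2.2⟩).subset fun q ⟨P', k', h', hk', hq⟩ => ?_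
      rw [← h'.1.1.2.2, h.1.1.2.2] at hk'
      rwa [C.delay_unique X hk' hk] at hq
    · exact Set.finite_empty.subset fun q ⟨P, k, h', hk, _⟩ => h ⟨P, k, h', hk⟩
  refine fin ((h1.union (C.pre_finite C.parent_spec.1 C.parent_spec.2)).union h2) fun x hx h => ?_
  cases x with
  | into s k =>
    exact .inl (.inl ⟨_, h.2, hH.packet_queued _ hx.1, (C.pre_iff hx.1).1 hx.2.2.2.1⟩)
  | outof s k | outofZombie s k => exact .inl (.inr (C.mem_pre hx.1 hx.2.1 hx.2.2.2.1))
  | late P k =>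
    obtain ⟨k₀, h₀, -⟩ := C.codonation_state X h
    have hq := queue_mem hH hx.2.2.1
    have hT := trigger_mem (X := X) hq
    have hk₀ : .dequeue k₀ ∈ H.eventsAt G := ⟨h₀.2, h₀.1.1.1, h₀.1.1.2.2⟩
    refine .inr ⟨P, k₀, h, h₀, hq, ?_⟩
    have hl := hx.2.2.2.2.2.1 k₀ h₀
    refine (queue_lt_iff (X := X) hH hq hk₀ trivial).2 ?_
    rcases hH.trichotomy hT hk₀ with h | h | h
    · exact h
    · exact absurd (h ▸ hl) (cleanLT_irrefl _)
    · exact absurd (cleanLT_trans hH (cleanOf_valid hT.1) (cleanOf_valid hk₀.1) (cleanOf_valid hT.1) hl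
        (C.cleanLT_of_lt_at hk₀ hT h)) (cleanLT_irrefl _)
  | _ => exact h.elim

lemma fibre (hg : g ∈ Line H G R) :
    {e | e ∈ (Hʳ).eventsAt R ∧ (rLbl e).con = cleanOf g}.Finite := by
  have h1 : {e : REvt | e ∈ (Hʳ).eventsAt R ∧
      (∃ x, e = .dequeue x) ∧ (rLbl e).con = cleanOf g}.Finite := by
    by_cases h : ∃ d, g = .dequeue d
    · obtain ⟨d, rfl⟩ := h
      refine (((C.direct_fibre (X := X) d).union (C.delay_fibre (X := X) (R := R) d)).image .dequeue).subset ?_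
      rintro _ ⟨he, ⟨x, rfl⟩, hc⟩
      refine ⟨x, ?_, rfl⟩
      rcases C.dequeue_cases he.1 with ⟨h1, -, h3⟩ | ⟨-, d', h2, h3⟩ <;> rw [h3] at hc <;> cases hc
      · exact .inl ⟨he.2.1, h1, rfl⟩
      · exact .inr ⟨he.2.1, h2, he.2.2⟩
    · refine Set.finite_empty.subset ?_
      rintro _ ⟨he, ⟨x, rfl⟩, hc⟩
      rcases C.dequeue_cases he.1 with ⟨-, -, h3⟩ | ⟨-, _, -, h3⟩ <;> rw [h3] at hc <;>
        cases g <;> cases hc <;> exact h ⟨_, rfl⟩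
  refine ((h1.union (C.queue_fibre (X := X) hg)).union (t := (fun i => .notify i R) '' {i | cleanOf g = .view i} ∪
    .request '' {r | g = .request r}) (((Set.Subsingleton.finite ?_).image _).union
      ((Set.Subsingleton.finite ?_).image _))).subset ?_
  · intro i hi j hj; exact Clean.view.inj (hi.symm.trans hj)
  · intro i hi j hj; exact Ev.request.inj (hi.symm.trans hj)
  · rintro e ⟨he, hc⟩
    cases e with
    | queue y => exact .inl (.inr ⟨he, hc, id⟩)
    | dequeue x => exact .inl (.inl ⟨he, ⟨x, rfl⟩, hc⟩)
    | notify i P => exact .inr (.inl ⟨i, hc.symm, congrArg _ he.2.symm⟩)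
    | request r =>
      refine .inr (.inr ⟨r, ?_, rfl⟩)
      cases g <;> cases hc
      rfl

lemma fibres {S : Set Evt} (hS : S.Finite) (hl : S ⊆ Line H G R) :
    {e | e ∈ (Hʳ).eventsAt R ∧ ∃ g ∈ S, (rLbl e).con = cleanOf g}.Finite :=
  (hS.biUnion fun _ hg => C.fibre (hl hg)).subset fun _ ⟨h, _, hg, hc⟩ => Set.mem_biUnion hg ⟨h, hc⟩

lemma rFoundation (he : e ∈ (Hʳ).eventsAt R) :
    {f | f ∈ (Hʳ).eventsAt R ∧ (Hʳ).lt f e}.Finite := by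
  obtain ⟨⟨g, hg, hc⟩, -⟩ := C.home he
  refine (C.fibres (C.line_finite hg) fun _ h => h.1).subset fun f ⟨hf, hl⟩ => ⟨hf, ?_⟩
  obtain ⟨⟨g', hg', hc'⟩, -⟩ := C.home hf
  refine ⟨g', ⟨hg', fun h => ?_⟩, hc'⟩
  exact C.rLT_asymm he.1 hf.1 (.inl (by rwa [hc, hc'])) ((C.lt_iff_at hf he).1 hl)

lemma rHalting_finite (h : R ∈ (Hʳ).halting) : ((Hʳ).eventsAt R).Finite := by
  have hH := C.hist
  have hline : (Line H G R).Finite := by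
    have hn := C.notify_critical C.parent_spec.1 C.parent_spec.2
    have pre : (Line H G none).Finite := (hH.foundation _ _ hn).subset fun g' h =>
      ⟨h.1, (hH.lt_notify_iff h.1 hn.1).2 h.2⟩
    cases R with
    | none => exact pre
    | some P =>
      have := hH.halting_finite P (mem_halting.1 h)
      by_cases hP : P = G
      · subst hP
        rw [Line, if_pos rfl]; exact pre.union this
      · rwa [line_of_ne hP]
  exact (C.fibres hline subset_rfl).subset fun e he => ⟨he, (C.home he).1⟩

lemma rJoin_first (h : ((Hʳ).eventsAt R).Nonempty) : .notify (rJn R) R ∈ rEvts ∧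
    ∀ e ∈ (Hʳ).eventsAt R, (Hʳ).le (.notify (rJn R) R) e := by
  have h1 : .notify (rJn R) R ∈ rEvts := by
    cases R with
    | none => exact C.joins
    | some P =>
      rw [rJoin]
      split_ifs with hP
      · exact .inr ⟨hP, C.joins⟩
      · obtain ⟨e, he⟩ := h
        obtain ⟨⟨g, hg, -⟩, -⟩ := C.home he
        rw [line_of_ne hP] at hg; exact .inl (C.hist.join_first P ⟨g, hg⟩).1
  refine ⟨h1, fun e he => C.le_at ⟨h1, rfl⟩ he fun hl => ?_⟩
  by_cases hn : ∀ i, e ≠ .notify i R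
  · exact not_lt.2 (C.anchor he hn).1 ((C.notify_rLT_iff he hn h1).2.1 hl)
  · push Not at hn
    obtain ⟨i, rfl⟩ := hn
    exact not_lt.2 (C.notify_rrange he.1).1 (notify_notify.1 hl)

lemma rHalt_last (h : rDth R = i) (h1 : .notify i R ∈ rEvts) (he : e ∈ (Hʳ).eventsAt R) :
    (Hʳ).le e (.notify i R) := by
  refine C.le_at he ⟨h1, rfl⟩ fun hl => ?_
  by_cases hn : ∀ i, e ≠ .notify i R
  · have := (C.anchor he hn).2.1
    rw [h, Nat.cast_lt] at this; exact not_le.2 this ((C.notify_rLT_iff he hn h1).1.1 hl)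
  · push Not at hn
    obtain ⟨j, rfl⟩ := hn
    have := (C.notify_rrange he.1).2
    rw [h, Nat.cast_le] at this; exact not_lt.2 this (notify_notify.1 hl)

lemma rMinimal : (Hʳ).le e f ↔ Relation.ReflTransGen (Hʳ).Generates e f := by
  constructor
  · refine Relation.ReflTransGen.mono (fun a b ⟨ha, hb, h⟩ => ⟨ha, hb, ?_⟩ : rPrim H X G ≤ _) e f
    rcases h with h | ⟨P, h1, h2, h3⟩ | ⟨J, h1, h2, h3⟩
    · exact .inr (.inl h)
    · exact .inl ⟨P, h1, h2, ((C.lt_iff_at h1 h2).2 h3).1⟩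
    · have : (Hʳ).joinView (some J) = H.joinView J := by rw [C.rJoin_eq, rJoin, if_neg h1]
      exact .inr (.inr ⟨some J, by rwa [this], by rwa [this]⟩)
  · intro h
    induction h with
    | refl => exact .refl
    | tail _ hb ih =>
      refine ih.trans ?_
      obtain ⟨ha, hb, ⟨P, -, -, h⟩ | h | ⟨J, h1, h2⟩⟩ := hb
      · exact h
      · exact .single ⟨ha, hb, .inl h⟩
      · obtain ⟨J, rfl, h3, h4, h5, -⟩ := C.joiner h1
        rw [h5] at h2; exact .single ⟨ha, hb, .inr (.inr ⟨J, h3, h4, h2⟩)⟩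

lemma rParent_event {J : Option Proc} (h : 0 < (Hʳ).joinView J)
    (h' : .notify ((Hʳ).joinView J) J ∈ rEvts) :
    .notify ((Hʳ).joinView J) (J.map H.parent) ∈ rEvts ∧
    (Hʳ).le (.notify ((Hʳ).joinView J) (J.map H.parent)) (.notify ((Hʳ).joinView J) J) ∧
    (Hʳ).le (.notify ((Hʳ).joinView J) J) (.notify ((Hʳ).joinView J) (J.map H.parent)) := by
  obtain ⟨J, rfl, h1, h2, h3, -⟩ := C.joiner h
  rw [h3] at h' ⊢
  have h4 : .notify (H.joinView J) (some (H.parent J)) ∈ rEvts :=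
    .inl (C.hist.parent_event J h2 (h'.resolve_right fun h => h1 h.1)).1
  exact ⟨h4, .single ⟨h4, h', .inr (.inr ⟨J, h1, h2, .inl ⟨rfl, rfl⟩⟩)⟩,
    .single ⟨h', h4, .inr (.inr ⟨J, h1, h2, .inr ⟨rfl, rfl⟩⟩)⟩⟩

lemma rParent_member {J : Option Proc} (h : 0 < (Hʳ).joinView J) :
    J.map H.parent ∈ (Hʳ).view ((Hʳ).joinView J - 1) := by
  obtain ⟨J, rfl, h1, h2, h3, -⟩ := C.joiner h
  have := C.hist.parent_member J h2
  rw [h3]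
  change _ ∈ if _ then _ else _
  split_ifs
  · exact .inl ⟨_, this, rfl⟩
  · exact ⟨_, this, rfl⟩

lemma rConforming_channel {P Q : Option Proc} (h : {x | x ∈ (Hʳ).channel P Q ∧ rDeqs x}.Finite) :
    (Hʳ).Removed P ∨ Q ∈ (Hʳ).halting := by
  cases Q with
  | none => exact .inr (.inl rfl)
  | some Q =>
    cases P with
    | none => exact .inl (by rw [Removed, C.rDeath_eq]; exact C.lt_numView)
    | some P =>
      rw [C.rRemoved, mem_halting]
      refine C.conf.conforming_channel P Q ?_
      have h1 : {k | k ∈ H.channel P Q ∧ (H.content k).IsDonation}.Subsingleton :=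
        fun k hk k' hk' => donation_unique (X := X) C.hist hk.1 hk'.1 hk.2 hk'.2
      have h2 : {k | k ∈ H.channel P Q ∧ (H.content k).IsCoDonation}.Subsingleton :=
        fun k hk k' hk' => codonation_unique (X := X) C.hist hk.1 hk'.1 hk.2 hk'.2
      refine (((h.preimage (f := RPkt.orig) fun a _ b _ h => RPkt.orig.inj h).union h1.finite).union
        h2.finite).subset fun k ⟨hk, hd⟩ => ?_
      by_cases hx : .orig k ∈ rPkts
      · exact .inl (.inl ⟨⟨hx, congrArg some hk.2.1, congrArg some hk.2.2⟩, hx, hd⟩)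
      · by_cases hc : (H.content k).IsDonation
        · exact .inl (.inr ⟨hk, hc⟩)
        · refine .inr ⟨hk, by_contra fun hc' => hx ⟨hk.1, fun P hP => hc hP.2.2, fun P hP => hc' hP.2.2⟩⟩

lemma reduced_history : (Hʳ).IsHistory where
  numView_pos := C.hist.numView_pos
  event_located e he := C.located he
  le_refl e _ := .refl
  le_trans _ _ _ _ _ _ h h' := h.trans h'
  member_nonempty P := by rw [C.rMember]; exact ⟨_, le_rfl, C.rJoin_lt P⟩
  view_interval P := by rw [C.rJoin_eq, C.rDeath_eq, C.rMember]
  view_zero_finite := by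
    change (if _ then _ else _ : Set (Option Proc)).Finite
    have := C.hist.view_zero_finite.image some
    split_ifs
    · exact this.union (Set.toFinite _)
    · exact this
  view_change i hi := C.rView_change hi
  packet_channel x hx := ⟨(_, _), ⟨hx, rfl, rfl⟩, fun c h => Prod.ext h.2.1.symm h.2.2.symm⟩
  received_sent x := by
    rintro ⟨hx, h⟩
    refine ⟨hx, ?_⟩
    cases x <;> first | exact C.hist.received_sent h | exact trivial
  sent_packet x hx := hx.1
  packet_queued x hx := C.queue_eventsAt hx
  packet_dequeued x hd := ⟨hd.1, C.lt_of_le_rLT (C.rQueued_of_mem hd.1)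
    (.single ⟨C.rQueued_of_mem hd.1, hd, .inl ⟨x, hd.1, rfl, rfl⟩⟩) (.inl (C.queue_cleanLT hd))⟩
  multicast_finite x hx := C.rMulticast_finite hx
  multicast_same x hx x' hx' h := C.rMulticast_same hx hx' h
  multicast_target x hx x' hx' h h' := C.rMulticast_target hx hx' h h'
  packet_order P Q x hx x' hx' h hd := by
    have ht : rTgt x = rTgt x' := hx.2.2.trans hx'.2.2.symm
    obtain ⟨h1, h2⟩ := C.order hx.1 hd (hx.2.1.trans hx'.2.1.symm) ht
      (C.rLT_of_lt (C.rQueued_of_mem hx.1) h)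
    exact ⟨h1, (C.lt_iff_at (C.dequeue_eventsAt h1) (ht ▸ C.dequeue_eventsAt hd)).2 h2⟩
  notice_before i P h := C.rNotice_before (by rwa [C.rJoin_eq] at h)
  notice_join P := by rw [C.rJoin_eq]; exact C.rNotice_join
  notice_joined i P J h1 h2 h3 := by
    rw [C.rJoin_eq] at h1
    rw [C.rDeath_eq] at h2; exact C.rNotice_joined h1 h2 h3
  notice_removed i P S h1 h2 h3 := by
    rw [C.rJoin_eq] at h1
    rw [C.rDeath_eq] at h2 h3; exact C.rNotice_removed h1 h2 h3
  notice_done i P h h' := C.rNotice_done (by rwa [C.rDeath_eq] at h) h'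
  notice_end i P h h1 h2 := C.rNotice_end (by rwa [C.rDeath_eq] at h) h1 h2
  notice_after i P h := C.rNotice_after (by rwa [C.rDeath_eq] at h)
  notify_notice i P h := (C.rNotify_notice.1 h).2
  notify_original P h := by
    rw [Original, C.rJoin_eq] at h
    refine C.rNotify_notice.2 ⟨fun _ => C.joins, ?_⟩
    rw [← h, C.rNotice_join]; simp
  notify_order P i j h1 h2 h3 h := by
    rw [C.rJoin_eq] at h1
    rw [C.rDeath_eq] at h3; exact C.rNotify_order h1 h2 h3 h
  parent_member J h := C.rParent_member h
  parent_event J h h' := C.rParent_event h h'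
  process_total P e he f hf := by
    rcases C.label_trichotomy he hf with h | rfl | h
    · exact .inl ((C.lt_iff_at he hf).2 h).1
    · exact .inl .refl
    · exact .inr ((C.lt_iff_at hf he).2 h).1
  process_antisymm P e he f hf h h' := by
    rcases C.le_or_eq_at he hf h with h | h
    · exact absurd h' ((C.lt_iff_at he hf).2 h).2
    · exact h
  liveness_join := by
    rintro P Q x ⟨hx, rfl, rfl⟩
    rw [C.rJoin_eq, C.rJoin_eq]; exact C.rLiveness_join hx
  liveness_death := by
    rintro P Q x ⟨hx, rfl, rfl⟩ i h hi
    rw [C.rDeath_eq] at h; exact C.rLiveness_death hx h hi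
  piggyback := by
    rintro P Q x ⟨hx, rfl, rfl⟩ hd i h
    rw [C.rJoin_eq] at h ⊢; exact C.rPiggyback hd h
  self_channel := by
    rintro P x ⟨hx, h, rfl⟩ i hi hl; exact C.rSelf_channel hx h hi hl
  foundation P e he := C.rFoundation he
  join_first P h := by rw [C.rJoin_eq]; exact C.rJoin_first h
  halt_last P i h h' e he := C.rHalt_last (by rwa [C.rDeath_eq] at h) h' he
  minimal_order e _ f _ := C.rMinimal
  halting_finite P h := C.rHalting_finite h
  dropped_not_processed _ _ h := h.elim
  notice_processed i P h h1 _ := C.rNotify_notice.2 ⟨fun h' => absurd (.inl h') h, h1⟩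
  packet_sent P Q x hx h := by
    refine ⟨hx.1, ?_⟩
    obtain ⟨hx, rfl, rfl⟩ := hx
    cases x <;> first
      | exact C.hist.packet_sent _ _ _ (mem_channel_self hx.1) fun h' => h (mem_halting.2 h')
      | exact trivial
  dequeued_received x hd := by
    refine ⟨hd.1, ?_⟩
    cases x <;> first | exact C.hist.dequeued_received _ hd.2 | exact hd
  packet_processed P Q x hx _ _ h := by
    have h1 := (h x hx .refl).2
    cases x <;> first | exact ⟨hx.1, C.trans.all_received _ h1⟩ | exact h1
  request_processed r _ := C.trans.all_requests r

lemma reduced_conforming : (Hʳ).IsConforming where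
  toIsHistory := C.reduced_history
  conforming_channel P Q h := C.rConforming_channel h
  conforming_packet := by
    rintro P Q i h hi x ⟨hx, rfl, rfl⟩ hd hl
    have h1 := C.rView_dequeue_lt hd
    have h2 := (C.lt_notify (C.dequeue_eventsAt hd) (by simp) hi).1.1 hl
    rw [show rDth (rSrc x) = i from C.of_rNotice_removed h, Nat.cast_lt] at h1; exact not_lt.2 h2 h1
  conforming_notification _ _ h := h.elim
  conforming_gms P h := by
    rw [C.rMember]
    cases P with
    | none => exact (Set.finite_Iio 𝔠).subset fun i hi => Nat.cast_lt.1 hi.2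
    | some P =>
      have := C.conf.conforming_gms P (mem_halting.1 h)
      refine ((Set.finite_Iio (H.joinView P)).union this).subset fun i hi => ?_
      rw [C.hist.view_interval]; exact (lt_or_ge i (H.joinView P)).imp id fun h => ⟨h, hi.2⟩
  conforming_parent := by
    rintro P he ⟨J, h1, rfl⟩
    obtain ⟨J, rfl, h2, h3, -⟩ := C.joiner h1
    refine C.conf.conforming_parent (H.parent J) (Set.not_nonempty_iff_eq_empty.1 fun h => ?_) ⟨J, h3, rfl⟩
    exact Set.eq_empty_iff_forall_notMem.1 he (.notify _ (some (H.parent J))) ⟨.inl (C.hist.join_first _ h).1, rfl⟩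
  conforming_halt P h := by
    cases P with
    | none => exact .inl rfl
    | some P => exact mem_halting.2 (C.conf.conforming_halt P (C.rRemoved.1 h))

end Critical

end CBCast

theorem mainTheorem6 {Proc Pkt Que Req Body : Type*}
    (H : CBCast.Computation Proc Pkt Que Req (CBCast.Content Proc Body) Body)
    (X : CBCast.Execution H) (hH : H.IsTransactional)
    (G : Proc) (hG : 0 < H.joinView G)
    (hfirst : ∀ J, 0 < H.joinView J → H.joinView G ≤ H.joinView J) :
    (CBCast.reduced H X G).IsHistory ∧
    (CBCast.reduced H X G).IsConforming ∧
    (∀ e ∈ (CBCast.reduced H X G).events, ∀ f ∈ (CBCast.reduced H X G).events,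
      (CBCast.reduced H X G).lt e f →
        CBCast.labelLT H (CBCast.rLabel H X G e) (CBCast.rLabel H X G f)) ∧
    (∀ P, ∀ e ∈ (CBCast.reduced H X G).eventsAt P, ∀ f ∈ (CBCast.reduced H X G).eventsAt P,
      ((CBCast.reduced H X G).lt e f ↔
        CBCast.labelLT H (CBCast.rLabel H X G e) (CBCast.rLabel H X G f))) := by
  have C : CBCast.Critical H G := ⟨hH, hG, hfirst⟩
  exact ⟨C.reduced_history, C.reduced_conforming, fun _ he _ _ h => C.rLT_of_lt he h,
    fun _ _ he _ hf => C.lt_iff_at he hf⟩
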